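/- **Setting.** Let $d\ge 0$, let $A,B=0,\dots,d$ be ambient indices with metric $\eta=\mathrm{diag}(+,-,\dots,-,+)$, and let $i,j\in\{1,2\}$ be $sp(2)$ indices, with $\epsilon_{12}=\epsilon^{12}=1$, $a^i=\epsilon^{ij}a_j$, $a_i=a^j\epsilon_{ji}$. Functions of the oscillators $Z_i^A,Y_i^A$ are formal power series with complex coefficients, with the star product $$f*g=f\,\exp\Big(\tfrac12\epsilon_{ij}\eta^{AB}\big(\overleftarrow{\partial}_{Y_i^A}+\overleftarrow{\partial}_{Z_i^A}\big)\big(\overrightarrow{\partial}_{Y_j^B}-\overrightarrow{\partial}_{Z_j^B}\big)\Big)\,g ,$$ which on functions of $Y$ is the Weyl–Moyal product ($[Y_i^A,Y_j^B]_*=\epsilon_{ij}\eta^{AB}$, $[Z_i^A,Z_j^B]_*=-\epsilon_{ij}\eta^{AB}$, $[Y_i^A,Z_j^B]_*=0$). Fix a constant vector $V^A$ with $V_AV^A=1$; put $y_i=V_AY_i^A$, $z_i=V_AZ_i^A$, ${}^\parallel Y_i^A=V^Ay_i$, ${}^\perp Y=Y-{}^\parallel Y$ (same for $Z$), let $\widetilde{\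 }$ be the reflection ${}^\parallel Y\to-{}^\parallel Y$, ${}^\parallel Z\to-{}^\parallel Z$, ${}^\parallel dZ\to-{}^\parallel dZ$, and $\mathcal K=\exp(-2z_iy^i)$. A function is *regular* if it is a finite sum of $P(Z,Y)\int_M d^n\tau\,\rho(\tau)\exp(\phi(\tau)z_iy^i)$ with polynomials $P,\phi$, $M\subset\mathbb R^n$ compact and $\rho$ integrable on $M$. Space-time is an open set $U\subset\mathbb R^d$, and fields have smooth coefficients. For $\kappa\in\mathbb R$ consider the system for $W=dx^\mu W_\mu$, $S=dZ_i^AS^i_A$, $B$: $$dW+W*W=0,\quad dB+W*B-B*\widetilde W=0,\quad dS+W*S+S*W=0,\quad S*B-B*\widetilde S=0,$$ $$S*S=-\tfrac12\big(dZ_i^A\,dZ^i_A+4\kappa\,dZ_{Ai}\,dZ^i_B\,V^AV^B\,B*\mathcal K\big),$$ together with $[t^{tot}_{ij},W]_*=[t^{tot}_{ij},B]_*=0$, $[t^{tot}_{ij},S_k^A]_*=\epsilon_{jk}S_i^A+\epsilon_{ik}S_j^A$, where $t^{tot}_{ij}=Y_i^AY_{Aj}-Z_i^AZ_{Aj}$.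 Let $\omega_0^{AB}(x)$ be an $AdS$ connection, i.e. a smooth flat $o(d-1,2)$ connection whose frame $E_0^A=\omega_0{}^A{}_BV^B$ has rank $d$, and put $W_0=\omega_0^{AB}T_{AB}$, $T_{AB}=\tfrac12Y^i_AY_{Bi}$. **Theorem.** 1. $S_0=dZ_i^AZ^i_A$, $W_0$, $B_0=0$ is an exact solution. All star products below are free of infinities: at each monomial only finitely many contractions contribute. 2. The system linearized at this vacuum is solved by $(W_1,S_1,B_1)$ if and only if there are $\omega=dx^\mu\omega_\mu(Y|x)$ and $C(Y|x)$ with $[t_{ij},\omega]_*=[t_{ij},C]_*=0$ ($t_{ij}=Y_i^AY_{jA}$), and $\epsilon_1(Z,Y|x)$ with $[t^{tot}_{ij},\epsilon_1]_*=0$, such that $$B_1=C(Y|x),\qquad S_1{}^i_A=\frac{\partial\epsilon_1}{\partial Z_i^A}+4\kappa\,V_A\,z^i\int_0^1dt\,t\,C({}^\perp Y-t\,{}^\parallel Z)\,e^{-2tz_ky^k},$$ $$W_1=d\epsilon_1+[W_0,\epsilon_1]_*+\omega(Y|x)+2\kappa\,z^j\int_0^1dt\,(1-t)\,e^{-2tz_iy^i}\,E_0^B\frac{\partial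 C}{\partial{}^\perp Y^{jB}}({}^\perp Y-t\,{}^\parallel Z),$$ and the free unfolded equations hold: $$\widetilde D_0C\equiv dC+W_0*C-C*\widetilde W_0=0,\qquad R_1\equiv d\omega+\{\omega,W_0\}_*=\frac{\kappa}{2}\,E_0^AE_0^B\,\frac{\partial^2C}{\partial{}^\perp Y^{Ai}\,\partial{}^\perp Y_i^B}({}^\perp Y).$$ In particular, for $\kappa=1$ one has $R_1=\tfrac12E_0^AE_0^B\,\partial^2C/\partial{}^\perp Y^{Ai}\partial{}^\perp Y^B_i$. If $B_1=C$ and $S_1$ has the form above with $\partial\epsilon_1/\partial Z=0$ (a gauge choice), then the linearized system holds if and only if $W_1$ has the form above without the $\epsilon_1$ terms, for some $\omega$ such that $(\omega,C)$ solves the free unfolded equations. 3. For $C$ and $\omega$ polynomial in $Y$, $B_1$ and (in the gauge $\partial\epsilon_1/\partial Z=0$) $S_1$ and $W_1$ are regular; for a power series $C$, the explicit $C$-dependent terms of $S_1$ and $W_1$ are the locally finite sums, over the homogeneous components $C_n$ of $C$, of the regular functions obtained from $C_n$. 4. Let $\mathfrak g$ be the set of the vacuum symmetry parameters: smooth $\epsilon(Z,Y|x)$,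 polynomial in $(Z,Y)$ at each $x$, with $[t^{tot}_{ij},\epsilon]_*=0$, $\bar\epsilon(Z,Y)=-\epsilon(-iZ,iY)$, $[S_0,\epsilon]_*=0$ and $D_0\epsilon=d\epsilon+[W_0,\epsilon]_*=0$. Suppose that $U$ is star-shaped about $x_0\in U$. Then every $\epsilon\in\mathfrak g$ is $Z$-independent, and $\epsilon\mapsto\epsilon(x_0)$ is a bijection of $\mathfrak g$ onto the polynomials $f(Y)$ with $[t_{ij},f]_*=0$ and $\bar f(Y)=-f(iY)$. The set $\mathfrak g$ is a real Lie algebra under the star commutator, and the quotient of $\mathfrak g$ by the ideal of those $\epsilon$ for which each $\epsilon(x)$ has the form $t_{ij}*g^{ij}=g^{ij}*t_{ij}$ (with polynomials $g^{ij}(Y)$) is isomorphic to $hu(1|2\!:\![d-1,2])$. Here $hu(1|2\!:\![d-1,2])$ is the real Lie algebra of the $sp(2)$-invariant elements $f$ with $f^\dagger=-f$ of the complex Weyl algebra $[\hat Y_i^A,\hat Y_j^B]=\epsilon_{ij}\eta^{AB}$, modulo those of the form $t_{ij}g^{ij}=g^{ij}t_{ij}$, where $t_{ij}=\tfrac12\{\hat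 Y_i^A,\hat Y_j^B\}\eta_{AB}$ and $\dagger$ is the involution with $(\hat Y_i^A)^\dagger=i\hat Y_i^A$. -/

import Mathlib

noncomputable section

namespace HigherSpin

/-! ## Index conventions

`Fin (d+1)` is the range of the ambient indices `A`: the value `0` is the time direction, the last
value is the extra time-like direction, and `η = diag(+,-,…,-,+)`.  The `sp(2)` indices `1, 2` are
the elements `0, 1` of `Fin 2`; they are raised and lowered by `a^i = ε^{ij} a_j`,
`a_i = a^j ε_{ji}`, with `ε_{12} = ε^{12} = 1`. -/

/-- Labels `(i, A)` of the oscillators `Y_i^A` (and of `Z_i^A`). -/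
abbrev Osc (d : ℕ) := Fin 2 × Fin (d + 1)

/-- Functions of `Y`, as formal power series (Weyl symbols). -/
abbrev YSeries (d : ℕ) := MvPowerSeries (Osc d) ℂ

/-- Functions of `(Z, Y)`, as formal power series: `inl` labels `Z`, `inr` labels `Y`. -/
abbrev ZYSeries (d : ℕ) := MvPowerSeries (Osc d ⊕ Osc d) ℂ

/-- The symplectic form; `ε_{ij}` and `ε^{ij}` have the same numerical values. -/
def eps (i j : Fin 2) : ℝ := if i < j then 1 else if j < i then -1 else 0

/-- The invariant metric of `o(d-1,2)`; `η_{AB}` and `η^{AB}` have the same numerical values. -/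
def eta {d : ℕ} (A B : Fin (d + 1)) : ℝ :=
  if A = B then (if A = 0 ∨ A = Fin.last d then 1 else -1) else 0

/-- `V_A = η_{AB} V^B`. -/
def lowerV {d : ℕ} (V : Fin (d + 1) → ℝ) (A : Fin (d + 1)) : ℝ := ∑ B, eta A B * V B

/-- `V_A V^A`. -/
def normV {d : ℕ} (V : Fin (d + 1) → ℝ) : ℝ := ∑ A, lowerV V A * V A

section Series

variable {σ : Type*}

/-- Being a polynomial. -/
def IsPoly (f : MvPowerSeries σ ℂ) : Prop := ∃ p : MvPolynomial σ ℂ, (p : MvPowerSeries σ ℂ) = f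

/-! ## Star products -/

/-- The `n`-fold contraction of `f` and `g`: the `n`-th power of the bidifferential operator
`½ ε_{ij} η^{AB} l_{iA} ⊗ r_{jB}`, applied to `f ⊗ g` and followed by multiplication. -/
def contraction {d : ℕ} (l r : Osc d → MvPowerSeries σ ℂ → MvPowerSeries σ ℂ) :
    ℕ → MvPowerSeries σ ℂ → MvPowerSeries σ ℂ → MvPowerSeries σ ℂ
  | 0, f, g => f * g
  | n + 1, f, g => ∑ i, ∑ j, ∑ A, ∑ B,
      ((1 / 2 * eps i j * eta A B : ℝ) : ℂ) • contraction l r n (l (i, A) f) (r (j, B) g)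

/-- `f exp(½ ε_{ij} η^{AB} l_{iA} ⊗ r_{jB}) g`, computed monomial by monomial. -/
def starWith {d : ℕ} (l r : Osc d → MvPowerSeries σ ℂ → MvPowerSeries σ ℂ)
    (f g : MvPowerSeries σ ℂ) : MvPowerSeries σ ℂ :=
  fun m => ∑ᶠ n : ℕ, (Nat.factorial n : ℂ)⁻¹ * MvPowerSeries.coeff m (contraction l r n f g)

/-- The product is free of infinities: only finitely many contractions contribute to each
monomial. -/
def StarDefinedWith {d : ℕ} (l r : Osc d → MvPowerSeries σ ℂ → MvPowerSeries σ ℂ)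
    (f g : MvPowerSeries σ ℂ) : Prop :=
  ∀ m, {n : ℕ | MvPowerSeries.coeff m (contraction l r n f g) ≠ 0}.Finite

end Series

variable {d : ℕ}

/-- `∂/∂Y_i^A` on functions of `Y`. -/
def dY (p : Osc d) (f : YSeries d) : YSeries d := MvPowerSeries.pderiv (R := ℂ) p f

/-- The Weyl–Moyal star product of functions of `Y`. -/
def starY (f g : YSeries d) : YSeries d := starWith dY dY f g

/-- `∂/∂Y_i^A + ∂/∂Z_i^A`. -/
def dLeft (p : Osc d) (f : ZYSeries d) : ZYSeries d :=
  MvPowerSeries.pderiv (R := ℂ) (Sum.inr p) f + MvPowerSeries.pderiv (R := ℂ) (Sum.inl p) f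

/-- `∂/∂Y_i^A - ∂/∂Z_i^A`. -/
def dRight (p : Osc d) (f : ZYSeries d) : ZYSeries d :=
  MvPowerSeries.pderiv (R := ℂ) (Sum.inr p) f - MvPowerSeries.pderiv (R := ℂ) (Sum.inl p) f

/-- The star product of functions of `(Z, Y)`: normal ordering with respect to `Z - Y`, `Z + Y`. -/
def starZY (f g : ZYSeries d) : ZYSeries d := starWith dLeft dRight f g

def StarDefined (f g : ZYSeries d) : Prop := StarDefinedWith dLeft dRight f g

/-- Star commutators. -/
def commY (f g : YSeries d) : YSeries d := starY f g - starY g f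

def comm (f g : ZYSeries d) : ZYSeries d := starZY f g - starZY g f

/-! ## Oscillators -/

/-- `Y_i^A` as a function of `Y`. -/
def y₀ (i : Fin 2) (A : Fin (d + 1)) : YSeries d := MvPowerSeries.X (i, A)

/-- `Y_i^A` and `Z_i^A` as functions of `(Z, Y)`. -/
def yv (i : Fin 2) (A : Fin (d + 1)) : ZYSeries d := MvPowerSeries.X (Sum.inr (i, A))

def zv (i : Fin 2) (A : Fin (d + 1)) : ZYSeries d := MvPowerSeries.X (Sum.inl (i, A))

/-- A function of `Y`, considered as a `Z`-independent function of `(Z, Y)`. -/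
def emb (f : YSeries d) : ZYSeries d := MvPowerSeries.subst (fun p : Osc d => yv p.1 p.2) f

/-- Raising an `sp(2)` index, `a^i = ε^{ij} a_j`. -/
def raise {M : Type*} [AddCommMonoid M] [Module ℂ M] (a : Fin 2 → M) (i : Fin 2) : M :=
  ∑ j, (eps i j : ℂ) • a j

/-- Lowering an ambient index, `a_A = η_{AB} a^B`. -/
def lower {M : Type*} [AddCommMonoid M] [Module ℂ M] (a : Fin (d + 1) → M) (A : Fin (d + 1)) : M :=
  ∑ B, (eta A B : ℂ) • a B

/-- The `o(d-1,2)` generators `T_{AB} = ½ Y^i_A Y_{Bi}`. -/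
def Tgen (A B : Fin (d + 1)) : YSeries d :=
  (1 / 2 : ℂ) • ∑ i, raise (fun j => lower (y₀ j) A) i * lower (y₀ i) B

/-- The `sp(2)` generators `t_{ij} = Y_i^A Y_{jA}`. -/
def tY (i j : Fin 2) : YSeries d := ∑ A, y₀ i A * lower (y₀ j) A

/-- `t^{tot}_{ij} = Y_i^A Y_{Aj} - Z_i^A Z_{Aj}`. -/
def tTot (i j : Fin 2) : ZYSeries d :=
  (∑ A, yv i A * lower (yv j) A) - ∑ A, zv i A * lower (zv j) A

section Compensator

variable (V : Fin (d + 1) → ℝ)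

/-- `y_i = V_A Y_i^A` and `z_i = V_A Z_i^A`. -/
def yl (i : Fin 2) : ZYSeries d := ∑ A, (lowerV V A : ℂ) • yv i A

def zl (i : Fin 2) : ZYSeries d := ∑ A, (lowerV V A : ℂ) • zv i A

/-- `z_i y^i`. -/
def zy : ZYSeries d := ∑ i, zl V i * raise (yl V) i

/-- `exp(a z_i y^i)`. -/
def expZY (a : ℂ) : ZYSeries d := PowerSeries.subst (a • zy V) (PowerSeries.exp ℂ)

/-- The Klein operator `𝒦 = exp(-2 z_i y^i)`. -/
def klein : ZYSeries d := expZY V (-2)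

/-- Substitution `Y ↦ ^⊥Y - t ^∥Z` in a function of `Y`. -/
def twistArg (t : ℝ) (f : YSeries d) : ZYSeries d :=
  MvPowerSeries.subst
    (fun p : Osc d => yv p.1 p.2 - (V p.2 : ℂ) • yl V p.1 - ((t * V p.2 : ℝ) : ℂ) • zl V p.1) f

/-- Substitution `Y ↦ ^⊥Y` in a function of `Y`. -/
def perpArg (f : YSeries d) : YSeries d :=
  MvPowerSeries.subst
    (fun p : Osc d => y₀ p.1 p.2 - (V p.2 : ℂ) • ∑ B, (lowerV V B : ℂ) • y₀ p.1 B) f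

/-- `f̃(Y) = f(Ỹ)`, `Ỹ_i^A = Y_i^A - 2 V^A V_B Y_i^B`. -/
def tildeY (f : YSeries d) : YSeries d :=
  MvPowerSeries.subst
    (fun p : Osc d => y₀ p.1 p.2 - (2 * V p.2 : ℂ) • ∑ B, (lowerV V B : ℂ) • y₀ p.1 B) f

/-- `f̃(Z, Y) = f(Z̃, Ỹ)`. -/
def tilde (f : ZYSeries d) : ZYSeries d :=
  MvPowerSeries.subst
    (Sum.elim (fun p : Osc d => zv p.1 p.2 - (2 * V p.2 : ℂ) • zl V p.1)
      (fun p : Osc d => yv p.1 p.2 - (2 * V p.2 : ℂ) • yl V p.1)) f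

/-- Components of `S̃ = S(dZ̃, Z̃, Ỹ)` for `S = dZ_i^A S^i_A`; the component `S^i_A` is
`S (i, A)`. -/
def tildeS (S : Osc d → ZYSeries d) (p : Osc d) : ZYSeries d :=
  tilde V (S p) - (2 * lowerV V p.2 : ℂ) • ∑ B, (V B : ℂ) • tilde V (S (p.1, B))

/-- The transversal derivative `∂/∂^⊥Y_i^A` on functions of `Y`. -/
def dPerp (A : Fin (d + 1)) (i : Fin 2) (f : YSeries d) : YSeries d :=
  dY (i, A) f - (lowerV V A : ℂ) • ∑ B, (V B : ℂ) • dY (i, B) f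

/-- The transversal derivative `∂/∂^⊥Y^{iA}` with respect to the variables with upper `sp(2)`
index; `Y_j = Y^i ε_{ij}` gives `∂/∂Y^i = ε_{ij} ∂/∂Y_j`. -/
def dPerpUp (A : Fin (d + 1)) (i : Fin 2) (f : YSeries d) : YSeries d :=
  ∑ j, (eps i j : ℂ) • dPerp V A j f

/-! ## The regular class -/

/-- `∫_M dτ ρ(τ) exp(φ(τ) z_i y^i)`, coefficientwise. -/
def regularExp (n : ℕ) (M : Set (Fin n → ℝ)) (ρ : (Fin n → ℝ) → ℂ) (φ : MvPolynomial (Fin n) ℂ) :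
    ZYSeries d :=
  fun m => ∫ τ in M, ρ τ *
    MvPowerSeries.coeff m (expZY V (MvPolynomial.eval (fun k => (τ k : ℂ)) φ))

/-- Regular functions: finite sums of `P(Z,Y) ∫_M dτ ρ(τ) exp(φ(τ) z_i y^i)` with `P`, `φ`
polynomials, `M` compact and `ρ` integrable on `M`. -/
def IsRegular (F : ZYSeries d) : Prop :=
  F ∈ Submodule.span ℂ {G : ZYSeries d | ∃ (P : ZYSeries d) (n : ℕ) (M : Set (Fin n → ℝ))
    (ρ : (Fin n → ℝ) → ℂ) (φ : MvPolynomial (Fin n) ℂ), IsPoly P ∧ IsCompact M ∧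
      MeasureTheory.IntegrableOn ρ M ∧ G = P * regularExp V n M ρ φ}

/-! ## The first-order solution -/

/-- `∫_0^1 dt F(t)`, coefficientwise. -/
def intSeries (F : ℝ → ZYSeries d) : ZYSeries d :=
  fun m => ∫ t in (0 : ℝ)..1, MvPowerSeries.coeff m (F t)

/-- `S_1{}^i_A = 4 κ V_A z^i ∫_0^1 dt t C(^⊥Y - t ^∥Z) exp(-2 t z_k y^k)`. -/
def solS (κ : ℝ) (C : YSeries d) (p : Osc d) : ZYSeries d :=
  (4 * κ * lowerV V p.2 : ℂ) • (raise (zl V) p.1 *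
    intSeries fun t => (t : ℂ) • (twistArg V t C * expZY V ((-2 * t : ℝ) : ℂ)))

/-- `2 κ z^j ∫_0^1 dt (1-t) exp(-2 t z_i y^i) E^B (∂C/∂^⊥Y^{jB})(^⊥Y - t ^∥Z)`. -/
def solW (κ : ℝ) (E : Fin (d + 1) → ℝ) (C : YSeries d) : ZYSeries d :=
  (2 * κ : ℂ) • ∑ j, raise (zl V) j * intSeries fun t =>
    ((1 - t : ℝ) : ℂ) • (expZY V ((-2 * t : ℝ) : ℂ) *
      ∑ B, (E B : ℂ) • twistArg V t (dPerpUp V B j C))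

end Compensator

/-! ## Space-time

Space-time is an open subset `U` of `ℝ^d` with its coordinates `x^μ`; one-forms are given by their
components. -/

variable {U : TopologicalSpace.Opens (Fin d → ℝ)}

section Calculus

variable {G : Type*} [NormedAddCommGroup G] [NormedSpace ℝ G]

/-- Extension by zero of a function on `U`. -/
def extendZero (F : U → G) : (Fin d → ℝ) → G := Function.extend Subtype.val F 0

/-- Smooth functions on `U`. -/
def SmoothFun (F : U → G) : Prop := ContDiffOn ℝ (⊤ : ℕ∞) (extendZero F) U

/-- `∂F/∂x^μ` at a point of the open set `U`. -/
def partialX (μ : Fin d) (F : U → G) (x : U) : G := fderiv ℝ (extendZero F) x (Pi.single μ 1)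

end Calculus

/-- Coefficientwise smooth functions with values in formal power series. -/
def SmoothSeries {σ : Type*} (F : U → MvPowerSeries σ ℂ) : Prop :=
  ∀ m, SmoothFun fun x => MvPowerSeries.coeff m (F x)

/-- `∂F/∂x^μ` for functions with values in formal power series. -/
def dX {σ : Type*} (μ : Fin d) (F : U → MvPowerSeries σ ℂ) (x : U) : MvPowerSeries σ ℂ :=
  fun m => partialX μ (fun x' => MvPowerSeries.coeff m (F x')) x

/-! ## The vacuum -/

/-- The frame `E^A = dV^A + ω^A{}_B V^B = ω^A{}_B V^B` of a connection, for constant `V`. -/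
def frame (V : Fin (d + 1) → ℝ) (ω₀ : Fin d → U → Matrix (Fin (d + 1)) (Fin (d + 1)) ℝ)
    (μ : Fin d) (x : U) (A : Fin (d + 1)) : ℝ := ∑ B, ω₀ μ x A B * lowerV V B

/-- `AdS` connections: smooth flat `o(d-1,2)` connections `ω₀_μ^{AB}` whose frame has rank `d`. -/
structure IsAdSConnection (V : Fin (d + 1) → ℝ)
    (ω₀ : Fin d → U → Matrix (Fin (d + 1)) (Fin (d + 1)) ℝ) : Prop where
  smooth : ∀ μ A B, SmoothFun fun x => ω₀ μ x A B
  antisymm : ∀ μ x A B, ω₀ μ x A B = -ω₀ μ x B A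
  flat : ∀ μ ν x A B,
    partialX μ (fun x' => ω₀ ν x' A B) x - partialX ν (fun x' => ω₀ μ x' A B) x
      + ∑ C, ∑ C', (ω₀ μ x A C * eta C C' * ω₀ ν x C' B - ω₀ ν x A C * eta C C' * ω₀ μ x C' B) = 0
  rank : ∀ x, LinearIndependent ℝ fun μ => frame V ω₀ μ x

/-- `W_0 = ω₀^{AB} T_{AB}(Y)`. -/
def W0 (ω₀ : Fin d → U → Matrix (Fin (d + 1)) (Fin (d + 1)) ℝ) (μ : Fin d) (x : U) : YSeries d :=
  ∑ A, ∑ B, (ω₀ μ x A B : ℂ) • Tgen A B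

/-- Components of `S_0 = dZ_i^A Z^i_A`. -/
def S0 (p : Osc d) : ZYSeries d := raise (fun j => lower (zv j) p.2) p.1

/-! ## The field equations

`W = dx^μ W_μ`, `S = dZ_i^A S^i_A`, `S^i_A = S (i, A)`. -/

/-- The `sp(2)` conditions: `W` and `B` are `sp(2)` singlets and `S_k^A` is an `sp(2)` doublet. -/
structure Sp2Fields (W : Fin d → U → ZYSeries d) (S : Osc d → U → ZYSeries d)
    (B : U → ZYSeries d) : Prop where
  onW : ∀ i j μ x, comm (tTot i j) (W μ x) = 0
  onB : ∀ i j x, comm (tTot i j) (B x) = 0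
  onS : ∀ i j k A x,
    let Sl : Fin 2 → ZYSeries d :=
      fun k => ∑ l, (eps l k : ℂ) • lower (fun A' => S (l, A') x) A
    comm (tTot i j) (Sl k) = (eps j k : ℂ) • Sl i + (eps i k : ℂ) • Sl j

/-- The nonlinear system in components.  The last equation is
`S * S = -½ (dZ_i^A dZ^i_A + 4 κ dZ_{Ai} dZ^i_B V^A V^B B * 𝒦)`. -/
structure IsSolution (V : Fin (d + 1) → ℝ) (κ : ℝ) (W : Fin d → U → ZYSeries d)
    (S : Osc d → U → ZYSeries d) (B : U → ZYSeries d) : Prop where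
  smoothW : ∀ μ, SmoothSeries (W μ)
  smoothS : ∀ p, SmoothSeries (S p)
  smoothB : SmoothSeries B
  sp2 : Sp2Fields W S B
  eqWW : ∀ μ ν x, dX μ (W ν) x - dX ν (W μ) x + comm (W μ x) (W ν x) = 0
  eqWB : ∀ μ x, dX μ B x + starZY (W μ x) (B x) - starZY (B x) (tilde V (W μ x)) = 0
  eqWS : ∀ μ p x, dX μ (S p) x + comm (W μ x) (S p x) = 0
  eqSB : ∀ p x, starZY (S p x) (B x) - starZY (B x) (tildeS V (fun q => S q x) p) = 0
  eqSS : ∀ i A j A' x, comm (S (i, A) x) (S (j, A') x) =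
    -((eps i j : ℂ) • ((eta A A' : ℂ) • (1 : ZYSeries d)
      + (4 * κ * lowerV V A * lowerV V A' : ℂ) • starZY (B x) (klein V)))

/-- The part of the nonlinear system of first order in `(W₁, S₁, B₁)`, for
`W = W_0 + W₁`, `S = S_0 + S₁`, `B = 0 + B₁`. -/
structure IsLinearizedSolution (V : Fin (d + 1) → ℝ) (κ : ℝ)
    (ω₀ : Fin d → U → Matrix (Fin (d + 1)) (Fin (d + 1)) ℝ)
    (W₁ : Fin d → U → ZYSeries d) (S₁ : Osc d → U → ZYSeries d) (B₁ : U → ZYSeries d) : Prop where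
  smoothW : ∀ μ, SmoothSeries (W₁ μ)
  smoothS : ∀ p, SmoothSeries (S₁ p)
  smoothB : SmoothSeries B₁
  sp2 : Sp2Fields W₁ S₁ B₁
  eqWW : ∀ μ ν x, dX μ (W₁ ν) x - dX ν (W₁ μ) x
    + comm (emb (W0 ω₀ μ x)) (W₁ ν x) + comm (W₁ μ x) (emb (W0 ω₀ ν x)) = 0
  eqWB : ∀ μ x, dX μ B₁ x + starZY (emb (W0 ω₀ μ x)) (B₁ x)
    - starZY (B₁ x) (tilde V (emb (W0 ω₀ μ x))) = 0
  eqWS : ∀ μ p x, dX μ (S₁ p) x + comm (emb (W0 ω₀ μ x)) (S₁ p x) + comm (W₁ μ x) (S0 p) = 0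
  eqSB : ∀ p x, starZY (S0 p) (B₁ x) - starZY (B₁ x) (tildeS V S0 p) = 0
  eqSS : ∀ i A j A' x, comm (S0 (i, A)) (S₁ (j, A') x) + comm (S₁ (i, A) x) (S0 (j, A')) =
    -((eps i j : ℂ) • ((4 * κ * lowerV V A * lowerV V A' : ℂ) • starZY (B₁ x) (klein V)))

/-! ## The free unfolded equations -/

/-- `D̃_0 C = dC + W_0 * C - C * W̃_0` with the Weyl–Moyal product. -/
def twistedD (V : Fin (d + 1) → ℝ) (ω₀ : Fin d → U → Matrix (Fin (d + 1)) (Fin (d + 1)) ℝ)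
    (C : U → YSeries d) (μ : Fin d) (x : U) : YSeries d :=
  dX μ C x + starY (W0 ω₀ μ x) (C x) - starY (C x) (tildeY V (W0 ω₀ μ x))

/-- Components of the linearized curvature `R_1 = dω + {ω, W_0}_*`. -/
def linCurv (ω₀ : Fin d → U → Matrix (Fin (d + 1)) (Fin (d + 1)) ℝ)
    (ω : Fin d → U → YSeries d) (μ ν : Fin d) (x : U) : YSeries d :=
  dX μ (ω ν) x - dX ν (ω μ) x + commY (W0 ω₀ μ x) (ω ν x) + commY (ω μ x) (W0 ω₀ ν x)

/-- Components of `½ κ E^A E^B (∂²C/∂^⊥Y^{Ai} ∂^⊥Y_i^B)(^⊥Y)`. -/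
def weylSource (V : Fin (d + 1) → ℝ) (κ : ℝ)
    (ω₀ : Fin d → U → Matrix (Fin (d + 1)) (Fin (d + 1)) ℝ)
    (C : U → YSeries d) (μ ν : Fin d) (x : U) : YSeries d :=
  (κ / 2 : ℂ) • ∑ A, ∑ B,
    ((frame V ω₀ μ x A * frame V ω₀ ν x B - frame V ω₀ ν x A * frame V ω₀ μ x B : ℝ) : ℂ) •
      perpArg V (∑ i, dPerpUp V A i (dPerp V B i (C x)))

/-- The free unfolded system for `sp(2)`-invariant `ω(Y|x)` and `C(Y|x)`. -/
structure IsFreeSolution (V : Fin (d + 1) → ℝ) (κ : ℝ)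
    (ω₀ : Fin d → U → Matrix (Fin (d + 1)) (Fin (d + 1)) ℝ)
    (ω : Fin d → U → YSeries d) (C : U → YSeries d) : Prop where
  smoothω : ∀ μ, SmoothSeries (ω μ)
  smoothC : SmoothSeries C
  sp2ω : ∀ i j μ x, commY (tY i j) (ω μ x) = 0
  sp2C : ∀ i j x, commY (tY i j) (C x) = 0
  twisted : ∀ μ x, twistedD V ω₀ C μ x = 0
  curvature : ∀ μ ν x, linCurv ω₀ ω μ ν x = weylSource V κ ω₀ C μ ν x

/-! ## The higher spin algebra `hu(1|2:[d-1,2])` -/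

/-- Defining relations of the Weyl algebra, `[Ŷ_i^A, Ŷ_j^B] = ε_{ij} η^{AB}`. -/
inductive WeylRel (d : ℕ) : FreeAlgebra ℂ (Osc d) → FreeAlgebra ℂ (Osc d) → Prop
  | comm (p q : Osc d) : WeylRel d
      (FreeAlgebra.ι ℂ p * FreeAlgebra.ι ℂ q - FreeAlgebra.ι ℂ q * FreeAlgebra.ι ℂ p)
      (algebraMap ℂ _ ((eps p.1 q.1 * eta p.2 q.2 : ℝ) : ℂ))

/-- The complex Weyl algebra `A_{d+1}(ℂ)`. -/
def Weyl (d : ℕ) : Type := RingQuot (WeylRel d)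

instance : Ring (Weyl d) := inferInstanceAs (Ring (RingQuot (WeylRel d)))

instance : Algebra ℂ (Weyl d) := inferInstanceAs (Algebra ℂ (RingQuot (WeylRel d)))

/-- The quotient map from the free algebra. -/
def weylMk (d : ℕ) : FreeAlgebra ℂ (Osc d) →ₐ[ℂ] Weyl d := RingQuot.mkAlgHom ℂ (WeylRel d)

/-- The generators `Ŷ_i^A`. -/
def Yhat (p : Osc d) : Weyl d := weylMk d (FreeAlgebra.ι ℂ p)

theorem Yhat_comm (p q : Osc d) : Yhat p * Yhat q - Yhat q * Yhat p
    = algebraMap ℂ (Weyl d) ((eps p.1 q.1 * eta p.2 q.2 : ℝ) : ℂ) := by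
  have h : weylMk d _ = weylMk d _ := RingQuot.mkAlgHom_rel ℂ (WeylRel.comm p q)
  rw [map_sub, map_mul, map_mul, AlgHom.commutes] at h
  exact h

/-- The opposite of the Weyl algebra, with complex conjugate scalars. -/
@[reducible] def conjAlgebra (d : ℕ) : Algebra ℂ (Weyl d)ᵐᵒᵖ :=
  RingHom.toAlgebra' ((algebraMap ℂ (Weyl d)ᵐᵒᵖ).comp (starRingEnd ℂ))
    (fun c x => Algebra.commutes ((starRingEnd ℂ) c) x)

def daggerFree (d : ℕ) : FreeAlgebra ℂ (Osc d) →+* (Weyl d)ᵐᵒᵖ :=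
  let _ := conjAlgebra d
  (FreeAlgebra.lift ℂ fun p : Osc d => MulOpposite.op (Complex.I • Yhat p)).toRingHom

theorem daggerFree_ι (p : Osc d) :
    daggerFree d (FreeAlgebra.ι ℂ p) = MulOpposite.op (Complex.I • Yhat p) := by
  let _ := conjAlgebra d
  exact FreeAlgebra.lift_ι_apply _ _

theorem daggerFree_algebraMap (c : ℂ) :
    daggerFree d (algebraMap ℂ _ c)
      = MulOpposite.op (algebraMap ℂ (Weyl d) ((starRingEnd ℂ) c)) := by
  let _ := conjAlgebra d
  exact AlgHom.commutes (FreeAlgebra.lift ℂ fun p : Osc d =>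
    (MulOpposite.op (Complex.I • Yhat p) : (Weyl d)ᵐᵒᵖ)) c

theorem daggerFree_rel ⦃a b : FreeAlgebra ℂ (Osc d)⦄ (h : WeylRel d a b) :
    daggerFree d a = daggerFree d b := by
  obtain ⟨p, q⟩ := h
  rw [map_sub, map_mul, map_mul, daggerFree_ι, daggerFree_ι, daggerFree_algebraMap,
    Complex.conj_ofReal, ← MulOpposite.op_mul, ← MulOpposite.op_mul, ← MulOpposite.op_sub,
    ← Yhat_comm]
  congr 1
  rw [smul_mul_smul_comm, smul_mul_smul_comm, Complex.I_mul_I, neg_one_smul, neg_one_smul]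
  abel

/-- The involution `†` of the complex Weyl algebra: it conjugates complex numbers, reverses the
order of operators, and maps `Ŷ_i^A` to `i Ŷ_i^A`. -/
def dagger : Weyl d →+* (Weyl d)ᵐᵒᵖ := RingQuot.lift ⟨daggerFree d, daggerFree_rel⟩

theorem dagger_mk (a : FreeAlgebra ℂ (Osc d)) : dagger (weylMk d a) = daggerFree d a := by
  have h : weylMk d a = RingQuot.mkRingHom (WeylRel d) a :=
    congrArg (fun g => g a) (RingQuot.mkAlgHom_coe ℂ (WeylRel d))
  rw [h]
  exact RingQuot.lift_mkRingHom_apply _ _ _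

theorem dagger_algebraMap (c : ℂ) :
    dagger (algebraMap ℂ (Weyl d) c)
      = MulOpposite.op (algebraMap ℂ (Weyl d) ((starRingEnd ℂ) c)) := by
  rw [← daggerFree_algebraMap, ← AlgHom.commutes (weylMk d)]
  exact dagger_mk _

/-- The `sp(2)` generators `t_{ij} = ½ {Ŷ_i^A, Ŷ_j^B} η_{AB}`. -/
def tHat (i j : Fin 2) : Weyl d :=
  (1 / 2 : ℂ) • ∑ A, ∑ B, (eta A B : ℂ) •
    (Yhat (i, A) * Yhat (j, B) + Yhat (j, B) * Yhat (i, A))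

/-- The commutator Lie bracket. -/
instance : LieRing (Weyl d) := LieRing.ofAssociativeRing

instance : LieAlgebra ℝ (Weyl d) := LieAlgebra.ofAssociativeAlgebra

/-- The real Lie algebra `hu_∞(1|2:[d-1,2])` of the `sp(2)`-invariant `f` with `f† = -f`. -/
def huInf (d : ℕ) : LieSubalgebra ℝ (Weyl d) where
  carrier := {f | (∀ i j, tHat i j * f = f * tHat i j) ∧ (dagger f).unop = -f}
  zero_mem' := by simp
  add_mem' := by
    rintro a b ⟨ha, ha'⟩ ⟨hb, hb'⟩
    refine ⟨fun i j => by rw [mul_add, add_mul, ha, hb], ?_⟩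
    rw [map_add, MulOpposite.unop_add, ha', hb', neg_add]
  smul_mem' := by
    rintro c a ⟨ha, ha'⟩
    refine ⟨fun i j => by rw [mul_smul_comm, smul_mul_assoc, ha], ?_⟩
    have hc : c • a = algebraMap ℂ (Weyl d) (c : ℂ) * a := by
      rw [← Algebra.smul_def]
      exact (Complex.coe_smul c a).symm
    rw [hc, map_mul, dagger_algebraMap, MulOpposite.unop_mul, ha', Complex.conj_ofReal,
      MulOpposite.unop_op, neg_mul, Algebra.commutes]
  lie_mem' := by
    rintro a b ⟨ha, ha'⟩ ⟨hb, hb'⟩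
    refine ⟨fun i j => ?_, ?_⟩
    · rw [Ring.lie_def, mul_sub, sub_mul, ← mul_assoc, ← mul_assoc, ha, hb, mul_assoc, mul_assoc,
        ha, hb, mul_assoc, mul_assoc]
    · rw [Ring.lie_def, map_sub, map_mul, map_mul, MulOpposite.unop_sub, MulOpposite.unop_mul,
        MulOpposite.unop_mul, ha', hb', neg_mul_neg, neg_mul_neg, neg_sub]

/-- The ideal of the elements `f = t_{ij} g^{ij} = g^{ij} t_{ij}`. -/
def huIdeal (d : ℕ) : LieIdeal ℝ (huInf d) where
  carrier := {f | ∃ g : Fin 2 → Fin 2 → Weyl d,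
    (f : Weyl d) = ∑ i, ∑ j, tHat i j * g i j ∧ (f : Weyl d) = ∑ i, ∑ j, g i j * tHat i j}
  zero_mem' := ⟨0, by simp⟩
  add_mem' := by
    rintro a b ⟨g, hg, hg'⟩ ⟨h, hh, hh'⟩
    refine ⟨g + h, ?_, ?_⟩
    · simp only [AddMemClass.coe_add, hg, hh, Pi.add_apply, mul_add, Finset.sum_add_distrib]
    · simp only [AddMemClass.coe_add, hg', hh', Pi.add_apply, add_mul, Finset.sum_add_distrib]
  smul_mem' := by
    rintro c a ⟨g, hg, hg'⟩
    refine ⟨c • g, ?_, ?_⟩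
    · change c • (a : Weyl d) = _
      simp only [hg, Pi.smul_apply, mul_smul_comm, Finset.smul_sum]
    · change c • (a : Weyl d) = _
      simp only [hg', Pi.smul_apply, smul_mul_assoc, Finset.smul_sum]
  lie_mem := by
    rintro ⟨x, hx, -⟩ a ⟨g, hg, hg'⟩
    refine ⟨fun i j => x * g i j - g i j * x, ?_, ?_⟩
    · rw [LieSubalgebra.coe_bracket, Ring.lie_def, hg]
      simp only [Finset.mul_sum, Finset.sum_mul, ← Finset.sum_sub_distrib, mul_sub, ← mul_assoc, hx]
    · rw [LieSubalgebra.coe_bracket, Ring.lie_def, hg']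
      simp only [Finset.mul_sum, Finset.sum_mul, ← Finset.sum_sub_distrib, sub_mul, mul_assoc, hx]

/-- The higher spin algebra `hu(1|2:[d-1,2])`. -/
abbrev HU (d : ℕ) := huInf d ⧸ huIdeal d

/-! ## Global symmetries of the vacuum -/

/-- The reality condition `f̄(Z,Y) = -f(-iZ,iY)`. -/
def IsReal (f : ZYSeries d) : Prop :=
  ∀ m : (Osc d ⊕ Osc d) →₀ ℕ, (starRingEnd ℂ) (MvPowerSeries.coeff m f) =
    -((-Complex.I) ^ (∑ p, m (Sum.inl p)) * Complex.I ^ (∑ p, m (Sum.inr p))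
      * MvPowerSeries.coeff m f)

/-- The gauge parameters `ε(Z,Y|x)` that leave the vacuum invariant:
`[S_0, ε]_* = 0` and `D_0 ε = dε + [W_0, ε]_* = 0`. -/
structure IsVacuumSymmetry (ω₀ : Fin d → U → Matrix (Fin (d + 1)) (Fin (d + 1)) ℝ)
    (ε : U → ZYSeries d) : Prop where
  smooth : SmoothSeries ε
  poly : ∀ x, IsPoly (ε x)
  sp2 : ∀ i j x, comm (tTot i j) (ε x) = 0
  isReal : ∀ x, IsReal (ε x)
  onS : ∀ p x, comm (S0 p) (ε x) = 0
  onW : ∀ μ x, dX μ ε x + comm (emb (W0 ω₀ μ x)) (ε x) = 0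

/-- Symbols `f(Y)` of elements of `hu_∞(1|2:[d-1,2])`. -/
structure IsHuSymbol (f : YSeries d) : Prop where
  poly : IsPoly f
  sp2 : ∀ i j, commY (tY i j) f = 0
  isReal : IsReal (emb f)

/-- Symbols `f = t_{ij} * g^{ij} = g^{ij} * t_{ij}` of elements of the ideal. -/
def IsIdealSymbol (f : YSeries d) : Prop :=
  ∃ g : Fin 2 → Fin 2 → YSeries d, (∀ i j, IsPoly (g i j)) ∧
    f = ∑ i, ∑ j, starY (tY i j) (g i j) ∧ f = ∑ i, ∑ j, starY (g i j) (tY i j)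

end HigherSpin

end

/-! The linearized system is a de Rham problem in the auxiliary variables Z. Commutation with `S0`
is the derivative ∂/∂Z (`comm_S0`), so to first order B₁ is independent of Z, the Z-curl of S₁ is
prescribed by B₁ * 𝒦, and the Z-gradient of W₁ equals the covariant derivative of S₁. Closed Z-forms
on power series are exact, with a primitive obtained by dividing by the degree in Z (`pd_homotopy`).
Everything therefore follows from one particular solution, and the freedom left is the exact part
generated by ε together with Z-independent integration "constants" ω and C.

The particular solution rests on the Klein operator. Each contraction acting on 𝒦 from the left
factor produces a factor z + y, which no further contraction can remove. Hence f * 𝒦 is locally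
finite for every series f (`rightGood_klein`), C(Y) * 𝒦 = C(^⊥Y - ^∥Z) 𝒦 (`kleinR_emb`), and 𝒦 * f =
f̃ * 𝒦 for polynomials f(Y) (`klein_star_emb`). So the vacuum covariant derivative of F = C * 𝒦 is
(D̃₀C) * 𝒦 (`covD_kleinR`), which is where the twisted equation for C enters.

Replacing Z by tZ multiplies the part of degree n in Z by tⁿ. The homotopy integrals are thus the
operators 1/(N+2) and 1/((N+1)(N+2)) in the degree operator N, and calculus with them is exact
algebra. Since F depends on Z through z_i only, the curl of V_A z^i G is (N+2)G up to sign and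
constants, which solves the S-equation (`solS_curl`). The commutator with W₀ is a first-order
operator preserving N plus a mixed operator ∂_Y∂_Z lowering N by one. Commuting the latter past z^i
and past 1/(N+2) yields derivatives along the frame, and a two-dimensional identity assembles them
into a Z-gradient (`covD_solS`). The curvature of this W then has zero Z-gradient, so its value at Z
= 0 determines it. That value is minus the Weyl source (`curl_solW`). Compatibility with sp(2) holds
because the generators act by derivations that commute with N and annihilate 𝒦.

Regularity holds because, for polynomial C, the integrands are polynomials times exp(-2t z_k y^k).
For a power series, a given coefficient of the result sees only finitely many homogeneous components
of C.

Vacuum symmetries are Z-independent polynomials parallel for the flat connection. A parallel frame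
exists on a star-shaped set by transport along segments, with flatness giving the derivative in all
directions (`exists_flat_transport`). Uniqueness is Grönwall's inequality on the finitely many
coefficients up to a given degree (`parallel_eq_zero`). Star products of parallel sections are
parallel (`IsParallel.star`), so sp(2) invariance, reality and membership in the ideal propagate
from x₀ to all of U. Finally the Weyl algebra is identified with polynomials under the star product
by sending an operator to its action on 1. Symmetric ordering provides the inverse
(`symb_injective`), and this turns the values at x₀ into elements of the higher spin algebra. -/

noncomputable section

namespace HigherSpin

open MvPowerSeries

/-! ### Power series: linear maps continuous for the order filtration, polynomials, substitution -/

section Toolkit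

variable {σ τ υ : Type*}

/-! ### Linear maps of power series that are continuous for the order filtration -/

/-- Linear maps of power series that are continuous for the order filtration. -/
def FinOrd (T : MvPowerSeries σ ℂ →ₗ[ℂ] MvPowerSeries τ ℂ) : Prop :=
  ∀ M : ℕ, ∃ N : ℕ, ∀ f, (N : ℕ∞) ≤ f.order → (M : ℕ∞) ≤ (T f).order

theorem le_order_sum {ι : Type*} (s : Finset ι) (f : ι → MvPowerSeries σ ℂ) (N : ℕ∞)
    (h : ∀ i ∈ s, N ≤ (f i).order) : N ≤ (∑ i ∈ s, f i).order := by
  classical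
  induction s using Finset.induction_on with
  | empty => simp
  | insert a s ha ih =>
    rw [Finset.sum_insert ha]
    exact (le_min (h _ (Finset.mem_insert_self _ _))
      (ih fun i hi => h i (Finset.mem_insert_of_mem hi))).trans min_order_le_add

theorem FinOrd.of_shift {T : MvPowerSeries σ ℂ →ₗ[ℂ] MvPowerSeries τ ℂ} (k : ℕ)
    (h : ∀ (M : ℕ) f, ((M + k : ℕ) : ℕ∞) ≤ f.order → (M : ℕ∞) ≤ (T f).order) : FinOrd T :=
  fun M => ⟨M + k, h M⟩

theorem FinOrd.zero : FinOrd (0 : MvPowerSeries σ ℂ →ₗ[ℂ] MvPowerSeries τ ℂ) :=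
  fun M => ⟨0, fun f _ => by simp⟩

theorem FinOrd.comp {T : MvPowerSeries τ ℂ →ₗ[ℂ] MvPowerSeries υ ℂ}
    {S : MvPowerSeries σ ℂ →ₗ[ℂ] MvPowerSeries τ ℂ} (hT : FinOrd T) (hS : FinOrd S) :
    FinOrd (T ∘ₗ S) := fun M => by
  obtain ⟨N, hN⟩ := hT M
  obtain ⟨N', hN'⟩ := hS N
  exact ⟨N', fun f hf => hN _ (hN' f hf)⟩

theorem FinOrd.add {T S : MvPowerSeries σ ℂ →ₗ[ℂ] MvPowerSeries τ ℂ} (hT : FinOrd T)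
    (hS : FinOrd S) : FinOrd (T + S) := fun M => by
  obtain ⟨N, hN⟩ := hT M
  obtain ⟨N', hN'⟩ := hS M
  refine ⟨max N N', fun f hf => ?_⟩
  have h1 : (N : ℕ∞) ≤ f.order := le_trans (by exact_mod_cast le_max_left _ _) hf
  have h2 : (N' : ℕ∞) ≤ f.order := le_trans (by exact_mod_cast le_max_right _ _) hf
  exact (le_min (hN f h1) (hN' f h2)).trans min_order_le_add

theorem FinOrd.smul {T : MvPowerSeries σ ℂ →ₗ[ℂ] MvPowerSeries τ ℂ} (c : ℂ) (hT : FinOrd T) :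
    FinOrd (c • T) := fun M => by
  obtain ⟨N, hN⟩ := hT M
  exact ⟨N, fun f hf => (hN f hf).trans le_order_smul⟩

theorem FinOrd.sub {T S : MvPowerSeries σ ℂ →ₗ[ℂ] MvPowerSeries τ ℂ} (hT : FinOrd T)
    (hS : FinOrd S) : FinOrd (T - S) := by
  have : T - S = T + (-1 : ℂ) • S := by
    refine LinearMap.ext fun f => ?_
    rw [LinearMap.sub_apply, LinearMap.add_apply, LinearMap.smul_apply, neg_smul, one_smul,
      sub_eq_add_neg]
  rw [this]; exact hT.add (hS.smul _)

theorem FinOrd.sum {ι : Type*} (s : Finset ι) (T : ι → MvPowerSeries σ ℂ →ₗ[ℂ] MvPowerSeries τ ℂ)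
    (h : ∀ i ∈ s, FinOrd (T i)) : FinOrd (∑ i ∈ s, T i) := by
  classical
  induction s using Finset.induction_on with
  | empty => simpa using FinOrd.zero
  | insert a s ha ih =>
    rw [Finset.sum_insert ha]
    exact (h _ (Finset.mem_insert_self _ _)).add (ih fun i hi => h i (Finset.mem_insert_of_mem hi))

/-- Multiplication by a fixed series. -/
def mulL (g : MvPowerSeries σ ℂ) : MvPowerSeries σ ℂ →ₗ[ℂ] MvPowerSeries σ ℂ := LinearMap.mulLeft ℂ g

@[simp] theorem mulL_apply (g f : MvPowerSeries σ ℂ) : mulL g f = g * f := rfl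

theorem le_order_mul_right {g f : MvPowerSeries σ ℂ} {N : ℕ∞} (h : N ≤ f.order) :
    N ≤ (g * f).order :=
  h.trans (le_add_self.trans le_order_mul)

theorem finOrd_mulL (g : MvPowerSeries σ ℂ) : FinOrd (mulL g) :=
  FinOrd.of_shift 0 fun _ _ h => le_order_mul_right h

/-- The partial derivative as a linear map. -/
def pd (s : σ) : MvPowerSeries σ ℂ →ₗ[ℂ] MvPowerSeries σ ℂ := (pderiv ℂ s).toLinearMap

theorem pd_apply (s : σ) (f : MvPowerSeries σ ℂ) : pd s f = pderiv ℂ s f := rfl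

theorem coeff_pd (s : σ) (f : MvPowerSeries σ ℂ) (n : σ →₀ ℕ) :
    coeff n (pd s f) = coeff (n + Finsupp.single s 1) f * (n s + 1) := coeff_pderiv f n

theorem pd_mul (s : σ) (f g : MvPowerSeries σ ℂ) : pd s (f * g) = pd s f * g + f * pd s g := by
  rw [pd_apply, Derivation.leibniz, smul_eq_mul, smul_eq_mul, pd_apply, pd_apply]; ring

theorem pd_X [DecidableEq σ] (s t : σ) :
    pd s (X t : MvPowerSeries σ ℂ) = if s = t then 1 else 0 := by
  rw [pd_apply, pderiv_X, Pi.single_apply]; simp [eq_comm]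

@[simp] theorem pd_one (s : σ) : pd s (1 : MvPowerSeries σ ℂ) = 0 := pderiv_one

theorem pd_comm (s t : σ) (f : MvPowerSeries σ ℂ) : pd s (pd t f) = pd t (pd s f) := by
  classical
  ext n
  rw [coeff_pd, coeff_pd, coeff_pd, coeff_pd, add_right_comm]
  by_cases h : s = t
  · subst h; ring
  · simp [h, Ne.symm h]; ring

theorem le_order_pd (s : σ) {f : MvPowerSeries σ ℂ} {M : ℕ} (h : ((M + 1 : ℕ) : ℕ∞) ≤ f.order) :
    (M : ℕ∞) ≤ (pd s f).order := by
  refine nat_le_order fun n hn => ?_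
  rw [coeff_pd, coeff_of_lt_order, zero_mul]
  refine lt_of_lt_of_le ?_ h
  rw [map_add, Finsupp.degree_single]
  exact_mod_cast Nat.add_lt_add_right hn 1

theorem finOrd_pd (s : σ) : FinOrd (pd s : MvPowerSeries σ ℂ →ₗ[ℂ] _) :=
  FinOrd.of_shift 1 fun _ _ h => le_order_pd s h

/-! ### Polynomials -/

theorem IsPoly.coe (p : MvPolynomial σ ℂ) : IsPoly (p : MvPowerSeries σ ℂ) := ⟨p, rfl⟩

theorem IsPoly.add {f g : MvPowerSeries σ ℂ} (hf : IsPoly f) (hg : IsPoly g) : IsPoly (f + g) := by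
  obtain ⟨p, rfl⟩ := hf; obtain ⟨q, rfl⟩ := hg; exact ⟨p + q, by simp⟩

theorem IsPoly.mul {f g : MvPowerSeries σ ℂ} (hf : IsPoly f) (hg : IsPoly g) : IsPoly (f * g) := by
  obtain ⟨p, rfl⟩ := hf; obtain ⟨q, rfl⟩ := hg; exact ⟨p * q, by simp⟩

theorem IsPoly.smul {f : MvPowerSeries σ ℂ} (c : ℂ) (hf : IsPoly f) : IsPoly (c • f) := by
  obtain ⟨p, rfl⟩ := hf; exact ⟨c • p, by simp⟩

theorem isPoly_zero : IsPoly (0 : MvPowerSeries σ ℂ) := ⟨0, by simp⟩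

theorem isPoly_one : IsPoly (1 : MvPowerSeries σ ℂ) := ⟨1, by simp⟩

theorem isPoly_X (s : σ) : IsPoly (X s : MvPowerSeries σ ℂ) := ⟨MvPolynomial.X s, by simp⟩

theorem isPoly_monomial (m : σ →₀ ℕ) (c : ℂ) : IsPoly (monomial m c) :=
  ⟨MvPolynomial.monomial m c, by simp⟩

theorem IsPoly.sub {f g : MvPowerSeries σ ℂ} (hf : IsPoly f) (hg : IsPoly g) : IsPoly (f - g) := by
  have := hf.add (hg.smul (-1)); rwa [neg_one_smul, ← sub_eq_add_neg] at this

theorem IsPoly.sum {ι : Type*} (s : Finset ι) (f : ι → MvPowerSeries σ ℂ)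
    (h : ∀ i ∈ s, IsPoly (f i)) : IsPoly (∑ i ∈ s, f i) := by
  classical
  induction s using Finset.induction_on with
  | empty => simpa using isPoly_zero
  | insert a s ha ih =>
    rw [Finset.sum_insert ha]
    exact (h _ (Finset.mem_insert_self _ _)).add (ih fun i hi => h i (Finset.mem_insert_of_mem hi))

theorem isPoly_pd {f : MvPowerSeries σ ℂ} (s : σ) (hf : IsPoly f) : IsPoly (pd s f) := by
  obtain ⟨p, rfl⟩ := hf; exact ⟨MvPolynomial.pderiv s p, (pderiv_coe p).symm⟩

/-- Polynomials are generated from `1` by linear combinations and multiplication by variables. -/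
theorem IsPoly.induction {P : MvPowerSeries σ ℂ → Prop} {f : MvPowerSeries σ ℂ} (hf : IsPoly f)
    (one : P 1) (add : ∀ f g, P f → P g → P (f + g)) (smul : ∀ (c : ℂ) f, P f → P (c • f))
    (mulX : ∀ s f, IsPoly f → P f → P (X s * f)) : P f := by
  obtain ⟨p, rfl⟩ := hf
  induction p using MvPolynomial.induction_on with
  | C a =>
    have : ((MvPolynomial.C a : MvPolynomial σ ℂ) : MvPowerSeries σ ℂ) = a • 1 := by
      rw [MvPolynomial.coe_C, MvPowerSeries.smul_eq_C_mul, mul_one]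
    rw [this]; exact smul _ _ one
  | add p q hp hq => rw [MvPolynomial.coe_add]; exact add _ _ hp hq
  | mul_X p s hp =>
    rw [MvPolynomial.coe_mul, MvPolynomial.coe_X, mul_comm]; exact mulX _ _ (IsPoly.coe p) hp

theorem le_order_sub_truncTotal [Finite σ] (N : ℕ) (f : MvPowerSeries σ ℂ) :
    (N : ℕ∞) ≤ (f - (truncTotal N f : MvPolynomial σ ℂ)).order := by
  refine nat_le_order fun m hm => ?_
  rw [map_sub, MvPolynomial.coeff_coe, coeff_truncTotal_eq_ite, if_pos hm, sub_self]

/-- A series differs from its truncation by a term of high order, which both maps send to high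
order. Agreement on the truncations therefore decides every coefficient. Most identities for
arbitrary series below are reduced to polynomials in this way. -/
theorem FinOrd.ext_poly [Finite σ] {T S : MvPowerSeries σ ℂ →ₗ[ℂ] MvPowerSeries τ ℂ}
    (hT : FinOrd T) (hS : FinOrd S) (h : ∀ f, IsPoly f → T f = S f) : T = S := by
  refine LinearMap.ext fun f => ?_
  ext m
  obtain ⟨N, hN⟩ := (hT.sub hS) (m.degree + 1)
  have h1 := hN _ (le_order_sub_truncTotal N f)
  rw [LinearMap.sub_apply, map_sub, map_sub, h _ (IsPoly.coe _)] at h1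
  have h2 := coeff_of_lt_order (d := m) (lt_of_lt_of_le (by exact_mod_cast Nat.lt_succ_self _) h1)
  simp only [map_sub, sub_sub_sub_cancel_right] at h2
  exact sub_eq_zero.1 h2

/-- Each coefficient of `T f` is a fixed finite linear combination of coefficients of `f`. -/
theorem FinOrd.exists_coeff [Finite σ] {T : MvPowerSeries σ ℂ →ₗ[ℂ] MvPowerSeries τ ℂ}
    (hT : FinOrd T) (m : τ →₀ ℕ) : ∃ (s : Finset (σ →₀ ℕ)) (a : (σ →₀ ℕ) → ℂ),
      ∀ f, coeff m (T f) = ∑ e ∈ s, a e * coeff e f := by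
  classical
  obtain ⟨N, hN⟩ := hT (m.degree + 1)
  -- The weights are the coefficients of the images of monomials. Terms of degree at least `N`
  -- cannot contribute, so the degree-`N` exponents present in the index set get weight zero.
  refine ⟨(Finsupp.finite_of_degree_le (σ := σ) N).toFinset,
    fun e => if e.degree < N then coeff m (T (monomial e 1)) else 0, fun f => ?_⟩
  have h1 := hN _ (le_order_sub_truncTotal N f)
  have h2 := coeff_of_lt_order (d := m) (lt_of_lt_of_le (by exact_mod_cast Nat.lt_succ_self _) h1)
  rw [map_sub, map_sub, sub_eq_zero] at h2
  rw [h2]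
  have h3 : ((truncTotal N f : MvPolynomial σ ℂ) : MvPowerSeries σ ℂ)
      = ∑ e ∈ (Finsupp.finite_of_degree_le (σ := σ) N).toFinset,
        (if e.degree < N then coeff e f else 0) • monomial e (1 : ℂ) := by
    ext n
    rw [MvPolynomial.coeff_coe, coeff_truncTotal_eq_ite, map_sum]
    simp only [map_smul, coeff_monomial, smul_eq_mul, mul_ite, mul_one, mul_zero]
    rw [Finset.sum_ite_eq]
    simp only [Set.Finite.mem_toFinset, Set.mem_ofPred_eq]
    split_ifs with h1 h2 h2 <;> first | rfl | omega
  rw [h3, map_sum, map_sum]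
  refine Finset.sum_congr rfl fun e _ => ?_
  rw [map_smul, map_smul, smul_eq_mul, ite_mul, ite_mul, zero_mul, zero_mul, mul_comm]

/-! ### Substitution of series without constant term -/

section Subst

variable [Finite σ] {a : σ → MvPowerSeries τ ℂ} (ha : ∀ s, constantCoeff (a s) = 0)

/-- Substitution as a linear map. -/
def substL (a : σ → MvPowerSeries τ ℂ) (ha : ∀ s, constantCoeff (a s) = 0) :
    MvPowerSeries σ ℂ →ₗ[ℂ] MvPowerSeries τ ℂ :=
  (substAlgHom (R := ℂ) (hasSubst_of_constantCoeff_zero ha)).toLinearMap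

theorem substL_apply (f : MvPowerSeries σ ℂ) : substL a ha f = subst a f := by
  rw [substL, AlgHom.toLinearMap_apply, coe_substAlgHom]

theorem finOrd_substL (ha : ∀ s, constantCoeff (a s) = 0) : FinOrd (substL a ha) := by
  refine FinOrd.of_shift 0 fun M f hf => ?_
  rw [substL_apply]
  refine le_trans ?_ (le_order_subst (hasSubst_of_constantCoeff_zero ha) f)
  have h1 : 1 ≤ ⨅ i, (a i).order := le_iInf fun i => one_le_order_iff_constCoeff_eq_zero.2 (ha i)
  calc ((M : ℕ) : ℕ∞) ≤ 1 * f.order := by rw [one_mul]; exact hf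
    _ ≤ _ := mul_le_mul_left h1 _

theorem substL_mul (ha : ∀ s, constantCoeff (a s) = 0) (f g : MvPowerSeries σ ℂ) :
    substL a ha (f * g) = substL a ha f * substL a ha g := by
  simp only [substL, AlgHom.toLinearMap_apply, map_mul]

theorem substL_one (ha : ∀ s, constantCoeff (a s) = 0) : substL a ha 1 = 1 := by
  simp only [substL, AlgHom.toLinearMap_apply, map_one]

theorem substL_X (ha : ∀ s, constantCoeff (a s) = 0) (s : σ) : substL a ha (X s) = a s := by
  rw [substL_apply, subst_X (hasSubst_of_constantCoeff_zero ha)]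

theorem isPoly_substL (ha : ∀ s, constantCoeff (a s) = 0) (h : ∀ s, IsPoly (a s))
    {f : MvPowerSeries σ ℂ} (hf : IsPoly f) : IsPoly (substL a ha f) :=
  hf.induction (P := fun f => IsPoly (substL a ha f)) (by rw [substL_one]; exact isPoly_one)
    (fun _ _ h1 h2 => by rw [map_add]; exact h1.add h2)
    (fun _ _ h1 => by rw [map_smul]; exact h1.smul _)
    (fun s _ _ h1 => by rw [substL_mul, substL_X]; exact (h s).mul h1)

end Subst

/-- The chain rule. -/
theorem pd_substL [Fintype σ] {a : σ → MvPowerSeries τ ℂ} (ha : ∀ s, constantCoeff (a s) = 0)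
    (u : τ) (f : MvPowerSeries σ ℂ) :
    pd u (substL a ha f) = ∑ s, pd u (a s) * substL a ha (pd s f) := by
  classical
  have key : pd u ∘ₗ substL a ha = ∑ s, mulL (pd u (a s)) ∘ₗ substL a ha ∘ₗ pd s := by
    refine FinOrd.ext_poly ((finOrd_pd u).comp (finOrd_substL ha)) (FinOrd.sum _ _ fun s _ =>
      (finOrd_mulL _).comp ((finOrd_substL ha).comp (finOrd_pd s))) fun f hf => ?_
    refine hf.induction (P := fun f => (pd u ∘ₗ substL a ha) f =
      (∑ s, mulL (pd u (a s)) ∘ₗ substL a ha ∘ₗ pd s) f) (by simp [substL_one])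
      (fun f g h1 h2 => by rw [map_add, map_add, h1, h2])
      (fun c f h => by rw [map_smul, map_smul, h]) fun s f _ h => ?_
    simp only [LinearMap.comp_apply, LinearMap.sum_apply, mulL_apply] at h ⊢
    simp only [substL_mul, pd_mul, h, substL_X, pd_X, map_add, mul_add, Finset.sum_add_distrib,
      Finset.mul_sum, ite_mul, one_mul, zero_mul, apply_ite (substL a ha), map_zero, mul_ite,
      mul_zero, Finset.sum_ite_eq', Finset.mem_univ, if_true]
    congr 1
    exact Finset.sum_congr rfl fun i _ => by ring
  have := LinearMap.congr_fun key f
  simpa using this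

end Toolkit

end HigherSpin

end

/-! ### Star products with a constant contraction matrix -/

noncomputable section

namespace HigherSpin

open MvPowerSeries

section GeneralStar

variable {σ : Type*} [Fintype σ]

/-! ### Star products with constant coefficients -/

/-- `∑_t b_{st} ∂_t`. -/
def dB (b : σ → σ → ℂ) (s : σ) : MvPowerSeries σ ℂ →ₗ[ℂ] MvPowerSeries σ ℂ := ∑ t, b s t • pd t

theorem dB_apply (b : σ → σ → ℂ) (s : σ) (f : MvPowerSeries σ ℂ) :
    dB b s f = ∑ t, b s t • pd t f := by simp [dB]

/-- The `n`-th power of `∑ b_{st} ∂_s ⊗ ∂_t`, followed by multiplication. -/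
def ctr (b : σ → σ → ℂ) :
    ℕ → MvPowerSeries σ ℂ →ₗ[ℂ] MvPowerSeries σ ℂ →ₗ[ℂ] MvPowerSeries σ ℂ
  | 0 => LinearMap.mul ℂ _
  | n + 1 => ∑ s, (ctr b n).compl₁₂ (pd s) (dB b s)

/-- `f exp(∑ b_{st} ∂_s ⊗ ∂_t) g`. -/
def gstar (b : σ → σ → ℂ) (f g : MvPowerSeries σ ℂ) : MvPowerSeries σ ℂ :=
  fun m => ∑ᶠ n : ℕ, (Nat.factorial n : ℂ)⁻¹ * coeff m (ctr b n f g)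

variable (b : σ → σ → ℂ)

@[simp] theorem ctr_zero (f g : MvPowerSeries σ ℂ) : ctr b 0 f g = f * g := rfl

theorem ctr_succ (n : ℕ) (f g : MvPowerSeries σ ℂ) :
    ctr b (n + 1) f g = ∑ s, ctr b n (pd s f) (dB b s g) := by
  simp [ctr]

theorem pd_dB (s t : σ) (f : MvPowerSeries σ ℂ) : pd s (dB b t f) = dB b t (pd s f) := by
  simp only [dB_apply, map_sum, map_smul]
  exact Finset.sum_congr rfl fun u _ => by rw [pd_comm]

theorem dB_comm (b' : σ → σ → ℂ) (s t : σ) (f : MvPowerSeries σ ℂ) :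
    dB b s (dB b' t f) = dB b' t (dB b s f) := by
  rw [dB_apply b s, dB_apply b s, map_sum]
  exact Finset.sum_congr rfl fun u _ => by rw [map_smul, pd_dB]

theorem dB_mul (s : σ) (f g : MvPowerSeries σ ℂ) : dB b s (f * g) = dB b s f * g + f * dB b s g := by
  simp only [dB_apply, pd_mul, smul_add, Finset.sum_add_distrib, Finset.sum_mul, Finset.mul_sum,
    smul_mul_assoc, mul_smul_comm]

theorem dB_X (s t : σ) : dB b s (X t) = b s t • (1 : MvPowerSeries σ ℂ) := by
  classical
  simp [dB_apply, pd_X]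

/-- The transposed form of the recursion. -/
theorem ctr_succ' (n : ℕ) (f g : MvPowerSeries σ ℂ) :
    ctr b (n + 1) f g = ∑ t, ctr b n (dB (fun s t => b t s) t f) (pd t g) := by
  rw [ctr_succ]
  simp only [dB_apply, map_sum, map_smul, LinearMap.sum_apply, LinearMap.smul_apply]
  exact Finset.sum_comm

/-- Exchanging the factors transposes the contraction matrix. Every statement about right factors
thereby yields its mirror image for left factors. -/
theorem ctr_flip (n : ℕ) (f g : MvPowerSeries σ ℂ) :
    ctr (fun s t => b t s) n g f = ctr b n f g := by
  induction n generalizing f g with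
  | zero => simp [mul_comm]
  | succ n ih => rw [ctr_succ, ctr_succ']; exact Finset.sum_congr rfl fun t _ => ih _ _

theorem star_flip (f g : MvPowerSeries σ ℂ) : gstar (fun s t => b t s) g f = gstar b f g := by
  funext m; simp only [gstar, ctr_flip]

theorem pd_ctr (u : σ) (n : ℕ) (f g : MvPowerSeries σ ℂ) :
    pd u (ctr b n f g) = ctr b n (pd u f) g + ctr b n f (pd u g) := by
  induction n generalizing f g with
  | zero => simp [pd_mul]
  | succ n ih =>
    simp only [ctr_succ, map_sum, ih, Finset.sum_add_distrib, pd_dB]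
    congr 1
    exact Finset.sum_congr rfl fun s _ => by rw [pd_comm]

/-- A variable can be differentiated only once. Among the n contractions there are n choices for the
one that hits it, and the remaining n - 1 act on `f`. -/
theorem ctr_X_mul (s : σ) (n : ℕ) (f g : MvPowerSeries σ ℂ) :
    ctr b n (X s * f) g = X s * ctr b n f g + (n : ℂ) • ctr b (n - 1) f (dB b s g) := by
  classical
  induction n generalizing f g with
  | zero => simp [mul_assoc]
  | succ n ih =>
    simp only [ctr_succ b n, pd_mul, pd_X, map_add, LinearMap.add_apply, Finset.sum_add_distrib, ih]
    have h1 : ∑ u, ctr b n ((if u = s then 1 else 0) * f) (dB b u g) = ctr b n f (dB b s g) := by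
      rw [Finset.sum_eq_single s]
      · simp
      · intro u _ hu; simp [hu]
      · simp
    rw [h1, ← Finset.mul_sum, ← Finset.smul_sum, add_comm, add_assoc]
    congr 1
    cases n with
    | zero => simp
    | succ k =>
      have h2 : ∑ u, ctr b (k + 1 - 1) (pd u f) (dB b s (dB b u g)) = ctr b (k + 1) f (dB b s g) := by
        rw [ctr_succ]; exact Finset.sum_congr rfl fun u _ => by rw [dB_comm]; rfl
      rw [h2, Nat.add_sub_cancel]
      push_cast; module

theorem ctr_mul_X (t : σ) (n : ℕ) (f g : MvPowerSeries σ ℂ) :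
    ctr b n f (X t * g) = X t * ctr b n f g
      + (n : ℂ) • ctr b (n - 1) (dB (fun s t => b t s) t f) g := by
  have := ctr_X_mul (fun s t => b t s) t n g f
  simpa only [ctr_flip] using this

theorem le_order_ctr_left (n : ℕ) {M : ℕ} {f : MvPowerSeries σ ℂ} (g : MvPowerSeries σ ℂ)
    (h : ((M + n : ℕ) : ℕ∞) ≤ f.order) : (M : ℕ∞) ≤ (ctr b n f g).order := by
  induction n generalizing f g with
  | zero =>
    rw [ctr_zero, mul_comm]; exact le_order_mul_right h
  | succ n ih =>
    rw [ctr_succ]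
    exact le_order_sum _ _ _ fun s _ => ih _ (le_order_pd s h)

/-! ### Pairs with locally finite star product -/

/-- The contractions of arbitrary series with `g` have orders tending to infinity. -/
def RightGood (g : MvPowerSeries σ ℂ) : Prop :=
  ∀ M : ℕ, ∃ N : ℕ, ∀ n, N ≤ n → ∀ f, (M : ℕ∞) ≤ (ctr b n f g).order

/-- The contractions of `f` with arbitrary series have orders tending to infinity. -/
def LeftGood (f : MvPowerSeries σ ℂ) : Prop := RightGood (fun s t => b t s) f

variable {b}

theorem RightGood.one : RightGood b (1 : MvPowerSeries σ ℂ) := fun M => by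
  refine ⟨1, fun n hn f => ?_⟩
  obtain ⟨k, rfl⟩ := Nat.exists_eq_add_of_le' hn
  rw [ctr_succ]
  simp [dB_apply]

theorem RightGood.add {g h : MvPowerSeries σ ℂ} (hg : RightGood b g) (hh : RightGood b h) :
    RightGood b (g + h) := fun M => by
  obtain ⟨N, hN⟩ := hg M
  obtain ⟨N', hN'⟩ := hh M
  refine ⟨max N N', fun n hn f => ?_⟩
  rw [map_add]
  exact (le_min (hN n (le_of_max_le_left hn) f) (hN' n (le_of_max_le_right hn) f)).trans
    min_order_le_add

theorem RightGood.smul {g : MvPowerSeries σ ℂ} (c : ℂ) (hg : RightGood b g) :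
    RightGood b (c • g) := fun M => by
  obtain ⟨N, hN⟩ := hg M
  exact ⟨N, fun n hn f => by rw [map_smul]; exact (hN n hn f).trans le_order_smul⟩

/-- By the product rule, differentiating `g` alone is differentiating the whole contraction minus
differentiating `f`. The arbitrary `f` absorbs the second term, and the first costs one order, hence
the bound for M + 1. -/
theorem RightGood.pd {g : MvPowerSeries σ ℂ} (u : σ) (hg : RightGood b g) :
    RightGood b (pd u g) := fun M => by
  obtain ⟨N, hN⟩ := hg (M + 1)
  refine ⟨N, fun n hn f => ?_⟩
  have h : ctr b n f (HigherSpin.pd u g)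
      = HigherSpin.pd u (ctr b n f g) + (-1 : ℂ) • ctr b n (HigherSpin.pd u f) g := by
    rw [pd_ctr]; module
  rw [h]
  refine (le_min (le_order_pd u (hN n hn f)) ?_).trans min_order_le_add
  exact (le_trans (by exact_mod_cast Nat.le_succ M) (hN n hn _)).trans le_order_smul

theorem RightGood.X_mul {g : MvPowerSeries σ ℂ} (t : σ) (hg : RightGood b g) :
    RightGood b (X t * g) := fun M => by
  obtain ⟨N, hN⟩ := hg M
  refine ⟨N + 1, fun n hn f => ?_⟩
  rw [ctr_mul_X]
  exact (le_min (le_order_mul_right (hN n (by omega) f))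
    ((hN (n - 1) (by omega) _).trans le_order_smul)).trans min_order_le_add

theorem RightGood.sum {ι : Type*} (s : Finset ι) (g : ι → MvPowerSeries σ ℂ)
    (h : ∀ i ∈ s, RightGood b (g i)) : RightGood b (∑ i ∈ s, g i) := by
  classical
  induction s using Finset.induction_on with
  | empty => simpa using (RightGood.one (b := b)).smul 0
  | insert a s ha ih =>
    rw [Finset.sum_insert ha]
    exact (h _ (Finset.mem_insert_self _ _)).add (ih fun i hi => h i (Finset.mem_insert_of_mem hi))

theorem RightGood.dB {g : MvPowerSeries σ ℂ} (b' : σ → σ → ℂ) (s : σ) (hg : RightGood b g) :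
    RightGood b (dB b' s g) := by
  rw [dB_apply]; exact RightGood.sum _ _ fun t _ => (hg.pd t).smul _

theorem _root_.HigherSpin.IsPoly.rightGood {g : MvPowerSeries σ ℂ} (hg : IsPoly g) :
    RightGood b g :=
  hg.induction (P := RightGood b) RightGood.one (fun _ _ => RightGood.add)
    (fun c _ => RightGood.smul c) fun s _ _ => RightGood.X_mul s

theorem _root_.HigherSpin.IsPoly.leftGood {g : MvPowerSeries σ ℂ} (hg : IsPoly g) :
    LeftGood b g := hg.rightGood

variable (b) in
/-- One of the two factors has a locally finite star product with all series. -/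
def Compat (f g : MvPowerSeries σ ℂ) : Prop := RightGood b g ∨ LeftGood b f

theorem Compat.exists_order {f g : MvPowerSeries σ ℂ} (h : Compat b f g) (M : ℕ) :
    ∃ N : ℕ, ∀ n, N ≤ n → (M : ℕ∞) ≤ (ctr b n f g).order := by
  obtain h | h := h
  · obtain ⟨N, hN⟩ := h M; exact ⟨N, fun n hn => hN n hn f⟩
  · obtain ⟨N, hN⟩ := h M; exact ⟨N, fun n hn => by rw [← ctr_flip]; exact hN n hn g⟩

theorem Compat.exists_coeff {f g : MvPowerSeries σ ℂ} (h : Compat b f g) (m : σ →₀ ℕ) :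
    ∃ N : ℕ, ∀ n, N ≤ n → coeff m (ctr b n f g) = 0 := by
  obtain ⟨N, hN⟩ := h.exists_order (m.degree + 1)
  exact ⟨N, fun n hn => coeff_of_lt_order
    (lt_of_lt_of_le (by exact_mod_cast Nat.lt_succ_self _) (hN n hn))⟩

theorem Compat.finite {f g : MvPowerSeries σ ℂ} (h : Compat b f g) (m : σ →₀ ℕ) :
    {n : ℕ | coeff m (ctr b n f g) ≠ 0}.Finite := by
  obtain ⟨N, hN⟩ := h.exists_coeff m
  exact (Set.finite_lt_nat N).subset fun n hn => by
    by_contra h'; exact hn (hN n (not_lt.1 h'))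

theorem coeff_star_eq_sum {f g : MvPowerSeries σ ℂ} {m : σ →₀ ℕ} {N : ℕ}
    (hN : ∀ n, N ≤ n → coeff m (ctr b n f g) = 0) : coeff m (gstar b f g)
      = ∑ n ∈ Finset.range N, (Nat.factorial n : ℂ)⁻¹ * coeff m (ctr b n f g) := by
  refine finsum_eq_sum_of_support_subset _ fun n hn => ?_
  by_contra h'
  rw [Finset.coe_range, Set.mem_Iio, not_lt] at h'
  exact hn (by simp only [hN n h', mul_zero])

theorem star_add_left' {f f' g : MvPowerSeries σ ℂ} (h : Compat b f g) (h' : Compat b f' g) :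
    gstar b (f + f') g = gstar b f g + gstar b f' g := by
  ext m
  obtain ⟨N, hN⟩ := h.exists_coeff m
  obtain ⟨N', hN'⟩ := h'.exists_coeff m
  have h1 : ∀ n, max N N' ≤ n → coeff m (ctr b n f g) = 0 := fun n hn => hN n (le_of_max_le_left hn)
  have h2 : ∀ n, max N N' ≤ n → coeff m (ctr b n f' g) = 0 :=
    fun n hn => hN' n (le_of_max_le_right hn)
  have h3 : ∀ n, max N N' ≤ n → coeff m (ctr b n (f + f') g) = 0 := fun n hn => by
    rw [map_add, LinearMap.add_apply, map_add, h1 n hn, h2 n hn, add_zero]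
  rw [map_add, coeff_star_eq_sum h1, coeff_star_eq_sum h2, coeff_star_eq_sum h3,
    ← Finset.sum_add_distrib]
  exact Finset.sum_congr rfl fun n _ => by
    rw [map_add, LinearMap.add_apply, map_add, mul_add]

/-- Local finiteness is not needed here: a nonzero scalar does not change the support of the sum
over n, and a zero scalar kills both sides. -/
theorem star_smul_left (c : ℂ) (f g : MvPowerSeries σ ℂ) : gstar b (c • f) g = c • gstar b f g := by
  ext m
  change ∑ᶠ n : ℕ, _ = c * ∑ᶠ n : ℕ, _
  by_cases hc : c = 0
  · subst hc; simp
  · rw [← smul_eq_mul, smul_finsum]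
    exact finsum_congr fun n => by
      rw [map_smul, LinearMap.smul_apply, map_smul, smul_eq_mul]; ring

theorem star_smul_right (c : ℂ) (f g : MvPowerSeries σ ℂ) : gstar b f (c • g) = c • gstar b f g := by
  rw [← star_flip, star_smul_left, star_flip]

theorem Compat.flip {f g : MvPowerSeries σ ℂ} (h : Compat b f g) :
    Compat (fun s t => b t s) g f := Or.symm h

theorem star_add_right' {f g g' : MvPowerSeries σ ℂ} (h : Compat b f g) (h' : Compat b f g') :
    gstar b f (g + g') = gstar b f g + gstar b f g' := by
  rw [← star_flip, star_add_left' h.flip h'.flip, star_flip b f g, star_flip b f g']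

/-- The star product with a fixed right factor, as a linear map. -/
def starR (g : MvPowerSeries σ ℂ) (hg : RightGood b g) :
    MvPowerSeries σ ℂ →ₗ[ℂ] MvPowerSeries σ ℂ where
  toFun f := gstar b f g
  map_add' _ _ := star_add_left' (.inl hg) (.inl hg)
  map_smul' c f := star_smul_left c f g

/-- The star product with a fixed left factor, as a linear map. -/
def starL (f : MvPowerSeries σ ℂ) (hf : LeftGood b f) :
    MvPowerSeries σ ℂ →ₗ[ℂ] MvPowerSeries σ ℂ where
  toFun g := gstar b f g
  map_add' _ _ := star_add_right' (.inr hf) (.inr hf)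
  map_smul' c g := star_smul_right c f g

theorem starR_apply {g : MvPowerSeries σ ℂ} (hg : RightGood b g) (f : MvPowerSeries σ ℂ) :
    starR g hg f = gstar b f g := rfl

theorem starL_apply {f : MvPowerSeries σ ℂ} (hf : LeftGood b f) (g : MvPowerSeries σ ℂ) :
    starL f hf g = gstar b f g := rfl

/-- Contractions with n ≥ N have high order whatever `f` is, and those with n < N lower the order of
`f` by at most n. An order M + N for `f` suffices for both. -/
theorem finOrd_starR {g : MvPowerSeries σ ℂ} (hg : RightGood b g) : FinOrd (starR g hg) := by
  intro M
  obtain ⟨N, hN⟩ := hg M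
  refine ⟨M + N, fun f hf => nat_le_order fun m hm => ?_⟩
  have h0 : ∀ n, coeff m (ctr b n f g) = 0 := fun n => by
    refine coeff_of_lt_order (lt_of_lt_of_le (by exact_mod_cast hm : (m.degree : ℕ∞) < M) ?_)
    by_cases hn : N ≤ n
    · exact hN n hn f
    · exact le_order_ctr_left b n g (le_trans (by exact_mod_cast (by omega)) hf)
  rw [starR_apply, coeff_star_eq_sum (N := 0) fun n _ => h0 n, Finset.sum_range_zero]

theorem finOrd_starL {f : MvPowerSeries σ ℂ} (hf : LeftGood b f) : FinOrd (starL f hf) := by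
  have : starL f hf = starR (b := fun s t => b t s) f hf :=
    LinearMap.ext fun g => (star_flip b f g).symm
  rw [this]; exact finOrd_starR _

theorem star_one_right (f : MvPowerSeries σ ℂ) : gstar b f 1 = f := by
  ext m
  rw [coeff_star_eq_sum (N := 1), Finset.sum_range_one]
  · simp
  · intro n hn
    obtain ⟨k, rfl⟩ := Nat.exists_eq_add_of_le' hn
    rw [ctr_succ]; simp [dB_apply]

theorem star_one_left (f : MvPowerSeries σ ℂ) : gstar b 1 f = f := by
  rw [← star_flip, star_one_right]

/-! ### Star products with variables -/

/-- In the exponential series the multiplicity n of `ctr_X_mul` turns 1/n! into 1/(n-1)!, so the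
correction terms resum to a full star product. -/
theorem star_X_mul {f g : MvPowerSeries σ ℂ} (s : σ) (h : Compat b f g)
    (h' : Compat b f (dB b s g)) (h'' : Compat b (X s * f) g) :
    gstar b (X s * f) g = X s * gstar b f g + gstar b f (dB b s g) := by
  classical
  ext m
  have hX : ∀ F : MvPowerSeries σ ℂ, coeff m (X s * F)
      = if Finsupp.single s 1 ≤ m then coeff (m - Finsupp.single s 1) F else 0 := fun F => by
    rw [X, coeff_monomial_mul]; simp
  obtain ⟨N₁, hN₁⟩ := h.exists_coeff (m - Finsupp.single s 1)
  obtain ⟨N₂, hN₂⟩ := h'.exists_coeff m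
  obtain ⟨N₃, hN₃⟩ := h''.exists_coeff m
  set N := max N₁ (max N₂ N₃)
  rw [map_add, hX, coeff_star_eq_sum (N := N + 1) fun n hn => hN₃ n (by omega),
    coeff_star_eq_sum (N := N + 1) fun n hn => hN₁ n (by omega),
    coeff_star_eq_sum (N := N) fun n hn => hN₂ n (by omega)]
  -- Index shift by one: the added term n = 0 carries the factor 0, so the truncated exponent n - 1
  -- is harmless there.
  have h2 : ∑ n ∈ Finset.range N, (Nat.factorial n : ℂ)⁻¹ * coeff m (ctr b n f (dB b s g))
      = ∑ n ∈ Finset.range (N + 1),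
        (Nat.factorial n : ℂ)⁻¹ * coeff m ((n : ℂ) • ctr b (n - 1) f (dB b s g)) := by
    rw [Finset.sum_range_succ']
    simp only [Nat.cast_zero, zero_smul, map_zero, mul_zero, add_zero]
    refine Finset.sum_congr rfl fun n _ => ?_
    rw [Nat.add_sub_cancel, map_smul, smul_eq_mul, Nat.factorial_succ]
    have : ((n : ℂ) + 1) ≠ 0 := Nat.cast_add_one_ne_zero n
    push_cast
    field_simp
  rw [h2]
  have h3 : ∀ n, coeff m (ctr b n (X s * f) g) = (if Finsupp.single s 1 ≤ m
      then coeff (m - Finsupp.single s 1) (ctr b n f g) else 0)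
      + coeff m ((n : ℂ) • ctr b (n - 1) f (dB b s g)) := fun n => by
    rw [ctr_X_mul, map_add, hX]
  simp only [h3, mul_add, Finset.sum_add_distrib]
  congr 1
  split_ifs <;> simp

theorem LeftGood.X_mul {f : MvPowerSeries σ ℂ} (s : σ) (hf : LeftGood b f) :
    LeftGood b (X s * f) := RightGood.X_mul s hf

theorem Compat.X_mul_left {f g : MvPowerSeries σ ℂ} (h : Compat b f g) (s : σ) :
    Compat b (X s * f) g := h.imp id (LeftGood.X_mul s)

theorem Compat.X_mul_right {f g : MvPowerSeries σ ℂ} (h : Compat b f g) (s : σ) :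
    Compat b f (X s * g) := h.imp (RightGood.X_mul s) id

theorem Compat.pd_left {f g : MvPowerSeries σ ℂ} (h : Compat b f g) (s : σ) :
    Compat b (pd s f) g := h.imp id (RightGood.pd s)

theorem Compat.pd_right {f g : MvPowerSeries σ ℂ} (h : Compat b f g) (s : σ) :
    Compat b f (pd s g) := h.imp (RightGood.pd s) id

theorem Compat.dB_left {f g : MvPowerSeries σ ℂ} (h : Compat b f g) (b' : σ → σ → ℂ) (s : σ) :
    Compat b (dB b' s f) g := h.imp id (RightGood.dB b' s)

theorem Compat.dB_right {f g : MvPowerSeries σ ℂ} (h : Compat b f g) (b' : σ → σ → ℂ) (s : σ) :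
    Compat b f (dB b' s g) := h.imp (RightGood.dB b' s) id

theorem Compat.X_mul_star {f g : MvPowerSeries σ ℂ} (h : Compat b f g) (s : σ) :
    gstar b (X s * f) g = X s * gstar b f g + gstar b f (dB b s g) :=
  star_X_mul s h (h.dB_right b s) (h.X_mul_left s)

theorem Compat.star_X_mul {f g : MvPowerSeries σ ℂ} (h : Compat b f g) (t : σ) :
    gstar b f (X t * g) = X t * gstar b f g + gstar b (dB (fun s t => b t s) t f) g := by
  have := h.flip.X_mul_star t
  simpa only [star_flip] using this

theorem Compat.pd_star {f g : MvPowerSeries σ ℂ} (h : Compat b f g) (u : σ) :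
    pd u (gstar b f g) = gstar b (pd u f) g + gstar b f (pd u g) := by
  ext m
  obtain ⟨N₁, hN₁⟩ := h.exists_coeff (m + Finsupp.single u 1)
  obtain ⟨N₂, hN₂⟩ := (h.pd_left u).exists_coeff m
  obtain ⟨N₃, hN₃⟩ := (h.pd_right u).exists_coeff m
  set N := max N₁ (max N₂ N₃)
  rw [coeff_pd, map_add, coeff_star_eq_sum (N := N) fun n hn => hN₁ n (by omega),
    coeff_star_eq_sum (N := N) fun n hn => hN₂ n (by omega),
    coeff_star_eq_sum (N := N) fun n hn => hN₃ n (by omega), Finset.sum_mul,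
    ← Finset.sum_add_distrib]
  refine Finset.sum_congr rfl fun n _ => ?_
  rw [mul_assoc, ← coeff_pd, pd_ctr, map_add, mul_add]

theorem star_zero_left (g : MvPowerSeries σ ℂ) : gstar b 0 g = 0 := by
  have := star_smul_left (b := b) 0 0 g; simpa using this

theorem star_zero_right (g : MvPowerSeries σ ℂ) : gstar b g 0 = 0 := by
  have := star_smul_right (b := b) 0 g 0; simpa using this

theorem Compat.sum_star {ι : Type*} {s : Finset ι} {f : ι → MvPowerSeries σ ℂ}
    {g : MvPowerSeries σ ℂ} (h : RightGood b g ∨ ∀ i ∈ s, LeftGood b (f i)) :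
    gstar b (∑ i ∈ s, f i) g = ∑ i ∈ s, gstar b (f i) g := by
  classical
  induction s using Finset.induction_on with
  | empty => simp [star_zero_left]
  | insert a s ha ih =>
    rw [Finset.sum_insert ha, Finset.sum_insert ha, star_add_left', ih]
    · exact h.imp id fun h i hi => h i (Finset.mem_insert_of_mem hi)
    · exact h.imp id fun h => h a (Finset.mem_insert_self _ _)
    · exact h.imp id fun h => RightGood.sum _ _ fun i hi => h i (Finset.mem_insert_of_mem hi)

theorem Compat.dB_star {f g : MvPowerSeries σ ℂ} (h : Compat b f g) (b' : σ → σ → ℂ) (s : σ) :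
    dB b' s (gstar b f g) = gstar b (dB b' s f) g + gstar b f (dB b' s g) := by
  have h1 : gstar b (dB b' s f) g = ∑ t, b' s t • gstar b (pd t f) g := by
    rw [dB_apply, Compat.sum_star (h.imp id fun h t _ => RightGood.smul _ (RightGood.pd t h))]
    exact Finset.sum_congr rfl fun t _ => star_smul_left _ _ _
  have h2 : gstar b f (dB b' s g) = ∑ t, b' s t • gstar b f (pd t g) := by
    rw [dB_apply, ← star_flip,
      Compat.sum_star (h.flip.imp id fun h t _ => RightGood.smul _ (RightGood.pd t h))]
    exact Finset.sum_congr rfl fun t _ => by rw [star_smul_left, star_flip]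
  rw [h1, h2, dB_apply, ← Finset.sum_add_distrib]
  exact Finset.sum_congr rfl fun t _ => by rw [h.pd_star, smul_add]

theorem X_star (s : σ) (g : MvPowerSeries σ ℂ) : gstar b (X s) g = X s * g + dB b s g := by
  have h : Compat b 1 g := .inr (isPoly_one.leftGood)
  simpa only [mul_one, star_one_left] using h.X_mul_star s

theorem star_X (t : σ) (f : MvPowerSeries σ ℂ) :
    gstar b f (X t) = X t * f + dB (fun s t => b t s) t f := by
  rw [← star_flip, X_star]

/-- Polynomials are generated from `1` by linear combinations and left star multiplication by
variables. -/
theorem IsPoly.star_induction {P : MvPowerSeries σ ℂ → Prop} {f : MvPowerSeries σ ℂ}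
    (hf : IsPoly f) (one : P 1) (add : ∀ f g, IsPoly f → IsPoly g → P f → P g → P (f + g))
    (smul : ∀ (c : ℂ) f, IsPoly f → P f → P (c • f))
    (starX : ∀ s f, IsPoly f → P f → P (gstar b (X s) f)) : P f := by
  classical
  have hsum : ∀ (s : Finset σ) (g : σ → MvPowerSeries σ ℂ), (∀ t, IsPoly (g t)) → (∀ t, P (g t)) →
      P (∑ t ∈ s, g t) := by
    intro s g hg hP
    induction s using Finset.induction_on with
    | empty => simpa using smul 0 1 isPoly_one one
    | insert a s ha ih =>
      rw [Finset.sum_insert ha]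
      exact add _ _ (hg _) (IsPoly.sum _ _ fun i _ => hg i) (hP _) ih
  have hmono : ∀ (n : ℕ) (m : σ →₀ ℕ), m.degree ≤ n → P (monomial m 1) := by
    intro n
    induction n using Nat.strong_induction_on with
    | _ n ih =>
      intro m hm
      by_cases h0 : m = 0
      · subst h0; exact one
      obtain ⟨s, hs⟩ : ∃ s, m s ≠ 0 := by
        by_contra! h; exact h0 (Finsupp.ext h)
      obtain ⟨m', rfl⟩ : ∃ m', m = Finsupp.single s 1 + m' :=
        ⟨m - Finsupp.single s 1, (add_tsub_cancel_of_le (by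
          rw [Finsupp.single_le_iff]; omega)).symm⟩
      rw [map_add, Finsupp.degree_single] at hm
      -- The ordinary product with a variable is the star product minus a derivative, and the
      -- derivative consists of monomials of lower degree. This makes strong induction on the degree
      -- work.
      have h1 : (monomial (Finsupp.single s 1 + m') (1 : ℂ) : MvPowerSeries σ ℂ)
          = gstar b (X s) (monomial m' 1) + (-1 : ℂ) • dB b s (monomial m' 1) := by
        rw [X_star, X, monomial_mul_monomial, mul_one]; module
      rw [h1, dB_apply]
      have hpd : ∀ t, pd t (monomial m' (1 : ℂ) : MvPowerSeries σ ℂ)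
          = (m' t : ℂ) • monomial (m' - Finsupp.single t 1) (1 : ℂ) := by
        intro t
        have := congrArg (fun p : MvPolynomial σ ℂ => (p : MvPowerSeries σ ℂ))
          (MvPolynomial.pderiv_monomial (i := t) (s := m') (a := (1 : ℂ)))
        simp only [one_mul] at this
        rw [← pderiv_coe, MvPolynomial.coe_monomial] at this
        rw [pd_apply, this, MvPolynomial.coe_monomial, ← map_smul, smul_eq_mul, mul_one]
      refine add _ _ ?_ ?_ (starX s _ (isPoly_monomial _ _)
        (ih m'.degree (by omega) m' le_rfl)) (smul _ _ ?_ (hsum _ _ ?_ ?_))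
      · rw [X_star, dB_apply]
        exact ((isPoly_X s).mul (isPoly_monomial _ _)).add
          (IsPoly.sum _ _ fun t _ => (isPoly_pd t (isPoly_monomial _ _)).smul _)
      · exact (IsPoly.sum _ _ fun t _ => (isPoly_pd t (isPoly_monomial _ _)).smul _).smul _
      · exact IsPoly.sum _ _ fun t _ => (isPoly_pd t (isPoly_monomial _ _)).smul _
      · exact fun t => (isPoly_pd t (isPoly_monomial _ _)).smul _
      · intro t
        rw [hpd]
        refine smul _ _ ((isPoly_monomial _ _).smul _) (smul _ _ (isPoly_monomial _ _) (ih
          (m' - Finsupp.single t 1).degree ?_ _ le_rfl))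
        have : (m' - Finsupp.single t 1).degree ≤ m'.degree :=
          Finsupp.degree_mono tsub_le_self
        omega
  obtain ⟨p, rfl⟩ := hf
  induction p using MvPolynomial.induction_on' with
  | monomial m c =>
    rw [MvPolynomial.coe_monomial]
    have : (monomial m c : MvPowerSeries σ ℂ) = c • monomial m 1 := by
      rw [← map_smul, smul_eq_mul, mul_one]
    rw [this]; exact smul _ _ (isPoly_monomial _ _) (hmono _ m le_rfl)
  | add p q hp hq => rw [MvPolynomial.coe_add]; exact add _ _ (IsPoly.coe _) (IsPoly.coe _) hp hq

/-! ### Associativity -/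

theorem isPoly_star_X {f : MvPowerSeries σ ℂ} (s : σ) (hf : IsPoly f) : IsPoly (gstar b (X s) f) := by
  rw [X_star, dB_apply]
  exact ((isPoly_X s).mul hf).add (IsPoly.sum _ _ fun t _ => (isPoly_pd t hf).smul _)

/-- Left star multiplication by a variable is multiplication plus the constant-coefficient
derivation `dB b s`. Since `dB b s` also obeys the product rule for the star product, the two
groupings expand alike. -/
theorem star_assoc_X_left {f g : MvPowerSeries σ ℂ} (h : Compat b f g) (s : σ) :
    gstar b (gstar b (X s) f) g = gstar b (X s) (gstar b f g) := by
  rw [X_star, X_star, star_add_left' (h.X_mul_left s) (h.dB_left b s), h.X_mul_star, h.dB_star]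
  abel

/-- Both groupings give the variable times f * g together with one contraction of the variable to
the left and one to the right. -/
theorem star_assoc_X_middle {f g : MvPowerSeries σ ℂ} (h : Compat b f g) (s : σ) :
    gstar b (gstar b f (X s)) g = gstar b f (gstar b (X s) g) := by
  rw [X_star, star_X, star_add_left' (h.X_mul_left s) (h.dB_left _ s),
    star_add_right' (h.X_mul_right s) (h.dB_right b s), h.X_mul_star, h.star_X_mul]
  abel

theorem RightGood.star_X {g : MvPowerSeries σ ℂ} (hg : RightGood b g) (s : σ) :
    RightGood b (gstar b (X s) g) := by
  rw [X_star]; exact (hg.X_mul s).add (hg.dB b s)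

theorem LeftGood.star_X {g : MvPowerSeries σ ℂ} (hg : LeftGood b g) (s : σ) :
    LeftGood b (gstar b (X s) g) := by
  rw [X_star]; exact (hg.X_mul s).add (RightGood.dB b s hg)

theorem LeftGood.poly_star {a f : MvPowerSeries σ ℂ} (ha : IsPoly a) (hf : LeftGood b f) :
    LeftGood b (gstar b a f) :=
  ha.star_induction (b := b) (P := fun a => LeftGood b (gstar b a f))
    (by rwa [star_one_left])
    (fun a a' ha ha' h1 h2 => by
      rw [star_add_left' (.inr ha.leftGood) (.inr ha'.leftGood)]; exact h1.add h2)
    (fun c a _ h1 => by rw [star_smul_left]; exact h1.smul c)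
    (fun s a ha h1 => by
      rw [star_assoc_X_left (.inr ha.leftGood)]; exact h1.star_X s)

theorem RightGood.poly_star {a g : MvPowerSeries σ ℂ} (ha : IsPoly a) (hg : RightGood b g) :
    RightGood b (gstar b a g) :=
  ha.star_induction (b := b) (P := fun a => RightGood b (gstar b a g))
    (by rwa [star_one_left])
    (fun a a' ha ha' h1 h2 => by
      rw [star_add_left' (.inr ha.leftGood) (.inr ha'.leftGood)]; exact h1.add h2)
    (fun c a _ h1 => by rw [star_smul_left]; exact h1.smul c)
    (fun s a ha h1 => by
      rw [star_assoc_X_left (.inr ha.leftGood)]; exact h1.star_X s)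

theorem LeftGood.star_poly {a f : MvPowerSeries σ ℂ} (ha : IsPoly a) (hf : LeftGood b f) :
    LeftGood b (gstar b f a) := by
  rw [← star_flip]; exact RightGood.poly_star ha hf

theorem IsPoly.star {a f : MvPowerSeries σ ℂ} (ha : IsPoly a) (hf : IsPoly f) :
    IsPoly (gstar b a f) :=
  ha.star_induction (b := b) (P := fun a => IsPoly (gstar b a f))
    (by rwa [star_one_left])
    (fun a a' ha ha' h1 h2 => by
      rw [star_add_left' (.inr ha.leftGood) (.inr ha'.leftGood)]; exact h1.add h2)
    (fun c a _ h1 => by rw [star_smul_left]; exact h1.smul c)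
    (fun s a ha h1 => by
      rw [star_assoc_X_left (.inr ha.leftGood)]; exact isPoly_star_X s h1)

theorem Compat.poly_star {a f g : MvPowerSeries σ ℂ} (h : Compat b f g) (ha : IsPoly a) :
    Compat b (gstar b a f) g := h.imp id (LeftGood.poly_star ha)

theorem Compat.star_poly {a f g : MvPowerSeries σ ℂ} (h : Compat b f g) (ha : IsPoly a) :
    Compat b (gstar b f a) g := h.imp id (LeftGood.star_poly ha)

theorem Compat.poly_star_right {a f g : MvPowerSeries σ ℂ} (h : Compat b f g) (ha : IsPoly a) :
    Compat b f (gstar b a g) := h.imp (RightGood.poly_star ha) id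

/-- Associativity with a polynomial left factor. -/
theorem star_assoc_left {a f g : MvPowerSeries σ ℂ} (ha : IsPoly a) (h : Compat b f g) :
    gstar b (gstar b a f) g = gstar b a (gstar b f g) :=
  ha.star_induction (b := b)
    (P := fun a => gstar b (gstar b a f) g = gstar b a (gstar b f g))
    (by rw [star_one_left, star_one_left])
    (fun a a' ha ha' h1 h2 => by
      rw [star_add_left' (.inr ha.leftGood) (.inr ha'.leftGood),
        star_add_left' (h.poly_star ha) (h.poly_star ha'),
        star_add_left' (.inr ha.leftGood) (.inr ha'.leftGood), h1, h2])
    (fun c a _ h1 => by rw [star_smul_left, star_smul_left, star_smul_left, h1])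
    (fun s a ha h1 => by
      rw [star_assoc_X_left (.inr ha.leftGood), star_assoc_X_left (.inr ha.leftGood),
        star_assoc_X_left (h.poly_star ha), h1])

/-- Associativity with a polynomial middle factor. -/
theorem star_assoc_middle {a f g : MvPowerSeries σ ℂ} (ha : IsPoly a) (h : Compat b f g) :
    gstar b (gstar b f a) g = gstar b f (gstar b a g) :=
  -- Both outer factors are quantified, because the inductive step moves a variable from the middle
  -- factor into the left one.
  (ha.star_induction (b := b)
    (P := fun a => ∀ f g, Compat b f g → gstar b (gstar b f a) g = gstar b f (gstar b a g))
    (fun f g _ => by rw [star_one_left, star_one_right])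
    (fun a a' ha ha' h1 h2 f g h => by
      rw [star_add_left' (.inr ha.leftGood) (.inr ha'.leftGood),
        star_add_right' (.inl ha.rightGood) (.inl ha'.rightGood),
        star_add_left' (h.star_poly ha) (h.star_poly ha'),
        star_add_right' (h.poly_star_right ha) (h.poly_star_right ha'), h1 f g h, h2 f g h])
    (fun c a _ h1 f g h => by
      rw [star_smul_left, star_smul_right, star_smul_left, star_smul_right, h1 f g h])
    (fun s a ha h1 f g h => by
      rw [← star_assoc_X_middle (.inl ha.rightGood), h1 _ _ (h.star_poly (isPoly_X s)),
        star_assoc_X_left (.inr ha.leftGood), star_assoc_X_middle (h.poly_star_right ha)])) f g h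

/-- Associativity with a polynomial right factor. -/
theorem star_assoc_right {a f g : MvPowerSeries σ ℂ} (ha : IsPoly a) (h : Compat b f g) :
    gstar b (gstar b f g) a = gstar b f (gstar b g a) := by
  rw [← star_flip b _ a, ← star_flip b f g, ← star_flip b f, ← star_flip b g a]
  exact (star_assoc_left ha h.flip).symm

/-! ### Commutators -/

/-- The star commutator. -/
def gcomm (b : σ → σ → ℂ) (f g : MvPowerSeries σ ℂ) : MvPowerSeries σ ℂ := gstar b f g - gstar b g f

/-- The star commutator with a polynomial, as a linear map. -/
def ad (b : σ → σ → ℂ) (a : MvPowerSeries σ ℂ) (ha : IsPoly a) :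
    MvPowerSeries σ ℂ →ₗ[ℂ] MvPowerSeries σ ℂ :=
  starL (b := b) a ha.leftGood - starR (b := b) a ha.rightGood

theorem ad_apply {a : MvPowerSeries σ ℂ} (ha : IsPoly a) (g : MvPowerSeries σ ℂ) :
    ad b a ha g = gcomm b a g := rfl

theorem finOrd_ad {a : MvPowerSeries σ ℂ} (ha : IsPoly a) : FinOrd (ad b a ha) :=
  (finOrd_starL _).sub (finOrd_starR _)

/-- The Jacobi identity for two polynomials and a series. -/
theorem gcomm_jacobi {a a' : MvPowerSeries σ ℂ} (ha : IsPoly a) (ha' : IsPoly a')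
    (g : MvPowerSeries σ ℂ) :
    gcomm b a (gcomm b a' g) = gcomm b (gcomm b a a') g + gcomm b a' (gcomm b a g) := by
  have e1 : gcomm b a (gcomm b a' g) = gstar b a (gstar b a' g) - gstar b a (gstar b g a')
      - gstar b (gstar b a' g) a + gstar b (gstar b g a') a := by
    rw [← ad_apply ha, gcomm, map_sub, ad_apply, ad_apply, gcomm, gcomm]; abel
  have e2 : gcomm b a' (gcomm b a g) = gstar b a' (gstar b a g) - gstar b a' (gstar b g a)
      - gstar b (gstar b a g) a' + gstar b (gstar b g a) a' := by
    rw [← ad_apply ha', gcomm, map_sub, ad_apply, ad_apply, gcomm, gcomm]; abel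
  have h1 : IsPoly (gstar b a a') := ha.star ha'
  have h2 : IsPoly (gstar b a' a) := ha'.star ha
  have e3 : gcomm b (gcomm b a a') g = gstar b (gstar b a a') g - gstar b (gstar b a' a) g
      - gstar b g (gstar b a a') + gstar b g (gstar b a' a) := by
    have e31 : gstar b (gcomm b a a') g = gstar b (gstar b a a') g - gstar b (gstar b a' a) g := by
      rw [gcomm, sub_eq_add_neg, ← neg_one_smul ℂ, star_add_left' (.inr h1.leftGood)
        (.inr (h2.smul _).leftGood), star_smul_left, neg_one_smul, sub_eq_add_neg]
    have e32 : gstar b g (gcomm b a a') = gstar b g (gstar b a a') - gstar b g (gstar b a' a) := by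
      rw [gcomm, sub_eq_add_neg, ← neg_one_smul ℂ, star_add_right' (.inl h1.rightGood)
        (.inl (h2.smul _).rightGood), star_smul_right, neg_one_smul, sub_eq_add_neg]
    rw [gcomm, e31, e32]; abel
  rw [e1, e2, e3, star_assoc_left ha (.inr ha'.leftGood), star_assoc_left ha' (.inr ha.leftGood),
    ← star_assoc_middle ha (.inl ha'.rightGood), ← star_assoc_middle ha' (.inl ha.rightGood),
    star_assoc_left ha (.inl ha'.rightGood), star_assoc_left ha' (.inl ha.rightGood)]
  abel

/-- The commutator with a product of two variables. -/
theorem gcomm_X_mul_X (s t : σ) (g : MvPowerSeries σ ℂ) :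
    gcomm b (X s * X t) g = X s * (dB b t g - dB (fun s t => b t s) t g)
      + X t * (dB b s g - dB (fun s t => b t s) s g)
      + (dB b t (dB b s g) - dB (fun s t => b t s) t (dB (fun s t => b t s) s g)) := by
  have h1 : ∀ (b : σ → σ → ℂ), gstar b (X s * X t) g = X s * (X t * g) + X s * dB b t g
      + X t * dB b s g + dB b t (dB b s g) := fun b => by
    rw [Compat.X_mul_star (.inr (isPoly_X t).leftGood), X_star, X_star]; ring
  rw [gcomm, h1, ← star_flip b g, h1]; ring

theorem gcomm_X (s : σ) (g : MvPowerSeries σ ℂ) :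
    gcomm b (X s) g = dB b s g - dB (fun s t => b t s) s g := by
  rw [gcomm, X_star, star_X]; ring

theorem gcomm_sum_left {ι : Type*} {s : Finset ι} {a : ι → MvPowerSeries σ ℂ}
    (ha : ∀ i ∈ s, IsPoly (a i)) (g : MvPowerSeries σ ℂ) :
    gcomm b (∑ i ∈ s, a i) g = ∑ i ∈ s, gcomm b (a i) g := by
  have h2 : gstar b g (∑ i ∈ s, a i) = ∑ i ∈ s, gstar b g (a i) := by
    rw [← star_flip, Compat.sum_star (.inr fun i hi => (ha i hi).leftGood)]
    exact Finset.sum_congr rfl fun i _ => star_flip _ _ _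
  rw [gcomm, h2, Compat.sum_star (.inr fun i hi => (ha i hi).leftGood), ← Finset.sum_sub_distrib]
  rfl

theorem gcomm_smul_left (c : ℂ) (a g : MvPowerSeries σ ℂ) :
    gcomm b (c • a) g = c • gcomm b a g := by
  rw [gcomm, gcomm, star_smul_left, star_smul_right, smul_sub]

end GeneralStar

end HigherSpin

end

/-! ### Smooth fields on an open set with values in power series -/

noncomputable section

namespace HigherSpin

open MvPowerSeries

section SpaceTime

variable {d : ℕ} {U : TopologicalSpace.Opens (Fin d → ℝ)}

theorem extendZero_coe {G : Type*} [NormedAddCommGroup G] (F : U → G) (x : U) : extendZero F x = F x :=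
  Subtype.val_injective.extend_apply _ _ _

theorem eventuallyEq_extendZero {G : Type*} [NormedAddCommGroup G] {F : U → G} {f : (Fin d → ℝ) → G} (h : ∀ y : U, f y = F y) (x : U) :
    extendZero F =ᶠ[nhds (x : Fin d → ℝ)] f := by
  filter_upwards [U.isOpen.mem_nhds x.2] with y hy
  exact (extendZero_coe F ⟨y, hy⟩).trans (h ⟨y, hy⟩).symm

section Functions

variable {G H : Type*} [NormedAddCommGroup G] [NormedSpace ℝ G] [NormedAddCommGroup H]
  [NormedSpace ℝ H]

theorem smoothFun_iff {F : U → G} {f : (Fin d → ℝ) → G} (h : ∀ y : U, f y = F y) :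
    SmoothFun F ↔ ContDiffOn ℝ (⊤ : ℕ∞) f U :=
  contDiffOn_congr fun y hy => (extendZero_coe F ⟨y, hy⟩).trans (h ⟨y, hy⟩).symm

theorem partialX_eq {F : U → G} {f : (Fin d → ℝ) → G} (h : ∀ y : U, f y = F y) (μ : Fin d) (x : U) :
    partialX μ F x = fderiv ℝ f x (Pi.single μ 1) := by
  rw [partialX, (eventuallyEq_extendZero h x).fderiv_eq]

theorem SmoothFun.contDiffAt {F : U → G} (hF : SmoothFun F) (x : U) :
    ContDiffAt ℝ (⊤ : ℕ∞) (extendZero F) x :=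
  ContDiffOn.contDiffAt hF (U.isOpen.mem_nhds x.2)

theorem SmoothFun.differentiableAt {F : U → G} (hF : SmoothFun F) (x : U) :
    DifferentiableAt ℝ (extendZero F) x :=
  (hF.contDiffAt x).differentiableAt (by simp)

theorem SmoothFun.const (c : G) : SmoothFun fun _ : U => c :=
  (smoothFun_iff (f := fun _ => c) fun _ => rfl).2 contDiffOn_const

theorem partialX_const (c : G) (μ : Fin d) (x : U) : partialX μ (fun _ : U => c) x = 0 := by
  rw [partialX_eq (f := fun _ => c) fun _ => rfl]; simp

theorem SmoothFun.add {F F' : U → G} (hF : SmoothFun F) (hF' : SmoothFun F') :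
    SmoothFun fun x => F x + F' x :=
  (smoothFun_iff (f := fun x => extendZero F x + extendZero F' x) fun y => by
    rw [extendZero_coe, extendZero_coe]).2 (ContDiffOn.add hF hF')

theorem partialX_add {F F' : U → G} (hF : SmoothFun F) (hF' : SmoothFun F') (μ : Fin d) (x : U) :
    partialX μ (fun x => F x + F' x) x = partialX μ F x + partialX μ F' x := by
  rw [partialX_eq (f := fun x => extendZero F x + extendZero F' x) fun y => by
    rw [extendZero_coe, extendZero_coe], fderiv_fun_add (hF.differentiableAt x)
    (hF'.differentiableAt x)]
  rfl

theorem SmoothFun.clm {F : U → G} (hF : SmoothFun F) (L : G →L[ℝ] H) :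
    SmoothFun fun x => L (F x) :=
  (smoothFun_iff (f := fun x => L (extendZero F x)) fun y => by rw [extendZero_coe]).2
    (L.contDiff.comp_contDiffOn hF)

theorem partialX_clm {F : U → G} (hF : SmoothFun F) (L : G →L[ℝ] H) (μ : Fin d) (x : U) :
    partialX μ (fun x => L (F x)) x = L (partialX μ F x) := by
  rw [partialX_eq (f := fun x => L (extendZero F x)) fun y => by rw [extendZero_coe],
    show fderiv ℝ (fun x => L (extendZero F x)) x = _ from
      (L.hasFDerivAt.comp (x : Fin d → ℝ) (hF.differentiableAt x).hasFDerivAt).fderiv]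
  rfl

theorem SmoothFun.mul {F F' : U → ℂ} (hF : SmoothFun F) (hF' : SmoothFun F') :
    SmoothFun fun x => F x * F' x :=
  (smoothFun_iff (f := fun x => extendZero F x * extendZero F' x) fun y => by
    rw [extendZero_coe, extendZero_coe]).2 (ContDiffOn.mul hF hF')

theorem partialX_mul {F F' : U → ℂ} (hF : SmoothFun F) (hF' : SmoothFun F') (μ : Fin d) (x : U) :
    partialX μ (fun x => F x * F' x) x = partialX μ F x * F' x + F x * partialX μ F' x := by
  rw [partialX_eq (f := fun x => extendZero F x * extendZero F' x) fun y => by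
    rw [extendZero_coe, extendZero_coe], fderiv_fun_mul (hF.differentiableAt x)
    (hF'.differentiableAt x), extendZero_coe, extendZero_coe]
  simp only [add_apply, smul_apply, smul_eq_mul, partialX]
  ring

theorem SmoothFun.partialX {F : U → G} (hF : SmoothFun F) (μ : Fin d) :
    SmoothFun fun x => partialX μ F x := by
  refine (smoothFun_iff (f := fun x => fderiv ℝ (extendZero F) x (Pi.single μ 1)) fun y => rfl).2 ?_
  have h := ((contDiffOn_infty_iff_fderiv_of_isOpen U.isOpen).1 hF).2
  exact ((ContinuousLinearMap.apply ℝ G (Pi.single μ (1 : ℝ) : Fin d → ℝ)).contDiff).comp_contDiffOn h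

theorem partialX_comm {F : U → G} (hF : SmoothFun F) (μ ν : Fin d) (x : U) :
    partialX μ (fun x => partialX ν F x) x = partialX ν (fun x => partialX μ F x) x := by
  have key : ∀ μ ν : Fin d, HigherSpin.partialX μ (fun x => HigherSpin.partialX ν F x) x
      = fderiv ℝ (fderiv ℝ (extendZero F)) x (Pi.single μ 1) (Pi.single ν 1) := fun μ ν => by
    rw [partialX_eq (F := fun x => HigherSpin.partialX ν F x)
      (f := fun x => fderiv ℝ (extendZero F) x (Pi.single ν 1)) fun y => rfl]
    have h : DifferentiableAt ℝ (fderiv ℝ (extendZero F)) x :=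
      (((contDiffOn_infty_iff_fderiv_of_isOpen U.isOpen).1 hF).2.contDiffAt
        (U.isOpen.mem_nhds x.2)).differentiableAt (by simp)
    rw [fderiv_clm_apply h (differentiableAt_const _)]
    simp
  rw [key, key]
  exact ((hF.contDiffAt x).isSymmSndFDerivAt (by
    rw [minSmoothness_of_isRCLikeNormedField]; exact WithTop.coe_le_coe.2 (le_top : (2 : ℕ∞) ≤ ⊤))) _ _

end Functions

/-! ### Functions with values in power series -/

variable {σ τ : Type*}

theorem coeff_dX (μ : Fin d) (F : U → MvPowerSeries σ ℂ) (x : U) (m : σ →₀ ℕ) :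
    coeff m (dX μ F x) = partialX μ (fun x' => coeff m (F x')) x := rfl

theorem SmoothFun.weighted_sum {ι : Type*} (s : Finset ι) {c : ι → ℂ} {F : ι → U → ℂ}
    (hF : ∀ i ∈ s, SmoothFun (F i)) : SmoothFun (fun x => ∑ i ∈ s, c i * F i x) ∧
      ∀ (μ : Fin d) (x : U), HigherSpin.partialX μ (fun x => ∑ i ∈ s, c i * F i x) x
        = ∑ i ∈ s, c i * HigherSpin.partialX μ (F i) x := by
  classical
  induction s using Finset.induction_on with
  | empty => exact ⟨SmoothFun.const 0, fun μ x => partialX_const (U := U) (0 : ℂ) μ x⟩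
  | insert a s ha ih =>
    obtain ⟨h1, h2⟩ := ih fun i hi => hF i (Finset.mem_insert_of_mem hi)
    have h3 := hF a (Finset.mem_insert_self _ _)
    have h4 : SmoothFun fun x => c a * F a x := (SmoothFun.const (c a)).mul h3
    simp only [Finset.sum_insert ha]
    refine ⟨h4.add h1, fun μ x => ?_⟩
    rw [partialX_add h4 h1, h2, partialX_mul (SmoothFun.const (c a)) h3, partialX_const]
    simp

theorem SmoothSeries.map [Finite σ] {T : MvPowerSeries σ ℂ →ₗ[ℂ] MvPowerSeries τ ℂ} (hT : FinOrd T)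
    {F : U → MvPowerSeries σ ℂ} (hF : SmoothSeries F) : SmoothSeries fun x => T (F x) := by
  intro m
  obtain ⟨s, a, h⟩ := hT.exists_coeff m
  simp only [h]
  exact (SmoothFun.weighted_sum s fun e _ => hF e).1

/-- Each output coefficient is a fixed finite linear combination of input coefficients, so
differentiation in x passes through without any convergence question. -/
theorem dX_map [Finite σ] {T : MvPowerSeries σ ℂ →ₗ[ℂ] MvPowerSeries τ ℂ} (hT : FinOrd T)
    {F : U → MvPowerSeries σ ℂ} (hF : SmoothSeries F) (μ : Fin d) (x : U) :
    dX μ (fun x => T (F x)) x = T (dX μ F x) := by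
  ext m
  obtain ⟨s, a, h⟩ := hT.exists_coeff m
  rw [coeff_dX, h]
  simp only [h]
  exact (SmoothFun.weighted_sum s fun e _ => hF e).2 μ x

theorem SmoothSeries.const (f : MvPowerSeries σ ℂ) : SmoothSeries fun _ : U => f :=
  fun _ => SmoothFun.const _

theorem dX_const (f : MvPowerSeries σ ℂ) (μ : Fin d) (x : U) : dX μ (fun _ : U => f) x = 0 := by
  ext m; rw [coeff_dX, partialX_const, map_zero]

theorem SmoothSeries.add {F G : U → MvPowerSeries σ ℂ} (hF : SmoothSeries F) (hG : SmoothSeries G) :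
    SmoothSeries fun x => F x + G x := fun m => by
  simp only [map_add]; exact (hF m).add (hG m)

theorem dX_add {F G : U → MvPowerSeries σ ℂ} (hF : SmoothSeries F) (hG : SmoothSeries G) (μ : Fin d)
    (x : U) : dX μ (fun x => F x + G x) x = dX μ F x + dX μ G x := by
  ext m
  rw [map_add, coeff_dX, coeff_dX, coeff_dX, ← partialX_add (hF m) (hG m)]
  simp only [map_add]

theorem SmoothSeries.smul {c : U → ℂ} {F : U → MvPowerSeries σ ℂ} (hc : SmoothFun c)
    (hF : SmoothSeries F) : SmoothSeries fun x => c x • F x := fun m => by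
  simp only [map_smul, smul_eq_mul]; exact hc.mul (hF m)

theorem dX_smul {c : U → ℂ} {F : U → MvPowerSeries σ ℂ} (hc : SmoothFun c) (hF : SmoothSeries F)
    (μ : Fin d) (x : U) :
    dX μ (fun x => c x • F x) x = partialX μ c x • F x + c x • dX μ F x := by
  ext m
  rw [map_add, map_smul, map_smul, coeff_dX, coeff_dX, smul_eq_mul, smul_eq_mul,
    ← partialX_mul hc (hF m)]
  simp only [map_smul, smul_eq_mul]

theorem SmoothSeries.const_smul (c : ℂ) {F : U → MvPowerSeries σ ℂ} (hF : SmoothSeries F) :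
    SmoothSeries fun x => c • F x := SmoothSeries.smul (SmoothFun.const c) hF

theorem dX_const_smul (c : ℂ) {F : U → MvPowerSeries σ ℂ} (hF : SmoothSeries F) (μ : Fin d)
    (x : U) : dX μ (fun x => c • F x) x = c • dX μ F x := by
  rw [dX_smul (SmoothFun.const c) hF, partialX_const, zero_smul, zero_add]

theorem SmoothSeries.sub {F G : U → MvPowerSeries σ ℂ} (hF : SmoothSeries F) (hG : SmoothSeries G) :
    SmoothSeries fun x => F x - G x := by
  have := hF.add (hG.const_smul (-1))
  simpa only [neg_smul, one_smul, ← sub_eq_add_neg] using this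

theorem SmoothSeries.sum {ι : Type*} (s : Finset ι) {F : ι → U → MvPowerSeries σ ℂ}
    (hF : ∀ i ∈ s, SmoothSeries (F i)) : SmoothSeries fun x => ∑ i ∈ s, F i x := by
  classical
  induction s using Finset.induction_on with
  | empty => simpa using SmoothSeries.const 0
  | insert a s ha ih =>
    simp only [Finset.sum_insert ha]
    exact (hF a (Finset.mem_insert_self _ _)).add (ih fun i hi => hF i (Finset.mem_insert_of_mem hi))

theorem dX_sum {ι : Type*} (s : Finset ι) {F : ι → U → MvPowerSeries σ ℂ}
    (hF : ∀ i ∈ s, SmoothSeries (F i)) (μ : Fin d) (x : U) :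
    dX μ (fun x => ∑ i ∈ s, F i x) x = ∑ i ∈ s, dX μ (F i) x := by
  classical
  induction s using Finset.induction_on with
  | empty => simpa using dX_const 0 μ x
  | insert a s ha ih =>
    simp only [Finset.sum_insert ha]
    rw [dX_add (hF a (Finset.mem_insert_self _ _))
      (SmoothSeries.sum s fun i hi => hF i (Finset.mem_insert_of_mem hi)),
      ih fun i hi => hF i (Finset.mem_insert_of_mem hi)]

theorem SmoothSeries.dX {F : U → MvPowerSeries σ ℂ} (hF : SmoothSeries F) (μ : Fin d) :
    SmoothSeries fun x => dX μ F x := fun m => (hF m).partialX μ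

theorem dX_comm {F : U → MvPowerSeries σ ℂ} (hF : SmoothSeries F) (μ ν : Fin d) (x : U) :
    dX μ (fun x => dX ν F x) x = dX ν (fun x => dX μ F x) x := by
  ext m; exact partialX_comm (hF m) μ ν x

theorem SmoothSeries.mul {F G : U → MvPowerSeries σ ℂ} (hF : SmoothSeries F) (hG : SmoothSeries G) :
    SmoothSeries fun x => F x * G x := by
  classical
  intro m
  simp only [coeff_mul]
  have := (SmoothFun.weighted_sum (c := fun _ => 1) (Finset.HasAntidiagonal.antidiagonal m)
    fun p _ => (hF p.1).mul (hG p.2)).1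
  simpa only [one_mul] using this

theorem partialX_ofReal {c : U → ℝ} (hc : SmoothFun c) (μ : Fin d) (x : U) :
    partialX μ (fun x => (c x : ℂ)) x = ((partialX μ c x : ℝ) : ℂ) :=
  partialX_clm hc Complex.ofRealCLM μ x

theorem SmoothFun.ofReal {c : U → ℝ} (hc : SmoothFun c) : SmoothFun fun x => (c x : ℂ) :=
  hc.clm Complex.ofRealCLM

end SpaceTime

end HigherSpin

end

/-! ### The oscillator star products and functions of Y inside functions of (Z, Y) -/

noncomputable section

namespace HigherSpin

open MvPowerSeries

variable {d : ℕ}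

/-! ### The star products of the oscillators -/

/-- `½ ε_{ij} η^{AB}`. -/
def bY (p q : Osc d) : ℂ := ((1 / 2 * eps p.1 q.1 * eta p.2 q.2 : ℝ) : ℂ)

/-- The contraction matrix of the star product of functions of `(Z, Y)`. -/
def bZY : Osc d ⊕ Osc d → Osc d ⊕ Osc d → ℂ
  | .inl p, .inl q => -bY p q
  | .inl p, .inr q => bY p q
  | .inr p, .inl q => -bY p q
  | .inr p, .inr q => bY p q

theorem eps_swap (i j : Fin 2) : eps j i = -eps i j := by
  fin_cases i <;> fin_cases j <;> simp [eps]

theorem eta_swap (A B : Fin (d + 1)) : eta B A = eta A B := by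
  by_cases h : A = B
  · rw [h]
  · simp [eta, h, Ne.symm h]

/-- The diagonal entries of the metric. -/
def sg (A : Fin (d + 1)) : ℝ := eta A A

theorem sg_mul_self (A : Fin (d + 1)) : sg A * sg A = 1 := by
  unfold sg eta; rw [if_pos rfl]; split_ifs <;> norm_num

theorem eta_eq (A B : Fin (d + 1)) : eta A B = if A = B then sg A else 0 := by
  by_cases h : A = B
  · subst h; simp [sg]
  · simp [eta, h]

theorem bY_swap (p q : Osc d) : bY q p = -bY p q := by
  simp only [bY, eps_swap p.1 q.1, eta_swap p.2 q.2]; push_cast; ring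

theorem lower_eq {M : Type*} [AddCommMonoid M] [Module ℂ M] (a : Fin (d + 1) → M)
    (A : Fin (d + 1)) : lower a A = (sg A : ℂ) • a A := by
  simp only [lower, eta_eq]
  rw [Finset.sum_eq_single A] <;> simp +contextual [eq_comm]

theorem lowerV_eq (V : Fin (d + 1) → ℝ) (A : Fin (d + 1)) : lowerV V A = sg A * V A := by
  simp only [lowerV, eta_eq]
  rw [Finset.sum_eq_single A] <;> simp +contextual [eq_comm]

theorem contraction_dY (n : ℕ) (f g : YSeries d) : contraction dY dY n f g = ctr bY n f g := by
  induction n generalizing f g with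
  | zero => rfl
  | succ n ih =>
    rw [contraction, ctr_succ]
    simp only [ih, dB_apply, map_sum, map_smul, Fintype.sum_prod_type]
    refine Finset.sum_congr rfl fun i _ => ?_
    rw [Finset.sum_comm]
    exact Finset.sum_congr rfl fun A _ => rfl

theorem starY_eq (f g : YSeries d) : starY f g = gstar bY f g := by
  funext m; simp only [starY, starWith, gstar, contraction_dY]

/-- The left operator of the bidifferential exponent is the sum ∂_Y + ∂_Z, so the Z and Y rows of
the contraction matrix coincide. -/
theorem dB_bZY_inl (p : Osc d) : dB (bZY (d := d)) (.inl p) = dB bZY (.inr p) := by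
  simp only [dB, Fintype.sum_sum_type]; rfl

theorem dB_bZY (p : Osc d) (g : ZYSeries d) :
    dB bZY (.inr p) g = ∑ q, bY p q • (pd (.inr q) g - pd (.inl q) g) := by
  rw [dB_apply, Fintype.sum_sum_type, add_comm, ← Finset.sum_add_distrib]
  exact Finset.sum_congr rfl fun q _ => by simp only [bZY]; module

theorem contraction_dLeft (n : ℕ) (f g : ZYSeries d) :
    contraction dLeft dRight n f g = ctr bZY n f g := by
  induction n generalizing f g with
  | zero => rfl
  | succ n ih =>
    rw [contraction, ctr_succ, Fintype.sum_sum_type]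
    simp only [ih, dB_bZY_inl, dB_bZY]
    rw [← Finset.sum_add_distrib]
    simp only [map_sum, map_smul, Fintype.sum_prod_type]
    refine Finset.sum_congr rfl fun i _ => ?_
    rw [Finset.sum_comm]
    refine Finset.sum_congr rfl fun A _ => ?_
    rw [← Finset.sum_add_distrib]
    refine Finset.sum_congr rfl fun j _ => ?_
    rw [← Finset.sum_add_distrib]
    refine Finset.sum_congr rfl fun B _ => ?_
    rw [← smul_add, ← LinearMap.add_apply, ← map_add, add_comm (pd (.inl (i, A)) f)]
    rfl

theorem starZY_eq (f g : ZYSeries d) : starZY f g = gstar bZY f g := by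
  funext m; simp only [starZY, starWith, gstar, contraction_dLeft]

theorem comm_eq (f g : ZYSeries d) : comm f g = gcomm bZY f g := by
  simp only [comm, gcomm, starZY_eq]

theorem commY_eq (f g : YSeries d) : commY f g = gcomm bY f g := by
  simp only [commY, gcomm, starY_eq]

theorem starDefined_of_compat {f g : ZYSeries d} (h : Compat bZY f g) : StarDefined f g := fun m => by
  simpa only [contraction_dLeft] using h.finite m

/-! ### Functions of `Y` as functions of `(Z, Y)` -/

theorem constantCoeff_yv (i : Fin 2) (A : Fin (d + 1)) :
    constantCoeff (yv i A : ZYSeries d) = 0 := constantCoeff_X _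

theorem constantCoeff_zv (i : Fin 2) (A : Fin (d + 1)) :
    constantCoeff (zv i A : ZYSeries d) = 0 := constantCoeff_X _

/-- The embedding of functions of `Y`, as a linear map. -/
def embL : YSeries d →ₗ[ℂ] ZYSeries d :=
  substL (fun p : Osc d => yv p.1 p.2) fun _ => constantCoeff_yv _ _

theorem embL_apply (f : YSeries d) : embL f = emb f := substL_apply _ f

theorem finOrd_embL : FinOrd (embL (d := d)) := finOrd_substL _

theorem emb_mul (f g : YSeries d) : emb (f * g) = emb f * emb g := by
  simp only [← embL_apply, embL, substL_mul]

theorem emb_one : emb (1 : YSeries d) = 1 := by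
  simp only [← embL_apply, embL, substL_one]

theorem emb_add (f g : YSeries d) : emb (f + g) = emb f + emb g := by
  simp only [← embL_apply, map_add]

theorem emb_sub (f g : YSeries d) : emb (f - g) = emb f - emb g := by
  simp only [← embL_apply, map_sub]

theorem emb_smul (c : ℂ) (f : YSeries d) : emb (c • f) = c • emb f := by
  simp only [← embL_apply, map_smul]

theorem emb_sum {ι : Type*} (s : Finset ι) (f : ι → YSeries d) :
    emb (∑ i ∈ s, f i) = ∑ i ∈ s, emb (f i) := by
  simp only [← embL_apply, map_sum]

theorem emb_zero : emb (0 : YSeries d) = 0 := by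
  simp only [← embL_apply, map_zero]

theorem emb_X (p : Osc d) : emb (X p : YSeries d) = X (.inr p) := by
  simp only [← embL_apply, embL, substL_X]; rfl

theorem emb_isPoly {f : YSeries d} (hf : IsPoly f) : IsPoly (emb f) := by
  rw [← embL_apply]; exact isPoly_substL _ (fun p => isPoly_X _) hf

theorem emb_eq_rename (f : YSeries d) :
    emb f = rename (Function.Embedding.inr : Osc d ↪ Osc d ⊕ Osc d) f := by
  rw [rename_eq_subst]; rfl

theorem emb_injective : Function.Injective (emb (d := d)) := fun f g h => by
  rw [emb_eq_rename, emb_eq_rename] at h; exact rename_injective _ h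

theorem pd_inr_emb (p : Osc d) (f : YSeries d) : pd (.inr p) (emb f) = emb (pd p f) := by
  classical
  rw [← embL_apply, embL, pd_substL, Finset.sum_eq_single p]
  · rw [yv, pd_X, if_pos rfl, one_mul, substL_apply]; rfl
  · intro q _ hq
    rw [yv, pd_X, if_neg (by simpa using fun h => hq h.symm), zero_mul]
  · simp

theorem pd_inl_emb (p : Osc d) (f : YSeries d) : pd (.inl p) (emb f) = 0 := by
  classical
  rw [← embL_apply, embL, pd_substL]
  exact Finset.sum_eq_zero fun q _ => by rw [yv, pd_X, if_neg (by simp), zero_mul]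

/-- Restriction to `Z = 0`. -/
def projY (g : ZYSeries d) : YSeries d :=
  fun m => coeff (m.embDomain (Function.Embedding.inr : Osc d ↪ Osc d ⊕ Osc d)) g

theorem coeff_projY (g : ZYSeries d) (m : Osc d →₀ ℕ) :
    coeff m (projY g) = coeff (m.embDomain Function.Embedding.inr) g := rfl

theorem coeff_emb (f : YSeries d) (m : Osc d →₀ ℕ) :
    coeff (m.embDomain Function.Embedding.inr) (emb f) = coeff m f := by
  rw [emb_eq_rename, coeff_embDomain_rename]

theorem projY_emb (f : YSeries d) : projY (emb f) = f := by
  ext m; rw [coeff_projY, coeff_emb]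

/-- A monomial either involves only `Y`, or some `Z`. -/
theorem exists_embDomain_or (m : (Osc d ⊕ Osc d) →₀ ℕ) :
    (∃ n : Osc d →₀ ℕ, m = n.embDomain Function.Embedding.inr) ∨ ∃ p, m (.inl p) ≠ 0 := by
  classical
  by_cases h : ∃ p, m (.inl p) ≠ 0
  · exact .inr h
  refine .inl ⟨m.comapDomain Sum.inr (Sum.inr_injective.injOn), ?_⟩
  push Not at h
  ext s
  obtain p | p := s
  · rw [h, Finsupp.embDomain_of_notMem_range]; simp
  · exact (Finsupp.embDomain_apply_self Function.Embedding.inr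
      (m.comapDomain Sum.inr (Sum.inr_injective.injOn)) p).symm

theorem coeff_eq_zero_of_pd_inl {g : ZYSeries d} (h : ∀ p, pd (.inl p) g = 0)
    {m : (Osc d ⊕ Osc d) →₀ ℕ} {p : Osc d} (hm : m (.inl p) ≠ 0) : coeff m g = 0 := by
  have h1 := congrArg (coeff (m - Finsupp.single (.inl p) 1)) (h p)
  rw [coeff_pd, map_zero, tsub_add_cancel_of_le (Finsupp.single_le_iff.2
    (Nat.one_le_iff_ne_zero.2 hm))] at h1
  exact (mul_eq_zero.1 h1).resolve_right (Nat.cast_add_one_ne_zero _)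

/-- Functions with vanishing `Z`-derivatives are functions of `Y`. -/
theorem emb_projY {g : ZYSeries d} (h : ∀ p, pd (.inl p) g = 0) : emb (projY g) = g := by
  ext m
  obtain ⟨n, rfl⟩ | ⟨p, hp⟩ := exists_embDomain_or m
  · rw [coeff_emb, coeff_projY]
  · rw [coeff_eq_zero_of_pd_inl h hp, coeff_eq_zero_of_pd_inl (fun p => pd_inl_emb p _) hp]

/-- On Z-independent functions all Z-derivatives drop out and the contraction matrix reduces to its
Y–Y block, that of the Weyl–Moyal product. -/
theorem emb_ctr (n : ℕ) (f g : YSeries d) : emb (ctr bY n f g) = ctr bZY n (emb f) (emb g) := by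
  induction n generalizing f g with
  | zero => exact emb_mul f g
  | succ n ih =>
    rw [ctr_succ, ctr_succ, emb_sum, Fintype.sum_sum_type]
    simp only [pd_inl_emb, pd_inr_emb, map_zero, LinearMap.zero_apply, Finset.sum_const_zero,
      zero_add, ih]
    refine Finset.sum_congr rfl fun p _ => ?_
    congr 1
    rw [dB_bZY, dB_apply, emb_sum]
    exact Finset.sum_congr rfl fun q _ => by rw [pd_inl_emb, pd_inr_emb, sub_zero, emb_smul]

theorem emb_gstar (f g : YSeries d) : emb (gstar bY f g) = gstar bZY (emb f) (emb g) := by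
  ext m
  change _ = ∑ᶠ n : ℕ, _
  simp only [← emb_ctr]
  obtain ⟨n, rfl⟩ | ⟨p, hp⟩ := exists_embDomain_or m
  · rw [coeff_emb]
    exact finsum_congr fun n => by rw [coeff_emb]
  · simp only [coeff_eq_zero_of_pd_inl (fun p => pd_inl_emb p _) hp]
    simp

theorem emb_gcomm (f g : YSeries d) : emb (gcomm bY f g) = gcomm bZY (emb f) (emb g) := by
  rw [gcomm, gcomm, emb_sub, emb_gstar, emb_gstar]

/-! ### Commutators with linear and quadratic functions -/

/-- `ε_{ij} ∂/∂Y_j^A`. -/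
def eY (i : Fin 2) (A : Fin (d + 1)) : ZYSeries d →ₗ[ℂ] ZYSeries d :=
  ∑ j, (eps i j : ℂ) • pd (.inr (j, A))

/-- `ε_{ij} ∂/∂Z_j^A`. -/
def eZ (i : Fin 2) (A : Fin (d + 1)) : ZYSeries d →ₗ[ℂ] ZYSeries d :=
  ∑ j, (eps i j : ℂ) • pd (.inl (j, A))

theorem eY_apply (i : Fin 2) (A : Fin (d + 1)) (g : ZYSeries d) :
    eY i A g = ∑ j, (eps i j : ℂ) • pd (.inr (j, A)) g := by simp [eY]

theorem eZ_apply (i : Fin 2) (A : Fin (d + 1)) (g : ZYSeries d) :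
    eZ i A g = ∑ j, (eps i j : ℂ) • pd (.inl (j, A)) g := by simp [eZ]

theorem sum_bY_smul (p : Osc d) (D : Osc d → ZYSeries d) :
    ∑ q, bY p q • D q = ((1 / 2 * sg p.2 : ℝ) : ℂ) • ∑ j, (eps p.1 j : ℂ) • D (j, p.2) := by
  rw [Fintype.sum_prod_type, Finset.smul_sum]
  refine Finset.sum_congr rfl fun j _ => ?_
  rw [Finset.sum_eq_single p.2]
  · rw [smul_smul]; congr 1; simp only [bY, sg]; push_cast; ring
  · intro A _ hA
    simp [bY, eta_eq, Ne.symm hA]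
  · simp

theorem dB_right (p : Osc d) (g : ZYSeries d) :
    dB bZY (.inr p) g = ((1 / 2 * sg p.2 : ℝ) : ℂ) • (eY p.1 p.2 g - eZ p.1 p.2 g) := by
  rw [dB_bZY, sum_bY_smul p fun q => pd (.inr q) g - pd (.inl q) g]
  simp only [eY_apply, eZ_apply, smul_sub, Finset.sum_sub_distrib]

theorem dB_left_inl (p : Osc d) (g : ZYSeries d) :
    dB (fun s t => bZY t s) (.inl p) g
      = ((1 / 2 * sg p.2 : ℝ) : ℂ) • (eY p.1 p.2 g + eZ p.1 p.2 g) := by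
  have : dB (fun s t => bZY t s) (.inl p) g = ∑ q, bY p q • (pd (.inr q) g + pd (.inl q) g) := by
    rw [dB_apply, Fintype.sum_sum_type, add_comm, ← Finset.sum_add_distrib]
    refine Finset.sum_congr rfl fun q _ => ?_
    simp only [bZY, bY_swap p q]; module
  rw [this, sum_bY_smul p fun q => pd (.inr q) g + pd (.inl q) g]
  simp only [eY_apply, eZ_apply, smul_add, Finset.sum_add_distrib]

theorem dB_left_inr (p : Osc d) (g : ZYSeries d) :
    dB (fun s t => bZY t s) (.inr p) g
      = -(((1 / 2 * sg p.2 : ℝ) : ℂ) • (eY p.1 p.2 g + eZ p.1 p.2 g)) := by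
  rw [← dB_left_inl, dB_apply, dB_apply, ← Finset.sum_neg_distrib]
  refine Finset.sum_congr rfl fun q _ => ?_
  obtain q | q := q <;> simp only [bZY] <;> module

theorem eY_comm_eZ (i j : Fin 2) (A B : Fin (d + 1)) (g : ZYSeries d) :
    eY i A (eZ j B g) = eZ j B (eY i A g) := by
  simp only [eY_apply, eZ_apply, map_sum, map_smul, Finset.smul_sum]
  rw [Finset.sum_comm]
  refine Finset.sum_congr rfl fun k _ => Finset.sum_congr rfl fun l _ => ?_
  rw [pd_comm, smul_comm]

theorem comm_zv (i : Fin 2) (A : Fin (d + 1)) (g : ZYSeries d) :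
    comm (zv i A) g = -((sg A : ℂ) • eZ i A g) := by
  rw [comm_eq, zv, gcomm_X, dB_bZY_inl, dB_right, dB_left_inl]
  push_cast; module

/-- The first-order terms rotate Y. The remaining mixed ∂_Y∂_Z term reflects that this star product
is not the Weyl one in (Z, Y), and it is the same for the quadratic functions of Z. It therefore
cancels in t^tot. -/
theorem comm_yv_mul_yv (i j : Fin 2) (A B : Fin (d + 1)) (g : ZYSeries d) :
    comm (yv i A * yv j B) g = (sg B : ℂ) • (yv i A * eY j B g) + (sg A : ℂ) • (yv j B * eY i A g)
      - ((1 / 2 * sg A * sg B : ℝ) : ℂ) • (eY j B (eZ i A g) + eY i A (eZ j B g)) := by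
  rw [comm_eq, yv, yv, gcomm_X_mul_X]
  simp only [dB_right, dB_left_inr, map_sub, map_neg, map_add, map_smul, mul_sub, mul_neg, mul_add,
    mul_smul_comm, eY_comm_eZ]
  push_cast
  module

theorem comm_zv_mul_zv (i j : Fin 2) (A B : Fin (d + 1)) (g : ZYSeries d) :
    comm (zv i A * zv j B) g
      = -((sg B : ℂ) • (zv i A * eZ j B g)) - (sg A : ℂ) • (zv j B * eZ i A g)
      - ((1 / 2 * sg A * sg B : ℝ) : ℂ) • (eY j B (eZ i A g) + eY i A (eZ j B g)) := by
  rw [comm_eq, zv, zv, gcomm_X_mul_X]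
  simp only [dB_bZY_inl, dB_right, dB_left_inl, map_sub, map_add, map_smul, mul_sub, mul_add,
    mul_smul_comm, eY_comm_eZ]
  push_cast
  module

end HigherSpin

end

/-! ### Commutators with the vacuum fields and with the sp(2) generators -/

noncomputable section

namespace HigherSpin

open MvPowerSeries

variable {d : ℕ}

theorem comm_smul_left (c : ℂ) (a g : ZYSeries d) : comm (c • a) g = c • comm a g := by
  rw [comm_eq, comm_eq, gcomm_smul_left]

theorem comm_sum_left {ι : Type*} {s : Finset ι} {a : ι → ZYSeries d}
    (ha : ∀ i ∈ s, IsPoly (a i)) (g : ZYSeries d) :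
    comm (∑ i ∈ s, a i) g = ∑ i ∈ s, comm (a i) g := by
  simp only [comm_eq, gcomm_sum_left ha]

theorem comm_add_left {a a' : ZYSeries d} (ha : IsPoly a) (ha' : IsPoly a') (g : ZYSeries d) :
    comm (a + a') g = comm a g + comm a' g := by
  have := comm_sum_left (s := Finset.univ) (a := ![a, a'])
    (fun i _ => by fin_cases i <;> simpa) g
  simpa [Fin.sum_univ_two] using this

theorem comm_sub_left {a a' : ZYSeries d} (ha : IsPoly a) (ha' : IsPoly a') (g : ZYSeries d) :
    comm (a - a') g = comm a g - comm a' g := by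
  rw [sub_eq_add_neg, ← neg_one_smul ℂ, comm_add_left ha (ha'.smul _), comm_smul_left]; module

theorem comm_swap (f g : ZYSeries d) : comm f g = -comm g f := by
  rw [comm, comm, neg_sub]

/-- The commutator with a polynomial, as a linear map. -/
def adL (a : ZYSeries d) (ha : IsPoly a) : ZYSeries d →ₗ[ℂ] ZYSeries d := ad bZY a ha

theorem adL_apply {a : ZYSeries d} (ha : IsPoly a) (g : ZYSeries d) : adL a ha g = comm a g := by
  rw [comm_eq]; rfl

theorem finOrd_adL {a : ZYSeries d} (ha : IsPoly a) : FinOrd (adL a ha) := finOrd_ad ha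

theorem comm_jacobi {a a' : ZYSeries d} (ha : IsPoly a) (ha' : IsPoly a') (g : ZYSeries d) :
    comm a (comm a' g) = comm (comm a a') g + comm a' (comm a g) := by
  simp only [comm_eq, gcomm_jacobi ha ha']

theorem isPoly_yv (i : Fin 2) (A : Fin (d + 1)) : IsPoly (yv i A : ZYSeries d) := isPoly_X _

theorem isPoly_zv (i : Fin 2) (A : Fin (d + 1)) : IsPoly (zv i A : ZYSeries d) := isPoly_X _

theorem eps_zero_zero : eps 0 0 = 0 := by simp [eps]
theorem eps_zero_one : eps 0 1 = 1 := by simp [eps]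
theorem eps_one_zero : eps 1 0 = -1 := by simp [eps]
theorem eps_one_one : eps 1 1 = 0 := by simp [eps]

theorem eY_zero (A : Fin (d + 1)) (g : ZYSeries d) : eY 0 A g = pd (.inr (1, A)) g := by
  rw [eY_apply, Fin.sum_univ_two, eps_zero_zero, eps_zero_one]
  push_cast
  module

theorem eY_one (A : Fin (d + 1)) (g : ZYSeries d) : eY 1 A g = -pd (.inr (0, A)) g := by
  rw [eY_apply, Fin.sum_univ_two, eps_one_zero, eps_one_one]
  push_cast
  module

theorem eZ_zero (A : Fin (d + 1)) (g : ZYSeries d) : eZ 0 A g = pd (.inl (1, A)) g := by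
  rw [eZ_apply, Fin.sum_univ_two, eps_zero_zero, eps_zero_one]
  push_cast
  module

theorem eZ_one (A : Fin (d + 1)) (g : ZYSeries d) : eZ 1 A g = -pd (.inl (0, A)) g := by
  rw [eZ_apply, Fin.sum_univ_two, eps_one_zero, eps_one_one]
  push_cast
  module

theorem sg_sq_complex (A : Fin (d + 1)) : (sg A : ℂ) * (sg A : ℂ) = 1 := by
  rw [← Complex.ofReal_mul, sg_mul_self, Complex.ofReal_one]

theorem raise_zero {M : Type*} [AddCommMonoid M] [Module ℂ M] (a : Fin 2 → M) :
    raise a 0 = a 1 := by simp [raise, eps]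

theorem raise_one {M : Type*} [AddCommGroup M] [Module ℂ M] (a : Fin 2 → M) :
    raise a 1 = -a 0 := by simp [raise, eps]

/-! ### The vacuum value of `S` -/

theorem S0_zero (A : Fin (d + 1)) : S0 (0, A) = (sg A : ℂ) • zv 1 A := by
  rw [S0, raise_zero, lower_eq]

theorem S0_one (A : Fin (d + 1)) : S0 (1, A) = (-sg A : ℂ) • zv 0 A := by
  rw [S0, raise_one, lower_eq, neg_smul]

theorem fin_two_cases {P : Fin 2 → Prop} (h0 : P 0) (h1 : P 1) (i : Fin 2) : P i := by
  fin_cases i <;> assumption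

theorem isPoly_S0 (p : Osc d) : IsPoly (S0 p) := by
  obtain ⟨i, A⟩ := p
  revert i
  refine fin_two_cases ?_ ?_
  · rw [S0_zero]; exact (isPoly_zv _ _).smul _
  · rw [S0_one]; exact (isPoly_zv _ _).smul _

/-- The commutator with Z is an ε-contracted Z-derivative. Raising the index in `S0` undoes the ε,
and the metric sign squares to one. This converts every equation involving S₀ into a differential
equation in Z. -/
theorem comm_S0 (p : Osc d) (g : ZYSeries d) : comm (S0 p) g = pd (.inl p) g := by
  obtain ⟨i, A⟩ := p
  revert i
  refine fin_two_cases ?_ ?_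
  · have h := sg_sq_complex A
    rw [S0_zero, comm_smul_left, comm_zv, eZ_one]
    match_scalars
    linear_combination h
  · rw [S0_one, comm_smul_left, comm_zv, eZ_zero, neg_smul, smul_neg, neg_neg, smul_smul,
      sg_sq_complex, one_smul]

/-! ### The `sp(2)` generators -/

/-- The action of the `sp(2)` generators. -/
def sp2Act (i j : Fin 2) (g : ZYSeries d) : ZYSeries d :=
  ∑ A, (yv i A * eY j A g + yv j A * eY i A g + (zv i A * eZ j A g + zv j A * eZ i A g))

theorem isPoly_tTot (i j : Fin 2) : IsPoly (tTot i j : ZYSeries d) := by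
  refine (IsPoly.sum _ _ fun A _ => ?_).sub (IsPoly.sum _ _ fun A _ => ?_)
  · rw [lower_eq]; exact (isPoly_yv _ _).mul ((isPoly_yv _ _).smul _)
  · rw [lower_eq]; exact (isPoly_zv _ _).mul ((isPoly_zv _ _).smul _)

/-- The second-order terms of the Y and Z parts cancel, so t^tot acts by a genuine derivation, the
simultaneous rotation of Y and Z. -/
theorem comm_tTot (i j : Fin 2) (g : ZYSeries d) : comm (tTot i j) g = sp2Act i j g := by
  have hy : ∀ A, IsPoly ((sg A : ℂ) • (yv i A * yv j A) : ZYSeries d) := fun A =>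
    ((isPoly_yv _ _).mul (isPoly_yv _ _)).smul _
  have hz : ∀ A, IsPoly ((sg A : ℂ) • (zv i A * zv j A) : ZYSeries d) := fun A =>
    ((isPoly_zv _ _).mul (isPoly_zv _ _)).smul _
  simp only [tTot, lower_eq, mul_smul_comm]
  rw [comm_sub_left (IsPoly.sum _ _ fun A _ => hy A) (IsPoly.sum _ _ fun A _ => hz A),
    comm_sum_left fun A _ => hy A, comm_sum_left fun A _ => hz A, ← Finset.sum_sub_distrib, sp2Act]
  refine Finset.sum_congr rfl fun A _ => ?_
  rw [comm_smul_left, comm_smul_left, comm_yv_mul_yv, comm_zv_mul_zv]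
  have h := sg_sq_complex A
  have e : ∀ u : ZYSeries d, u = ((sg A : ℂ) * (sg A : ℂ)) • u := fun u => by rw [h, one_smul]
  rw [e (yv i A * eY j A g + yv j A * eY i A g + (zv i A * eZ j A g + zv j A * eZ i A g))]
  module

theorem eY_mul (i : Fin 2) (A : Fin (d + 1)) (f g : ZYSeries d) :
    eY i A (f * g) = eY i A f * g + f * eY i A g := by
  simp only [eY_apply, pd_mul, smul_add, Finset.sum_add_distrib, Finset.sum_mul, Finset.mul_sum,
    smul_mul_assoc, mul_smul_comm]

theorem eZ_mul (i : Fin 2) (A : Fin (d + 1)) (f g : ZYSeries d) :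
    eZ i A (f * g) = eZ i A f * g + f * eZ i A g := by
  simp only [eZ_apply, pd_mul, smul_add, Finset.sum_add_distrib, Finset.sum_mul, Finset.mul_sum,
    smul_mul_assoc, mul_smul_comm]

theorem sp2Act_mul (i j : Fin 2) (f g : ZYSeries d) :
    sp2Act i j (f * g) = sp2Act i j f * g + f * sp2Act i j g := by
  simp only [sp2Act, eY_mul, eZ_mul, Finset.sum_mul, Finset.mul_sum, ← Finset.sum_add_distrib]
  exact Finset.sum_congr rfl fun A _ => by ring

theorem sp2Act_add (i j : Fin 2) (f g : ZYSeries d) :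
    sp2Act i j (f + g) = sp2Act i j f + sp2Act i j g := by
  simp only [sp2Act, map_add, mul_add, ← Finset.sum_add_distrib]
  exact Finset.sum_congr rfl fun A _ => by ring

theorem sp2Act_smul (i j : Fin 2) (c : ℂ) (g : ZYSeries d) :
    sp2Act i j (c • g) = c • sp2Act i j g := by
  simp only [sp2Act, map_smul, mul_smul_comm, Finset.smul_sum, smul_add]

theorem sp2Act_sum {ι : Type*} (i j : Fin 2) (s : Finset ι) (g : ι → ZYSeries d) :
    sp2Act i j (∑ a ∈ s, g a) = ∑ a ∈ s, sp2Act i j (g a) := by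
  have := map_sum (adL (tTot i j) (isPoly_tTot i j)) g s
  simpa only [adL_apply, comm_tTot] using this

theorem eY_yv (i k : Fin 2) (A B : Fin (d + 1)) :
    eY i A (yv k B : ZYSeries d) = if A = B then (eps i k : ℂ) • 1 else 0 := by
  by_cases h : A = B
  · subst h; simp [eY_apply, yv, pd_X]
  · simp [eY_apply, yv, pd_X, h]

theorem eZ_zv (i k : Fin 2) (A B : Fin (d + 1)) :
    eZ i A (zv k B : ZYSeries d) = if A = B then (eps i k : ℂ) • 1 else 0 := by
  by_cases h : A = B
  · subst h; simp [eZ_apply, zv, pd_X]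
  · simp [eZ_apply, zv, pd_X, h]

theorem eY_zv (i k : Fin 2) (A B : Fin (d + 1)) : eY i A (zv k B : ZYSeries d) = 0 := by
  simp [eY_apply, zv, pd_X]

theorem eZ_yv (i k : Fin 2) (A B : Fin (d + 1)) : eZ i A (yv k B : ZYSeries d) = 0 := by
  simp [eZ_apply, yv, pd_X]

theorem sp2Act_yv (i j k : Fin 2) (A : Fin (d + 1)) :
    sp2Act i j (yv k A : ZYSeries d) = (eps j k : ℂ) • yv i A + (eps i k : ℂ) • yv j A := by
  simp only [sp2Act, eY_yv, eZ_yv, mul_zero, add_zero, mul_ite, mul_smul_comm, mul_one,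
    Finset.sum_add_distrib, Finset.sum_ite_eq', Finset.mem_univ, if_true]

theorem sp2Act_zv (i j k : Fin 2) (A : Fin (d + 1)) :
    sp2Act i j (zv k A : ZYSeries d) = (eps j k : ℂ) • zv i A + (eps i k : ℂ) • zv j A := by
  simp only [sp2Act, eZ_zv, eY_zv, mul_zero, add_zero, zero_add, mul_ite, mul_smul_comm, mul_one,
    Finset.sum_add_distrib, Finset.sum_ite_eq', Finset.mem_univ, if_true]

/-- The `sp(2)` action on functions of `Y`. -/
theorem sp2Act_emb (i j : Fin 2) (f : YSeries d) : sp2Act i j (emb f) = emb (commY (tY i j) f) := by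
  have h0 : ∀ A, eZ i A (emb f) = 0 ∧ eZ j A (emb f) = 0 := fun A => by
    simp [eZ_apply, pd_inl_emb]
  have hy : ∀ A, IsPoly ((sg A : ℂ) • (yv i A * yv j A) : ZYSeries d) := fun A =>
    ((isPoly_yv _ _).mul (isPoly_yv _ _)).smul _
  have ht : emb (tY i j : YSeries d) = ∑ A, (sg A : ℂ) • (yv i A * yv j A) := by
    simp only [tY, lower_eq, y₀, mul_smul_comm, emb_sum, emb_smul, emb_mul, emb_X]; rfl
  rw [commY_eq, emb_gcomm, ← comm_eq, ht, comm_sum_left fun A _ => hy A, sp2Act]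
  refine Finset.sum_congr rfl fun A _ => ?_
  rw [comm_smul_left, comm_yv_mul_yv, (h0 A).1, (h0 A).2]
  have h := sg_sq_complex A
  have e : ∀ u : ZYSeries d, u = ((sg A : ℂ) * (sg A : ℂ)) • u := fun u => by rw [h, one_smul]
  rw [e (yv i A * eY j A (emb f) + yv j A * eY i A (emb f) + (zv i A * 0 + zv j A * 0))]
  simp only [map_zero, mul_zero, smul_zero, add_zero, sub_zero]
  module

/-! ### The vacuum connection -/

/-- `w^{AB} T_{AB}`. -/
def Wm (w : Matrix (Fin (d + 1)) (Fin (d + 1)) ℝ) : YSeries d := ∑ A, ∑ B, (w A B : ℂ) • Tgen A B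

theorem Tgen_eq (A B : Fin (d + 1)) : (Tgen A B : YSeries d)
    = (1 / 2 * (sg A : ℂ) * (sg B : ℂ)) • (X (1, A) * X (0, B) - X (0, A) * X (1, B)) := by
  simp only [Tgen, Fin.sum_univ_two, raise_zero, raise_one, lower_eq, y₀, neg_mul, smul_mul_assoc,
    mul_smul_comm]
  module

theorem emb_Tgen (A B : Fin (d + 1)) : emb (Tgen A B : YSeries d)
    = (1 / 2 * (sg A : ℂ) * (sg B : ℂ)) • (yv 1 A * yv 0 B - yv 0 A * yv 1 B) := by
  simp only [Tgen_eq, emb_smul, emb_sub, emb_mul, emb_X]; rfl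

theorem isPoly_Tgen (A B : Fin (d + 1)) : IsPoly (Tgen A B : YSeries d) := by
  rw [Tgen_eq]
  exact (((isPoly_X _).mul (isPoly_X _)).sub ((isPoly_X _).mul (isPoly_X _))).smul _

theorem isPoly_Wm (w : Matrix (Fin (d + 1)) (Fin (d + 1)) ℝ) : IsPoly (Wm w) :=
  IsPoly.sum _ _ fun A _ => IsPoly.sum _ _ fun B _ => (isPoly_Tgen A B).smul _

theorem isPoly_emb_Wm (w : Matrix (Fin (d + 1)) (Fin (d + 1)) ℝ) : IsPoly (emb (Wm w)) :=
  emb_isPoly (isPoly_Wm w)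

/-- The first-order part of the commutator with `w^{AB} T_{AB}`. -/
def Rop (w : Matrix (Fin (d + 1)) (Fin (d + 1)) ℝ) : ZYSeries d →ₗ[ℂ] ZYSeries d :=
  ∑ A, ∑ B, (-(w A B * sg B) : ℂ) • ∑ k, mulL (yv k B) ∘ₗ pd (.inr (k, A))

/-- The second-order part of the commutator with `w^{AB} T_{AB}`. -/
def Qop (w : Matrix (Fin (d + 1)) (Fin (d + 1)) ℝ) : ZYSeries d →ₗ[ℂ] ZYSeries d :=
  ∑ A, ∑ B, (1 / 2 * w A B : ℂ) • ∑ k, pd (.inr (k, A)) ∘ₗ eZ k B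

theorem Rop_apply (w : Matrix (Fin (d + 1)) (Fin (d + 1)) ℝ) (g : ZYSeries d) : Rop w g
    = ∑ A, ∑ B, (-(w A B * sg B) : ℂ) • ∑ k, yv k B * pd (.inr (k, A)) g := by
  simp [Rop]

theorem Qop_apply (w : Matrix (Fin (d + 1)) (Fin (d + 1)) ℝ) (g : ZYSeries d) : Qop w g
    = ∑ A, ∑ B, (1 / 2 * w A B : ℂ) • ∑ k, pd (.inr (k, A)) (eZ k B g) := by
  simp [Qop]

theorem comm_emb_Wm_eq_sum (w : Matrix (Fin (d + 1)) (Fin (d + 1)) ℝ) (g : ZYSeries d) :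
    comm (emb (Wm w)) g = ∑ A, ∑ B, (w A B : ℂ) • comm (emb (Tgen A B)) g := by
  rw [Wm, emb_sum, comm_sum_left fun A _ => emb_isPoly (IsPoly.sum _ _ fun B _ =>
    (isPoly_Tgen A B).smul _)]
  refine Finset.sum_congr rfl fun A _ => ?_
  rw [emb_sum, comm_sum_left fun B _ => emb_isPoly ((isPoly_Tgen A B).smul _)]
  exact Finset.sum_congr rfl fun B _ => by rw [emb_smul, comm_smul_left]

theorem comm_emb_Tgen (A B : Fin (d + 1)) (g : ZYSeries d) : comm (emb (Tgen A B)) g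
    = (1 / 2 : ℂ) • ((sg A : ℂ) • ∑ k, yv k A * pd (.inr (k, B)) g
        - (sg B : ℂ) • ∑ k, yv k B * pd (.inr (k, A)) g)
      + (1 / 4 : ℂ) • (∑ k, pd (.inr (k, A)) (eZ k B g) - ∑ k, pd (.inr (k, B)) (eZ k A g)) := by
  have h1 := sg_sq_complex A
  have h2 := sg_sq_complex B
  rw [emb_Tgen, comm_smul_left, comm_sub_left ((isPoly_yv _ _).mul (isPoly_yv _ _))
    ((isPoly_yv _ _).mul (isPoly_yv _ _)), comm_yv_mul_yv, comm_yv_mul_yv]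
  simp only [Fin.sum_univ_two, eY_zero, eY_one, eZ_zero, eZ_one, map_neg, mul_neg]
  set a := (sg A : ℂ)
  set b := (sg B : ℂ)
  push_cast
  -- Squares of metric signs are inserted so that the coefficients on the two sides become
  -- comparable polynomials in the signs.
  have e3 : (1 / 4 : ℂ) = 1 / 4 * (a * a) * (b * b) := by rw [h1, h2]; ring
  rw [e3]
  match_scalars <;> grind

/-- Antisymmetry of the coefficients identifies the two halves of each bracket in `comm_emb_Tgen`.
What remains is a first-order operator preserving the degree in Z and a mixed second-order operator
lowering it by one. -/
theorem comm_emb_Wm {w : Matrix (Fin (d + 1)) (Fin (d + 1)) ℝ} (hw : ∀ A B, w A B = -w B A)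
    (g : ZYSeries d) : comm (emb (Wm w)) g = Rop w g + Qop w g := by
  have h1 : ∀ F : Fin (d + 1) → Fin (d + 1) → ZYSeries d,
      ∑ A, ∑ B, (w A B : ℂ) • F B A = -∑ A, ∑ B, (w A B : ℂ) • F A B := fun F => by
    rw [Finset.sum_comm, ← Finset.sum_neg_distrib]
    refine Finset.sum_congr rfl fun A _ => ?_
    rw [← Finset.sum_neg_distrib]
    exact Finset.sum_congr rfl fun B _ => by rw [hw A B]; push_cast; module
  set F : Fin (d + 1) → Fin (d + 1) → ZYSeries d := fun A B =>
    (1 / 2 * sg B : ℂ) • ∑ k, yv k B * pd (.inr (k, A)) g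
  set G : Fin (d + 1) → Fin (d + 1) → ZYSeries d := fun A B =>
    (1 / 4 : ℂ) • ∑ k, pd (.inr (k, A)) (eZ k B g)
  have h2 : comm (emb (Wm w)) g = (∑ A, ∑ B, (w A B : ℂ) • F B A - ∑ A, ∑ B, (w A B : ℂ) • F A B)
      + (∑ A, ∑ B, (w A B : ℂ) • G A B - ∑ A, ∑ B, (w A B : ℂ) • G B A) := by
    rw [comm_emb_Wm_eq_sum]
    simp only [← Finset.sum_sub_distrib, ← Finset.sum_add_distrib]
    refine Finset.sum_congr rfl fun A _ => Finset.sum_congr rfl fun B _ => ?_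
    rw [comm_emb_Tgen]
    simp only [F, G]
    module
  rw [h2, h1 F, h1 G, Rop_apply, Qop_apply]
  simp only [← Finset.sum_neg_distrib, sub_eq_add_neg, ← Finset.sum_add_distrib]
  refine Finset.sum_congr rfl fun A _ => Finset.sum_congr rfl fun B _ => ?_
  simp only [F, G]
  module

end HigherSpin

end

/-! ### Functions of the degree in Z -/

noncomputable section

namespace HigherSpin

open MvPowerSeries

/-- Identities between algebra-like maps are proved by matching their values at 1 and their
recursions under multiplication by a variable. -/
theorem FinOrd.ext_mul {σ τ : Type*} [Finite σ] {T S : MvPowerSeries σ ℂ →ₗ[ℂ] MvPowerSeries τ ℂ}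
    (hT : FinOrd T) (hS : FinOrd S) (h1 : T 1 = S 1)
    (h : ∀ s f, T f = S f → T (X s * f) = S (X s * f)) : T = S :=
  hT.ext_poly hS fun f hf => hf.induction (P := fun f => T f = S f) h1
    (fun f g hf hg => by rw [map_add, map_add, hf, hg]) (fun c f hf => by
      rw [map_smul, map_smul, hf]) fun s f _ hf => h s f hf

variable {d : ℕ}

/-! ### Degree in `Z` -/

/-- The degree in `Z`. -/
def zdeg (m : (Osc d ⊕ Osc d) →₀ ℕ) : ℕ := ∑ p, m (.inl p)

theorem zdeg_add (m n : (Osc d ⊕ Osc d) →₀ ℕ) : zdeg (m + n) = zdeg m + zdeg n := by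
  simp [zdeg, Finset.sum_add_distrib]

theorem zdeg_single_inl (p : Osc d) (k : ℕ) : zdeg (Finsupp.single (.inl p) k) = k := by
  classical
  simp [zdeg, Finsupp.single_apply]

theorem zdeg_single_inr (p : Osc d) (k : ℕ) : zdeg (Finsupp.single (.inr p) k) = 0 := by
  simp [zdeg, Finsupp.single_apply]

/-- The operator `φ(N)`, where `N` is the degree in `Z`. -/
def Hop (φ : ℕ → ℂ) : ZYSeries d →ₗ[ℂ] ZYSeries d where
  toFun f := fun m => φ (zdeg m) * coeff m f
  map_add' f g := by
    ext m
    change _ * coeff m (f + g) = _ * coeff m f + _ * coeff m g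
    rw [map_add, mul_add]
  map_smul' c f := by
    ext m
    change _ * coeff m (c • f) = c * (_ * coeff m f)
    rw [coeff_smul]; ring

theorem coeff_Hop (φ : ℕ → ℂ) (f : ZYSeries d) (m : (Osc d ⊕ Osc d) →₀ ℕ) :
    coeff m (Hop φ f) = φ (zdeg m) * coeff m f := rfl

theorem finOrd_Hop (φ : ℕ → ℂ) : FinOrd (Hop φ : ZYSeries d →ₗ[ℂ] ZYSeries d) := by
  refine FinOrd.of_shift 0 fun M f h => ?_
  refine MvPowerSeries.le_order fun m hm => ?_
  rw [coeff_Hop, coeff_of_lt_order (lt_of_lt_of_le hm (by simpa using h)), mul_zero]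

theorem Hop_Hop (φ ψ : ℕ → ℂ) (f : ZYSeries d) : Hop φ (Hop ψ f) = Hop (fun n => φ n * ψ n) f := by
  ext m
  simp only [coeff_Hop, mul_assoc]

theorem Hop_add_fun (φ ψ : ℕ → ℂ) (f : ZYSeries d) :
    Hop (fun n => φ n + ψ n) f = Hop φ f + Hop ψ f := by
  ext m
  simp only [coeff_Hop, map_add, add_mul]

theorem Hop_sub_fun (φ ψ : ℕ → ℂ) (f : ZYSeries d) :
    Hop (fun n => φ n - ψ n) f = Hop φ f - Hop ψ f := by
  ext m
  simp only [coeff_Hop, map_sub, sub_mul]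

theorem Hop_const (c : ℂ) (f : ZYSeries d) : Hop (fun _ => c) f = c • f := by
  ext m
  simp only [coeff_Hop, coeff_smul]

theorem coeff_X_mul' {σ : Type*} (s : σ) (f : MvPowerSeries σ ℂ) (m : σ →₀ ℕ) :
    coeff m (X s * f) = if Finsupp.single s 1 ≤ m then coeff (m - Finsupp.single s 1) f else 0 := by
  classical
  rw [X, coeff_monomial_mul, one_mul]

/-- A factor of Z raises the degree by one, so it shifts the argument of the weight. This shift
carries all later computations with the homotopy operators. -/
theorem Hop_X_inl_mul (φ : ℕ → ℂ) (p : Osc d) (f : ZYSeries d) :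
    Hop φ (X (.inl p) * f) = X (.inl p) * Hop (fun n => φ (n + 1)) f := by
  ext m
  rw [coeff_Hop, coeff_X_mul', coeff_X_mul']
  split_ifs with h
  · obtain ⟨n, rfl⟩ := exists_add_of_le h
    rw [add_tsub_cancel_left, coeff_Hop, zdeg_add, zdeg_single_inl, add_comm]
  · rw [mul_zero]

theorem Hop_X_inr_mul (φ : ℕ → ℂ) (p : Osc d) (f : ZYSeries d) :
    Hop φ (X (.inr p) * f) = X (.inr p) * Hop φ f := by
  ext m
  rw [coeff_Hop, coeff_X_mul', coeff_X_mul']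
  split_ifs with h
  · obtain ⟨n, rfl⟩ := exists_add_of_le h
    rw [add_tsub_cancel_left, coeff_Hop, zdeg_add, zdeg_single_inr, zero_add]
  · rw [mul_zero]

theorem pd_inl_Hop (φ : ℕ → ℂ) (p : Osc d) (f : ZYSeries d) :
    pd (.inl p) (Hop φ f) = Hop (fun n => φ (n + 1)) (pd (.inl p) f) := by
  ext m
  rw [coeff_pd, coeff_Hop, coeff_Hop, coeff_pd, zdeg_add, zdeg_single_inl]; ring

theorem pd_inr_Hop (φ : ℕ → ℂ) (p : Osc d) (f : ZYSeries d) :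
    pd (.inr p) (Hop φ f) = Hop φ (pd (.inr p) f) := by
  ext m
  rw [coeff_pd, coeff_Hop, coeff_Hop, coeff_pd, zdeg_add, zdeg_single_inr, add_zero]; ring

theorem eY_Hop (φ : ℕ → ℂ) (i : Fin 2) (A : Fin (d + 1)) (f : ZYSeries d) :
    eY i A (Hop φ f) = Hop φ (eY i A f) := by
  simp only [eY_apply, pd_inr_Hop, map_sum, map_smul]

theorem eZ_Hop (φ : ℕ → ℂ) (i : Fin 2) (A : Fin (d + 1)) (f : ZYSeries d) :
    eZ i A (Hop φ f) = Hop (fun n => φ (n + 1)) (eZ i A f) := by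
  simp only [eZ_apply, pd_inl_Hop, map_sum, map_smul]

/-- Euler's identity. -/
theorem euler_inl (f : ZYSeries d) :
    ∑ p, X (.inl p) * pd (.inl p) f = Hop (fun n => (n : ℂ)) f := by
  ext m
  rw [map_sum, coeff_Hop, zdeg, Nat.cast_sum, Finset.sum_mul]
  refine Finset.sum_congr rfl fun p _ => ?_
  rw [coeff_X_mul']
  split_ifs with h
  · rw [coeff_pd, tsub_add_cancel_of_le h, Finsupp.tsub_apply, Finsupp.single_eq_same]
    have h1 : 1 ≤ m (.inl p) := by simpa using h (.inl p)
    rw [Nat.cast_sub h1]; push_cast; ring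
  · have : m (.inl p) = 0 := by
      by_contra h0
      exact h (by rw [Finsupp.single_le_iff]; omega)
    rw [this, Nat.cast_zero, zero_mul]

theorem sp2Act_Hop (i j : Fin 2) (φ : ℕ → ℂ) (f : ZYSeries d) :
    sp2Act i j (Hop φ f) = Hop φ (sp2Act i j f) := by
  simp only [sp2Act, map_sum, map_add, eY_Hop, eZ_Hop, yv, zv, Hop_X_inl_mul, Hop_X_inr_mul]

/-- The substitution `Z ↦ t Z`. -/
def zscale (t : ℂ) : ZYSeries d →+* ZYSeries d :=
  rescale (Sum.elim (fun _ => t) (fun _ => 1))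

theorem coeff_zscale (t : ℂ) (f : ZYSeries d) (m : (Osc d ⊕ Osc d) →₀ ℕ) :
    coeff m (zscale t f) = t ^ zdeg m * coeff m f := by
  rw [zscale, coeff_rescale, Finsupp.prod_fintype _ _ (by simp), Fintype.prod_sum_type]
  simp [zdeg, Finset.prod_pow_eq_pow_sum]

theorem zscale_eq (t : ℂ) (f : ZYSeries d) : zscale t f = Hop (fun n => t ^ n) f := by
  ext m
  rw [coeff_zscale, coeff_Hop]

theorem zscale_zv (t : ℂ) (i : Fin 2) (A : Fin (d + 1)) : zscale t (zv i A) = t • zv i A := by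
  have := Hop_X_inl_mul (fun n => t ^ n) (i, A) (1 : ZYSeries d)
  rw [mul_one] at this
  rw [zscale_eq, zv, this]
  have h1 : Hop (fun n => t ^ (n + 1)) (1 : ZYSeries d) = t • Hop (fun n => t ^ n) 1 := by
    ext m
    simp only [coeff_smul, coeff_Hop, pow_succ]; ring
  rw [h1, ← zscale_eq, map_one, mul_smul_comm, mul_one]

theorem zscale_yv (t : ℂ) (i : Fin 2) (A : Fin (d + 1)) : zscale t (yv i A) = yv i A := by
  have := Hop_X_inr_mul (fun n => t ^ n) (i, A) (1 : ZYSeries d)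
  rw [mul_one] at this
  rw [zscale_eq, yv, this, ← zscale_eq, map_one, mul_one]

theorem zscale_smul (t c : ℂ) (f : ZYSeries d) : zscale t (c • f) = c • zscale t f := by
  rw [zscale_eq, zscale_eq, map_smul]

/-- Setting Z to zero is scaling by t = 0, with the convention 0⁰ = 1 keeping the Z-independent
part. Multiplicativity of the restriction is then inherited from the scaling homomorphism. -/
theorem emb_projY_eq_zscale (f : ZYSeries d) : emb (projY f) = zscale 0 f := by
  ext m
  rw [coeff_zscale]
  obtain ⟨n, rfl⟩ | ⟨p, hp⟩ := exists_embDomain_or m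
  · have : zdeg (n.embDomain (Function.Embedding.inr : Osc d ↪ Osc d ⊕ Osc d)) = 0 := by
      refine Finset.sum_eq_zero fun p _ => ?_
      exact Finsupp.embDomain_notin_range _ _ _ (by simp)
    rw [coeff_emb, coeff_projY, this, pow_zero, one_mul]
  · rw [coeff_eq_zero_of_pd_inl (fun q => pd_inl_emb q _) hp]
    have : zdeg m ≠ 0 := fun h => hp (Finset.sum_eq_zero_iff.1 h p (Finset.mem_univ _))
    rw [zero_pow this, zero_mul]

theorem projY_mul (f g : ZYSeries d) : projY (f * g) = projY f * projY g := by
  apply emb_injective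
  rw [emb_mul, emb_projY_eq_zscale, emb_projY_eq_zscale, emb_projY_eq_zscale, map_mul]

/-- Restriction to `Z = 0`, as a linear map. -/
def projL : ZYSeries d →ₗ[ℂ] YSeries d where
  toFun := projY
  map_add' f g := by
    apply emb_injective
    rw [emb_add, emb_projY_eq_zscale, emb_projY_eq_zscale, emb_projY_eq_zscale, map_add]
  map_smul' c f := by
    apply emb_injective
    rw [RingHom.id_apply, emb_smul, emb_projY_eq_zscale, emb_projY_eq_zscale, zscale_smul]

theorem projL_apply (f : ZYSeries d) : projL f = projY f := rfl

theorem degree_embDomain (m : Osc d →₀ ℕ) :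
    (m.embDomain (Function.Embedding.inr : Osc d ↪ Osc d ⊕ Osc d)).degree = m.degree := by
  rw [Finsupp.degree_apply, Finsupp.degree_apply, Finsupp.support_embDomain, Finset.sum_map]
  simp

theorem finOrd_projL : FinOrd (projL (d := d)) := by
  refine FinOrd.of_shift 0 fun M f h => ?_
  refine MvPowerSeries.le_order fun m hm => ?_
  rw [projL_apply, coeff_projY]
  refine coeff_of_lt_order (lt_of_lt_of_le ?_ (by simpa using h))
  rwa [degree_embDomain]

theorem projY_zv (i : Fin 2) (A : Fin (d + 1)) : projY (zv i A) = 0 := by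
  apply emb_injective
  rw [emb_projY_eq_zscale, zscale_zv, emb_zero, zero_smul]

theorem projY_yv (i : Fin 2) (A : Fin (d + 1)) : projY (yv i A) = X (i, A) := by
  rw [yv, ← emb_X, projY_emb]

theorem pd_projY (p : Osc d) (f : ZYSeries d) : pd p (projY f) = projY (pd (.inr p) f) := by
  apply emb_injective
  rw [← pd_inr_emb, emb_projY_eq_zscale, emb_projY_eq_zscale, zscale_eq, zscale_eq, pd_inr_Hop]

end HigherSpin

end

/-! ### The Klein operator and local finiteness of right star multiplication by it -/

noncomputable section

namespace HigherSpin

open MvPowerSeries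

variable {d : ℕ} (V : Fin (d + 1) → ℝ)

/-! ### The Klein operator -/

theorem pd_inl_zl (k i : Fin 2) (D : Fin (d + 1)) :
    pd (.inl (k, D)) (zl V i) = (if k = i then (lowerV V D : ℂ) else 0) • (1 : ZYSeries d) := by
  by_cases h : k = i
  · subst h; simp [zl, zv, pd_X, -Complex.coe_smul]
  · simp [zl, zv, pd_X, h]

theorem pd_inr_zl (p : Osc d) (i : Fin 2) : pd (.inr p) (zl V i) = 0 := by
  simp [zl, zv, pd_X]

theorem pd_inr_yl (k i : Fin 2) (D : Fin (d + 1)) :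
    pd (.inr (k, D)) (yl V i) = (if k = i then (lowerV V D : ℂ) else 0) • (1 : ZYSeries d) := by
  by_cases h : k = i
  · subst h; simp [yl, yv, pd_X, -Complex.coe_smul]
  · simp [yl, yv, pd_X, h]

theorem pd_inl_yl (p : Osc d) (i : Fin 2) : pd (.inl p) (yl V i) = 0 := by
  simp [yl, yv, pd_X]

theorem zy_eq : zy V = zl V 0 * yl V 1 - zl V 1 * yl V 0 := by
  rw [zy, Fin.sum_univ_two, raise_zero, raise_one]; ring

theorem pd_inr_zy (k : Fin 2) (D : Fin (d + 1)) :
    pd (.inr (k, D)) (zy V) = (-lowerV V D : ℂ) • raise (zl V) k := by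
  rw [zy_eq, map_sub, pd_mul, pd_mul, pd_inr_zl, pd_inr_zl, pd_inr_yl, pd_inr_yl]
  revert k
  refine fin_two_cases ?_ ?_
  · rw [raise_zero]; simp
  · rw [raise_one]; simp

theorem pd_inl_zy (k : Fin 2) (D : Fin (d + 1)) :
    pd (.inl (k, D)) (zy V) = (lowerV V D : ℂ) • raise (yl V) k := by
  rw [zy_eq, map_sub, pd_mul, pd_mul, pd_inl_zl, pd_inl_zl, pd_inl_yl, pd_inl_yl]
  revert k
  refine fin_two_cases ?_ ?_
  · rw [raise_zero]; simp
  · rw [raise_one]; simp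

theorem constantCoeff_yl (i : Fin 2) : constantCoeff (yl V i) = 0 := by
  simp [yl, constantCoeff_yv, smul_eq_C_mul]

theorem constantCoeff_zl (i : Fin 2) : constantCoeff (zl V i) = 0 := by
  simp [zl, constantCoeff_zv, smul_eq_C_mul]

theorem constantCoeff_zy : constantCoeff (zy V) = 0 := by
  rw [zy_eq, map_sub, map_mul, map_mul, constantCoeff_zl, constantCoeff_zl, zero_mul, zero_mul,
    sub_zero]

theorem constantCoeff_smul_zy (a : ℂ) : constantCoeff (a • zy V) = 0 := by
  rw [smul_eq_C_mul, map_mul, constantCoeff_zy, mul_zero]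

theorem expZY_eq (a : ℂ) : expZY V a = substL (fun _ : Unit => a • zy V)
    (fun _ => constantCoeff_smul_zy V a) (PowerSeries.exp ℂ) := by
  rw [substL_apply]; rfl

theorem pd_exp : pd () (PowerSeries.exp ℂ) = PowerSeries.exp ℂ := by
  refine MvPowerSeries.ext fun m => ?_
  obtain ⟨n, rfl⟩ : ∃ n, m = Finsupp.single () n := ⟨m (), by ext; simp⟩
  rw [coeff_pd, ← Finsupp.single_add]
  change PowerSeries.coeff (n + 1) _ * _ = PowerSeries.coeff n _
  rw [PowerSeries.coeff_exp, PowerSeries.coeff_exp, Finsupp.single_eq_same, Nat.factorial_succ]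
  simp only [one_div, eq_ratCast, Rat.cast_inv, Rat.cast_natCast]
  push_cast
  have h1 : (n + 1 : ℂ) ≠ 0 := Nat.cast_add_one_ne_zero n
  have h2 : (n.factorial : ℂ) ≠ 0 := Nat.cast_ne_zero.2 n.factorial_ne_zero
  field_simp

theorem pd_expZY (u : Osc d ⊕ Osc d) (a : ℂ) :
    pd u (expZY V a) = a • (pd u (zy V) * expZY V a) := by
  rw [expZY_eq, pd_substL]
  simp only [Finset.univ_unique, Finset.sum_singleton, map_smul, smul_mul_assoc]
  congr 3
  exact pd_exp

theorem pd_inr_klein (k : Fin 2) (D : Fin (d + 1)) :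
    pd (.inr (k, D)) (klein V) = (2 * lowerV V D : ℂ) • (raise (zl V) k * klein V) := by
  rw [klein, pd_expZY, pd_inr_zy, smul_mul_assoc, smul_smul]
  congr 1; ring

theorem pd_inl_klein (k : Fin 2) (D : Fin (d + 1)) :
    pd (.inl (k, D)) (klein V) = (-(2 * lowerV V D) : ℂ) • (raise (yl V) k * klein V) := by
  rw [klein, pd_expZY, pd_inl_zy, smul_mul_assoc, smul_smul]
  congr 1; ring

theorem sg_mul_lowerV (A : Fin (d + 1)) : (sg A : ℂ) * lowerV V A = V A := by
  rw [lowerV_eq]; push_cast; rw [← mul_assoc, sg_sq_complex, one_mul]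

/-- The Klein operator is an exponential of z_i y^i, so the combination of derivatives occurring in
a right contraction reproduces it with the linear factor z + y. -/
theorem dB_klein (s : Osc d ⊕ Osc d) : dB bZY s (klein V)
    = (-(V (s.elim Prod.snd Prod.snd)) : ℂ) •
      ((zl V (s.elim Prod.fst Prod.fst) + yl V (s.elim Prod.fst Prod.fst)) * klein V) := by
  have key : ∀ p : Osc d, dB bZY (.inr p) (klein V)
      = (-(V p.2) : ℂ) • ((zl V p.1 + yl V p.1) * klein V) := by
    rintro ⟨i, A⟩
    rw [dB_right, ← sg_mul_lowerV]
    revert i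
    refine fin_two_cases ?_ ?_
    · dsimp only
      rw [eY_zero, eZ_zero, pd_inr_klein, pd_inl_klein, raise_one, raise_one, neg_mul, neg_mul]
      push_cast
      rw [add_mul]
      module
    · dsimp only
      rw [eY_one, eZ_one, pd_inr_klein, pd_inl_klein, raise_zero, raise_zero]
      push_cast
      rw [add_mul]
      module
  rcases s with p | p
  · rw [dB_bZY_inl]; exact key p
  · exact key p

theorem dB_flip_klein (p : Osc d) : dB (fun s t => bZY t s) (.inr p) (klein V)
    = (V p.2 : ℂ) • ((zl V p.1 - yl V p.1) * klein V) := by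
  obtain ⟨i, A⟩ := p
  rw [dB_left_inr, ← sg_mul_lowerV]
  revert i
  refine fin_two_cases ?_ ?_
  · dsimp only
    rw [eY_zero, eZ_zero, pd_inr_klein, pd_inl_klein, raise_one, raise_one, sub_mul, neg_mul, neg_mul]
    push_cast
    module
  · dsimp only
    rw [eY_one, eZ_one, pd_inr_klein, pd_inl_klein, raise_zero, raise_zero, sub_mul]
    push_cast
    module

/-- The Z and Y columns of the contraction matrix are opposite, so no right contraction sees the sum
z + y. -/
theorem dB_zl_add_yl (s : Osc d ⊕ Osc d) (i : Fin 2) : dB bZY s (zl V i + yl V i) = 0 := by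
  rw [zl, yl, ← Finset.sum_add_distrib, map_sum]
  refine Finset.sum_eq_zero fun A _ => ?_
  rw [map_add, map_smul, map_smul, zv, yv, dB_X, dB_X]
  rcases s with p | p <;> simp only [bZY] <;> module

/-- Each contraction multiplies the right factor by z + y, and later contractions do not
differentiate these factors. After n contractions the result is divisible by n linear forms and has
order at least n, uniformly in the left factor. -/
theorem rightGood_klein : RightGood bZY (klein V) := by
  -- The prefactor `h` collects the forms z + y produced so far; the induction uses only its order
  -- and that right contractions annihilate it.
  have key : ∀ (n M : ℕ) (f h : ZYSeries d), (∀ s, dB bZY s h = 0) → (M : ℕ∞) ≤ h.order →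
      ((M + n : ℕ) : ℕ∞) ≤ (ctr bZY n f (h * klein V)).order := by
    intro n
    induction n with
    | zero =>
      intro M f h _ hM
      rw [ctr_zero, mul_comm h, ← mul_assoc]
      exact le_order_mul_right (by simpa using hM)
    | succ n ih =>
      intro M f h hh hM
      rw [ctr_succ]
      refine le_order_sum _ _ _ fun s _ => ?_
      rw [dB_mul, hh s, zero_mul, zero_add, dB_klein, mul_smul_comm, map_smul]
      set c := zl V (s.elim Prod.fst Prod.fst) + yl V (s.elim Prod.fst Prod.fst) with hc
      have hcd : ∀ t, dB bZY t (h * c) = 0 := fun t => by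
        rw [dB_mul, hh t, hc, dB_zl_add_yl, mul_zero, zero_mul, add_zero]
      have hc1 : (1 : ℕ∞) ≤ c.order := by
        rw [one_le_order_iff_constCoeff_eq_zero, hc, map_add, constantCoeff_zl, constantCoeff_yl,
          add_zero]
      have hM1 : ((M + 1 : ℕ) : ℕ∞) ≤ (h * c).order := by
        push_cast
        exact (add_le_add hM hc1).trans le_order_mul
      have := ih (M + 1) (pd s f) (h * c) hcd hM1
      rw [mul_assoc, show M + 1 + n = M + (n + 1) by ring] at this
      exact this.trans le_order_smul
  intro M
  refine ⟨M, fun n hn f => ?_⟩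
  have := key n 0 f 1 (fun s => by
    rw [dB_apply]; exact Finset.sum_eq_zero fun t _ => by rw [pd_one, smul_zero]) (by simp)
  rw [one_mul, zero_add] at this
  exact le_trans (by exact_mod_cast hn) this

theorem compat_klein (f : ZYSeries d) : Compat bZY f (klein V) := Or.inl (rightGood_klein V)

/-- Right star multiplication by the Klein operator. -/
def kleinR : ZYSeries d →ₗ[ℂ] ZYSeries d := starR (klein V) (rightGood_klein V)

theorem kleinR_apply (f : ZYSeries d) : kleinR V f = gstar bZY f (klein V) := rfl

theorem finOrd_kleinR : FinOrd (kleinR V) := finOrd_starR _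

/-- `z + y` can be moved through a star product from the right factor. -/
theorem star_zl_add_yl_mul {f g : ZYSeries d} (h : Compat bZY f g) (i : Fin 2) :
    gstar bZY f ((zl V i + yl V i) * g) = (zl V i + yl V i) * gstar bZY f g := by
  have e : ∀ u : ZYSeries d, (zl V i + yl V i) * u
      = ∑ A, (lowerV V A : ℂ) • (zv i A * u + yv i A * u) := fun u => by
    rw [zl, yl, ← Finset.sum_add_distrib, Finset.sum_mul]
    exact Finset.sum_congr rfl fun A _ => by rw [← smul_add, smul_mul_assoc, add_mul]
  have h1 : ∀ A ∈ Finset.univ, Compat bZY f ((lowerV V A : ℂ) • (zv i A * g + yv i A * g)) := by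
    intro A _
    rcases h with h | h
    · exact Or.inl (((h.X_mul _).add (h.X_mul _)).smul _)
    · exact Or.inr h
  have hs : gstar bZY f (∑ A, (lowerV V A : ℂ) • (zv i A * g + yv i A * g))
      = ∑ A, gstar bZY f ((lowerV V A : ℂ) • (zv i A * g + yv i A * g)) := by
    have := Compat.sum_star (b := fun s t => bZY t s) (s := Finset.univ)
      (f := fun A => (lowerV V A : ℂ) • (zv i A * g + yv i A * g)) (g := f) (by
        rcases h with h | h
        · exact Or.inr fun A _ => ((h.X_mul _).add (h.X_mul _)).smul _
        · exact Or.inl h)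
    simpa only [star_flip] using this
  rw [e, e, hs]
  refine Finset.sum_congr rfl fun A _ => ?_
  rw [star_smul_right, zv, yv, star_add_right' (h.X_mul_right _) (h.X_mul_right _),
    h.star_X_mul, h.star_X_mul, dB_left_inl, dB_left_inr, ← neg_one_smul ℂ (_ • _)]
  simp only [star_smul_left]
  module

/-- The contraction of the variable with 𝒦 yields a factor z + y, which leaves the star product as
ordinary multiplication. This recursion determines f * 𝒦 for all f. -/
theorem kleinR_X_mul (s : Osc d ⊕ Osc d) (f : ZYSeries d) : kleinR V (X s * f)
    = (X s - (V (s.elim Prod.snd Prod.snd) : ℂ) •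
      (zl V (s.elim Prod.fst Prod.fst) + yl V (s.elim Prod.fst Prod.fst))) * kleinR V f := by
  have h := compat_klein V f
  rw [kleinR_apply, h.X_mul_star, dB_klein, star_smul_right, star_zl_add_yl_mul V h, kleinR_apply,
    sub_mul, smul_mul_assoc, neg_smul, sub_eq_add_neg]

end HigherSpin

end

/-! ### Reflection by the Klein operator, and homotopy integrals as degree operators -/

noncomputable section

namespace HigherSpin

open MvPowerSeries

variable {d : ℕ} (V : Fin (d + 1) → ℝ)

theorem constantCoeff_smul {σ : Type*} (c : ℂ) (f : MvPowerSeries σ ℂ) :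
    constantCoeff (c • f) = c * constantCoeff f := by
  rw [smul_eq_C_mul, map_mul, constantCoeff_C]

theorem constantCoeff_twist (t : ℝ) (p : Osc d) :
    constantCoeff (yv p.1 p.2 - (V p.2 : ℂ) • yl V p.1 - ((t * V p.2 : ℝ) : ℂ) • zl V p.1) = 0 := by
  simp only [map_sub, constantCoeff_smul, constantCoeff_yv, constantCoeff_yl, constantCoeff_zl,
    mul_zero, sub_zero]

/-- The substitution `Y ↦ ^⊥Y - t ^∥Z`, as a linear map. -/
def twistL (t : ℝ) : YSeries d →ₗ[ℂ] ZYSeries d := substL _ (constantCoeff_twist V t)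

theorem twistL_apply (t : ℝ) (f : YSeries d) : twistL V t f = twistArg V t f := by
  rw [twistL, substL_apply]; rfl

theorem constantCoeff_yl₀ (i : Fin 2) :
    constantCoeff (∑ B, (lowerV V B : ℂ) • y₀ i B : YSeries d) = 0 := by
  rw [map_sum]
  exact Finset.sum_eq_zero fun B _ => by rw [constantCoeff_smul, y₀, constantCoeff_X, mul_zero]

theorem constantCoeff_perp (c : ℂ) (p : Osc d) :
    constantCoeff (y₀ p.1 p.2 - c • ∑ B, (lowerV V B : ℂ) • y₀ p.1 B : YSeries d) = 0 := by
  rw [map_sub, constantCoeff_smul, constantCoeff_yl₀, y₀, constantCoeff_X, mul_zero, sub_zero]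

/-- The substitution `Y ↦ ^⊥Y`, as a linear map. -/
def perpL : YSeries d →ₗ[ℂ] YSeries d := substL _ fun p => constantCoeff_perp V (V p.2 : ℂ) p

theorem perpL_apply (f : YSeries d) : perpL V f = perpArg V f := by
  rw [perpL, substL_apply]; rfl

/-- The reflection, as a linear map. -/
def tildeYL : YSeries d →ₗ[ℂ] YSeries d := substL _ fun p => constantCoeff_perp V (2 * V p.2 : ℂ) p

theorem tildeYL_apply (f : YSeries d) : tildeYL V f = tildeY V f := by
  rw [tildeYL, substL_apply]; rfl

theorem constantCoeff_tilde (s : Osc d ⊕ Osc d) : constantCoeff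
    (Sum.elim (fun p : Osc d => zv p.1 p.2 - (2 * V p.2 : ℂ) • zl V p.1)
      (fun p : Osc d => yv p.1 p.2 - (2 * V p.2 : ℂ) • yl V p.1) s) = 0 := by
  rcases s with p | p <;>
  simp only [Sum.elim_inl, Sum.elim_inr, map_sub, constantCoeff_smul, constantCoeff_yv,
    constantCoeff_zv, constantCoeff_yl, constantCoeff_zl, mul_zero, sub_zero]

/-- The reflection, as a linear map. -/
def tildeL : ZYSeries d →ₗ[ℂ] ZYSeries d := substL _ (constantCoeff_tilde V)

theorem tildeL_apply (f : ZYSeries d) : tildeL V f = tilde V f := by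
  rw [tildeL, substL_apply]; rfl

theorem emb_yl₀ (i : Fin 2) : emb (∑ B, (lowerV V B : ℂ) • y₀ i B) = yl V i := by
  simp only [emb_sum, emb_smul, y₀, emb_X]; rfl

theorem tilde_emb (f : YSeries d) : tilde V (emb f) = emb (tildeY V f) := by
  rw [← tildeL_apply, ← tildeYL_apply, ← embL_apply, ← embL_apply]
  refine LinearMap.congr_fun (f := tildeL V ∘ₗ embL) (g := embL ∘ₗ tildeYL V) ?_ f
  refine FinOrd.ext_mul ((finOrd_substL _).comp finOrd_embL) (finOrd_embL.comp (finOrd_substL _))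
    ?_ fun p f hf => ?_
  · simp only [LinearMap.comp_apply, embL_apply, emb_one, tildeL, tildeYL, substL_one]
  · simp only [LinearMap.comp_apply, embL_apply, tildeL, tildeYL] at hf ⊢
    rw [emb_mul, substL_mul, substL_mul, emb_mul, hf, emb_X, substL_X, substL_X, emb_sub, emb_smul,
      emb_yl₀, y₀, emb_X]
    rfl

/-- The reflection acts both on the differentials and on Z, and as an isometry (this uses V² = 1) it
preserves their pairing. -/
theorem tildeS_S0 (hV : normV V = 1) (p : Osc d) : tildeS V S0 p = S0 p := by
  have hz : ∀ i A, tilde V (zv i A : ZYSeries d) = zv i A - (2 * V A : ℂ) • zl V i := fun i A => by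
    rw [← tildeL_apply, tildeL, zv, substL_X]; rfl
  have hS : ∀ c : ℂ, ∀ i A, tilde V (c • zv i A : ZYSeries d)
      = c • zv i A - (c * (2 * V A)) • zl V i := fun c i A => by
    rw [← tildeL_apply, map_smul, tildeL_apply, hz]; module
  have hsum : ∀ c : ℂ, ∀ i, ∑ B, (V B : ℂ) • ((c * sg B) • zv i B - (c * sg B * (2 * V B)) • zl V i)
      = -(c • zl V i) := fun c i => by
    simp only [smul_sub, Finset.sum_sub_distrib, smul_smul, ← Finset.sum_smul]
    have h1 : ∑ B, ((V B : ℂ) * (c * sg B * (2 * V B))) = 2 * c := by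
      have : (∑ B, (lowerV V B : ℂ) * V B) = 1 := by
        rw [← Complex.ofReal_one, ← hV, normV]; push_cast; rfl
      calc _ = ∑ B, 2 * c * ((lowerV V B : ℂ) * V B) :=
            Finset.sum_congr rfl fun B _ => by rw [lowerV_eq]; push_cast; ring
        _ = _ := by rw [← Finset.mul_sum, this, mul_one]
    rw [h1]
    have h2 : ∑ B, ((V B : ℂ) * (c * sg B)) • zv i B = c • zl V i := by
      rw [zl, Finset.smul_sum]
      exact Finset.sum_congr rfl fun B _ => by rw [lowerV_eq, smul_smul]; push_cast; congr 1; ring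
    rw [h2]; module
  obtain ⟨i, A⟩ := p
  revert i
  refine fin_two_cases ?_ ?_
  · rw [tildeS]
    simp only [S0_zero, hS]
    have := hsum 1 1
    simp only [one_mul] at this
    rw [this, lowerV_eq]; push_cast; module
  · rw [tildeS]
    simp only [S0_one, hS]
    have := hsum (-1) 0
    simp only [neg_one_mul] at this
    rw [this, lowerV_eq]; push_cast; module

/-! ### Star products with the Klein operator -/

theorem kleinR_one : kleinR V 1 = klein V := star_one_left _

/-- Right star multiplication by 𝒦 turns multiplication by Y into multiplication by Y - V(y + z),
which is ^⊥Y - ^∥Z. Both sides obey this recursion and equal 𝒦 at f = 1. -/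
theorem kleinR_emb (f : YSeries d) : kleinR V (emb f) = twistArg V 1 f * klein V := by
  rw [← twistL_apply, mul_comm]
  suffices h : kleinR V ∘ₗ embL = mulL (klein V) ∘ₗ twistL V 1 by
    simpa only [LinearMap.comp_apply, embL_apply, mulL_apply] using LinearMap.congr_fun h f
  refine FinOrd.ext_mul ((finOrd_kleinR V).comp finOrd_embL)
    ((finOrd_mulL _).comp (finOrd_substL _)) ?_ fun p f hf => ?_
  · simp only [LinearMap.comp_apply, embL_apply, emb_one, mulL_apply, twistL, substL_one,
      kleinR_one, mul_one]
  · simp only [LinearMap.comp_apply, embL_apply, mulL_apply, twistL] at hf ⊢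
    rw [emb_mul, emb_X, kleinR_X_mul, hf, substL_mul, substL_X]
    simp only [Sum.elim_inr, one_mul, yv]
    rw [smul_add]; ring

theorem kleinR_X_mul_inr (p : Osc d) (f : ZYSeries d) : kleinR V (X (.inr p) * f)
    = (yv p.1 p.2 - (V p.2 : ℂ) • (zl V p.1 + yl V p.1)) * kleinR V f := kleinR_X_mul V (.inr p) f

/-- Contracting the recursion with V and using V² = 1, the longitudinal part y is traded for -z. -/
theorem kleinR_yl_mul (hV : normV V = 1) (i : Fin 2) (f : ZYSeries d) :
    kleinR V (yl V i * f) = -zl V i * kleinR V f := by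
  have : (∑ B, (lowerV V B : ℂ) * V B) = 1 := by
    rw [← Complex.ofReal_one, ← hV, normV]; push_cast; rfl
  rw [yl, Finset.sum_mul, map_sum]
  calc _ = ∑ A, ((lowerV V A : ℂ) • yv i A - ((lowerV V A : ℂ) * V A) • (zl V i + yl V i))
        * kleinR V f := Finset.sum_congr rfl fun A _ => by
          rw [smul_mul_assoc, map_smul, yv, kleinR_X_mul_inr]
          simp only [yv, sub_mul, smul_mul_assoc, smul_sub, smul_smul]
    _ = _ := by
      rw [← Finset.sum_mul, Finset.sum_sub_distrib, ← Finset.sum_smul, this, one_smul]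
      congr 1
      rw [yl]; abel

/-- Mirror image of `kleinR_X_mul`. With 𝒦 on the left the contraction produces z - y, and this
difference passes through because Z and Y have the same left contractions. -/
theorem klein_star_X_mul (p : Osc d) (f : ZYSeries d) (hf : IsPoly f) :
    gstar bZY (klein V) (X (.inr p) * f)
      = (yv p.1 p.2 + (V p.2 : ℂ) • (zl V p.1 - yl V p.1)) * gstar bZY (klein V) f := by
  have hL : LeftGood bZY f := hf.leftGood
  have hR : RightGood bZY f := hf.rightGood
  have hC : ∀ g, Compat bZY g f := fun g => Or.inl hR
  have h1 : gstar bZY ((zl V p.1 - yl V p.1) * klein V) f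
      = (zl V p.1 - yl V p.1) * gstar bZY (klein V) f := by
    have e : ∀ u : ZYSeries d, (zl V p.1 - yl V p.1) * u
        = ∑ A, (lowerV V A : ℂ) • (zv p.1 A * u + (-1 : ℂ) • (yv p.1 A * u)) := fun u => by
      rw [zl, yl, ← Finset.sum_sub_distrib, Finset.sum_mul]
      exact Finset.sum_congr rfl fun A _ => by
        rw [← smul_sub, smul_mul_assoc, sub_mul, neg_one_smul, sub_eq_add_neg]
    rw [e, e, Compat.sum_star (Or.inl hR)]
    refine Finset.sum_congr rfl fun A _ => ?_
    rw [star_smul_left, star_add_left' (hC _) (hC _), star_smul_left, zv, yv, (hC _).X_mul_star,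
      (hC _).X_mul_star, dB_bZY_inl]
    module
  rw [(hC _).star_X_mul, dB_flip_klein, star_smul_left, h1, add_mul, smul_mul_assoc]; rfl

/-- Multiplication by Y becomes Y + V(z - y) behind 𝒦. The reflected variable Y - 2Vy in front of 𝒦
becomes Y - V(z + y) + 2Vz, which is the same. This is the intertwining property that creates the
twisted covariant derivative. -/
theorem klein_star_emb (hV : normV V = 1) {f : YSeries d} (hf : IsPoly f) :
    gstar bZY (klein V) (emb f) = kleinR V (emb (tildeY V f)) := by
  rw [← tildeYL_apply]
  refine (hf.induction (P := fun f => IsPoly f ∧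
    gstar bZY (klein V) (emb f) = kleinR V (emb (tildeYL V f)))
    ⟨isPoly_one, ?_⟩ (fun f g hf hg => ⟨hf.1.add hg.1, ?_⟩) (fun c f hf => ⟨hf.1.smul c, ?_⟩)
    fun p f hp hf => ⟨(isPoly_X p).mul hp, ?_⟩).2
  · rw [tildeYL, substL_one, emb_one, kleinR_one, star_one_right]
  · rw [emb_add, map_add, emb_add, map_add, ← hf.2, ← hg.2]
    exact star_add_right' (Or.inl (emb_isPoly hf.1).rightGood) (Or.inl (emb_isPoly hg.1).rightGood)
  · rw [emb_smul, map_smul, emb_smul, map_smul, ← hf.2, star_smul_right]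
  · rw [emb_mul, emb_X, klein_star_X_mul V p _ (emb_isPoly hp), hf.2, tildeYL, substL_mul, substL_X,
      emb_mul, emb_sub, emb_smul, emb_yl₀, y₀, emb_X, sub_mul, map_sub, smul_mul_assoc, map_smul,
      kleinR_yl_mul V hV, kleinR_X_mul_inr]
    simp only [add_mul, sub_mul, smul_mul_assoc, smul_add, smul_sub, neg_mul]
    module

/-! ### Homotopy integrals -/

theorem zscale_zl (t : ℂ) (i : Fin 2) : zscale t (zl V i) = t • zl V i := by
  rw [zl, map_sum, Finset.smul_sum]
  exact Finset.sum_congr rfl fun A _ => by rw [zscale_smul, zscale_zv, smul_comm]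

theorem zscale_yl (t : ℂ) (i : Fin 2) : zscale t (yl V i) = yl V i := by
  rw [yl, map_sum]
  exact Finset.sum_congr rfl fun A _ => by rw [zscale_smul, zscale_yv]

theorem zscale_zy (t : ℂ) : zscale t (zy V) = t • zy V := by
  simp only [zy_eq, map_sub, map_mul, zscale_zl, zscale_yl, smul_mul_assoc, smul_sub]

theorem zscale_expZY (t a : ℂ) : zscale t (expZY V a) = expZY V (a * t) := by
  rw [zscale_eq, expZY_eq, expZY_eq]
  refine LinearMap.congr_fun (f := Hop (fun n => t ^ n) ∘ₗ substL (fun _ : Unit => a • zy V)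
    (fun _ => constantCoeff_smul_zy V a)) ?_ (PowerSeries.exp ℂ : MvPowerSeries Unit ℂ)
  refine FinOrd.ext_mul ((finOrd_Hop _).comp (finOrd_substL _)) (finOrd_substL _) ?_
    fun p f hf => ?_
  · simp only [LinearMap.comp_apply, substL_one, ← zscale_eq, map_one]
  · simp only [LinearMap.comp_apply, ← zscale_eq] at hf ⊢
    rw [substL_mul, substL_mul, map_mul, hf, substL_X, substL_X, zscale_smul, zscale_zy, smul_smul]

theorem zscale_twistArg (t : ℝ) (f : YSeries d) : zscale t (twistArg V 1 f) = twistArg V t f := by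
  rw [zscale_eq, ← twistL_apply, ← twistL_apply]
  refine LinearMap.congr_fun (f := Hop (fun n => (t : ℂ) ^ n) ∘ₗ twistL V 1) ?_ f
  refine FinOrd.ext_mul ((finOrd_Hop _).comp (finOrd_substL _)) (finOrd_substL _) ?_
    fun p f hf => ?_
  · simp only [LinearMap.comp_apply, twistL, substL_one, ← zscale_eq, map_one]
  · simp only [LinearMap.comp_apply, twistL, ← zscale_eq] at hf ⊢
    rw [substL_mul, substL_mul, map_mul, hf, substL_X, substL_X, map_sub, map_sub, zscale_smul,
      zscale_smul, zscale_yv, zscale_yl, zscale_zl, smul_smul]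
    congr 3
    push_cast; ring

/-- The integrands of the first-order solution are C * 𝒦 with Z rescaled by t. -/
theorem twistArg_mul_expZY (t : ℝ) (f : YSeries d) :
    twistArg V t f * expZY V ((-2 * t : ℝ) : ℂ) = zscale t (kleinR V (emb f)) := by
  rw [kleinR_emb, map_mul, zscale_twistArg, klein, zscale_expZY]; push_cast; rfl

/-- On the part of degree n in Z the rescaled function is multiplied by tⁿ, so the integral over t
is multiplication by the n-th moment of the weight. -/
theorem intSeries_smul_zscale {w : ℝ → ℝ} {φ : ℕ → ℂ}
    (h : ∀ n : ℕ, ∫ t in (0 : ℝ)..1, (w t : ℂ) * (t : ℂ) ^ n = φ n) (f : ZYSeries d) :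
    intSeries (fun t => (w t : ℂ) • zscale t f) = Hop φ f := by
  ext m
  rw [coeff_Hop, ← h (zdeg m), ← intervalIntegral.integral_mul_const]
  change ∫ t in (0 : ℝ)..1, _ = _
  refine intervalIntegral.integral_congr fun t _ => ?_
  simp only [coeff_smul, coeff_zscale]; ring

theorem integral_ofReal_pow (n : ℕ) : ∫ t in (0 : ℝ)..1, (t : ℂ) ^ n = 1 / (n + 1) := by
  have h := integral_pow (a := 0) (b := 1) n
  have : ∀ t : ℝ, (t : ℂ) ^ n = ((t ^ n : ℝ) : ℂ) := fun t => by push_cast; rfl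
  simp only [this, intervalIntegral.integral_ofReal, h]
  push_cast; simp

theorem integral_mul_pow (n : ℕ) : ∫ t in (0 : ℝ)..1, (t : ℂ) * (t : ℂ) ^ n = 1 / (n + 2) := by
  have := integral_ofReal_pow (n + 1)
  simp only [pow_succ'] at this
  rw [this]; push_cast; congr 1; ring

theorem integral_one_sub_mul_pow (n : ℕ) :
    ∫ t in (0 : ℝ)..1, ((1 - t : ℝ) : ℂ) * (t : ℂ) ^ n = 1 / ((n + 1) * (n + 2)) := by
  have e : ∀ t : ℝ, ((1 - t : ℝ) : ℂ) * (t : ℂ) ^ n = (t : ℂ) ^ n - (t : ℂ) * (t : ℂ) ^ n :=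
    fun t => by push_cast; ring
  simp only [e]
  rw [intervalIntegral.integral_sub, integral_ofReal_pow, integral_mul_pow]
  · have h1 : (n + 1 : ℂ) ≠ 0 := Nat.cast_add_one_ne_zero n
    have h2 : (n + 2 : ℂ) ≠ 0 := by exact_mod_cast (Nat.succ_ne_zero (n + 1))
    field_simp; ring
  · exact (by fun_prop : Continuous fun t : ℝ => (t : ℂ) ^ n).intervalIntegrable _ _
  · exact (by fun_prop : Continuous fun t : ℝ => (t : ℂ) * (t : ℂ) ^ n).intervalIntegrable _ _

/-- `∫_0^1 dt t F(tZ)`. -/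
def hopS : ZYSeries d →ₗ[ℂ] ZYSeries d := Hop fun n => 1 / (n + 2)

/-- `∫_0^1 dt (1-t) F(tZ)`. -/
def hopW : ZYSeries d →ₗ[ℂ] ZYSeries d := Hop fun n => 1 / ((n + 1) * (n + 2))

theorem solS_eq (κ : ℝ) (C : YSeries d) (p : Osc d) : solS V κ C p
    = (4 * κ * lowerV V p.2 : ℂ) • (raise (zl V) p.1 * hopS (kleinR V (emb C))) := by
  rw [solS, hopS, ← intSeries_smul_zscale integral_mul_pow]
  simp only [twistArg_mul_expZY]

theorem solW_eq (κ : ℝ) (E : Fin (d + 1) → ℝ) (C : YSeries d) : solW V κ E C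
    = (2 * κ : ℂ) • ∑ j, raise (zl V) j *
        hopW (kleinR V (emb (∑ B, (E B : ℂ) • dPerpUp V B j C))) := by
  rw [solW]
  congr 1
  refine Finset.sum_congr rfl fun j _ => ?_
  rw [hopW, ← intSeries_smul_zscale integral_one_sub_mul_pow]
  congr 2
  funext t
  rw [← twistArg_mul_expZY, mul_comm]
  congr 2
  simp only [← twistL_apply, map_sum, map_smul]

end HigherSpin

end

/-! ### Z-curl of the S-solution, and how the vacuum commutator acts on functions of z -/

noncomputable section

namespace HigherSpin

open MvPowerSeries

variable {d : ℕ} (V : Fin (d + 1) → ℝ)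

/-! ### Differential properties of the first-order solution -/

/-- `E^B ∂/∂Y_k^B`. -/
def eDot (E : Fin (d + 1) → ℝ) (k : Fin 2) : ZYSeries d →ₗ[ℂ] ZYSeries d :=
  ∑ B, (E B : ℂ) • pd (.inr (k, B))

theorem eDot_apply (E : Fin (d + 1) → ℝ) (k : Fin 2) (g : ZYSeries d) :
    eDot E k g = ∑ B, (E B : ℂ) • pd (.inr (k, B)) g := by
  simp [eDot, -Complex.coe_smul]

theorem eDot_Hop (E : Fin (d + 1) → ℝ) (k : Fin 2) (φ : ℕ → ℂ) (g : ZYSeries d) :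
    eDot E k (Hop φ g) = Hop φ (eDot E k g) := by
  simp only [eDot_apply, pd_inr_Hop, map_sum, map_smul]

theorem eDot_zl_mul (E : Fin (d + 1) → ℝ) (k l : Fin 2) (g : ZYSeries d) :
    eDot E k (zl V l * g) = zl V l * eDot E k g := by
  simp only [eDot_apply, pd_mul, pd_inr_zl, zero_mul, zero_add, Finset.mul_sum, mul_smul_comm]

theorem pd_inl_eDot (E : Fin (d + 1) → ℝ) (k : Fin 2) (p : Osc d) (g : ZYSeries d) :
    pd (.inl p) (eDot E k g) = eDot E k (pd (.inl p) g) := by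
  simp only [eDot_apply, map_sum, map_smul]
  exact Finset.sum_congr rfl fun B _ => by rw [pd_comm]

/-- `G` depends on `Z` through `z_k` only, with `∂G/∂z_k = Gz k`. -/
def IsVertical (G : ZYSeries d) (Gz : Fin 2 → ZYSeries d) : Prop :=
  ∀ k D, pd (.inl (k, D)) G = (lowerV V D : ℂ) • Gz k

variable {V}

theorem IsVertical.Hop {G : ZYSeries d} {Gz : Fin 2 → ZYSeries d} (h : IsVertical V G Gz)
    (φ : ℕ → ℂ) : IsVertical V (Hop φ G) fun k => Hop (fun n => φ (n + 1)) (Gz k) := fun k D => by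
  rw [pd_inl_Hop, h, map_smul]

theorem IsVertical.euler {G : ZYSeries d} {Gz : Fin 2 → ZYSeries d} (h : IsVertical V G Gz) :
    ∑ k, zl V k * Gz k = HigherSpin.Hop (fun n => (n : ℂ)) G := by
  rw [← euler_inl, Fintype.sum_prod_type]
  refine Finset.sum_congr rfl fun k _ => ?_
  rw [zl, Finset.sum_mul]
  exact Finset.sum_congr rfl fun A _ => by rw [h, smul_mul_assoc, mul_smul_comm]; rfl

theorem IsVertical.eZ {G : ZYSeries d} {Gz : Fin 2 → ZYSeries d} (h : IsVertical V G Gz)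
    (i : Fin 2) (A : Fin (d + 1)) :
    eZ i A G = (lowerV V A : ℂ) • ∑ l, (eps i l : ℂ) • Gz l := by
  rw [eZ_apply, Finset.smul_sum]
  exact Finset.sum_congr rfl fun l _ => by rw [h, smul_comm]

variable (V)

/-- C(Y) does not contain Z, so only 𝒦 is differentiated, and its Z-gradient is proportional to V.
-/
theorem isVertical_kleinR (C : YSeries d) : IsVertical V (kleinR V (emb C)) fun k =>
    gstar bZY (emb C) ((-2 : ℂ) • (raise (yl V) k * klein V)) := fun k D => by
  rw [kleinR_apply, (compat_klein V _).pd_star, pd_inl_emb, star_zero_left, zero_add,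
    pd_inl_klein, ← star_smul_right, smul_smul]
  congr 2; ring

theorem pd_inl_raise_zl_mul (p : Osc d) (j : Fin 2) (G : ZYSeries d) :
    pd (.inl p) (raise (zl V) j * G)
      = (eps j p.1 * lowerV V p.2 : ℂ) • G + raise (zl V) j * pd (.inl p) G := by
  obtain ⟨k, D⟩ := p
  rw [pd_mul]
  congr 1
  revert j
  refine fin_two_cases ?_ ?_
  · rw [raise_zero, pd_inl_zl]
    revert k
    refine fin_two_cases ?_ ?_ <;> simp [eps, -Complex.coe_smul]
  · rw [raise_one, map_neg, pd_inl_zl]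
    revert k
    refine fin_two_cases ?_ ?_ <;> simp [eps, -Complex.coe_smul]

/-- `∂_p (V_q z^j G) - ∂_q (V_p z^i G) = -ε_{ij} V_p V_q (N + 2) G`. -/
theorem curl_raise_zl_mul {G : ZYSeries d} {Gz : Fin 2 → ZYSeries d} (h : IsVertical V G Gz)
    (i j : Fin 2) (A B : Fin (d + 1)) :
    (lowerV V B : ℂ) • pd (.inl (i, A)) (raise (zl V) j * G)
      - (lowerV V A : ℂ) • pd (.inl (j, B)) (raise (zl V) i * G)
      = -((eps i j * lowerV V A * lowerV V B : ℂ) • Hop (fun n => (n + 2 : ℂ)) G) := by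
  rw [pd_inl_raise_zl_mul, pd_inl_raise_zl_mul, h, h, Hop_add_fun, Hop_const, ← h.euler,
    Fin.sum_univ_two]
  revert i j
  refine fin_two_cases (fin_two_cases ?_ ?_) (fin_two_cases ?_ ?_) <;>
  simp only [raise_zero, raise_one, eps_zero_zero, eps_zero_one, eps_one_zero, eps_one_one,
    mul_smul_comm, neg_mul] <;> push_cast <;> module

theorem Hop_hopS (F : ZYSeries d) : Hop (fun n => (n + 2 : ℂ)) (hopS F) = F := by
  rw [hopS, Hop_Hop]
  have : (fun n : ℕ => ((n : ℂ) + 2) * (1 / (n + 2))) = fun _ => 1 := by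
    funext n
    have h2 : (n + 2 : ℂ) ≠ 0 := by exact_mod_cast (Nat.succ_ne_zero (n + 1))
    field_simp
  rw [this, Hop_const, one_smul]

/-- In `curl_raise_zl_mul` the two derivatives hitting the explicit z contribute 2 and Euler's
identity contributes N. The weight t in the integral is chosen so that its moments 1/(n+2) invert N
+ 2. -/
theorem solS_curl (κ : ℝ) (C : YSeries d) (i j : Fin 2) (A B : Fin (d + 1)) :
    pd (.inl (i, A)) (solS V κ C (j, B)) - pd (.inl (j, B)) (solS V κ C (i, A))
      = -((eps i j : ℂ) • ((4 * κ * lowerV V A * lowerV V B : ℂ) • kleinR V (emb C))) := by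
  have h := curl_raise_zl_mul V ((isVertical_kleinR V C).Hop (fun n => 1 / ((n : ℂ) + 2))) i j A B
  change _ = -(_ • Hop _ (hopS _)) at h
  rw [Hop_hopS] at h
  rw [solS_eq, solS_eq, map_smul, map_smul, mul_smul, mul_smul _ (lowerV V A : ℂ), ← smul_sub, hopS,
    h]
  module

variable {w : Matrix (Fin (d + 1)) (Fin (d + 1)) ℝ}

theorem Rop_Hop (w : Matrix (Fin (d + 1)) (Fin (d + 1)) ℝ) (φ : ℕ → ℂ) (g : ZYSeries d) :
    Rop w (Hop φ g) = Hop φ (Rop w g) := by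
  simp only [Rop_apply, pd_inr_Hop, map_sum, map_smul, yv, Hop_X_inr_mul]

theorem Qop_Hop (w : Matrix (Fin (d + 1)) (Fin (d + 1)) ℝ) (φ : ℕ → ℂ) (g : ZYSeries d) :
    Qop w (Hop φ g) = Hop (fun n => φ (n + 1)) (Qop w g) := by
  simp only [Qop_apply, eZ_Hop, pd_inr_Hop, map_sum, map_smul]

theorem Rop_zl_mul (w : Matrix (Fin (d + 1)) (Fin (d + 1)) ℝ) (l : Fin 2) (g : ZYSeries d) :
    Rop w (zl V l * g) = zl V l * Rop w g := by
  simp only [Rop_apply, pd_mul, pd_inr_zl, zero_mul, zero_add, Finset.mul_sum, mul_smul_comm,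
    mul_left_comm]

theorem eZ_zl (k l : Fin 2) (B : Fin (d + 1)) :
    eZ k B (zl V l) = (eps k l * lowerV V B : ℂ) • (1 : ZYSeries d) := by
  rw [eZ_apply, Fin.sum_univ_two, pd_inl_zl, pd_inl_zl]
  revert l
  refine fin_two_cases ?_ ?_ <;> simp <;> module

/-- The Z-derivative inside `Qop` may hit the explicit z, giving V. Contracted with the connection
this produces the frame, so the anomaly is half a Y-derivative along the frame. -/
theorem Qop_zl_mul (w : Matrix (Fin (d + 1)) (Fin (d + 1)) ℝ) (l : Fin 2) (g : ZYSeries d) :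
    Qop w (zl V l * g) = zl V l * Qop w g
      + (1 / 2 : ℂ) • ∑ k, (eps k l : ℂ) • eDot (fun A => ∑ B, w A B * lowerV V B) k g := by
  have h1 : ∀ k A B, pd (.inr (k, A)) (eZ k B (zl V l * g))
      = zl V l * pd (.inr (k, A)) (eZ k B g)
        + (eps k l * lowerV V B : ℂ) • pd (.inr (k, A)) g := fun k A B => by
    rw [eZ_mul, eZ_zl, smul_mul_assoc, one_mul, map_add, map_smul, pd_mul, pd_inr_zl, zero_mul,
      zero_add, add_comm]
  simp only [Qop_apply, h1, eDot_apply, Finset.mul_sum, Finset.smul_sum, mul_smul_comm,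
    Finset.sum_add_distrib, smul_add]
  congr 1
  rw [Finset.sum_congr rfl fun A _ => Finset.sum_comm, Finset.sum_comm]
  refine Finset.sum_congr rfl fun k _ => ?_
  refine Finset.sum_congr rfl fun A _ => ?_
  push_cast
  rw [Finset.sum_smul, Finset.smul_sum, Finset.smul_sum]
  exact Finset.sum_congr rfl fun B _ => by module

theorem Qop_raise_zl_mul (w : Matrix (Fin (d + 1)) (Fin (d + 1)) ℝ) (i : Fin 2) (g : ZYSeries d) :
    Qop w (raise (zl V) i * g) = raise (zl V) i * Qop w g
      + (1 / 2 : ℂ) • eDot (fun A => ∑ B, w A B * lowerV V B) i g := by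
  revert i
  refine fin_two_cases ?_ ?_
  · rw [raise_zero, Qop_zl_mul, Fin.sum_univ_two, eps_zero_one, eps_one_one]
    push_cast; module
  · rw [raise_one, neg_mul, map_neg, Qop_zl_mul, Fin.sum_univ_two, eps_zero_zero, eps_one_zero]
    push_cast
    rw [neg_mul]; module

theorem Rop_raise_zl_mul (w : Matrix (Fin (d + 1)) (Fin (d + 1)) ℝ) (i : Fin 2) (g : ZYSeries d) :
    Rop w (raise (zl V) i * g) = raise (zl V) i * Rop w g := by
  revert i
  refine fin_two_cases ?_ ?_
  · rw [raise_zero, Rop_zl_mul]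
  · rw [raise_one, neg_mul, map_neg, Rop_zl_mul, neg_mul]

variable {V}

/-- For functions of z alone the Z-derivative is V times a z-derivative, so here too only the frame
component of the connection survives. -/
theorem IsVertical.Qop {G : ZYSeries d} {Gz : Fin 2 → ZYSeries d} (h : IsVertical V G Gz)
    (w : Matrix (Fin (d + 1)) (Fin (d + 1)) ℝ) : Qop w G
      = (1 / 2 : ℂ) • ∑ k, ∑ l, (eps k l : ℂ) •
        HigherSpin.eDot (fun A => ∑ B, w A B * lowerV V B) k (Gz l) := by
  have h1 : ∀ k A B, pd (.inr (k, A)) (HigherSpin.eZ k B G)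
      = ∑ l, (eps k l * lowerV V B : ℂ) • pd (.inr (k, A)) (Gz l) := fun k A B => by
    rw [h.eZ, map_smul, map_sum, Finset.smul_sum]
    exact Finset.sum_congr rfl fun l _ => by rw [map_smul]; module
  simp only [Qop_apply, h1, eDot_apply, Finset.smul_sum]
  rw [Finset.sum_congr rfl fun A _ => Finset.sum_comm, Finset.sum_comm]
  refine Finset.sum_congr rfl fun k _ => ?_
  rw [Finset.sum_congr rfl fun A _ => Finset.sum_comm, Finset.sum_comm]
  refine Finset.sum_congr rfl fun l _ => ?_
  refine Finset.sum_congr rfl fun A _ => ?_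
  push_cast
  rw [Finset.sum_smul, Finset.smul_sum, Finset.smul_sum]
  exact Finset.sum_congr rfl fun B _ => by module

variable (V)

/-- For E orthogonal to V, the transversal and full derivatives along E agree, and 𝒦 is constant
along E because its Y-gradient is proportional to V. Hence E·∂ commutes with right star
multiplication by 𝒦 and with the homotopy operator. The two ε tensors combine to z_k ∂_k. -/
theorem solW_eq_of_orthogonal (κ : ℝ) {E : Fin (d + 1) → ℝ} (hE : ∑ B, E B * lowerV V B = 0)
    (C : YSeries d) : solW V κ E C
      = (2 * κ : ℂ) • ∑ k, zl V k * eDot E k (hopW (kleinR V (emb C))) := by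
  have hE' : ∑ B, (E B : ℂ) * (lowerV V B : ℂ) = 0 := by exact_mod_cast congrArg Complex.ofReal hE
  have h1 : ∀ k, kleinR V (emb (∑ B, (E B : ℂ) • dPerp V B k C)) = eDot E k (kleinR V (emb C)) := by
    intro k
    have h2 : ∑ B, (E B : ℂ) • dPerp V B k C = ∑ B, (E B : ℂ) • pd (k, B) C := by
      simp only [dPerp, smul_sub, Finset.sum_sub_distrib, smul_smul, ← Finset.sum_smul, hE',
        zero_smul, sub_zero]
      rfl
    -- The last term is the derivative of 𝒦; being proportional to V_B it disappears after
    -- contraction with E.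
    have h3 : ∀ B, pd (.inr (k, B)) (kleinR V (emb C)) = kleinR V (emb (pd (k, B) C))
        + (lowerV V B : ℂ) • gstar bZY (emb C) ((2 : ℂ) • (raise (zl V) k * klein V)) := fun B => by
      rw [kleinR_apply, (compat_klein V _).pd_star, pd_inr_emb, pd_inr_klein, ← star_smul_right,
        smul_smul, kleinR_apply, mul_comm (2 : ℂ)]
    simp only [h2, eDot_apply, h3, smul_add, Finset.sum_add_distrib, smul_smul, ← Finset.sum_smul,
      hE', zero_smul, add_zero, emb_sum, emb_smul, map_sum, map_smul]
  have h4 : ∀ j, kleinR V (emb (∑ B, (E B : ℂ) • dPerpUp V B j C))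
      = ∑ k, (eps j k : ℂ) • eDot E k (kleinR V (emb C)) := fun j => by
    have h5 : ∑ B, (E B : ℂ) • dPerpUp V B j C
        = ∑ k, (eps j k : ℂ) • ∑ B, (E B : ℂ) • dPerp V B k C := by
      simp only [dPerpUp, Finset.smul_sum]
      rw [Finset.sum_comm]
      exact Finset.sum_congr rfl fun k _ => Finset.sum_congr rfl fun B _ => by module
    rw [h5, emb_sum, map_sum]
    exact Finset.sum_congr rfl fun k _ => by rw [emb_smul, map_smul, h1]
  rw [solW_eq]
  simp only [h4, hopW, Fin.sum_univ_two, raise_zero, raise_one, eps_zero_zero, eps_zero_one,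
    eps_one_zero, eps_one_one, map_add, map_smul, eDot_Hop]
  push_cast
  simp only [mul_add, mul_smul_comm, neg_mul]
  module

end HigherSpin

end

/-! ### The flat vacuum covariant derivative -/

noncomputable section

namespace HigherSpin

open MvPowerSeries

variable {d : ℕ}

/-! ### The vacuum connection on space-time -/

theorem emb_Wm_eq {w : Matrix (Fin (d + 1)) (Fin (d + 1)) ℝ} (hw : ∀ A B, w A B = -w B A) :
    emb (Wm w) = ∑ A, ∑ B, (w A B * (sg A * sg B) : ℂ) • (yv 1 A * yv 0 B) := by
  have h1 : ∑ A, ∑ B, (w A B * (sg A * sg B) : ℂ) • (yv 1 B * yv 0 A : ZYSeries d)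
      = -∑ A, ∑ B, (w A B * (sg A * sg B) : ℂ) • (yv 1 A * yv 0 B : ZYSeries d) := by
    rw [Finset.sum_comm, ← Finset.sum_neg_distrib]
    refine Finset.sum_congr rfl fun A _ => ?_
    rw [← Finset.sum_neg_distrib]
    exact Finset.sum_congr rfl fun B _ => by rw [hw B A]; push_cast; module
  have h2 : emb (Wm w) = (1 / 2 : ℂ) • (∑ A, ∑ B, (w A B * (sg A * sg B) : ℂ) • (yv 1 A * yv 0 B)
      - ∑ A, ∑ B, (w A B * (sg A * sg B) : ℂ) • (yv 1 B * yv 0 A)) := by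
    simp only [Wm, emb_sum, emb_smul, emb_Tgen, ← Finset.sum_sub_distrib, Finset.smul_sum]
    refine Finset.sum_congr rfl fun A _ => Finset.sum_congr rfl fun B _ => ?_
    rw [mul_comm (yv 1 B)]
    module
  rw [h2, h1]; module

theorem Rop_mul (w : Matrix (Fin (d + 1)) (Fin (d + 1)) ℝ) (f g : ZYSeries d) :
    Rop w (f * g) = Rop w f * g + f * Rop w g := by
  simp only [Rop_apply, Finset.sum_mul, Finset.mul_sum, ← Finset.sum_add_distrib]
  refine Finset.sum_congr rfl fun A _ => Finset.sum_congr rfl fun B _ => ?_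
  simp only [pd_mul, mul_add, Finset.sum_add_distrib, smul_add, smul_mul_assoc, mul_smul_comm,
    Finset.sum_mul, Finset.mul_sum]
  congr 2 <;> exact Finset.sum_congr rfl fun k _ => by ring

theorem Rop_yv (w : Matrix (Fin (d + 1)) (Fin (d + 1)) ℝ) (k : Fin 2) (C : Fin (d + 1)) :
    Rop w (yv k C) = -∑ B, (w C B * sg B : ℂ) • yv k B := by
  rw [Rop_apply, Finset.sum_eq_single C, ← Finset.sum_neg_distrib]
  · refine Finset.sum_congr rfl fun B _ => ?_
    rw [Finset.sum_eq_single k]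
    · rw [yv, yv, pd_X, if_pos rfl, mul_one, neg_smul]
    · intro l _ hl
      rw [yv, yv, pd_X, if_neg (by simpa using hl), mul_zero]
    · simp
  · intro A _ hA
    refine Finset.sum_eq_zero fun B _ => ?_
    rw [Finset.sum_eq_zero, smul_zero]
    intro l _
    rw [yv, yv, pd_X, if_neg (by simp [hA]), mul_zero]
  · simp

theorem Qop_emb (w : Matrix (Fin (d + 1)) (Fin (d + 1)) ℝ) (f : YSeries d) :
    Qop w (emb f) = 0 := by
  have : ∀ k B, eZ k B (emb f) = 0 := fun k B => by simp [eZ_apply, pd_inl_emb]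
  simp [Qop_apply, this]

/-- The commutator of matrices with indices contracted by the metric. -/
def lieEta (w w' : Matrix (Fin (d + 1)) (Fin (d + 1)) ℝ) : Matrix (Fin (d + 1)) (Fin (d + 1)) ℝ :=
  fun A B => ∑ C, ∑ C', (w A C * eta C C' * w' C' B - w' A C * eta C C' * w C' B)

theorem lieEta_eq (w w' : Matrix (Fin (d + 1)) (Fin (d + 1)) ℝ) (A B : Fin (d + 1)) :
    lieEta w w' A B = ∑ C, sg C * (w A C * w' C B - w' A C * w C B) := by
  refine Finset.sum_congr rfl fun C _ => ?_
  rw [Finset.sum_eq_single C]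
  · rw [eta_eq, if_pos rfl]; ring
  · intro C' _ h
    rw [eta_eq, if_neg (Ne.symm h)]; ring
  · simp

/-- The second-order part of the commutator vanishes on functions of Y, and the first-order part
acts linearly on Y. On quadratic functions this is the matrix commutator, so the T_AB represent
o(d-1,2). -/
theorem comm_Wm_Wm {w w' : Matrix (Fin (d + 1)) (Fin (d + 1)) ℝ} (hw : ∀ A B, w A B = -w B A)
    (hw' : ∀ A B, w' A B = -w' B A) :
    comm (emb (Wm w)) (emb (Wm w')) = emb (Wm (lieEta w w')) := by
  have hl : ∀ A B, lieEta w w' A B = -lieEta w w' B A := fun A B => by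
    rw [lieEta_eq, lieEta_eq, ← Finset.sum_neg_distrib]
    refine Finset.sum_congr rfl fun C _ => ?_
    rw [hw A C, hw' C B, hw' A C, hw C B]; ring
  rw [comm_emb_Wm hw, Qop_emb, add_zero, emb_Wm_eq hw', emb_Wm_eq hl]
  simp only [map_sum, map_smul, Rop_mul, Rop_yv, neg_mul, mul_neg, Finset.sum_mul, Finset.mul_sum,
    smul_mul_assoc, mul_smul_comm, smul_add, smul_neg, Finset.sum_add_distrib, Finset.smul_sum,
    Finset.sum_neg_distrib]
  have h1 : ∑ A, ∑ B, ∑ C, (w' A B * (sg A * sg B) : ℂ) • (w A C * sg C : ℂ) •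
        (yv 1 C * yv 0 B : ZYSeries d)
      = ∑ A, ∑ B, ∑ C, (w' C B * (sg C * sg B) : ℂ) • (w C A * sg A : ℂ) • (yv 1 A * yv 0 B) := by
    rw [Finset.sum_comm, Finset.sum_congr rfl fun B _ => Finset.sum_comm, Finset.sum_comm]
  have h2 : ∑ A, ∑ B, ∑ C, (w' A B * (sg A * sg B) : ℂ) • (w B C * sg C : ℂ) •
        (yv 1 A * yv 0 C : ZYSeries d)
      = ∑ A, ∑ B, ∑ C, (w' A C * (sg A * sg C) : ℂ) • (w C B * sg B : ℂ) • (yv 1 A * yv 0 B) :=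
    Finset.sum_congr rfl fun A _ => Finset.sum_comm
  rw [h1, h2, ← sub_eq_zero, ← sub_eq_add_neg]
  simp only [← Finset.sum_neg_distrib, ← Finset.sum_sub_distrib]
  refine Finset.sum_eq_zero fun A _ => Finset.sum_eq_zero fun B _ => ?_
  rw [lieEta_eq, Finset.sum_sub_distrib, sub_eq_zero, ← Finset.sum_sub_distrib]
  push_cast
  rw [Finset.sum_mul, Finset.sum_smul]
  refine Finset.sum_congr rfl fun C _ => ?_
  rw [hw C A]
  push_cast
  module

variable {U : TopologicalSpace.Opens (Fin d → ℝ)}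
  (ω₀ : Fin d → U → Matrix (Fin (d + 1)) (Fin (d + 1)) ℝ)

/-- The covariant derivative of the vacuum. -/
def covD (μ : Fin d) (F : U → ZYSeries d) (x : U) : ZYSeries d :=
  dX μ F x + comm (emb (W0 ω₀ μ x)) (F x)

variable {V : Fin (d + 1) → ℝ} {ω₀}

theorem W0_eq (μ : Fin d) (x : U) : W0 ω₀ μ x = Wm (ω₀ μ x) := rfl

theorem isPoly_emb_W0 (μ : Fin d) (x : U) : IsPoly (emb (W0 ω₀ μ x)) := isPoly_emb_Wm _

theorem smooth_emb_W0 (hω : ∀ μ A B, SmoothFun fun x => ω₀ μ x A B) (μ : Fin d) :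
    SmoothSeries fun x => emb (W0 ω₀ μ x) := by
  simp only [W0, emb_sum, emb_smul]
  exact SmoothSeries.sum _ fun A _ => SmoothSeries.sum _ fun B _ =>
    SmoothSeries.smul (hω μ A B).ofReal (SmoothSeries.const _)

theorem dX_emb_W0 (hω : ∀ μ A B, SmoothFun fun x => ω₀ μ x A B) (μ ν : Fin d) (x : U) :
    dX μ (fun x => emb (W0 ω₀ ν x)) x
      = emb (Wm fun A B => partialX μ (fun x => ω₀ ν x A B) x) := by
  simp only [W0, Wm, emb_sum, emb_smul]
  have h : ∀ A B, SmoothSeries fun x => (ω₀ ν x A B : ℂ) • emb (Tgen A B : YSeries d) :=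
    fun A B => SmoothSeries.smul (hω ν A B).ofReal (SmoothSeries.const _)
  rw [dX_sum _ fun A _ => SmoothSeries.sum _ fun B _ => h A B]
  refine Finset.sum_congr rfl fun A _ => ?_
  rw [dX_sum _ fun B _ => h A B]
  refine Finset.sum_congr rfl fun B _ => ?_
  rw [dX_smul (hω ν A B).ofReal (SmoothSeries.const _), dX_const, smul_zero, add_zero,
    partialX_ofReal (hω ν A B)]

theorem smooth_comm_W0 (hω : ∀ μ A B, SmoothFun fun x => ω₀ μ x A B) {F : U → ZYSeries d}
    (hF : SmoothSeries F) (ν : Fin d) :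
    SmoothSeries fun x => comm (emb (W0 ω₀ ν x)) (F x) := by
  have h : ∀ A B, SmoothSeries fun x => (ω₀ ν x A B : ℂ) • comm (emb (Tgen A B)) (F x) := by
    intro A B
    have := SmoothSeries.smul (hω ν A B).ofReal (SmoothSeries.map
      (finOrd_adL (emb_isPoly (isPoly_Tgen A B))) hF)
    simpa only [adL_apply] using this
  simp only [W0_eq, comm_emb_Wm_eq_sum]
  exact SmoothSeries.sum _ fun A _ => SmoothSeries.sum _ fun B _ => h A B

theorem dX_comm_W0 (hω : ∀ μ A B, SmoothFun fun x => ω₀ μ x A B) {F : U → ZYSeries d}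
    (hF : SmoothSeries F) (μ ν : Fin d) (x : U) :
    dX μ (fun x => comm (emb (W0 ω₀ ν x)) (F x)) x
      = comm (dX μ (fun x => emb (W0 ω₀ ν x)) x) (F x) + comm (emb (W0 ω₀ ν x)) (dX μ F x) := by
  have ht : ∀ A B, FinOrd (adL (emb (Tgen A B : YSeries d)) (emb_isPoly (isPoly_Tgen A B))) :=
    fun A B => finOrd_adL _
  have h : ∀ A B, SmoothSeries fun x => (ω₀ ν x A B : ℂ) • comm (emb (Tgen A B)) (F x) := by
    intro A B
    have := SmoothSeries.smul (hω ν A B).ofReal (SmoothSeries.map (ht A B) hF)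
    simpa only [adL_apply] using this
  have e : (fun x => comm (emb (W0 ω₀ ν x)) (F x))
      = fun x => ∑ A, ∑ B, (ω₀ ν x A B : ℂ) • comm (emb (Tgen A B)) (F x) :=
    funext fun x => comm_emb_Wm_eq_sum _ _
  rw [dX_emb_W0 hω, e, W0_eq, comm_emb_Wm_eq_sum (ω₀ ν x),
    comm_emb_Wm_eq_sum (fun A B => partialX μ (fun x => ω₀ ν x A B) x)]
  rw [dX_sum _ fun A _ => SmoothSeries.sum _ fun B _ => h A B, ← Finset.sum_add_distrib]
  refine Finset.sum_congr rfl fun A _ => ?_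
  rw [dX_sum _ fun B _ => h A B, ← Finset.sum_add_distrib]
  refine Finset.sum_congr rfl fun B _ => ?_
  have h1 := dX_smul (hω ν A B).ofReal (SmoothSeries.map (ht A B) hF) μ x
  rw [dX_map (ht A B) hF, partialX_ofReal (hω ν A B)] at h1
  simpa only [adL_apply] using h1

theorem smooth_covD (hω : ∀ μ A B, SmoothFun fun x => ω₀ μ x A B) {F : U → ZYSeries d}
    (hF : SmoothSeries F) (μ : Fin d) : SmoothSeries (covD ω₀ μ F) :=
  hF.dX μ |>.add (smooth_comm_W0 hω hF μ)

theorem comm_zero_left (g : ZYSeries d) : comm 0 g = 0 := by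
  have := comm_smul_left 0 (0 : ZYSeries d) g
  rwa [zero_smul, zero_smul] at this

theorem comm_zero_right (g : ZYSeries d) : comm g 0 = 0 := by
  rw [comm_swap, comm_zero_left, neg_zero]

theorem vacuum_flat (hω : IsAdSConnection V ω₀) (μ ν : Fin d) (x : U) :
    dX μ (fun x => emb (W0 ω₀ ν x)) x - dX ν (fun x => emb (W0 ω₀ μ x)) x
      + comm (emb (W0 ω₀ μ x)) (emb (W0 ω₀ ν x)) = 0 := by
  rw [dX_emb_W0 hω.smooth, dX_emb_W0 hω.smooth, W0_eq, W0_eq,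
    comm_Wm_Wm (hω.antisymm μ x) (hω.antisymm ν x), ← emb_sub, ← emb_add]
  rw [← emb_zero]
  congr 1
  simp only [Wm, ← Finset.sum_sub_distrib, ← Finset.sum_add_distrib, ← sub_smul, ← add_smul]
  refine Finset.sum_eq_zero fun A _ => Finset.sum_eq_zero fun B _ => ?_
  have := hω.flat μ ν x A B
  rw [lieEta]
  rw [← Complex.ofReal_sub, ← Complex.ofReal_add, this, Complex.ofReal_zero, zero_smul]

theorem comm_add_right {a : ZYSeries d} (ha : IsPoly a) (f g : ZYSeries d) :
    comm a (f + g) = comm a f + comm a g := by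
  simp only [← adL_apply ha, map_add]

theorem comm_sub_right {a : ZYSeries d} (ha : IsPoly a) (f g : ZYSeries d) :
    comm a (f - g) = comm a f - comm a g := by
  simp only [← adL_apply ha, map_sub]

theorem isPoly_dX_W0 (hω : ∀ μ A B, SmoothFun fun x => ω₀ μ x A B) (μ ν : Fin d) (x : U) :
    IsPoly (dX μ (fun x => emb (W0 ω₀ ν x)) x) := by
  rw [dX_emb_W0 hω]; exact isPoly_emb_Wm _

theorem IsPoly.comm {a b : ZYSeries d} (ha : IsPoly a) (hb : IsPoly b) :
    IsPoly (HigherSpin.comm a b) := by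
  rw [comm_eq]; exact (ha.star hb).sub (hb.star ha)

/-- The commutator of covariant derivatives is the commutator with the curvature of W₀, by the
Jacobi identity. The curvature vanishes by `vacuum_flat`. -/
theorem covD_comm (hω : IsAdSConnection V ω₀) {F : U → ZYSeries d} (hF : SmoothSeries F)
    (μ ν : Fin d) (x : U) : covD ω₀ μ (covD ω₀ ν F) x = covD ω₀ ν (covD ω₀ μ F) x := by
  have h1 : ∀ μ ν, dX μ (covD ω₀ ν F) x = dX μ (fun x => dX ν F x) x
      + (comm (dX μ (fun x => emb (W0 ω₀ ν x)) x) (F x)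
        + comm (emb (W0 ω₀ ν x)) (dX μ F x)) := fun μ ν => by
    rw [← dX_comm_W0 hω.smooth hF, ← dX_add (hF.dX ν) (smooth_comm_W0 hω.smooth hF ν)]; rfl
  have hp : ∀ μ, IsPoly (emb (W0 ω₀ μ x)) := fun μ => isPoly_emb_W0 μ x
  have h2 := comm_jacobi (hp μ) (hp ν) (F x)
  have h3 : comm (dX μ (fun x => emb (W0 ω₀ ν x)) x) (F x)
      - comm (dX ν (fun x => emb (W0 ω₀ μ x)) x) (F x)
      + comm (comm (emb (W0 ω₀ μ x)) (emb (W0 ω₀ ν x))) (F x) = 0 := by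
    have hd : ∀ μ ν, IsPoly (dX μ (fun x => emb (W0 ω₀ ν x)) x) := fun μ ν =>
      isPoly_dX_W0 hω.smooth μ ν x
    rw [← comm_sub_left (hd μ ν) (hd ν μ), ← comm_add_left ((hd μ ν).sub (hd ν μ))
      ((hp μ).comm (hp ν)), vacuum_flat hω, comm_zero_left]
  unfold covD at h1 ⊢
  rw [h1, h1, comm_add_right (hp μ), comm_add_right (hp ν), dX_comm hF μ ν, h2]
  rw [← sub_eq_zero]
  linear_combination (exp := 1) h3

/-- The Z-derivative is the commutator with S₀, which commutes with every function of Y; the claim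
is the Jacobi identity. -/
theorem pd_inl_comm_emb {a : YSeries d} (ha : IsPoly a) (p : Osc d) (g : ZYSeries d) :
    pd (.inl p) (comm (emb a) g) = comm (emb a) (pd (.inl p) g) := by
  have := comm_jacobi (isPoly_S0 p) (emb_isPoly ha) g
  rwa [comm_S0, comm_S0, comm_S0, pd_inl_emb, comm_zero_left, zero_add] at this

theorem pd_inl_covD {F : U → ZYSeries d} (hF : SmoothSeries F) (p : Osc d) (μ : Fin d) (x : U) :
    pd (.inl p) (covD ω₀ μ F x) = covD ω₀ μ (fun x => pd (.inl p) (F x)) x := by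
  rw [covD, covD, map_add, pd_inl_comm_emb (a := W0 ω₀ μ x) (isPoly_Wm _), dX_map (finOrd_pd _) hF]

/-- The sp(2) indices of T_AB are contracted with ε, so the two rotations cancel: o(d-1,2) and sp(2)
commute. -/
theorem sp2Act_emb_Wm (i j : Fin 2) (w : Matrix (Fin (d + 1)) (Fin (d + 1)) ℝ) :
    sp2Act i j (emb (Wm w)) = 0 := by
  simp only [Wm, emb_sum, emb_smul, sp2Act_sum, sp2Act_smul]
  refine Finset.sum_eq_zero fun A _ => Finset.sum_eq_zero fun B _ => ?_
  rw [emb_Tgen, sp2Act_smul, sub_eq_add_neg, ← neg_one_smul ℂ, sp2Act_add, sp2Act_smul, sp2Act_mul,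
    sp2Act_mul, sp2Act_yv, sp2Act_yv, sp2Act_yv, sp2Act_yv]
  have : (eps j 1 : ℂ) • yv i A * yv 0 B + (eps i 1 : ℂ) • yv j A * yv 0 B
      + (yv 1 A * ((eps j 0 : ℂ) • yv i B) + yv 1 A * ((eps i 0 : ℂ) • yv j B))
      - ((eps j 0 : ℂ) • yv i A * yv 1 B + (eps i 0 : ℂ) • yv j A * yv 1 B
      + (yv 0 A * ((eps j 1 : ℂ) • yv i B) + yv 0 A * ((eps i 1 : ℂ) • yv j B)))
      = (0 : ZYSeries d) := by
    revert i j
    refine fin_two_cases (fin_two_cases ?_ ?_) (fin_two_cases ?_ ?_) <;>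
    simp only [eps_zero_zero, eps_zero_one, eps_one_zero, eps_one_one, smul_mul_assoc,
      mul_smul_comm] <;> push_cast <;> module
  rw [add_mul, add_mul, mul_add, mul_add, neg_one_smul, ← sub_eq_add_neg, this, smul_zero,
    smul_zero]

theorem comm_tTot_comm_W0 (i j : Fin 2) (μ : Fin d) (x : U) (g : ZYSeries d) :
    comm (tTot i j) (comm (emb (W0 ω₀ μ x)) g) = comm (emb (W0 ω₀ μ x)) (comm (tTot i j) g) := by
  rw [comm_jacobi (isPoly_tTot i j) (isPoly_emb_W0 μ x), comm_tTot i j (emb _), W0_eq,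
    sp2Act_emb_Wm, comm_zero_left, zero_add]

theorem comm_tTot_covD {F : U → ZYSeries d} (hF : SmoothSeries F) (i j : Fin 2) (μ : Fin d)
    (x : U) : comm (tTot i j) (covD ω₀ μ F x) = covD ω₀ μ (fun x => comm (tTot i j) (F x)) x := by
  have h := dX_map (finOrd_adL (isPoly_tTot i j)) hF μ x
  simp only [adL_apply] at h
  rw [covD, covD, comm_add_right (isPoly_tTot i j), comm_tTot_comm_W0, h]

end HigherSpin

end

/-! ### Covariant derivative of the S-solution -/

noncomputable section

namespace HigherSpin

open MvPowerSeries

variable {d : ℕ}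

/-! ### The first-order solution on space-time -/

/-- The three-term ε identity of two-dimensional linear algebra: antisymmetrizing over three
two-valued indices gives zero. -/
theorem raise_zl_identity (V : Fin (d + 1) → ℝ) (E : Fin (d + 1) → ℝ) (i : Fin 2) (H : ZYSeries d)
    (Hz : Fin 2 → ZYSeries d) :
    eDot E i (H + ∑ l, zl V l * Hz l)
        - raise (zl V) i * ∑ k, ∑ l, (eps k l : ℂ) • eDot E k (Hz l)
      = eDot E i H + ∑ k, zl V k * eDot E k (Hz i) := by
  simp only [map_add, Fin.sum_univ_two, eDot_zl_mul, eps_zero_zero, eps_zero_one, eps_one_zero,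
    eps_one_one]
  revert i
  refine fin_two_cases ?_ ?_ <;> simp only [raise_zero, raise_one, mul_add, neg_mul,
    mul_smul_comm] <;> push_cast <;> module

theorem hopS_eq (F : ZYSeries d) : hopS F = Hop (fun n => (n + 1 : ℂ)) (hopW F) := by
  rw [hopS, hopW, Hop_Hop]
  congr 1
  congr 1
  funext n
  have h1 : (n + 1 : ℂ) ≠ 0 := Nat.cast_add_one_ne_zero n
  have h2 : (n + 2 : ℂ) ≠ 0 := by exact_mod_cast (Nat.succ_ne_zero (n + 1))
  field_simp

/-- `Qop` lowers N by one, so the commutator with 1/(N+2) has weight 1/(n+3) - 1/(n+2) =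
-1/((n+2)(n+3)). This is the weight of `hopW` shifted by one and explains the factor 1 - t in the
W-solution. -/
theorem Qop_hopS_sub (w : Matrix (Fin (d + 1)) (Fin (d + 1)) ℝ) (F : ZYSeries d) :
    Qop w (hopS F) - hopS (Qop w F) = -Qop w (hopW F) := by
  rw [hopS, hopW, Qop_Hop, Qop_Hop, ← Hop_sub_fun, ← map_neg, ← sub_eq_zero, map_neg,
    sub_neg_eq_add, ← Hop_add_fun]
  have : (fun n : ℕ => 1 / (((n + 1 : ℕ) : ℂ) + 2) - 1 / ((n : ℂ) + 2)
      + 1 / ((((n + 1 : ℕ) : ℂ) + 1) * (((n + 1 : ℕ) : ℂ) + 2))) = fun _ => 0 := by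
    funext n
    have h2 : (n + 2 : ℂ) ≠ 0 := by exact_mod_cast (Nat.succ_ne_zero (n + 1))
    have h3 : (n + 3 : ℂ) ≠ 0 := by exact_mod_cast (Nat.succ_ne_zero (n + 2))
    push_cast
    rw [show (n : ℂ) + 1 + 2 = n + 3 by ring, show (n : ℂ) + 1 + 1 = n + 2 by ring]
    field_simp; ring
  rw [this, Hop_const, zero_smul]

variable {U : TopologicalSpace.Opens (Fin d → ℝ)}
  {ω₀ : Fin d → U → Matrix (Fin (d + 1)) (Fin (d + 1)) ℝ} {V : Fin (d + 1) → ℝ}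

/-- The contraction of V twice with an antisymmetric connection vanishes. -/
theorem frame_orthogonal (hω : IsAdSConnection V ω₀) (μ : Fin d) (x : U) :
    ∑ B, frame V ω₀ μ x B * lowerV V B = 0 := by
  have h : ∑ B, frame V ω₀ μ x B * lowerV V B = -∑ B, frame V ω₀ μ x B * lowerV V B := by
    conv_lhs => simp only [frame, Finset.sum_mul]
    rw [Finset.sum_comm, ← Finset.sum_neg_distrib]
    refine Finset.sum_congr rfl fun A _ => ?_
    rw [frame, Finset.sum_mul, ← Finset.sum_neg_distrib]
    exact Finset.sum_congr rfl fun B _ => by rw [hω.antisymm μ x A B]; ring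
  linarith

theorem dX_kleinR {C : U → YSeries d} (hC : SmoothSeries C) (μ : Fin d) (x : U) :
    dX μ (fun x => kleinR V (emb (C x))) x = kleinR V (emb (dX μ C x)) := by
  have := dX_map ((finOrd_kleinR V).comp finOrd_embL) hC μ x
  simpa only [LinearMap.comp_apply, embL_apply] using this

/-- In the commutator of W₀ with C * 𝒦, associativity isolates 𝒦 * W₀. Moving 𝒦 through W₀ reflects
it, so the adjoint action becomes the twisted adjoint action on C. -/
theorem covD_kleinR (hV : normV V = 1) {C : U → YSeries d} (hC : SmoothSeries C) (μ : Fin d)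
    (x : U) : covD ω₀ μ (fun x => kleinR V (emb (C x))) x
      = kleinR V (emb (twistedD V ω₀ C μ x)) := by
  have hp := isPoly_emb_W0 (ω₀ := ω₀) μ x
  have hK := compat_klein V (emb (C x))
  have h1 : comm (emb (W0 ω₀ μ x)) (kleinR V (emb (C x)))
      = kleinR V (gstar bZY (emb (W0 ω₀ μ x)) (emb (C x))
        - gstar bZY (emb (C x)) (emb (tildeY V (W0 ω₀ μ x)))) := by
    have ht : IsPoly (emb (tildeY V (W0 ω₀ μ x))) := by
      refine emb_isPoly ?_
      rw [← tildeYL_apply]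
      exact isPoly_substL _ (fun p => (isPoly_X _).sub ((IsPoly.sum _ _ fun B _ =>
        (isPoly_X _).smul _).smul _)) (isPoly_Wm _)
    rw [map_sub, kleinR_apply, kleinR_apply, kleinR_apply, star_assoc_left hp hK,
      star_assoc_middle ht hK, ← kleinR_apply V (emb (tildeY V _)), ← klein_star_emb V hV
      (f := W0 ω₀ μ x) (isPoly_Wm _), ← star_assoc_right hp hK, comm_eq]
    rfl
  rw [covD, dX_kleinR hC, h1, ← map_add, twistedD, starY_eq, starY_eq, emb_sub, emb_add, emb_gstar,
    emb_gstar, add_sub_assoc]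

/-- `solS` as a linear map. -/
def solSL (V : Fin (d + 1) → ℝ) (κ : ℝ) (p : Osc d) : YSeries d →ₗ[ℂ] ZYSeries d :=
  (4 * κ * lowerV V p.2 : ℂ) • mulL (raise (zl V) p.1) ∘ₗ hopS ∘ₗ kleinR V ∘ₗ embL

theorem solSL_apply (κ : ℝ) (p : Osc d) (C : YSeries d) : solSL V κ p C = solS V κ C p := by
  rw [solS_eq, solSL]
  simp only [LinearMap.smul_apply, LinearMap.comp_apply, mulL_apply, embL_apply]

theorem finOrd_solSL (κ : ℝ) (p : Osc d) : FinOrd (solSL V κ p) :=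
  ((finOrd_mulL _).comp ((finOrd_Hop _).comp ((finOrd_kleinR V).comp finOrd_embL))).smul _

theorem smooth_solS {C : U → YSeries d} (hC : SmoothSeries C) (κ : ℝ) (p : Osc d) :
    SmoothSeries fun x => solS V κ (C x) p := by
  simpa only [solSL_apply] using hC.map (finOrd_solSL (V := V) κ p)

/-- With F = C * 𝒦 covariantly constant, only two failures of commutation remain: that of the mixed
operator `Qop` with z^i, and that of `Qop` with 1/(N+2). Both are derivatives along the frame of the
function H = `hopW` F and its z-gradient, and the two-dimensional identity adds them up to the
gradient of z_k E·∂_k H. -/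
theorem covD_solS (hω : IsAdSConnection V ω₀) (hV : normV V = 1) {C : U → YSeries d}
    (hC : SmoothSeries C) (htw : ∀ μ x, twistedD V ω₀ C μ x = 0) (κ : ℝ) (p : Osc d) (μ : Fin d)
    (x : U) : covD ω₀ μ (fun x => solS V κ (C x) p) x
      = pd (.inl p) (solW V κ (frame V ω₀ μ x) (C x)) := by
  obtain ⟨i, A⟩ := p
  have hF := covD_kleinR (ω₀ := ω₀) hV hC μ x
  rw [htw, emb_zero, map_zero, covD, dX_kleinR hC, W0_eq, comm_emb_Wm (hω.antisymm μ x)] at hF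
  have hd := dX_map (finOrd_solSL (V := V) κ (i, A)) hC μ x
  simp only [solSL_apply] at hd
  rw [covD, hd, solW_eq_of_orthogonal V κ (frame_orthogonal hω μ x), solS_eq, solS_eq, W0_eq,
    comm_emb_Wm (hω.antisymm μ x)]
  set D := kleinR V (emb (dX μ C x))
  set F := kleinR V (emb (C x)) with hFdef
  -- The covariant constancy of F, with the first-order operator already moved through the homotopy
  -- operator.
  have hD : hopS D = -(Rop (ω₀ μ x) (hopS F) + hopS (Qop (ω₀ μ x) F)) := by
    have : D = -(Rop (ω₀ μ x) F + Qop (ω₀ μ x) F) := eq_neg_of_add_eq_zero_left hF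
    rw [this, map_neg, map_add, hopS, Rop_Hop]
  have hvert := (isVertical_kleinR V (C x)).Hop (fun n => 1 / (((n : ℂ) + 1) * ((n : ℂ) + 2)))
  change IsVertical V (hopW F) _ at hvert
  generalize hHz : (fun k => Hop (fun n => 1 / ((((n + 1 : ℕ) : ℂ) + 1) * (((n + 1 : ℕ) : ℂ) + 2)))
    (gstar bZY (emb (C x)) ((-2 : ℂ) • (raise (yl V) k * klein V)))) = Hz at hvert
  -- The weights 1/(n+2) and 1/((n+1)(n+2)) differ by the factor n + 1, that is, identity plus Euler
  -- operator, and the latter is z_l ∂/∂z_l.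
  have hG : hopS F = hopW F + ∑ l, zl V l * Hz l := by
    rw [hopS_eq, Hop_add_fun, Hop_const, one_smul, hvert.euler, add_comm]
  have hQ := Qop_hopS_sub (ω₀ μ x) F
  have hQH := hvert.Qop (ω₀ μ x)
  have hid := raise_zl_identity V (frame V ω₀ μ x) i (hopW F) Hz
  rw [← hG] at hid
  have hpd : pd (.inl (i, A)) (∑ k, zl V k * eDot (frame V ω₀ μ x) k (hopW F))
      = (lowerV V A : ℂ) • (eDot (frame V ω₀ μ x) i (hopW F)
        + ∑ k, zl V k * eDot (frame V ω₀ μ x) k (Hz i)) := by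
    simp only [map_sum, pd_mul, pd_inl_zl, pd_inl_eDot, hvert i A, map_smul, mul_smul_comm,
      smul_mul_assoc, one_mul, Finset.sum_add_distrib, ← Finset.smul_sum, smul_add]
    congr 1
    rw [Finset.sum_eq_single i]
    · rw [if_pos rfl]
    · intro k _ hk
      rw [if_neg hk.symm, zero_smul]
    · simp
  rw [map_smul, map_smul, map_smul, hpd, ← hid, Rop_raise_zl_mul, Qop_raise_zl_mul]
  change _ + (_ + _ • (_ + (1 / 2 : ℂ) • eDot (frame V ω₀ μ x) i (hopS F))) = _
  change _ = (1 / 2 : ℂ) • ∑ k, ∑ l, (eps k l : ℂ) • eDot (frame V ω₀ μ x) k (Hz l) at hQH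
  have hsum : ∑ k, ∑ l, (eps k l : ℂ) • eDot (frame V ω₀ μ x) k (Hz l)
      = (2 : ℂ) • Qop (ω₀ μ x) (hopW F) := by rw [hQH]; module
  rw [hsum, hD]
  have hQ' : hopS (Qop (ω₀ μ x) F) = Qop (ω₀ μ x) (hopS F) + Qop (ω₀ μ x) (hopW F) := by
    linear_combination (exp := 1) -hQ
  rw [hQ']
  simp only [mul_neg, mul_add, mul_smul_comm]
  module

end HigherSpin

end

/-! ### Curvature of the W-solution and the Weyl source -/

noncomputable section

namespace HigherSpin

open MvPowerSeries

variable {d : ℕ} (V : Fin (d + 1) → ℝ)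

theorem expZY_zero : expZY V 0 = 1 := by
  have h : PowerSeries.exp ℂ = 1 + X () * (PowerSeries.mk fun n =>
      PowerSeries.coeff (n + 1) (PowerSeries.exp ℂ)) := by
    have := PowerSeries.eq_X_mul_shift_add_const (PowerSeries.exp ℂ)
    rw [PowerSeries.constantCoeff_exp, map_one, add_comm] at this
    exact this
  rw [expZY_eq, h, map_add, substL_one, substL_mul, substL_X]
  simp only [zero_smul, zero_mul, add_zero]

theorem projY_klein : projY (klein V) = 1 := by
  apply emb_injective
  rw [emb_projY_eq_zscale, klein, zscale_expZY, mul_zero, expZY_zero, emb_one]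

theorem projL_zl (i : Fin 2) : projY (zl V i) = 0 := by
  rw [← projL_apply, zl, map_sum]
  exact Finset.sum_eq_zero fun A _ => by rw [map_smul, projL_apply, projY_zv, smul_zero]

theorem projY_zl_mul (i : Fin 2) (g : ZYSeries d) : projY (zl V i * g) = 0 := by
  rw [projY_mul, projL_zl, zero_mul]

theorem projL_yl (i : Fin 2) : projY (yl V i) = ∑ B, (lowerV V B : ℂ) • y₀ i B := by
  rw [← emb_yl₀, projY_emb]

theorem projY_kleinR (C : YSeries d) : projY (kleinR V (emb C)) = perpArg V C := by
  rw [kleinR_emb, projY_mul, projY_klein, mul_one, ← perpL_apply, ← twistL_apply]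
  refine LinearMap.congr_fun (f := projL ∘ₗ twistL V 1) (g := perpL V) ?_ C
  refine FinOrd.ext_mul (finOrd_projL.comp (finOrd_substL _)) (finOrd_substL _) ?_ fun p f hf => ?_
  · simp only [LinearMap.comp_apply, twistL, perpL, substL_one, projL_apply]
    rw [← emb_one, projY_emb]
  · simp only [LinearMap.comp_apply, twistL, perpL, projL_apply] at hf ⊢
    rw [substL_mul, substL_mul, projY_mul, hf, substL_X, substL_X]
    congr 1
    simp only [← projL_apply, map_sub, map_smul]
    simp only [projL_apply, projL_zl, projL_yl, projY_yv, smul_zero, sub_zero]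
    rfl

/-- Only degree zero survives at Z = 0, where the weight 1/((n+1)(n+2)) is 1/2. -/
theorem projY_hopW (F : ZYSeries d) : projY (hopW F) = (1 / 2 : ℂ) • projY F := by
  apply emb_injective
  rw [emb_smul, emb_projY_eq_zscale, emb_projY_eq_zscale, zscale_eq, zscale_eq, hopW, Hop_Hop,
    ← map_smul, ← Hop_const (1 / 2), Hop_Hop]
  congr 2
  funext n
  rcases n with _ | n <;> simp

theorem pd_perpArg (k : Fin 2) (A : Fin (d + 1)) (f : YSeries d) :
    pd (k, A) (perpArg V f) = perpArg V (dPerp V A k f) := by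
  rw [← perpL_apply, ← perpL_apply, perpL, pd_substL, ← perpL, dPerp, map_sub, map_smul, map_sum,
    Fintype.sum_prod_type]
  have h1 : ∀ l B, pd (k, A) (y₀ l B - (V B : ℂ) • ∑ D, (lowerV V D : ℂ) • y₀ l D : YSeries d)
      = if k = l then ((if A = B then 1 else 0) - (V B * lowerV V A : ℂ)) • (1 : YSeries d)
        else 0 := by
    intro l B
    by_cases h : k = l
    · subst h
      simp only [y₀, map_sub, map_smul, map_sum, pd_X, Prod.mk.injEq, true_and, if_true]
      rw [Finset.sum_eq_single A (fun D _ hD => by rw [if_neg (Ne.symm hD), smul_zero]) (by simp),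
        if_pos rfl]
      split_ifs <;> module
    · simp [y₀, pd_X, h]
  simp only [h1]
  rw [Finset.sum_eq_single k (fun l _ hl => by simp [Ne.symm hl]) (by simp)]
  simp only [if_true, sub_smul, sub_mul, smul_mul_assoc, one_mul, Finset.sum_sub_distrib, ite_smul,
    one_smul, zero_smul, ite_mul, one_mul, zero_mul, Finset.sum_ite_eq, Finset.mem_univ, if_true]
  congr 1
  rw [Finset.smul_sum]
  exact Finset.sum_congr rfl fun B _ => by rw [map_smul, smul_smul, mul_comm]; rfl

/-- `dPerp` as a linear map. -/
def dPerpL (A : Fin (d + 1)) (i : Fin 2) : YSeries d →ₗ[ℂ] YSeries d :=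
  pd (i, A) - (lowerV V A : ℂ) • ∑ B, (V B : ℂ) • pd (i, B)

theorem dPerpL_apply (A : Fin (d + 1)) (i : Fin 2) (f : YSeries d) :
    dPerpL V A i f = dPerp V A i f := by
  simp only [dPerpL, LinearMap.sub_apply, LinearMap.smul_apply, LinearMap.sum_apply]; rfl

theorem finOrd_dPerpL (A : Fin (d + 1)) (i : Fin 2) : FinOrd (dPerpL V A i) :=
  (finOrd_pd _).sub ((FinOrd.sum _ _ fun _ _ => (finOrd_pd _).smul _).smul _)

/-- `dPerpUp` as a linear map. -/
def dPerpUpL (A : Fin (d + 1)) (i : Fin 2) : YSeries d →ₗ[ℂ] YSeries d :=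
  ∑ j, (eps i j : ℂ) • dPerpL V A j

theorem dPerpUpL_apply (A : Fin (d + 1)) (i : Fin 2) (f : YSeries d) :
    dPerpUpL V A i f = dPerpUp V A i f := by
  simp only [dPerpUpL, LinearMap.smul_apply, LinearMap.sum_apply, dPerpL_apply]; rfl

theorem finOrd_dPerpUpL (A : Fin (d + 1)) (i : Fin 2) : FinOrd (dPerpUpL V A i) :=
  FinOrd.sum _ _ fun _ _ => (finOrd_dPerpL V _ _).smul _

/-- `solW` for a coordinate frame, as a linear map. -/
def solWL (κ : ℝ) (B : Fin (d + 1)) : YSeries d →ₗ[ℂ] ZYSeries d :=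
  (2 * κ : ℂ) • ∑ j, mulL (raise (zl V) j) ∘ₗ hopW ∘ₗ kleinR V ∘ₗ embL ∘ₗ dPerpUpL V B j

theorem finOrd_solWL (κ : ℝ) (B : Fin (d + 1)) : FinOrd (solWL V κ B) :=
  (FinOrd.sum _ _ fun _ _ => (finOrd_mulL _).comp ((finOrd_Hop _).comp ((finOrd_kleinR V).comp
    (finOrd_embL.comp (finOrd_dPerpUpL V _ _))))).smul _

theorem solW_eq_sum (κ : ℝ) (E : Fin (d + 1) → ℝ) (C : YSeries d) :
    solW V κ E C = ∑ B, (E B : ℂ) • solWL V κ B C := by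
  simp only [solW_eq, solWL, LinearMap.smul_apply, LinearMap.sum_apply, LinearMap.comp_apply,
    mulL_apply, embL_apply, dPerpUpL_apply, emb_sum, emb_smul, map_sum, map_smul, Finset.mul_sum,
    Finset.smul_sum, mul_smul_comm]
  rw [Finset.sum_comm]
  exact Finset.sum_congr rfl fun B _ => Finset.sum_congr rfl fun j _ => by module

theorem projY_solW (κ : ℝ) (E : Fin (d + 1) → ℝ) (C : YSeries d) : projY (solW V κ E C) = 0 := by
  rw [solW_eq, ← projL_apply, map_smul, map_sum, Fin.sum_univ_two, raise_zero, raise_one, neg_mul,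
    map_neg, projL_apply, projL_apply, projY_zl_mul, projY_zl_mul, neg_zero, add_zero, smul_zero]

theorem projY_eDot (E : Fin (d + 1) → ℝ) (k : Fin 2) (g : ZYSeries d) :
    projY (eDot E k g) = ∑ B, (E B : ℂ) • pd (k, B) (projY g) := by
  simp only [eDot_apply, ← projL_apply, map_sum, map_smul]
  exact Finset.sum_congr rfl fun B _ => by rw [projL_apply, projL_apply, pd_projY]

variable {V} {U : TopologicalSpace.Opens (Fin d → ℝ)}
  {ω₀ : Fin d → U → Matrix (Fin (d + 1)) (Fin (d + 1)) ℝ}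

theorem smooth_frame (hω : IsAdSConnection V ω₀) (μ : Fin d) (A : Fin (d + 1)) :
    SmoothFun fun x => (frame V ω₀ μ x A : ℂ) := by
  simp only [frame]
  push_cast
  have := (SmoothFun.weighted_sum Finset.univ (c := fun B => (lowerV V B : ℂ))
    (F := fun B x => (ω₀ μ x A B : ℂ)) fun B _ => (hω.smooth μ A B).ofReal).1
  simpa only [mul_comm] using this

theorem smooth_solW (hω : IsAdSConnection V ω₀) {C : U → YSeries d} (hC : SmoothSeries C) (κ : ℝ)
    (μ : Fin d) : SmoothSeries fun x => solW V κ (frame V ω₀ μ x) (C x) := by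
  simp only [solW_eq_sum]
  exact SmoothSeries.sum _ fun B _ => SmoothSeries.smul (smooth_frame hω μ B)
    (hC.map (finOrd_solWL V κ B))

theorem projY_dX {F : U → ZYSeries d} (hF : SmoothSeries F) (μ : Fin d) (x : U) :
    projY (dX μ F x) = dX μ (fun x => projY (F x)) x := by
  have := dX_map finOrd_projL hF μ x
  simp only [projL_apply] at this
  exact this.symm

/-- The W-solution carries an explicit z, so at Z = 0 only the term in which `Qop` differentiates
that z survives. The constant is the product of 2κ, the 1/2 of `Qop_zl_mul` and the 1/2 of the
homotopy weight at degree zero. -/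
theorem projY_covD_solW (hω : IsAdSConnection V ω₀) {C : U → YSeries d} (hC : SmoothSeries C)
    (κ : ℝ) (μ ν : Fin d) (x : U) :
    projY (covD ω₀ μ (fun x => solW V κ (frame V ω₀ ν x) (C x)) x)
      = (κ / 2 : ℂ) • ∑ A, ∑ B, ((frame V ω₀ μ x A * frame V ω₀ ν x B : ℝ) : ℂ) •
          ∑ i, ∑ j, (eps j i : ℂ) • perpArg V (dPerp V A j (dPerp V B i (C x))) := by
  have h0 : projY (dX μ (fun x => solW V κ (frame V ω₀ ν x) (C x)) x) = 0 := by
    rw [projY_dX (smooth_solW hω hC κ ν)]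
    simp only [projY_solW]
    exact dX_const 0 μ x
  have h2 : ∀ k l, projY (eDot (frame V ω₀ μ x) k (eDot (frame V ω₀ ν x) l
      (hopW (kleinR V (emb (C x)))))) = (1 / 2 : ℂ) • ∑ A, ∑ B,
        ((frame V ω₀ μ x A * frame V ω₀ ν x B : ℝ) : ℂ) •
          perpArg V (dPerp V A k (dPerp V B l (C x))) := fun k l => by
    simp only [projY_eDot, projY_hopW, projY_kleinR, map_smul, map_sum, pd_perpArg,
      Finset.smul_sum]
    refine Finset.sum_congr rfl fun A _ => Finset.sum_congr rfl fun B _ => ?_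
    push_cast; module
  rw [covD, ← projL_apply, map_add, projL_apply, h0, zero_add,
    solW_eq_of_orthogonal V κ (frame_orthogonal hω ν x), W0_eq, comm_emb_Wm (hω.antisymm μ x)]
  simp only [map_add, map_smul, map_sum, Rop_zl_mul, Qop_zl_mul]
  simp only [projL_apply, projY_zl_mul, Finset.sum_const_zero, smul_zero, zero_add]
  change (2 * κ : ℂ) • ∑ i, (1 / 2 : ℂ) • ∑ k, (eps k i : ℂ) • projY (eDot (frame V ω₀ μ x) k _) = _
  simp only [h2, Finset.smul_sum]
  rw [Finset.sum_congr rfl fun i _ => Finset.sum_congr rfl fun k _ => Finset.sum_congr rfl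
    fun A _ => rfl]
  simp only [Fin.sum_univ_two, ← Finset.sum_add_distrib]
  refine Finset.sum_congr rfl fun A _ => Finset.sum_congr rfl fun B _ => ?_
  module

/-- The Z-gradient of this curvature is the antisymmetrized second covariant derivative of the
S-solution, which is zero by flatness. The curvature is therefore Z-independent and equals its value
at Z = 0, with the sign coming from ε_{ji} = -ε_{ij}. -/
theorem curl_solW (hω : IsAdSConnection V ω₀) (hV : normV V = 1) {C : U → YSeries d}
    (hC : SmoothSeries C) (htw : ∀ μ x, twistedD V ω₀ C μ x = 0) (κ : ℝ) (μ ν : Fin d) (x : U) :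
    covD ω₀ μ (fun x => solW V κ (frame V ω₀ ν x) (C x)) x
      - covD ω₀ ν (fun x => solW V κ (frame V ω₀ μ x) (C x)) x
      = -emb (weylSource V κ ω₀ C μ ν x) := by
  have hs := fun μ => smooth_solW hω hC κ μ
  have h1 : ∀ p, pd (.inl p) (covD ω₀ μ (fun x => solW V κ (frame V ω₀ ν x) (C x)) x
      - covD ω₀ ν (fun x => solW V κ (frame V ω₀ μ x) (C x)) x) = 0 := fun p => by
    rw [map_sub, pd_inl_covD (hs ν), pd_inl_covD (hs μ)]
    simp only [← covD_solS hω hV hC htw κ p]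
    rw [covD_comm hω (smooth_solS hC κ p), sub_self]
  rw [← emb_projY h1, ← neg_one_smul ℂ (emb _), ← emb_smul]
  congr 1
  rw [← projL_apply, map_sub, projL_apply, projL_apply, projY_covD_solW hω hC,
    projY_covD_solW hω hC, ← smul_sub, weylSource]
  have h2 : ∀ A B, perpArg V (∑ i, dPerpUp V A i (dPerp V B i (C x)))
      = ∑ i, ∑ j, (eps i j : ℂ) • perpArg V (dPerp V A j (dPerp V B i (C x))) := fun A B => by
    simp only [← perpL_apply, map_sum, dPerpUp, map_smul]
  have h3 : ∀ A B, ∑ i, ∑ j, (eps j i : ℂ) • perpArg V (dPerp V A j (dPerp V B i (C x)))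
      = -∑ i, ∑ j, (eps i j : ℂ) • perpArg V (dPerp V A j (dPerp V B i (C x))) := fun A B => by
    simp only [← Finset.sum_neg_distrib]
    exact Finset.sum_congr rfl fun i _ => Finset.sum_congr rfl fun j _ => by
      rw [eps_swap]; push_cast; module
  -- The tensor of second derivatives is replaced by an opaque one, so that only the frame factors
  -- and signs remain to be compared.
  obtain ⟨Y, hY⟩ : ∃ Y : Fin (d + 1) → Fin (d + 1) → YSeries d, ∀ A B,
      ∑ i, ∑ j, (eps i j : ℂ) • perpArg V (dPerp V A j (dPerp V B i (C x))) = Y A B :=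
    ⟨_, fun _ _ => rfl⟩
  simp only [h2, h3, hY, Finset.smul_sum, ← Finset.sum_sub_distrib]
  refine Finset.sum_congr rfl fun A _ => Finset.sum_congr rfl fun B _ => ?_
  push_cast
  module

end HigherSpin

end

/-! ### Covariance under sp(2) and the Poincaré lemma in Z -/

noncomputable section

namespace HigherSpin

open MvPowerSeries

variable {d : ℕ} (V : Fin (d + 1) → ℝ)

/-! ### `sp(2)` covariance -/

theorem sp2Act_zl (i j k : Fin 2) :
    sp2Act i j (zl V k) = (eps j k : ℂ) • zl V i + (eps i k : ℂ) • zl V j := by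
  simp only [zl, sp2Act_sum, sp2Act_smul, sp2Act_zv, Finset.smul_sum, ← Finset.sum_add_distrib]
  exact Finset.sum_congr rfl fun A _ => by module

theorem sp2Act_yl (i j k : Fin 2) :
    sp2Act i j (yl V k) = (eps j k : ℂ) • yl V i + (eps i k : ℂ) • yl V j := by
  simp only [yl, sp2Act_sum, sp2Act_smul, sp2Act_yv, Finset.smul_sum, ← Finset.sum_add_distrib]
  exact Finset.sum_congr rfl fun A _ => by module

theorem sp2Act_zy (i j : Fin 2) : sp2Act i j (zy V) = 0 := by
  rw [zy_eq, sub_eq_add_neg, ← neg_one_smul ℂ, sp2Act_add, sp2Act_smul, sp2Act_mul, sp2Act_mul,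
    sp2Act_zl, sp2Act_zl, sp2Act_yl, sp2Act_yl]
  revert i j
  refine fin_two_cases (fin_two_cases ?_ ?_) (fin_two_cases ?_ ?_) <;>
  simp only [eps_zero_zero, eps_zero_one, eps_one_zero, eps_one_one, add_mul, mul_add,
    smul_mul_assoc, mul_smul_comm] <;> push_cast <;> module

/-- The action is a derivation and 𝒦 is a function of the invariant z_i y^i. -/
theorem sp2Act_klein (i j : Fin 2) : sp2Act i j (klein V) = 0 := by
  have hY : ∀ k A, eY k A (klein V) = eY k A (zy V) * ((-2 : ℂ) • klein V) := fun k A => by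
    simp only [eY_apply, klein, pd_expZY, Finset.sum_mul, mul_smul_comm, smul_mul_assoc]
    rw [Finset.smul_sum]
    exact Finset.sum_congr rfl fun j _ => by module
  have hZ : ∀ k A, eZ k A (klein V) = eZ k A (zy V) * ((-2 : ℂ) • klein V) := fun k A => by
    simp only [eZ_apply, klein, pd_expZY, Finset.sum_mul, mul_smul_comm, smul_mul_assoc]
    rw [Finset.smul_sum]
    exact Finset.sum_congr rfl fun j _ => by module
  have : sp2Act i j (klein V) = sp2Act i j (zy V) * ((-2 : ℂ) • klein V) := by
    simp only [sp2Act, hY, hZ, Finset.sum_mul]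
    exact Finset.sum_congr rfl fun A _ => by ring
  rw [this, sp2Act_zy, zero_mul]

/-- Since t^tot commutes with 𝒦, associativity moves the commutator onto the factor C, where t^tot
acts as t_ij. -/
theorem sp2Act_kleinR (i j : Fin 2) (C : YSeries d) :
    sp2Act i j (kleinR V (emb C)) = kleinR V (emb (commY (tY i j) C)) := by
  have ht := isPoly_tTot (d := d) i j
  have hK := compat_klein V (emb C)
  have h0 : gstar bZY (klein V) (tTot i j) = gstar bZY (tTot i j) (klein V) := by
    have : comm (tTot i j) (klein V) = 0 := by rw [comm_tTot, sp2Act_klein]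
    rw [comm_eq] at this
    exact (sub_eq_zero.1 this).symm
  rw [← sp2Act_emb, ← comm_tTot, ← comm_tTot, comm_eq, comm_eq]
  change gstar bZY _ (gstar bZY _ _) - gstar bZY (gstar bZY _ _) _ = kleinR V (_ - _)
  rw [map_sub, star_assoc_right ht hK, h0, ← star_assoc_left ht hK, ← star_assoc_middle ht hK]
  rfl

theorem pd_inr_sp2Act (i j k : Fin 2) (B : Fin (d + 1)) (g : ZYSeries d) :
    pd (.inr (k, B)) (sp2Act i j g) = sp2Act i j (pd (.inr (k, B)) g)
      + ((if k = i then eY j B g else 0) + if k = j then eY i B g else 0) := by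
  have hY : ∀ l A, pd (.inr (k, B)) (eY l A g) = eY l A (pd (.inr (k, B)) g) := fun l A => by
    simp only [eY_apply, map_sum, map_smul, pd_comm (Sum.inr (k, B))]
  have hZ : ∀ l A, pd (.inr (k, B)) (eZ l A g) = eZ l A (pd (.inr (k, B)) g) := fun l A => by
    simp only [eZ_apply, map_sum, map_smul, pd_comm (Sum.inr (k, B))]
  have h1 : ∀ l A, pd (.inr (k, B)) (yv l A : ZYSeries d)
      = if B = A then (if k = l then 1 else 0) else 0 := fun l A => by
    rw [yv, pd_X]; simp only [Sum.inr.injEq, Prod.mk.injEq]; split_ifs <;> simp_all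
  have h2 : ∀ l A, pd (.inr (k, B)) (zv l A : ZYSeries d) = 0 := fun l A => by simp [zv, pd_X]
  simp only [sp2Act, map_sum, map_add, pd_mul, hY, hZ, h1, h2, zero_mul, zero_add, ite_mul, one_mul,
    Finset.sum_add_distrib, Finset.sum_ite_eq, Finset.mem_univ, if_true]
  abel

theorem pd_inl_sp2Act (i j k : Fin 2) (B : Fin (d + 1)) (g : ZYSeries d) :
    pd (.inl (k, B)) (sp2Act i j g) = sp2Act i j (pd (.inl (k, B)) g)
      + ((if k = i then eZ j B g else 0) + if k = j then eZ i B g else 0) := by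
  have hY : ∀ l A, pd (.inl (k, B)) (eY l A g) = eY l A (pd (.inl (k, B)) g) := fun l A => by
    simp only [eY_apply, map_sum, map_smul, pd_comm (Sum.inl (k, B))]
  have hZ : ∀ l A, pd (.inl (k, B)) (eZ l A g) = eZ l A (pd (.inl (k, B)) g) := fun l A => by
    simp only [eZ_apply, map_sum, map_smul, pd_comm (Sum.inl (k, B))]
  have h1 : ∀ l A, pd (.inl (k, B)) (zv l A : ZYSeries d)
      = if B = A then (if k = l then 1 else 0) else 0 := fun l A => by
    rw [zv, pd_X]; simp only [Sum.inl.injEq, Prod.mk.injEq]; split_ifs <;> simp_all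
  have h2 : ∀ l A, pd (.inl (k, B)) (yv l A : ZYSeries d) = 0 := fun l A => by simp [yv, pd_X]
  simp only [sp2Act, map_sum, map_add, pd_mul, hY, hZ, h1, h2, zero_mul, zero_add, ite_mul, one_mul,
    Finset.sum_add_distrib, Finset.sum_ite_eq, Finset.mem_univ, if_true]
  abel

theorem sp2Act_eDot (i j k : Fin 2) (E : Fin (d + 1) → ℝ) {g : ZYSeries d}
    (hg : sp2Act i j g = 0) : sp2Act i j (eDot E k g)
      = -((if k = i then ∑ l, (eps j l : ℂ) • eDot E l g else 0)
        + if k = j then ∑ l, (eps i l : ℂ) • eDot E l g else 0) := by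
  have h0 : ∀ j, ∑ l, (eps j l : ℂ) • eDot E l g = ∑ B, (E B : ℂ) • eY j B g := fun j => by
    simp only [eDot_apply, eY_apply, Finset.smul_sum]
    rw [Finset.sum_comm]
    exact Finset.sum_congr rfl fun B _ => Finset.sum_congr rfl fun l _ => by module
  have h1 : ∀ B, sp2Act i j (pd (.inr (k, B)) g)
      = -((if k = i then eY j B g else 0) + if k = j then eY i B g else 0) := fun B => by
    have := pd_inr_sp2Act i j k B g
    rw [hg, map_zero] at this
    exact eq_neg_of_add_eq_zero_left this.symm
  rw [h0, h0, eDot_apply, sp2Act_sum]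
  simp only [sp2Act_smul, h1]
  simp only [smul_neg, smul_add, smul_ite, smul_zero, Finset.sum_neg_distrib,
    Finset.sum_add_distrib]
  split_ifs <;> simp only [Finset.sum_const_zero]

/-- H = `hopW` (C * 𝒦) is invariant, z_k is a doublet and ∂/∂Y_k the dual doublet, so the
contraction z_k E·∂_k H is a singlet. -/
theorem sp2Act_solW (κ : ℝ) {E : Fin (d + 1) → ℝ} (hE : ∑ B, E B * lowerV V B = 0)
    {C : YSeries d} (i j : Fin 2) (hC : commY (tY i j) C = 0) :
    sp2Act i j (solW V κ E C) = 0 := by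
  have hH : sp2Act i j (hopW (kleinR V (emb C))) = 0 := by
    rw [hopW, sp2Act_Hop, sp2Act_kleinR, hC, emb_zero, map_zero, map_zero]
  rw [solW_eq_of_orthogonal V κ hE, sp2Act_smul, sp2Act_sum]
  simp only [sp2Act_mul, sp2Act_zl, sp2Act_eDot _ _ _ _ hH, Fin.sum_univ_two]
  generalize eDot E 0 (hopW (kleinR V (emb C))) = a
  generalize eDot E 1 (hopW (kleinR V (emb C))) = b
  revert i j
  refine fin_two_cases (fin_two_cases ?_ ?_) (fin_two_cases ?_ ?_) <;> intro _ _ <;>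
  simp only [eps_zero_zero, eps_zero_one, eps_one_zero, eps_one_one, if_true, if_false,
    zero_ne_one, one_ne_zero, add_mul, mul_add, mul_neg, smul_mul_assoc, mul_smul_comm, mul_zero,
    add_zero, zero_add] <;> push_cast <;> module

/-- The `sp(2)` doublet with lower index made from the components of `S`. -/
def lowS (S : Osc d → ZYSeries d) (A : Fin (d + 1)) (k : Fin 2) : ZYSeries d :=
  ∑ l, (eps l k : ℂ) • lower (fun A' => S (l, A')) A

/-- The doublet condition. -/
def IsDoublet (S : Osc d → ZYSeries d) : Prop := ∀ i j k A, comm (tTot i j) (lowS S A k)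
  = (eps j k : ℂ) • lowS S A i + (eps i k : ℂ) • lowS S A j

theorem lowS_eq (S : Osc d → ZYSeries d) (A : Fin (d + 1)) (k : Fin 2) :
    lowS S A k = ∑ l, (eps l k * sg A : ℂ) • S (l, A) := by
  simp only [lowS, lower_eq, smul_smul]

theorem IsDoublet.add {S S' : Osc d → ZYSeries d} (h : IsDoublet S) (h' : IsDoublet S') :
    IsDoublet (fun p => S p + S' p) := fun i j k A => by
  have e : ∀ k, lowS (fun p => S p + S' p) A k = lowS S A k + lowS S' A k := fun k => by
    simp only [lowS_eq, smul_add, Finset.sum_add_distrib]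
  rw [e, e, e, comm_add_right (isPoly_tTot i j), h, h']; module

theorem IsDoublet.sub {S S' : Osc d → ZYSeries d} (h : IsDoublet S) (h' : IsDoublet S') :
    IsDoublet (fun p => S p - S' p) := fun i j k A => by
  have e : ∀ k, lowS (fun p => S p - S' p) A k = lowS S A k - lowS S' A k := fun k => by
    simp only [lowS_eq, smul_sub, Finset.sum_sub_distrib]
  rw [e, e, e, comm_sub_right (isPoly_tTot i j), h, h']; module

theorem isDoublet_solS (κ : ℝ) {C : YSeries d} (hC : ∀ i j, commY (tY i j) C = 0) :
    IsDoublet (solS V κ C) := fun i j k A => by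
  have e : ∀ k, lowS (solS V κ C) A k
      = (4 * κ * lowerV V A * sg A : ℂ) • (zl V k * hopS (kleinR V (emb C))) := fun k => by
    rw [lowS_eq, Fin.sum_univ_two, solS_eq, solS_eq, raise_zero, raise_one]
    revert k
    refine fin_two_cases ?_ ?_ <;> simp only [eps_zero_zero, eps_zero_one, eps_one_zero,
      eps_one_one, neg_mul] <;> push_cast <;> module
  have hH : sp2Act i j (hopS (kleinR V (emb C))) = 0 := by
    rw [hopS, sp2Act_Hop, sp2Act_kleinR, hC, emb_zero, map_zero, map_zero]
  rw [e, e, e, comm_tTot, sp2Act_smul, sp2Act_mul, hH, mul_zero, add_zero, sp2Act_zl, add_mul,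
    smul_mul_assoc, smul_mul_assoc]
  module

theorem lowS_pd (g : ZYSeries d) (A : Fin (d + 1)) (k : Fin 2) :
    lowS (fun p => pd (.inl p) g) A k = (-sg A : ℂ) • eZ k A g := by
  rw [lowS_eq, eZ_apply, Finset.smul_sum]
  exact Finset.sum_congr rfl fun l _ => by rw [eps_swap]; push_cast; module

/-- The Z-gradient with lowered index is itself a doublet of operators, so acting after
differentiating differs from differentiating after acting by exactly the doublet rotation. -/
theorem comm_tTot_lowS_pd (g : ZYSeries d) (i j k : Fin 2) (A : Fin (d + 1)) :
    comm (tTot i j) (lowS (fun p => pd (.inl p) g) A k)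
      = lowS (fun p => pd (.inl p) (sp2Act i j g)) A k
        + ((eps j k : ℂ) • lowS (fun p => pd (.inl p) g) A i
        + (eps i k : ℂ) • lowS (fun p => pd (.inl p) g) A j) := by
  simp only [lowS_pd]
  rw [comm_tTot, sp2Act_smul, eZ_apply, eZ_apply, sp2Act_sum]
  simp only [sp2Act_smul, pd_inl_sp2Act, smul_add, Finset.sum_add_distrib, smul_ite, smul_zero,
    Finset.sum_ite_eq', Finset.mem_univ, if_true, eps_swap k i, eps_swap k j]
  push_cast
  module

theorem isDoublet_pd {g : ZYSeries d} (hg : ∀ i j, sp2Act i j g = 0) :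
    IsDoublet fun p => pd (.inl p) g := fun i j k A => by
  have h : lowS (fun p => pd (.inl p) (sp2Act i j g)) A k = 0 := by
    simp only [lowS_eq, hg, map_zero, smul_zero, Finset.sum_const_zero]
  rw [comm_tTot_lowS_pd, h, zero_add]

theorem isDoublet_S0 : IsDoublet (S0 : Osc d → ZYSeries d) := fun i j k A => by
  have e : ∀ k, lowS S0 A k = (zv k A : ZYSeries d) := fun k => by
    have h := sg_sq_complex A
    rw [lowS_eq, Fin.sum_univ_two, S0_zero, S0_one]
    revert k
    refine fin_two_cases ?_ ?_ <;> simp only [eps_zero_zero, eps_zero_one, eps_one_zero,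
      eps_one_one] <;> push_cast <;> match_scalars <;>
      first | linear_combination h | ring1
  rw [e, e, e, comm_tTot, sp2Act_zv]

/-! ### The homotopy operator in `Z` -/

theorem eq_zero_of_pd_inl {g : ZYSeries d} (h : ∀ p, pd (.inl p) g = 0)
    (h0 : Hop (fun n => (0 : ℂ) ^ n) g = 0) : g = 0 := by
  rw [← emb_projY h, emb_projY_eq_zscale, zscale_eq, h0]

/-- The primitive of a closed `S`. -/
def homotopy (S : Osc d → ZYSeries d) : ZYSeries d :=
  -- At n = 0 the quotient is 0 by convention; the argument has no part of degree zero in Z, so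
  -- nothing is lost and the primitive vanishes at Z = 0.
  Hop (fun n => 1 / (n : ℂ)) (∑ p, X (.inl p) * S p)

/-- For closed S, the q-derivative of the radial contraction Z^p S_p is (N+1) S_q by Euler's
identity, and the shifted weight 1/(n+1) cancels this factor. -/
theorem pd_homotopy {S : Osc d → ZYSeries d}
    (hS : ∀ p q, pd (.inl p) (S q) = pd (.inl q) (S p)) (q : Osc d) :
    pd (.inl q) (homotopy S) = S q := by
  have h1 : pd (.inl q) (∑ p, X (.inl p) * S p) = Hop (fun n => ((n + 1 : ℕ) : ℂ)) (S q) := by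
    push_cast
    rw [Hop_add_fun, Hop_const, one_smul, ← euler_inl, map_sum]
    simp only [pd_mul, pd_X, hS q, Finset.sum_add_distrib, Sum.inl.injEq, ite_mul, one_mul,
      zero_mul, Finset.sum_ite_eq, Finset.mem_univ, if_true]
    rw [add_comm]
  rw [homotopy, pd_inl_Hop, h1, Hop_Hop]
  have : (fun n : ℕ => 1 / ((n + 1 : ℕ) : ℂ) * ((n + 1 : ℕ) : ℂ)) = fun _ => 1 := by
    funext n
    have : ((n + 1 : ℕ) : ℂ) ≠ 0 := Nat.cast_ne_zero.2 n.succ_ne_zero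
    field_simp
  rw [this, Hop_const, one_smul]

theorem Hop_zero_pow_homotopy (S : Osc d → ZYSeries d) :
    Hop (fun n => (0 : ℂ) ^ n) (homotopy S) = 0 := by
  rw [homotopy, Hop_Hop]
  have : (fun n : ℕ => (0 : ℂ) ^ n * (1 / (n : ℂ))) = fun _ => 0 := by
    funext n
    rcases n with _ | n <;> simp
  rw [this, Hop_const, zero_smul]

/-- Since the gradient S is a doublet, the image of the primitive under sp(2) has zero gradient. It
also vanishes at Z = 0, as the primitive does and sp(2) preserves the degree in Z. Hence it is zero.
-/
theorem sp2Act_homotopy {S : Osc d → ZYSeries d}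
    (hS : ∀ p q, pd (.inl p) (S q) = pd (.inl q) (S p)) (hd : IsDoublet S) (i j : Fin 2) :
    sp2Act i j (homotopy S) = 0 := by
  have hS' : (fun p => pd (.inl p) (homotopy S)) = S := funext fun p => pd_homotopy hS p
  refine eq_zero_of_pd_inl ?_ (by rw [← sp2Act_Hop, Hop_zero_pow_homotopy, ← comm_tTot,
    comm_zero_right])
  have h : ∀ A k, lowS (fun p => pd (.inl p) (sp2Act i j (homotopy S))) A k = 0 := fun A k => by
    have := comm_tTot_lowS_pd (homotopy S) i j k A
    rw [hS', hd i j k A] at this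
    exact right_eq_add.1 this
  rintro ⟨l, A⟩
  have hs : (sg A : ℂ) ≠ 0 := left_ne_zero_of_mul_eq_one (sg_sq_complex A)
  have h' : ∀ k, eZ k A (sp2Act i j (homotopy S)) = 0 := fun k => by
    have := h A k
    rw [lowS_pd] at this
    exact (smul_eq_zero.1 this).resolve_left (neg_ne_zero.2 hs)
  revert l
  refine fin_two_cases ?_ ?_
  · have := h' 1
    rwa [eZ_one, neg_eq_zero] at this
  · have := h' 0
    rwa [eZ_zero] at this

end HigherSpin

end

/-! ### The vacuum solution and the general solution of the linearized system -/

noncomputable section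

namespace HigherSpin

open MvPowerSeries

variable {d : ℕ} {V : Fin (d + 1) → ℝ} {U : TopologicalSpace.Opens (Fin d → ℝ)}
  {ω₀ : Fin d → U → Matrix (Fin (d + 1)) (Fin (d + 1)) ℝ}

/-! ### The linearized system -/

theorem smooth_emb {C : U → YSeries d} (hC : SmoothSeries C) :
    SmoothSeries fun x => emb (C x) := by
  simpa only [embL_apply] using hC.map finOrd_embL

theorem dX_emb {C : U → YSeries d} (hC : SmoothSeries C) (μ : Fin d) (x : U) :
    dX μ (fun x => emb (C x)) x = emb (dX μ C x) := by
  simpa only [embL_apply] using dX_map finOrd_embL hC μ x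

theorem smooth_of_emb {C : U → YSeries d} (hC : SmoothSeries fun x => emb (C x)) :
    SmoothSeries C := by
  have := hC.map finOrd_projL
  simpa only [projL_apply, projY_emb] using this

theorem smooth_pd_inl {F : U → ZYSeries d} (hF : SmoothSeries F) (p : Osc d) :
    SmoothSeries fun x => pd (.inl p) (F x) := hF.map (finOrd_pd _)

theorem covD_add {F G : U → ZYSeries d} (hF : SmoothSeries F) (hG : SmoothSeries G) (μ : Fin d)
    (x : U) : covD ω₀ μ (fun x => F x + G x) x = covD ω₀ μ F x + covD ω₀ μ G x := by
  rw [covD, covD, covD, dX_add hF hG, comm_add_right (isPoly_emb_W0 μ x)]; abel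

theorem emb_commY (f g : YSeries d) : emb (commY f g) = comm (emb f) (emb g) := by
  rw [commY_eq, comm_eq, emb_gcomm]

theorem emb_linCurv {ω : Fin d → U → YSeries d} (hω : ∀ μ, SmoothSeries (ω μ)) (μ ν : Fin d)
    (x : U) : emb (linCurv ω₀ ω μ ν x) = covD ω₀ μ (fun x => emb (ω ν x)) x
      - covD ω₀ ν (fun x => emb (ω μ x)) x := by
  rw [linCurv, emb_add, emb_add, emb_sub, emb_commY, emb_commY, covD, covD, dX_emb (hω ν),
    dX_emb (hω μ), comm_swap (emb (ω μ x))]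
  abel

theorem emb_twistedD {C : U → YSeries d} (hC : SmoothSeries C) (μ : Fin d) (x : U) :
    emb (twistedD V ω₀ C μ x) = dX μ (fun x => emb (C x)) x
      + starZY (emb (W0 ω₀ μ x)) (emb (C x)) - starZY (emb (C x)) (tilde V (emb (W0 ω₀ μ x))) := by
  rw [twistedD, emb_sub, emb_add, starY_eq, starY_eq, emb_gstar, emb_gstar, starZY_eq, starZY_eq,
    tilde_emb, dX_emb hC]

theorem comm_tTot_emb (i j : Fin 2) (f : YSeries d) :
    comm (tTot i j) (emb f) = emb (commY (tY i j) f) := by rw [comm_tTot, sp2Act_emb]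

theorem starZY_S0_sub (hV : normV V = 1) (p : Osc d) (g : ZYSeries d) :
    starZY (S0 p) g - starZY g (tildeS V S0 p) = pd (.inl p) g := by
  rw [tildeS_S0 V hV, ← comm_S0]; rfl

/-- The pure gauge term drops out because covariant derivatives commute, ω contributes its
linearized curvature and the particular solution contributes minus the source. -/
theorem curv_form (hω : IsAdSConnection V ω₀) (hV : normV V = 1) {κ : ℝ} {C : U → YSeries d}
    {ε : U → ZYSeries d} {ω : Fin d → U → YSeries d} (hC : SmoothSeries C)
    (htw : ∀ μ x, twistedD V ω₀ C μ x = 0) (hε : SmoothSeries ε) (hs : ∀ μ, SmoothSeries (ω μ))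
    (μ ν : Fin d) (x : U) :
    covD ω₀ μ (fun x => covD ω₀ ν ε x + (emb (ω ν x) + solW V κ (frame V ω₀ ν x) (C x))) x
      - covD ω₀ ν (fun x => covD ω₀ μ ε x + (emb (ω μ x) + solW V κ (frame V ω₀ μ x) (C x))) x
      = emb (linCurv ω₀ ω μ ν x - weylSource V κ ω₀ C μ ν x) := by
  have h1 := fun μ => smooth_covD hω.smooth hε μ
  have h2 := fun μ => smooth_emb (hs μ)
  have h3 := fun μ => smooth_solW hω hC κ μ
  rw [covD_add (h1 ν) ((h2 ν).add (h3 ν)), covD_add (h1 μ) ((h2 μ).add (h3 μ)),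
    covD_add (h2 ν) (h3 ν), covD_add (h2 μ) (h3 μ), emb_sub, emb_linCurv hs,
    ← neg_eq_iff_eq_neg.2 (curl_solW hω hV hC htw κ μ ν x)]
  have h4 : covD ω₀ μ (fun x => covD ω₀ ν ε x) x = covD ω₀ ν (fun x => covD ω₀ μ ε x) x :=
    covD_comm hω hε μ ν x
  rw [h4]
  abel

/-- With B₁ and S₁ in the stated form, the W–S equation fixes the Z-gradient of W₁. Its solutions
are the particular one plus an arbitrary Z-independent ω, the W–W equation then becomes the
curvature equation for ω, and the W–B equation is the twisted equation for C. -/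
theorem isLinearizedSolution_iff (hω : IsAdSConnection V ω₀) (hV : normV V = 1) {κ : ℝ}
    {W₁ : Fin d → U → ZYSeries d} {S₁ : Osc d → U → ZYSeries d} {B₁ : U → ZYSeries d}
    {C : U → YSeries d} {ε : U → ZYSeries d} (hε : SmoothSeries ε)
    (hε2 : ∀ i j x, comm (tTot i j) (ε x) = 0) (hB : ∀ x, B₁ x = emb (C x))
    (hS : ∀ p x, S₁ p x = pd (.inl p) (ε x) + solS V κ (C x) p) :
    IsLinearizedSolution V κ ω₀ W₁ S₁ B₁ ↔ ∃ ω : Fin d → U → YSeries d,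
      IsFreeSolution V κ ω₀ ω C ∧
        ∀ μ x, W₁ μ x = covD ω₀ μ ε x + (emb (ω μ x) + solW V κ (frame V ω₀ μ x) (C x)) := by
  obtain rfl : B₁ = fun x => emb (C x) := funext hB
  obtain rfl : S₁ = fun p x => pd (.inl p) (ε x) + solS V κ (C x) p :=
    funext fun p => funext fun x => hS p x
  clear hB hS
  have hWW : ∀ (W₁ : Fin d → U → ZYSeries d) μ ν x, dX μ (W₁ ν) x - dX ν (W₁ μ) x
      + comm (emb (W0 ω₀ μ x)) (W₁ ν x) + comm (W₁ μ x) (emb (W0 ω₀ ν x))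
      = covD ω₀ μ (W₁ ν) x - covD ω₀ ν (W₁ μ) x := fun W₁ μ ν x => by
    rw [covD, covD, comm_swap (W₁ μ x)]; abel
  have hWS : ∀ (W₁ : Fin d → U → ZYSeries d) (S : U → ZYSeries d) μ p x,
      dX μ S x + comm (emb (W0 ω₀ μ x)) (S x) + comm (W₁ μ x) (S0 p)
      = covD ω₀ μ S x - pd (.inl p) (W₁ μ x) := fun W₁ S μ p x => by
    rw [covD, comm_swap (W₁ μ x), comm_S0]; abel
  have hcovS : SmoothSeries C → (∀ μ x, twistedD V ω₀ C μ x = 0) → ∀ μ p x,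
      covD ω₀ μ (fun x => pd (.inl p) (ε x) + solS V κ (C x) p) x
      = pd (.inl p) (covD ω₀ μ ε x + solW V κ (frame V ω₀ μ x) (C x)) := fun hC htw μ p x => by
    rw [covD_add (smooth_pd_inl hε p) (smooth_solS hC κ p), covD_solS hω hV hC htw, map_add,
      pd_inl_covD hε]
  constructor
  · intro h
    have hC : SmoothSeries C := smooth_of_emb h.smoothB
    have hC2 : ∀ i j x, commY (tY i j) (C x) = 0 := fun i j x => by
      apply emb_injective
      rw [← comm_tTot_emb, h.sp2.onB, emb_zero]
    have htw : ∀ μ x, twistedD V ω₀ C μ x = 0 := fun μ x => by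
      apply emb_injective
      rw [emb_twistedD hC, h.eqWB, emb_zero]
    -- What is left of W₁ after removing the gauge term and the particular solution has zero
    -- Z-gradient; its restriction to Z = 0 will be ω.
    have hd : ∀ μ x p, pd (.inl p)
        (W₁ μ x - covD ω₀ μ ε x - solW V κ (frame V ω₀ μ x) (C x)) = 0 := fun μ x p => by
      have := h.eqWS μ p x
      rw [hWS W₁ (fun x => pd (.inl p) (ε x) + solS V κ (C x) p), hcovS hC htw, sub_eq_zero] at this
      rw [map_sub, map_sub, ← this, map_add]; abel
    set ω : Fin d → U → YSeries d := fun μ x =>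
      projY (W₁ μ x - covD ω₀ μ ε x - solW V κ (frame V ω₀ μ x) (C x)) with hωdef
    have hω1 : ∀ μ x, emb (ω μ x)
        = W₁ μ x - covD ω₀ μ ε x - solW V κ (frame V ω₀ μ x) (C x) := fun μ x =>
      emb_projY (hd μ x)
    have hW : ∀ μ x, W₁ μ x = covD ω₀ μ ε x + (emb (ω μ x) + solW V κ (frame V ω₀ μ x) (C x)) :=
      fun μ x => by rw [hω1]; abel
    have hsω : ∀ μ, SmoothSeries (ω μ) := fun μ => by
      apply smooth_of_emb
      simp only [hω1]
      exact ((h.smoothW μ).sub (smooth_covD hω.smooth hε μ)).sub (smooth_solW hω hC κ μ)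
    refine ⟨ω, ⟨hsω, hC, fun i j μ x => ?_, hC2, htw, fun μ ν x => ?_⟩, hW⟩
    · apply emb_injective
      -- The covariant derivative commutes with sp(2), so the gauge term is invariant because ε is.
      have h0 : covD ω₀ μ (fun x => comm (tTot i j) (ε x)) x = 0 := by
        simp only [hε2, covD]
        rw [comm_zero_right, add_zero]
        exact dX_const 0 μ x
      rw [← comm_tTot_emb, hω1, comm_sub_right (isPoly_tTot i j), comm_sub_right (isPoly_tTot i j),
        h.sp2.onW, comm_tTot_covD hε, h0, comm_tTot i j (solW _ _ _ _),
        sp2Act_solW V κ (frame_orthogonal hω μ x) i j (hC2 i j x), emb_zero, sub_zero, sub_zero]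
    · have h1 := h.eqWW μ ν x
      have h2 := fun μ => funext fun x => hW μ x
      rw [hWW, h2, h2, curv_form hω hV hC htw hε hsω] at h1
      exact sub_eq_zero.1 (emb_injective (h1.trans emb_zero.symm))
  · rintro ⟨ω, hf, hW⟩
    obtain rfl : W₁ = fun μ x => covD ω₀ μ ε x
        + (emb (ω μ x) + solW V κ (frame V ω₀ μ x) (C x)) := funext fun μ => funext fun x => hW μ x
    have hC := hf.smoothC
    have hεs : ∀ i j x, sp2Act i j (ε x) = 0 := fun i j x => by rw [← comm_tTot, hε2]
    refine ⟨fun μ => ?_, fun p => ?_, ?_, ⟨fun i j μ x => ?_, fun i j x => ?_, ?_⟩, fun μ ν x => ?_,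
      fun μ x => ?_, fun μ p x => ?_, fun p x => ?_, fun i A j A' x => ?_⟩
    · exact (smooth_covD hω.smooth hε μ).add ((smooth_emb (hf.smoothω μ)).add
        (smooth_solW hω hC κ μ))
    · exact (smooth_pd_inl hε p).add (smooth_solS hC κ p)
    · exact smooth_emb hC
    · have h0 : covD ω₀ μ (fun x => comm (tTot i j) (ε x)) x = 0 := by
        simp only [hε2, covD]
        rw [comm_zero_right, add_zero]
        exact dX_const 0 μ x
      rw [comm_add_right (isPoly_tTot i j), comm_add_right (isPoly_tTot i j), comm_tTot_covD hε, h0,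
        comm_tTot_emb, hf.sp2ω, comm_tTot,
        sp2Act_solW V κ (frame_orthogonal hω μ x) i j (hf.sp2C i j x), emb_zero, add_zero, add_zero]
    · rw [comm_tTot_emb, hf.sp2C, emb_zero]
    · intro i j k A x
      exact (isDoublet_pd fun i j => hεs i j x).add
        (isDoublet_solS V κ fun i j => hf.sp2C i j x) i j k A
    · refine (hWW (fun μ x => covD ω₀ μ ε x
        + (emb (ω μ x) + solW V κ (frame V ω₀ μ x) (C x))) μ ν x).trans ?_
      rw [curv_form hω hV hC hf.twisted hε hf.smoothω, hf.curvature, sub_self, emb_zero]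
    · rw [← emb_twistedD hC, hf.twisted, emb_zero]
    · refine (hWS (fun μ x => covD ω₀ μ ε x + (emb (ω μ x) + solW V κ (frame V ω₀ μ x) (C x)))
        (fun x => pd (.inl p) (ε x) + solS V κ (C x) p) μ p x).trans ?_
      rw [hcovS hC hf.twisted]
      simp only [map_add, pd_inl_emb]
      abel
    · rw [starZY_S0_sub hV, pd_inl_emb]
    · rw [comm_S0, comm_swap _ (S0 _), comm_S0, starZY_eq, ← kleinR_apply, ← solS_curl, map_add,
        map_add, pd_comm (Sum.inl (j, A'))]
      abel

/-- The S–B equation makes B₁ independent of Z. Subtracting the particular solution from S₁ leaves a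
Z-closed doublet, whose homotopy primitive is the invariant gauge parameter ε. -/
theorem isLinearizedSolution_iff_exists (hω : IsAdSConnection V ω₀) (hV : normV V = 1) (κ : ℝ)
    (W₁ : Fin d → U → ZYSeries d) (S₁ : Osc d → U → ZYSeries d) (B₁ : U → ZYSeries d) :
    IsLinearizedSolution V κ ω₀ W₁ S₁ B₁ ↔
      ∃ (ω : Fin d → U → YSeries d) (C : U → YSeries d) (ε : U → ZYSeries d),
        IsFreeSolution V κ ω₀ ω C ∧ SmoothSeries ε ∧ (∀ i j x, comm (tTot i j) (ε x) = 0) ∧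
        (∀ x, B₁ x = emb (C x)) ∧
        (∀ p x, S₁ p x = pderiv (R := ℂ) (Sum.inl p) (ε x) + solS V κ (C x) p) ∧
        (∀ μ x, W₁ μ x = dX μ ε x + comm (emb (W0 ω₀ μ x)) (ε x)
          + (emb (ω μ x) + solW V κ (frame V ω₀ μ x) (C x))) := by
  constructor
  · intro h
    have hBz : ∀ x p, pd (.inl p) (B₁ x) = 0 := fun x p => by rw [← starZY_S0_sub hV, h.eqSB]
    set C : U → YSeries d := fun x => projY (B₁ x)
    have hB : ∀ x, B₁ x = emb (C x) := fun x => (emb_projY (hBz x)).symm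
    have hC : SmoothSeries C := h.smoothB.map finOrd_projL
    have hC2 : ∀ x i j, commY (tY i j) (C x) = 0 := fun x i j => by
      apply emb_injective
      rw [← comm_tTot_emb, ← hB, h.sp2.onB, emb_zero]
    -- S₁ and the particular solution have the same Z-curl, since both are sourced by the same B₁ *
    -- 𝒦.
    have hcl : ∀ x p q, pd (.inl p) (S₁ q x - solS V κ (C x) q)
        = pd (.inl q) (S₁ p x - solS V κ (C x) p) := fun x p q => by
      have h1 := h.eqSS p.1 p.2 q.1 q.2 x
      rw [comm_S0, comm_swap _ (S0 _), comm_S0, starZY_eq, hB, ← kleinR_apply, ← solS_curl] at h1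
      rw [map_sub, map_sub]
      linear_combination (exp := 1) h1
    have hdb : ∀ x, IsDoublet fun p => S₁ p x - solS V κ (C x) p := fun x =>
      IsDoublet.sub (S := fun p => S₁ p x) (fun i j k A => h.sp2.onS i j k A x)
        (isDoublet_solS V κ (hC2 x))
    set ε : U → ZYSeries d := fun x => homotopy fun p => S₁ p x - solS V κ (C x) p
    have hε : SmoothSeries ε := by
      refine SmoothSeries.map (finOrd_Hop _) (SmoothSeries.sum _ fun p _ => ?_)
      exact SmoothSeries.mul (SmoothSeries.const _) ((h.smoothS p).sub (smooth_solS hC κ p))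
    have hε2 : ∀ i j x, comm (tTot i j) (ε x) = 0 := fun i j x => by
      rw [comm_tTot]; exact sp2Act_homotopy (hcl x) (hdb x) i j
    have hS : ∀ p x, S₁ p x = pd (.inl p) (ε x) + solS V κ (C x) p := fun p x => by
      rw [pd_homotopy (hcl x)]; abel
    obtain ⟨ω, hf, hW⟩ := (isLinearizedSolution_iff hω hV hε hε2 hB hS).1 h
    exact ⟨ω, C, ε, hf, hε, hε2, hB, hS, hW⟩
  · rintro ⟨ω, C, ε, hf, hε, hε2, hB, hS, hW⟩
    exact (isLinearizedSolution_iff hω hV hε hε2 hB hS).2 ⟨ω, hf, hW⟩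

theorem isLinearizedSolution_gauge_iff (hω : IsAdSConnection V ω₀) (hV : normV V = 1) (κ : ℝ)
    (W₁ : Fin d → U → ZYSeries d) (C : U → YSeries d) :
    IsLinearizedSolution V κ ω₀ W₁ (fun p x => solS V κ (C x) p) (fun x => emb (C x)) ↔
      ∃ ω : Fin d → U → YSeries d, IsFreeSolution V κ ω₀ ω C ∧
        ∀ μ x, W₁ μ x = emb (ω μ x) + solW V κ (frame V ω₀ μ x) (C x) := by
  have h := isLinearizedSolution_iff (W₁ := W₁) (C := C) (ε := fun _ => 0) (κ := κ) hω hV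
    (SmoothSeries.const 0) (fun i j _ => comm_zero_right _) (fun _ => rfl) (fun p x => by
      rw [map_zero, zero_add])
  have h0 : ∀ μ x, covD ω₀ μ (fun _ : U => (0 : ZYSeries d)) x = 0 := fun μ x => by
    rw [covD, comm_zero_right, add_zero]; exact dX_const 0 μ x
  simpa only [h0, zero_add] using h

/-- Flatness of the connection gives the W–W equation, and the commutators with S₀ are
Z-derivatives: zero on W₀, constants on S₀. The constants reproduce the ε–η term of the S–S
equation. -/
theorem isSolution_vacuum (hω : IsAdSConnection V ω₀) (hV : normV V = 1) (κ : ℝ) :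
    IsSolution V κ (fun μ x => emb (W0 ω₀ μ x)) (fun p (_ : U) => S0 p) (fun _ => 0) where
  smoothW := smooth_emb_W0 hω.smooth
  smoothS p := SmoothSeries.const _
  smoothB := SmoothSeries.const _
  sp2 := ⟨fun i j μ x => by rw [comm_tTot, W0_eq, sp2Act_emb_Wm], fun i j _ => comm_zero_right _,
    fun i j k A _ => isDoublet_S0 i j k A⟩
  eqWW := vacuum_flat hω
  eqWB μ x := by
    rw [starZY_eq, starZY_eq, star_zero_right, star_zero_left, sub_zero, add_zero]
    exact dX_const 0 μ x
  eqWS μ p x := by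
    rw [comm_swap, comm_S0, pd_inl_emb, neg_zero, add_zero]
    exact dX_const _ μ x
  eqSB p x := by
    rw [starZY_S0_sub hV, map_zero]
  eqSS i A j A' x := by
    have h := sg_sq_complex A
    rw [comm_S0, starZY_eq, star_zero_left, smul_zero, add_zero, eta_eq]
    revert i j
    refine fin_two_cases (fin_two_cases ?_ ?_) (fin_two_cases ?_ ?_) <;>
    simp only [S0_zero, S0_one, zv, map_smul, pd_X, eps_zero_zero, eps_zero_one, eps_one_zero,
      eps_one_one, Sum.inl.injEq, Prod.mk.injEq, zero_ne_one, one_ne_zero, false_and, true_and,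
      if_false, Complex.ofReal_zero, zero_smul, neg_zero, smul_zero] <;>
    by_cases hA : A = A' <;> simp only [hA, if_true, if_false] <;> push_cast <;> module

end HigherSpin

end

/-! ### The regular class and homogeneous components -/

noncomputable section

namespace HigherSpin

open MvPowerSeries

variable {d : ℕ} (V : Fin (d + 1) → ℝ)

/-! ### Star products with polynomials and with the Klein operator -/

theorem starDefined_poly (f g : ZYSeries d) (hf : IsPoly f) : StarDefined f g ∧ StarDefined g f :=
  ⟨starDefined_of_compat (Or.inr hf.leftGood), starDefined_of_compat (Or.inl hf.rightGood)⟩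

theorem starDefined_klein (f : ZYSeries d) : StarDefined f (klein V) :=
  starDefined_of_compat (compat_klein V f)

/-! ### The regular class -/

variable {V}

theorem IsRegular.poly_mul {F P : ZYSeries d} (hP : IsPoly P) (hF : IsRegular V F) :
    IsRegular V (P * F) := by
  unfold IsRegular at hF ⊢
  induction hF using Submodule.span_induction with
  | mem G hG =>
    obtain ⟨Q, n, M, ρ, φ, hQ, hM, hρ, rfl⟩ := hG
    exact Submodule.subset_span ⟨P * Q, n, M, ρ, φ, hP.mul hQ, hM, hρ, (mul_assoc _ _ _).symm⟩
  | zero => rw [mul_zero]; exact Submodule.zero_mem _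
  | add G H _ _ hG hH => rw [mul_add]; exact Submodule.add_mem _ hG hH
  | smul c G _ hG => rw [mul_smul_comm]; exact Submodule.smul_mem _ _ hG

theorem IsRegular.add {F G : ZYSeries d} (hF : IsRegular V F) (hG : IsRegular V G) :
    IsRegular V (F + G) := Submodule.add_mem _ hF hG

theorem IsRegular.smul {F : ZYSeries d} (c : ℂ) (hF : IsRegular V F) : IsRegular V (c • F) :=
  Submodule.smul_mem _ _ hF

theorem IsRegular.sum {ι : Type*} (s : Finset ι) (F : ι → ZYSeries d)
    (hF : ∀ i ∈ s, IsRegular V (F i)) : IsRegular V (∑ i ∈ s, F i) := Submodule.sum_mem _ hF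

theorem setIntegral_fin_one (g : ℝ → ℂ) :
    ∫ τ in (Set.Icc 0 1 : Set (Fin 1 → ℝ)), g (τ 0) = ∫ t in (0 : ℝ)..1, g t := by
  rw [intervalIntegral.integral_of_le zero_le_one, ← MeasureTheory.integral_Icc_eq_integral_Ioc,
    ← (MeasureTheory.volume_preserving_funUnique (Fin 1) ℝ).setIntegral_preimage_emb
      (MeasurableEquiv.measurableEmbedding _)]
  congr 2
  ext τ
  simp [Set.mem_Icc, Pi.le_def]

/-- The one-parameter case of the defining class, with M the unit interval and φ linear. -/
theorem isRegular_of_integral {ρ : ℝ → ℂ} (hρ : Continuous ρ) (a : ℂ) {G : ZYSeries d}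
    (hG : ∀ m, coeff m G = ∫ t in (0 : ℝ)..1, ρ t * coeff m (expZY V (a * t))) :
    IsRegular V G := by
  refine Submodule.subset_span ⟨1, 1, Set.Icc 0 1, fun τ => ρ (τ 0),
    MvPolynomial.C a * MvPolynomial.X 0, isPoly_one, isCompact_Icc, ?_, ?_⟩
  · exact (hρ.comp (continuous_apply 0)).continuousOn.integrableOn_compact isCompact_Icc
  · rw [one_mul]
    ext m
    rw [hG, ← setIntegral_fin_one fun t => ρ t * coeff m (expZY V (a * t))]
    change _ = ∫ τ in (Set.Icc 0 1 : Set (Fin 1 → ℝ)), ρ (τ 0) * coeff m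
      (expZY V (MvPolynomial.eval (fun k => (τ k : ℂ)) (MvPolynomial.C a * MvPolynomial.X 0)))
    simp only [map_mul, MvPolynomial.eval_C, MvPolynomial.eval_X]

theorem isRegular_one : IsRegular V (1 : ZYSeries d) :=
  isRegular_of_integral (ρ := fun _ => 1) continuous_const 0 fun m => by
    simp [expZY_zero]

theorem isRegular_of_isPoly {P : ZYSeries d} (hP : IsPoly P) : IsRegular V P := by
  have := isRegular_one.poly_mul (V := V) hP
  rwa [mul_one] at this

/-- Pulling a factor Z out of the degree operator multiplies the integration weight by t, so the
induction over P runs over all continuous weights at once. The case P = 1 is the integral of exp(-2t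
z_i y^i). -/
theorem isRegular_Hop {P : ZYSeries d} (hP : IsPoly P) {ρ : ℝ → ℂ} (hρ : Continuous ρ) {φ : ℕ → ℂ}
    (hφ : ∀ n : ℕ, ∫ t in (0 : ℝ)..1, ρ t * (t : ℂ) ^ n = φ n) :
    IsRegular V (Hop φ (P * klein V)) := by
  refine hP.induction (P := fun P => ∀ (ρ : ℝ → ℂ) (φ : ℕ → ℂ), Continuous ρ →
    (∀ n : ℕ, ∫ t in (0 : ℝ)..1, ρ t * (t : ℂ) ^ n = φ n) → IsRegular V (Hop φ (P * klein V)))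
    ?_ ?_ ?_ ?_ ρ φ hρ hφ
  · intro ρ φ hρ hφ
    refine isRegular_of_integral hρ (-2) fun m => ?_
    rw [one_mul, coeff_Hop, ← hφ, ← intervalIntegral.integral_mul_const]
    refine intervalIntegral.integral_congr fun t _ => ?_
    simp only [← zscale_expZY, coeff_zscale, klein, mul_assoc]
  · intro f g hf hg ρ φ hρ hφ
    rw [add_mul, map_add]
    exact (hf ρ φ hρ hφ).add (hg ρ φ hρ hφ)
  · intro c f hf ρ φ hρ hφ
    rw [smul_mul_assoc, map_smul]
    exact (hf ρ φ hρ hφ).smul c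
  · intro s f _ hf ρ φ hρ hφ
    rw [mul_assoc]
    rcases s with p | p
    · rw [Hop_X_inl_mul]
      refine IsRegular.poly_mul (isPoly_X _) (hf (fun t => ρ t * t) _
        (hρ.mul Complex.continuous_ofReal) fun n => ?_)
      rw [← hφ (n + 1)]
      refine intervalIntegral.integral_congr fun t _ => ?_
      simp only [pow_succ']; ring
    · rw [Hop_X_inr_mul]
      exact IsRegular.poly_mul (isPoly_X _) (hf ρ φ hρ hφ)

theorem isPoly_zl (i : Fin 2) : IsPoly (zl V i) := IsPoly.sum _ _ fun A _ => (isPoly_zv _ _).smul _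

theorem isPoly_yl (i : Fin 2) : IsPoly (yl V i) := IsPoly.sum _ _ fun A _ => (isPoly_yv _ _).smul _

theorem isPoly_raise_zl (i : Fin 2) : IsPoly (raise (zl V) i) :=
  IsPoly.sum _ _ fun j _ => (isPoly_zl j).smul _

theorem isPoly_twistArg (t : ℝ) {f : YSeries d} (hf : IsPoly f) : IsPoly (twistArg V t f) := by
  rw [← twistL_apply]
  exact isPoly_substL _ (fun p => ((isPoly_yv _ _).sub ((isPoly_yl _).smul _)).sub
    ((isPoly_zl _).smul _)) hf

theorem isPoly_dPerpUp (A : Fin (d + 1)) (i : Fin 2) {f : YSeries d} (hf : IsPoly f) :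
    IsPoly (dPerpUp V A i f) :=
  IsPoly.sum _ _ fun _ _ => ((isPoly_pd _ hf).sub ((IsPoly.sum _ _ fun _ _ =>
    (isPoly_pd _ hf).smul _).smul _)).smul _

theorem isRegular_solS (κ : ℝ) {f : YSeries d} (hf : IsPoly f) (p : Osc d) :
    IsRegular V (solS V κ f p) := by
  rw [solS_eq, kleinR_emb]
  exact ((isRegular_Hop (isPoly_twistArg 1 hf) Complex.continuous_ofReal integral_mul_pow).poly_mul
    (isPoly_raise_zl _)).smul _

theorem isRegular_solW (κ : ℝ) {f : YSeries d} (hf : IsPoly f) (E : Fin (d + 1) → ℝ) :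
    IsRegular V (solW V κ E f) := by
  rw [solW_eq]
  refine (IsRegular.sum _ _ fun j _ => IsRegular.poly_mul (isPoly_raise_zl _) ?_).smul _
  rw [kleinR_emb]
  exact isRegular_Hop (isPoly_twistArg 1 (IsPoly.sum _ _ fun B _ => (isPoly_dPerpUp _ _ hf).smul _))
    (ρ := fun t => ((1 - t : ℝ) : ℂ)) (by fun_prop) integral_one_sub_mul_pow

/-! ### Homogeneous components -/

theorem le_order_substL {σ τ : Type*} [Finite σ] {a : σ → MvPowerSeries τ ℂ}
    (ha : ∀ s, constantCoeff (a s) = 0) {N : ℕ∞} {f : MvPowerSeries σ ℂ} (hf : N ≤ f.order) :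
    N ≤ (substL a ha f).order := by
  rw [substL_apply]
  refine le_trans ?_ (le_order_subst (hasSubst_of_constantCoeff_zero ha) f)
  have h1 : 1 ≤ ⨅ i, (a i).order := le_iInf fun i => one_le_order_iff_constCoeff_eq_zero.2 (ha i)
  calc N ≤ 1 * f.order := by rw [one_mul]; exact hf
    _ ≤ _ := mul_le_mul_left h1 _

theorem le_order_kleinR_emb {N : ℕ∞} {f : YSeries d} (hf : N ≤ f.order) :
    N ≤ (kleinR V (emb f)).order := by
  rw [kleinR_emb, mul_comm, ← twistL_apply]
  exact le_order_mul_right (le_order_substL _ hf)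

theorem le_order_Hop (φ : ℕ → ℂ) {N : ℕ∞} {f : ZYSeries d} (hf : N ≤ f.order) :
    N ≤ (Hop φ f).order := by
  refine hf.trans (MvPowerSeries.le_order fun m hm => ?_)
  rw [coeff_Hop, coeff_of_lt_order hm, mul_zero]

theorem one_le_order_raise_zl (j : Fin 2) : 1 ≤ (raise (zl V) j).order := by
  rw [one_le_order_iff_constCoeff_eq_zero, raise, map_sum]
  exact Finset.sum_eq_zero fun i _ => by rw [constantCoeff_smul, constantCoeff_zl, mul_zero]

theorem le_order_dPerpUpL {A : Fin (d + 1)} {i : Fin 2} {f : YSeries d} {N : ℕ}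
    (hf : ((N + 1 : ℕ) : ℕ∞) ≤ f.order) : (N : ℕ∞) ≤ (dPerpUpL V A i f).order := by
  have hp : ∀ p, (N : ℕ∞) ≤ (pd p f).order := fun p => le_order_pd p hf
  have hs : ∀ (c : ℂ) (g : YSeries d), (N : ℕ∞) ≤ g.order → (N : ℕ∞) ≤ (c • g).order :=
    fun c g hg => hg.trans le_order_smul
  simp only [dPerpUpL, LinearMap.sum_apply, LinearMap.smul_apply, dPerpL, LinearMap.sub_apply]
  refine le_order_sum _ _ _ fun j _ => hs _ _ ?_
  rw [sub_eq_add_neg, ← neg_one_smul ℂ]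
  exact (le_min (hp _) (hs _ _ (hs _ _ (le_order_sum _ _ _ fun B _ => hs _ _ (hp _))))).trans
    min_order_le_add

theorem le_order_solSL (κ : ℝ) (p : Osc d) {f : YSeries d} {N : ℕ} (hf : (N : ℕ∞) ≤ f.order) :
    (N : ℕ∞) ≤ (solSL V κ p f).order := by
  simp only [solSL, LinearMap.smul_apply, LinearMap.comp_apply, mulL_apply, embL_apply]
  exact (le_order_mul_right (le_order_Hop _ (le_order_kleinR_emb hf))).trans le_order_smul

/-- The derivative of C loses one order and the explicit factor z restores it. -/
theorem le_order_solWL (κ : ℝ) (B : Fin (d + 1)) {f : YSeries d} {N : ℕ}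
    (hf : ((N + 1 : ℕ) : ℕ∞) ≤ f.order) : ((N + 1 : ℕ) : ℕ∞) ≤ (solWL V κ B f).order := by
  simp only [solWL, LinearMap.smul_apply, LinearMap.sum_apply, LinearMap.comp_apply, mulL_apply,
    embL_apply]
  refine (le_order_sum _ _ _ fun j _ => ?_).trans le_order_smul
  refine le_trans ?_ le_order_mul
  push_cast
  rw [add_comm]
  exact add_le_add (one_le_order_raise_zl j) (le_order_Hop _ (le_order_kleinR_emb
    (le_order_dPerpUpL hf)))

theorem le_order_sub_sum_homogeneousComponent {σ : Type*} (f : MvPowerSeries σ ℂ) (N : ℕ) :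
    (N : ℕ∞) ≤ (f - ∑ n ∈ Finset.range N, homogeneousComponent n f).order := by
  refine MvPowerSeries.le_order fun e he => ?_
  rw [map_sub, map_sum]
  simp only [coeff_homogeneousComponent]
  rw [Finset.sum_ite_eq, if_pos (Finset.mem_range.2 (by exact_mod_cast he)), sub_self]

/-- A map that does not lower orders cannot see, in a coefficient of degree n, the homogeneous
components of degree greater than n. -/
theorem coeff_eq_sum_homogeneousComponent {T : YSeries d →ₗ[ℂ] ZYSeries d}
    (hT : ∀ (N : ℕ) f, ((N + 1 : ℕ) : ℕ∞) ≤ f.order → ((N + 1 : ℕ) : ℕ∞) ≤ (T f).order)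
    (f : YSeries d) (m : (Osc d ⊕ Osc d) →₀ ℕ) : coeff m (T f)
      = ∑ n ∈ Finset.range (m.degree + 1), coeff m (T (homogeneousComponent n f)) := by
  have h := hT m.degree _ (le_order_sub_sum_homogeneousComponent f (m.degree + 1))
  rw [map_sub, map_sum] at h
  have h2 := coeff_of_lt_order (lt_of_lt_of_le (by exact_mod_cast Nat.lt_succ_self m.degree) h)
  rw [map_sub, map_sum] at h2
  exact sub_eq_zero.1 h2

theorem coeff_solS_eq_sum (κ : ℝ) (f : YSeries d) (m : (Osc d ⊕ Osc d) →₀ ℕ) (p : Osc d) :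
    coeff m (solS V κ f p) = ∑ n ∈ Finset.range (m.degree + 1),
      coeff m (solS V κ (homogeneousComponent n f) p) := by
  simp only [← solSL_apply]
  exact coeff_eq_sum_homogeneousComponent (fun N f hf => le_order_solSL κ p hf) f m

theorem coeff_solW_eq_sum (κ : ℝ) (f : YSeries d) (m : (Osc d ⊕ Osc d) →₀ ℕ)
    (E : Fin (d + 1) → ℝ) : coeff m (solW V κ E f) = ∑ n ∈ Finset.range (m.degree + 1),
      coeff m (solW V κ E (homogeneousComponent n f)) := by
  have h := coeff_eq_sum_homogeneousComponent (T := ∑ B, (E B : ℂ) • solWL V κ B)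
    (fun N f hf => by
      simp only [LinearMap.sum_apply, LinearMap.smul_apply]
      exact le_order_sum _ _ _ fun B _ => (le_order_solWL κ B hf).trans le_order_smul) f m
  simpa only [LinearMap.sum_apply, LinearMap.smul_apply, ← solW_eq_sum] using h

end HigherSpin

end

/-! ### Parallel transport of a flat connection with values in a Banach algebra -/

noncomputable section

namespace HigherSpin

open Set Filter Topology MeasureTheory

section Transport

variable {𝔸 : Type*} [NormedRing 𝔸] [NormedAlgebra ℝ 𝔸] [CompleteSpace 𝔸]

/-- The terms of the path-ordered exponential of `a`. -/
def pathTerm (a : ℝ → 𝔸) : ℕ → ℝ → 𝔸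
  | 0, _ => 1
  | n + 1, t => ∫ s in (0 : ℝ)..t, pathTerm a n s * a s

theorem pathTerm_succ (a : ℝ → 𝔸) (n : ℕ) (t : ℝ) :
    pathTerm a (n + 1) t = ∫ s in (0 : ℝ)..t, pathTerm a n s * a s := rfl

theorem continuous_pathTerm {a : ℝ → 𝔸} (ha : Continuous a) (n : ℕ) : Continuous (pathTerm a n) := by
  induction n with
  | zero => exact continuous_const
  | succ n ih =>
    exact intervalIntegral.continuous_primitive
      (fun _ _ => (ih.mul ha).intervalIntegrable _ _) 0

theorem hasDerivAt_pathTerm_succ {a : ℝ → 𝔸} (ha : Continuous a) (n : ℕ) (t : ℝ) :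
    HasDerivAt (pathTerm a (n + 1)) (pathTerm a n t * a t) t :=
  intervalIntegral.integral_hasDerivAt_right
    (((continuous_pathTerm ha n).mul ha).intervalIntegrable _ _)
    (((continuous_pathTerm ha n).mul ha).stronglyMeasurableAtFilter _ _)
    ((continuous_pathTerm ha n).mul ha).continuousAt

/-- Integrating the bound for |t|ⁿ/n! gives that for n + 1: the iterated integrals are dominated by
the exponential series. -/
theorem norm_pathTerm_le {a : ℝ → 𝔸} (ha : Continuous a) {K : ℝ} (hK : ∀ t, ‖a t‖ ≤ K) (n : ℕ)
    (t : ℝ) : ‖pathTerm a n t‖ ≤ ‖(1 : 𝔸)‖ * (K * |t|) ^ n / n.factorial := by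
  have hK0 : 0 ≤ K := (norm_nonneg _).trans (hK 0)
  induction n generalizing t with
  | zero => simp [pathTerm]
  | succ n ih =>
    rw [pathTerm_succ]
    refine intervalIntegral.norm_integral_le_integral_norm_uIoc.trans ?_
    have h : ∀ s, ‖pathTerm a n s * a s‖
        ≤ ‖(1 : 𝔸)‖ * K ^ (n + 1) / n.factorial * |s - 0| ^ n := fun s => by
      refine (norm_mul_le _ _).trans
        ((mul_le_mul (ih s) (hK s) (norm_nonneg _) (by positivity)).trans_eq ?_)
      rw [sub_zero, mul_pow, pow_succ]; ring
    have hi : IntegrableOn (fun s => ‖pathTerm a n s * a s‖) (uIoc 0 t) :=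
      (((continuous_pathTerm ha n).mul ha).norm.intervalIntegrable 0 t).def'
    have hi' : IntegrableOn (fun s : ℝ => ‖(1 : 𝔸)‖ * K ^ (n + 1) / n.factorial * |s - 0| ^ n)
        (uIoc 0 t) :=
      ((by fun_prop : Continuous fun s : ℝ =>
        ‖(1 : 𝔸)‖ * K ^ (n + 1) / n.factorial * |s - 0| ^ n).intervalIntegrable 0 t).def'
    refine (integral_mono hi hi' h).trans_eq ?_
    rw [integral_const_mul, integral_pow_abs_sub_uIoc, sub_zero, Nat.factorial_succ, mul_pow]
    push_cast
    field_simp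

/-- Linear ordinary differential equations with continuous bounded coefficients are solvable. -/
theorem exists_hasDerivAt_eq_mul {a : ℝ → 𝔸} (ha : Continuous a) {K : ℝ} (hK : ∀ t, ‖a t‖ ≤ K) :
    ∃ u : ℝ → 𝔸, u 0 = 1 ∧ ∀ t ∈ Icc (0 : ℝ) 1, HasDerivAt u (u t * a t) t := by
  have hK0 : 0 ≤ K := (norm_nonneg _).trans (hK 0)
  -- An open interval containing [0, 1] is used so that the derivatives at the endpoints are
  -- two-sided; the radius 2 is otherwise immaterial.
  have hb : ∀ n, ∀ t ∈ Ioo (-2 : ℝ) 2,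
      ‖pathTerm a n t‖ ≤ ‖(1 : 𝔸)‖ * ((K * 2) ^ n / n.factorial) := fun n t ht => by
    refine (norm_pathTerm_le ha hK n t).trans ?_
    rw [mul_div_assoc]
    have : |t| ≤ 2 := abs_le.2 ⟨ht.1.le, ht.2.le⟩
    gcongr
  have hs : Summable fun n => ‖(1 : 𝔸)‖ * ((K * 2) ^ n / n.factorial) :=
    (Real.summable_pow_div_factorial (K * 2)).mul_left _
  have hsum : ∀ t ∈ Ioo (-2 : ℝ) 2, Summable fun n => pathTerm a n t := fun t ht =>
    .of_norm_bounded hs fun n => hb n t ht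
  refine ⟨fun t => ∑' n, pathTerm a n t, ?_, fun t ht => ?_⟩
  · change ∑' n, pathTerm a n 0 = 1
    rw [tsum_eq_single 0]
    · rfl
    · intro n hn
      obtain ⟨k, rfl⟩ := Nat.exists_eq_succ_of_ne_zero hn
      rw [Nat.succ_eq_add_one, pathTerm_succ, intervalIntegral.integral_same]
  · have ht' : t ∈ Ioo (-2 : ℝ) 2 := ⟨by linarith [ht.1], by linarith [ht.2]⟩
    have h0 : (0 : ℝ) ∈ Ioo (-2 : ℝ) 2 := by norm_num
    -- The series without its constant first term is differentiated term by term: each derivative is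
    -- the preceding term times the coefficient, so the full series reappears.
    have hd := hasDerivAt_tsum_of_isPreconnected (𝕜 := ℝ)
      (g := fun n => pathTerm a (n + 1)) (g' := fun n t => pathTerm a n t * a t)
      (hs.mul_right K) isOpen_Ioo isPreconnected_Ioo
      (fun n y _ => hasDerivAt_pathTerm_succ ha n y)
      (fun n y hy => (norm_mul_le _ _).trans
        (mul_le_mul (hb n y hy) (hK y) (norm_nonneg _) (by positivity)))
      h0 ((summable_nat_add_iff 1).2 (hsum 0 h0)) ht'
    rw [(hsum t ht').tsum_mul_right] at hd
    refine (hd.const_add 1).congr_of_eventuallyEq ?_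
    filter_upwards [isOpen_Ioo.mem_nhds ht'] with s hs'
    rw [(hsum s hs').tsum_eq_zero_add]; rfl

variable {E : Type*} [NormedAddCommGroup E] [NormedSpace ℝ E]

/-- Compactness of the segment parameter makes joint continuity at h = 0 uniform in t. -/
theorem eventually_forall_norm_le {F : Type*} [NormedAddCommGroup F] {f : E → ℝ → F}
    (hf : ∀ t ∈ Icc (0 : ℝ) 1, ContinuousAt (fun z : E × ℝ => f z.1 z.2) (0, t))
    (h0 : ∀ t ∈ Icc (0 : ℝ) 1, f 0 t = 0) {ε : ℝ} (hε : 0 < ε) :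
    ∀ᶠ h in 𝓝 (0 : E), ∀ t ∈ Icc (0 : ℝ) 1, ‖f h t‖ ≤ ε := by
  refine isCompact_Icc.eventually_forall_of_forall_eventually fun t ht => ?_
  have h1 := (hf t ht).norm
  have h2 : ‖f ((0 : E), t).1 ((0 : E), t).2‖ < ε := by simpa [h0 t ht] using hε
  exact (h1.eventually_lt_const h2).mono fun _ h => h.le

variable {U : Set E} {x₀ : E} {A : E → E →L[ℝ] 𝔸}

/-- Uniform first-order expansion along a segment. -/
theorem eventually_norm_taylor_le {F : Type*} [NormedAddCommGroup F] [NormedSpace ℝ F]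
    (hU : IsOpen U) {f : E → F} (hf : ContDiffOn ℝ (⊤ : ℕ∞) f U)
    {γ : ℝ → E} (hγ : Continuous γ) (hγU : ∀ t ∈ Icc (0 : ℝ) 1, γ t ∈ U) {ε : ℝ} (hε : 0 < ε) :
    ∀ᶠ h in 𝓝 (0 : E), ∀ t ∈ Icc (0 : ℝ) 1,
      ‖f (γ t + t • h) - f (γ t) - t • fderiv ℝ f (γ t) h‖ ≤ ε * ‖h‖ := by
  refine isCompact_Icc.eventually_forall_of_forall_eventually fun t₀ ht₀ => ?_
  have hc : ContDiffAt ℝ (⊤ : ℕ∞) f (γ t₀) := hf.contDiffAt (hU.mem_nhds (hγU t₀ ht₀))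
  have hs := (hc.hasStrictFDerivAt (by simp)).isLittleO.def (by positivity : (0 : ℝ) < ε / 4)
  have ht : Tendsto (fun z : E × ℝ => (γ z.2 + z.2 • z.1, γ z.2)) (𝓝 (0, t₀))
      (𝓝 (γ t₀, γ t₀)) := by
    have : Continuous fun z : E × ℝ => (γ z.2 + z.2 • z.1, γ z.2) := by fun_prop
    convert this.tendsto (0, t₀) using 2
    simp
  have hd : ContinuousAt (fun z : E × ℝ => fderiv ℝ f (γ z.2)) (0, t₀) :=
    ContinuousAt.comp (g := fderiv ℝ f) (f := fun z : E × ℝ => γ z.2)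
      (((contDiffOn_infty_iff_fderiv_of_isOpen hU).1 hf).2.continuousOn.continuousAt
        (hU.mem_nhds (hγU t₀ ht₀))) (by fun_prop)
  have hd' := Metric.tendsto_nhds.1 hd (ε / 4) (by positivity)
  have h1 : ∀ᶠ z : E × ℝ in 𝓝 (0, t₀), ‖z.2‖ ≤ 2 := by
    have : ContinuousAt (fun z : E × ℝ => ‖z.2‖) (0, t₀) := by fun_prop
    refine (this.eventually_lt_const (u := 2) ?_).mono fun _ h => h.le
    simp only [Real.norm_eq_abs]
    rw [abs_of_nonneg ht₀.1]; linarith [ht₀.2]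
  filter_upwards [ht.eventually hs, hd', h1] with z hz hz' hz2
  rw [dist_eq_norm] at hz'
  simp only [add_sub_cancel_left] at hz
  have hn : ‖z.2 • z.1‖ ≤ 2 * ‖z.1‖ := by
    rw [norm_smul]; gcongr
  have e : f (γ z.2 + z.2 • z.1) - f (γ z.2) - z.2 • fderiv ℝ f (γ z.2) z.1
      = (f (γ z.2 + z.2 • z.1) - f (γ z.2) - fderiv ℝ f (γ t₀) (z.2 • z.1))
        - (fderiv ℝ f (γ z.2) - fderiv ℝ f (γ t₀)) (z.2 • z.1) := by
    rw [ContinuousLinearMap.sub_apply, map_smul, map_smul]; abel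
  rw [e]
  calc _ ≤ ε / 4 * (2 * ‖z.1‖) + ε / 4 * (2 * ‖z.1‖) := by
        refine (norm_sub_le _ _).trans (add_le_add (hz.trans (by gcongr)) ?_)
        refine (ContinuousLinearMap.le_opNorm _ _).trans ?_
        gcongr
    _ = ε * ‖z.1‖ := by ring

/-- The first-order variation of the transport equation under a flat connection. -/
theorem transport_variation {v h : E} {t : ℝ} {D : E →L[ℝ] E →L[ℝ] 𝔸} {A₀ A₁ : E →L[ℝ] 𝔸}
    (hflat : ∀ v w, D v w - D w v + (A₀ v * A₀ w - A₀ w * A₀ v) = 0) :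
    (1 + t • A₀ h) * A₁ (v + h) - (A₀ v * (1 + t • A₀ h) + (A₀ h + t • D v h))
      = (A₁ - A₀ - t • D h) v + (A₁ - A₀) h + t • (A₀ h * (A₁ (v + h) - A₀ v)) := by
  -- Flatness exchanges the derivative of A along v, evaluated on h, for the derivative along h,
  -- evaluated on v; the latter appears in the Taylor expansion of A.
  have e := congrArg (fun z => t • z) (hflat h v)
  simp only [smul_zero] at e
  rw [← sub_eq_zero, ← e]
  simp only [add_mul, mul_add, one_mul, mul_one, mul_sub, smul_mul_assoc, mul_smul_comm, map_add,
    ContinuousLinearMap.sub_apply, ContinuousLinearMap.smul_apply, smul_add, smul_sub]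
  abel

/-- Parallel transport of a smooth flat connection on a star-shaped open set. -/
theorem exists_flat_transport (hU : IsOpen U) (hx₀ : x₀ ∈ U) (hs : StarConvex ℝ x₀ U)
    (hA : ContDiffOn ℝ (⊤ : ℕ∞) A U)
    (hflat : ∀ x ∈ U, ∀ v w, fderiv ℝ A x v w - fderiv ℝ A x w v
      + (A x v * A x w - A x w * A x v) = 0) :
    ∃ G : E → 𝔸, G x₀ = 1 ∧
      ∀ x ∈ U, HasFDerivAt G ((ContinuousLinearMap.mul ℝ 𝔸 (G x)).comp (A x)) x := by
  have hseg : ∀ y ∈ U, ∀ t ∈ Icc (0 : ℝ) 1, x₀ + t • (y - x₀) ∈ U := fun y hy t ht =>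
    hs.add_smul_sub_mem hy ht.1 ht.2
  have hcont : ∀ y ∈ U, ContinuousOn (fun t : ℝ => A (x₀ + t • (y - x₀)) (y - x₀)) (Icc 0 1) :=
    fun y hy => (hA.continuousOn.comp (f := fun t : ℝ => x₀ + t • (y - x₀))
      (by fun_prop) (hseg y hy)).clm_apply continuousOn_const
  -- The equation along the segment from x₀ to y. The coefficient is extended constantly outside [0,
  -- 1] to be continuous and bounded on the whole line.
  have hex : ∀ y, ∃ u : ℝ → 𝔸, y ∈ U → u 0 = 1 ∧ ∀ t ∈ Icc (0 : ℝ) 1,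
      HasDerivAt u (u t * A (x₀ + t • (y - x₀)) (y - x₀)) t := by
    intro y
    by_cases hy : y ∈ U
    · obtain ⟨K, hK⟩ := isCompact_Icc.exists_bound_of_continuousOn (hcont y hy)
      have hcl := (continuousOn_iff_continuous_restrict.1 (hcont y hy)).Icc_extend' (h := zero_le_one)
      obtain ⟨u, hu0, hu⟩ := exists_hasDerivAt_eq_mul hcl (K := K) fun t => by
        exact hK _ (projIcc (0 : ℝ) 1 zero_le_one t).2
      refine ⟨u, fun _ => ⟨hu0, fun t ht => ?_⟩⟩
      have := hu t ht
      rwa [IccExtend_of_mem _ _ ht] at this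
    · exact ⟨0, fun h => absurd h hy⟩
  choose u hu using hex
  refine ⟨fun y => u y 1, ?_, fun x hx => ?_⟩
  · obtain ⟨h0, h1⟩ := hu x₀ hx₀
    rw [← h0]
    refine constant_of_has_deriv_right_zero
      (fun t ht => (h1 t ht).continuousAt.continuousWithinAt) (fun t ht => ?_) 1 (by simp)
    have := (h1 t ⟨ht.1, ht.2.le⟩).hasDerivWithinAt (s := Ici t)
    simpa using this
  · obtain ⟨hx0, hx1⟩ := hu x hx
    set v := x - x₀ with hv
    set γ : ℝ → E := fun t => x₀ + t • v with hγ
    have hγc : Continuous γ := by fun_prop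
    have hγU : ∀ t ∈ Icc (0 : ℝ) 1, γ t ∈ U := hseg x hx
    have huc : ContinuousOn (u x) (Icc 0 1) := fun t ht => (hx1 t ht).continuousAt.continuousWithinAt
    obtain ⟨K₁, hK₁⟩ := isCompact_Icc.exists_bound_of_continuousOn huc
    obtain ⟨K₂, hK₂⟩ := isCompact_Icc.exists_bound_of_continuousOn
      (hA.continuousOn.comp (f := γ) hγc.continuousOn hγU)
    have hK₁0 : 0 ≤ K₁ := (norm_nonneg _).trans (hK₁ 0 (by simp))
    have hK₂0 : 0 ≤ K₂ := (norm_nonneg _).trans (hK₂ 0 (by simp))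
    have hAc : ∀ t ∈ Icc (0 : ℝ) 1,
        ContinuousAt (fun z : E × ℝ => A (γ z.2 + z.2 • z.1)) (0, t) := fun t ht =>
      ContinuousAt.comp (g := A) (f := fun z : E × ℝ => γ z.2 + z.2 • z.1)
        (hA.continuousOn.continuousAt (by simpa using hU.mem_nhds (hγU t ht))) (by fun_prop)
    have hAc' : ∀ t ∈ Icc (0 : ℝ) 1, ContinuousAt (fun z : E × ℝ => A (γ z.2)) (0, t) :=
      fun t ht => ContinuousAt.comp (g := A) (f := fun z : E × ℝ => γ z.2)
        (hA.continuousOn.continuousAt (hU.mem_nhds (hγU t ht))) (by fun_prop)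
    have e1 : ∀ ε > 0, ∀ᶠ h in 𝓝 (0 : E), ∀ t ∈ Icc (0 : ℝ) 1,
        ‖A (γ t + t • h) - A (γ t)‖ ≤ ε := fun ε hε =>
      eventually_forall_norm_le (f := fun h t => A (γ t + t • h) - A (γ t))
        (fun t ht => (hAc t ht).sub (hAc' t ht)) (fun t _ => by simp) hε
    have e2 : ∀ ε > 0, ∀ᶠ h in 𝓝 (0 : E), ∀ t ∈ Icc (0 : ℝ) 1,
        ‖A (γ t + t • h) (v + h) - A (γ t) v‖ ≤ ε := fun ε hε =>
      eventually_forall_norm_le (f := fun h t => A (γ t + t • h) (v + h) - A (γ t) v)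
        (fun t ht => ((hAc t ht).clm_apply (by fun_prop)).sub
          ((hAc' t ht).clm_apply continuousAt_const)) (fun t _ => by simp) hε
    -- Bounds the coefficient of the equation for the endpoint x + h uniformly in small h: the
    -- unperturbed bound plus an error of at most 1.
    set K := K₂ * ‖v‖ + 1 with hK
    have hK0 : 0 < K := by positivity
    rw [hasFDerivAt_iff_isLittleO_nhds_zero, Asymptotics.isLittleO_iff]
    intro c hc
    -- Grönwall's factor per unit of inhomogeneity. The choice ε = c/(M+1) then makes the final
    -- error at most c‖h‖.
    set M := K₁ * (‖v‖ + 1 + K₂) / K * (Real.exp K - 1) with hM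
    have hM0 : 0 ≤ M := by
      have : 0 ≤ Real.exp K - 1 := by linarith [Real.add_one_le_exp K]
      positivity
    set ε := c / (M + 1) with hε
    have hε0 : 0 < ε := by positivity
    have hxU : ∀ᶠ h in 𝓝 (0 : E), x + h ∈ U := by
      have : ContinuousAt (fun h : E => x + h) 0 := by fun_prop
      exact this.eventually_mem (hU.mem_nhds (by simpa using hx))
    filter_upwards [hxU, e1 ε hε0, e2 ε hε0, e2 1 one_pos,
      eventually_norm_taylor_le hU hA hγc hγU hε0] with h hh h1 h2 h3 h4
    obtain ⟨hh0, hh1⟩ := hu (x + h) hh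
    have hpt : ∀ t : ℝ, x₀ + t • (v + h) = γ t + t • h := fun t => by
      rw [hγ, smul_add, ← add_assoc]
    have hpv : x + h - x₀ = v + h := by rw [hv]; abel
    simp only [hpv, hpt] at hh1
    -- The expected transport to x + h, to first order in h, is u(t)(1 + t A(γ t) h). It is compared
    -- with the true one by Grönwall.
    have hdQ : ∀ t ∈ Icc (0 : ℝ) 1, HasDerivAt (fun t => u x t * (1 + t • A (γ t) h))
        (u x t * A (γ t) v * (1 + t • A (γ t) h)
          + u x t * (A (γ t) h + t • fderiv ℝ A (γ t) v h)) t := fun t ht => by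
      have hdA : HasFDerivAt A (fderiv ℝ A (γ t)) (γ t) :=
        ((hA.contDiffAt (hU.mem_nhds (hγU t ht))).differentiableAt (by simp)).hasFDerivAt
      have hdγ : HasDerivAt γ v t := by
        exact (((hasDerivAt_id t).smul_const v).const_add x₀).congr_deriv (one_smul _ _)
      have hdAγ : HasDerivAt (fun t => A (γ t) h) (fderiv ℝ A (γ t) v h) t := by
        have := hdA.comp_hasDerivAt t hdγ
        exact ((ContinuousLinearMap.apply ℝ 𝔸 h).hasFDerivAt.comp_hasDerivAt t this)
      have hs : HasDerivAt (fun t => 1 + t • A (γ t) h)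
          (A (γ t) h + t • fderiv ℝ A (γ t) v h) t := by
        refine (((hasDerivAt_id t).smul hdAγ).const_add 1).congr_deriv ?_
        rw [one_smul, add_comm]; rfl
      exact (hx1 t ht).mul hs
    have hR := norm_le_gronwallBound_of_norm_deriv_right_le
      (f := fun t => u (x + h) t - u x t * (1 + t • A (γ t) h)) (δ := 0) (K := K)
      (ε := K₁ * (‖v‖ + 1 + K₂) * (ε * ‖h‖)) (a := 0) (b := 1)
      (fun t ht => ((hh1 t ht).sub (hdQ t ht)).continuousAt.continuousWithinAt)
      (fun t ht => ((hh1 t ⟨ht.1, ht.2.le⟩).sub (hdQ t ⟨ht.1, ht.2.le⟩)).hasDerivWithinAt)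
      (by simp [hx0, hh0]) (fun t ht => ?_) 1 (by simp)
    · rw [gronwallBound_of_K_ne_0 hK0.ne'] at hR
      simp only [zero_mul, zero_add, one_smul, sub_zero, mul_one] at hR
      have hγ1 : γ 1 = x := by simp [hγ, hv]
      rw [hγ1] at hR
      have e : u (x + h) 1 - u x 1 - ((ContinuousLinearMap.mul ℝ 𝔸 (u x 1)).comp (A x)) h
          = u (x + h) 1 - u x 1 * (1 + A x h) := by
        rw [mul_add, mul_one, sub_sub]; rfl
      rw [e]
      refine hR.trans ?_
      have : K₁ * (‖v‖ + 1 + K₂) * (ε * ‖h‖) / K * (Real.exp K - 1) = M * ε * ‖h‖ := by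
        rw [hM]; ring
      rw [this]
      gcongr
      rw [hε, mul_div_assoc', div_le_iff₀ (by positivity)]
      nlinarith
    · have ht' : t ∈ Icc (0 : ℝ) 1 := ⟨ht.1, ht.2.le⟩
      -- The difference satisfies the same linear equation up to the residue of
      -- `transport_variation`, every term of which is o(h) thanks to flatness.
      have e : u (x + h) t * A (γ t + t • h) (v + h)
          - (u x t * A (γ t) v * (1 + t • A (γ t) h)
            + u x t * (A (γ t) h + t • fderiv ℝ A (γ t) v h))
          = (u (x + h) t - u x t * (1 + t • A (γ t) h)) * A (γ t + t • h) (v + h)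
            + u x t * ((A (γ t + t • h) - A (γ t) - t • fderiv ℝ A (γ t) h) v
              + (A (γ t + t • h) - A (γ t)) h
              + t • (A (γ t) h * (A (γ t + t • h) (v + h) - A (γ t) v))) := by
        rw [← transport_variation (hflat _ (hγU t ht'))]
        generalize 1 + t • A (γ t) h = X
        generalize A (γ t) h + t • fderiv ℝ A (γ t) v h = Y
        simp only [mul_sub, sub_mul, mul_add, mul_assoc]
        abel
      rw [e]
      refine (norm_add_le _ _).trans (add_le_add ?_ ?_)
      · rw [mul_comm K]
        refine (norm_mul_le _ _).trans ?_
        gcongr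
        have := norm_le_norm_add_norm_sub (A (γ t) v) (A (γ t + t • h) (v + h))
        rw [norm_sub_rev] at this
        refine this.trans (add_le_add ?_ (h3 t ht'))
        exact ((A (γ t)).le_opNorm v).trans (by gcongr; exact hK₂ t ht')
      · refine (norm_mul_le _ _).trans ?_
        rw [mul_assoc]
        gcongr
        · exact hK₁ t ht'
        · have b1 : ‖(A (γ t + t • h) - A (γ t) - t • fderiv ℝ A (γ t) h) v‖ ≤ ε * ‖h‖ * ‖v‖ :=
            (ContinuousLinearMap.le_opNorm _ _).trans (by gcongr; exact h4 t ht')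
          have b2 : ‖(A (γ t + t • h) - A (γ t)) h‖ ≤ ε * ‖h‖ :=
            (ContinuousLinearMap.le_opNorm _ _).trans (by gcongr; exact h1 t ht')
          have b3 : ‖t • (A (γ t) h * (A (γ t + t • h) (v + h) - A (γ t) v))‖
              ≤ 1 * (K₂ * ‖h‖ * ε) := by
            rw [norm_smul]
            refine mul_le_mul ?_ ((norm_mul_le _ _).trans ?_) (norm_nonneg _) zero_le_one
            · rw [Real.norm_eq_abs, abs_of_nonneg ht.1]; exact ht.2.le
            · gcongr
              · exact ((A (γ t)).le_opNorm h).trans (by gcongr; exact hK₂ t ht')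
              · exact h2 t ht'
          refine ((norm_add₃_le).trans (add_le_add (add_le_add b1 b2) b3)).trans_eq ?_
          ring

/-- Bootstrapping: the derivative G·A is as smooth as G, so each order of smoothness gives the next.
-/
theorem contDiffOn_of_hasFDerivAt_mul (hU : IsOpen U) (hA : ContDiffOn ℝ (⊤ : ℕ∞) A U) {G : E → 𝔸}
    (hG : ∀ x ∈ U, HasFDerivAt G ((ContinuousLinearMap.mul ℝ 𝔸 (G x)).comp (A x)) x) :
    ContDiffOn ℝ (⊤ : ℕ∞) G U := by
  refine contDiffOn_infty.2 fun n => ?_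
  induction n with
  | zero =>
    exact contDiffOn_zero.2 fun x hx => (hG x hx).continuousAt.continuousWithinAt
  | succ n ih =>
    rw [Nat.cast_add, Nat.cast_one, contDiffOn_succ_iff_fderiv_of_isOpen hU]
    refine ⟨fun x hx => (hG x hx).differentiableAt.differentiableWithinAt, by simp, ?_⟩
    refine ContDiffOn.congr ?_ fun x hx => (hG x hx).fderiv
    exact ((ContinuousLinearMap.mul ℝ 𝔸).contDiff.comp_contDiffOn ih).clm_comp
      (hA.of_le (by exact_mod_cast le_top))

end Transport

end HigherSpin

end

/-! ### The AdS connection as a flat matrix connection and its parallel frame -/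

noncomputable section

namespace HigherSpin

open MvPowerSeries

variable {d : ℕ} {V : Fin (d + 1) → ℝ} {U : TopologicalSpace.Opens (Fin d → ℝ)}
  {ω₀ : Fin d → U → Matrix (Fin (d + 1)) (Fin (d + 1)) ℝ}

section MatrixTransport

/-- Endomorphisms of the fundamental representation. -/
abbrev EndV (d : ℕ) := (Fin (d + 1) → ℝ) →L[ℝ] (Fin (d + 1) → ℝ)

/-- The matrix entries of an endomorphism. -/
def entryL (A B : Fin (d + 1)) : EndV d →L[ℝ] ℝ :=
  (ContinuousLinearMap.proj (R := ℝ) (φ := fun _ : Fin (d + 1) => ℝ) A).comp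
    (ContinuousLinearMap.apply ℝ (Fin (d + 1) → ℝ) (Pi.single B (1 : ℝ)))

theorem entryL_apply (A B : Fin (d + 1)) (T : EndV d) : entryL A B T = T (Pi.single B 1) A := rfl

theorem clm_apply_eq_sum {n : ℕ} {F : Type*} [NormedAddCommGroup F] [NormedSpace ℝ F]
    (L : (Fin n → ℝ) →L[ℝ] F) (v : Fin n → ℝ) : L v = ∑ μ, v μ • L (Pi.single μ 1) := by
  conv_lhs => rw [pi_eq_sum_univ' v]
  simp only [map_sum, map_smul]

theorem entryL_ext {S T : EndV d} (h : ∀ A B, entryL A B S = entryL A B T) : S = T := by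
  refine ContinuousLinearMap.ext fun v => ?_
  rw [clm_apply_eq_sum S, clm_apply_eq_sum T]
  exact Finset.sum_congr rfl fun B _ => by rw [show S (Pi.single B 1) = T (Pi.single B 1) from
    funext fun A => h A B]

theorem entryL_mul (A B : Fin (d + 1)) (S T : EndV d) :
    entryL A B (S * T) = ∑ C, entryL A C S * entryL C B T := by
  rw [entryL_apply, ContinuousLinearMap.mul_apply, clm_apply_eq_sum S, Finset.sum_apply]
  exact Finset.sum_congr rfl fun C _ => mul_comm _ _

theorem entryL_one (A B : Fin (d + 1)) :
    entryL A B (1 : EndV d) = (1 : Matrix (Fin (d + 1)) (Fin (d + 1)) ℝ) A B := by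
  rw [entryL_apply, Matrix.one_apply, ContinuousLinearMap.one_apply, Pi.single_apply]

variable (ω₀) in
/-- The endomorphisms `ω₀_μ{}^A{}_B`. -/
def connMatrix (μ : Fin d) (y : Fin d → ℝ) : EndV d :=
  ∑ A, ∑ B, (extendZero (fun x => ω₀ μ x A B) y * sg B) •
    (ContinuousLinearMap.proj B).smulRight (Pi.single A (1 : ℝ))

theorem entryL_connMatrix (μ : Fin d) (y : Fin d → ℝ) (A B : Fin (d + 1)) :
    entryL A B (connMatrix ω₀ μ y) = extendZero (fun x => ω₀ μ x A B) y * sg B := by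
  rw [connMatrix, map_sum, Finset.sum_eq_single A]
  · rw [map_sum, Finset.sum_eq_single B]
    · simp [entryL_apply]
    · intro B' _ h; simp [entryL_apply, Pi.single_apply, h]
    · simp
  · intro A' _ h
    refine (map_sum _ _ _).trans (Finset.sum_eq_zero fun B' _ => ?_)
    simp [entryL_apply, Pi.single_apply, h.symm]
  · simp

theorem contDiffOn_connMatrix (hω : ∀ μ A B, SmoothFun fun x => ω₀ μ x A B) (μ : Fin d) :
    ContDiffOn ℝ (⊤ : ℕ∞) (connMatrix ω₀ μ) U := by
  unfold connMatrix
  refine ContDiffOn.sum fun A _ => ContDiffOn.sum fun B _ => ?_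
  exact (ContDiffOn.mul (hω μ A B) contDiffOn_const).smul contDiffOn_const

theorem fderiv_connMatrix (hω : ∀ μ A B, SmoothFun fun x => ω₀ μ x A B) (μ : Fin d) (x : U)
    (v : Fin d → ℝ) (A B : Fin (d + 1)) : entryL A B (fderiv ℝ (connMatrix ω₀ μ) x v)
      = ∑ ν, v ν * (partialX ν (fun x => ω₀ μ x A B) x * sg B) := by
  have hd : DifferentiableAt ℝ (connMatrix ω₀ μ) x :=
    ((contDiffOn_connMatrix hω μ).contDiffAt (U.isOpen.mem_nhds x.2)).differentiableAt (by simp)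
  have h1 := ((entryL A B).hasFDerivAt.comp (x : Fin d → ℝ) hd.hasFDerivAt).fderiv
  have h2 : (entryL A B ∘ connMatrix ω₀ μ : (Fin d → ℝ) → ℝ)
      = fun y => extendZero (fun x => ω₀ μ x A B) y * sg B := by
    funext y; exact entryL_connMatrix μ y A B
  have h3 := DFunLike.congr_fun h1 v
  rw [h2, fderiv_mul_const ((hω μ A B).differentiableAt x)] at h3
  change _ = entryL A B (fderiv ℝ (connMatrix ω₀ μ) x v) at h3
  rw [← h3, clm_apply_eq_sum]
  refine Finset.sum_congr rfl fun ν _ => ?_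
  rw [ContinuousLinearMap.smul_apply, smul_eq_mul, smul_eq_mul, mul_comm (sg B)]; rfl

variable (ω₀) in
/-- The connection as an endomorphism-valued one-form. -/
def connForm (y : Fin d → ℝ) : (Fin d → ℝ) →L[ℝ] EndV d :=
  ∑ μ, (ContinuousLinearMap.proj μ).smulRight (connMatrix ω₀ μ y)

theorem connForm_apply (y v : Fin d → ℝ) : connForm ω₀ y v = ∑ μ, v μ • connMatrix ω₀ μ y := by
  rw [connForm, ContinuousLinearMap.sum_apply]; rfl

theorem contDiffOn_connForm (hω : ∀ μ A B, SmoothFun fun x => ω₀ μ x A B) :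
    ContDiffOn ℝ (⊤ : ℕ∞) (connForm ω₀) U := by
  unfold connForm
  exact ContDiffOn.sum fun μ _ => contDiffOn_const.smulRight (contDiffOn_connMatrix hω μ)

theorem fderiv_connForm (hω : ∀ μ A B, SmoothFun fun x => ω₀ μ x A B) (x : U)
    (v w : Fin d → ℝ) : fderiv ℝ (connForm ω₀) x v w
      = ∑ μ, w μ • fderiv ℝ (connMatrix ω₀ μ) x v := by
  have hd : ∀ μ, DifferentiableAt ℝ (connMatrix ω₀ μ) x := fun μ =>
    ((contDiffOn_connMatrix hω μ).contDiffAt (U.isOpen.mem_nhds x.2)).differentiableAt (by simp)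
  have hc : DifferentiableAt ℝ (connForm ω₀) x :=
    ((contDiffOn_connForm hω).contDiffAt (U.isOpen.mem_nhds x.2)).differentiableAt (by simp)
  have h1 : HasFDerivAt (fun y => connForm ω₀ y w) _ (x : Fin d → ℝ) :=
    hc.hasFDerivAt.clm_apply (hasFDerivAt_const w _)
  have h2 : HasFDerivAt (fun y => connForm ω₀ y w)
      (∑ μ, w μ • fderiv ℝ (connMatrix ω₀ μ) x) (x : Fin d → ℝ) := by
    simp only [connForm_apply]
    exact HasFDerivAt.fun_sum fun μ (_ : μ ∈ Finset.univ) => (hd μ).hasFDerivAt.const_smul (w μ)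
  have h3 := DFunLike.congr_fun (h1.unique h2) v
  simpa [ContinuousLinearMap.sum_apply] using h3

/-- The component form of flatness, with one index lowered by the metric and contracted with two
arbitrary vectors. -/
theorem connForm_flat (hω : IsAdSConnection V ω₀) (x : U) (v w : Fin d → ℝ) :
    fderiv ℝ (connForm ω₀) x v w - fderiv ℝ (connForm ω₀) x w v
      + (connForm ω₀ x v * connForm ω₀ x w - connForm ω₀ x w * connForm ω₀ x v) = 0 := by
  refine entryL_ext fun A B => ?_
  have e1 : ∀ v w : Fin d → ℝ, entryL A B (fderiv ℝ (connForm ω₀) x v w)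
      = ∑ ν, ∑ μ, v ν * w μ * (partialX ν (fun x => ω₀ μ x A B) x * sg B) := fun v w => by
    rw [fderiv_connForm hω.smooth, map_sum]
    simp only [map_smul, fderiv_connMatrix hω.smooth, smul_eq_mul, Finset.mul_sum]
    rw [Finset.sum_comm]
    exact Finset.sum_congr rfl fun _ _ => Finset.sum_congr rfl fun _ _ => by ring
  have e2 : ∀ v w : Fin d → ℝ, entryL A B (connForm ω₀ x v * connForm ω₀ x w)
      = ∑ ν, ∑ μ, v ν * w μ * ∑ C, (ω₀ ν x A C * sg C) * (ω₀ μ x C B * sg B) := fun v w => by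
    rw [connForm_apply, connForm_apply, Finset.sum_mul_sum]
    simp only [map_sum, smul_mul_smul_comm, map_smul, entryL_mul,
      entryL_connMatrix, extendZero_coe, smul_eq_mul]
  have e3 := e1 w v
  have e4 := e2 w v
  rw [Finset.sum_comm] at e3 e4
  rw [map_add, map_sub, map_sub, map_zero, e1 v w, e3, e2 v w, e4,
    ← Finset.sum_sub_distrib, ← Finset.sum_sub_distrib, ← Finset.sum_add_distrib]
  refine Finset.sum_eq_zero fun ν _ => ?_
  rw [← Finset.sum_sub_distrib, ← Finset.sum_sub_distrib, ← Finset.sum_add_distrib]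
  refine Finset.sum_eq_zero fun μ _ => ?_
  have hf := hω.flat ν μ x A B
  have hl := lieEta_eq (ω₀ ν x) (ω₀ μ x) A B
  unfold lieEta at hl
  rw [hl] at hf
  have : ∑ C, (ω₀ ν x A C * sg C) * (ω₀ μ x C B * sg B)
      - ∑ C, (ω₀ μ x A C * sg C) * (ω₀ ν x C B * sg B)
      = (∑ C, sg C * (ω₀ ν x A C * ω₀ μ x C B - ω₀ μ x A C * ω₀ ν x C B)) * sg B := by
    rw [← Finset.sum_sub_distrib, Finset.sum_mul]
    exact Finset.sum_congr rfl fun _ _ => by ring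
  linear_combination v ν * w μ * sg B * hf + v ν * w μ * this

/-- A parallel frame of the fundamental representation. -/
theorem exists_parallel_frame (hω : IsAdSConnection V ω₀) {x₀ : U}
    (hs : StarConvex ℝ (x₀ : Fin d → ℝ) (U : Set (Fin d → ℝ))) :
    ∃ M : U → Matrix (Fin (d + 1)) (Fin (d + 1)) ℝ, (∀ A B, SmoothFun fun x => M x A B) ∧
      M x₀ = 1 ∧ ∀ μ x A B, partialX μ (fun x => M x A B) x
        = ∑ C, M x A C * (ω₀ μ x C B * sg B) := by
  have hA := contDiffOn_connForm hω.smooth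
  obtain ⟨G, hG0, hG⟩ := exists_flat_transport U.isOpen x₀.2 hs hA
    fun x hx v w => connForm_flat hω ⟨x, hx⟩ v w
  have hGs := contDiffOn_of_hasFDerivAt_mul U.isOpen hA hG
  refine ⟨fun x A B => entryL A B (G x), fun A B => ?_, ?_, fun μ x A B => ?_⟩
  · exact (smoothFun_iff (f := fun y => entryL A B (G y)) fun _ => rfl).2
      ((entryL A B).contDiff.comp_contDiffOn hGs)
  · funext A B
    change entryL A B (G x₀) = _
    rw [hG0, entryL_one]
  · rw [partialX_eq (f := fun y => entryL A B (G y)) fun _ => rfl,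
      show fderiv ℝ (fun y => entryL A B (G y)) x = _ from
        ((entryL A B).hasFDerivAt.comp (x : Fin d → ℝ) (hG x x.2)).fderiv]
    change entryL A B (G x * connForm ω₀ x (Pi.single μ 1)) = _
    rw [connForm_apply, entryL_mul]
    refine Finset.sum_congr rfl fun C _ => ?_
    rw [Finset.sum_eq_single μ (fun ν _ h => by simp [h]) (by simp), Pi.single_eq_same, one_smul,
      entryL_connMatrix, extendZero_coe]

end MatrixTransport

end HigherSpin

end

/-! ### Parallel sections: definition and uniqueness -/

noncomputable section

namespace HigherSpin

open MvPowerSeries Set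

variable {d : ℕ} {V : Fin (d + 1) → ℝ} {U : TopologicalSpace.Opens (Fin d → ℝ)}
  {ω₀ : Fin d → U → Matrix (Fin (d + 1)) (Fin (d + 1)) ℝ}

/-! ### Parallel sections -/

/-- The action of `w^{AB} T_{AB}` on functions of `Y`. -/
def RYop (w : Matrix (Fin (d + 1)) (Fin (d + 1)) ℝ) : YSeries d →ₗ[ℂ] YSeries d :=
  ∑ A, ∑ B, (-(w A B * sg B) : ℂ) • ∑ k, mulL (X (k, B)) ∘ₗ pd (k, A)

theorem RYop_apply (w : Matrix (Fin (d + 1)) (Fin (d + 1)) ℝ) (g : YSeries d) : RYop w g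
    = ∑ A, ∑ B, (-(w A B * sg B) : ℂ) • ∑ k, X (k, B) * pd (k, A) g := by
  simp [RYop, LinearMap.sum_apply]

theorem emb_RYop (w : Matrix (Fin (d + 1)) (Fin (d + 1)) ℝ) (g : YSeries d) :
    emb (RYop w g) = Rop w (emb g) := by
  simp only [RYop_apply, Rop_apply, emb_sum, emb_smul, emb_mul, emb_X, pd_inr_emb]
  rfl

theorem commY_Wm {w : Matrix (Fin (d + 1)) (Fin (d + 1)) ℝ} (hw : ∀ A B, w A B = -w B A)
    (g : YSeries d) : commY (Wm w) g = RYop w g := by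
  apply emb_injective
  rw [emb_commY, comm_emb_Wm hw, Qop_emb, add_zero, emb_RYop]

/-- Parallel sections of the bundle of polynomials in `Y`. -/
structure IsParallel (ω₀ : Fin d → U → Matrix (Fin (d + 1)) (Fin (d + 1)) ℝ)
    (f : U → YSeries d) : Prop where
  smooth : SmoothSeries f
  poly : ∀ x, IsPoly (f x)
  eq : ∀ μ x, dX μ f x + RYop (ω₀ μ x) (f x) = 0

theorem coeff_X_mul_pd (s t : Osc d) (f : YSeries d) (m : Osc d →₀ ℕ) :
    coeff m (X s * pd t f) = if Finsupp.single s 1 ≤ m then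
      coeff (m - Finsupp.single s 1 + Finsupp.single t 1) f
        * (((m - Finsupp.single s 1 : Osc d →₀ ℕ) t + 1 : ℕ) : ℂ) else 0 := by
  rw [coeff_X_mul']
  split_ifs
  · rw [coeff_pd]; push_cast; rfl
  · rfl

theorem norm_coeff_X_mul_pd_le {s t : Osc d} {f : YSeries d} {N : ℕ} {K : ℝ} (hK : 0 ≤ K)
    (hf : ∀ m, m.degree ≤ N → ‖coeff m f‖ ≤ K) {m : Osc d →₀ ℕ} (hm : m.degree ≤ N) :
    ‖coeff m (X s * pd t f)‖ ≤ K * (N + 1) := by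
  rw [coeff_X_mul_pd]
  split_ifs with h
  · obtain ⟨m', rfl⟩ := exists_add_of_le h
    rw [add_tsub_cancel_left]
    rw [map_add, Finsupp.degree_single] at hm
    rw [norm_mul, Complex.norm_natCast]
    refine mul_le_mul (hf _ ?_) ?_ (by positivity) hK
    · rw [map_add, Finsupp.degree_single]; omega
    · have := Finsupp.le_degree t m'
      exact_mod_cast (by omega : m' t + 1 ≤ N + 1)
  · rw [norm_zero]; positivity

/-- The operator replaces one Y by another and preserves the degree, so coefficients up to degree N
bound its coefficients up to degree N, linearly in the connection. -/
theorem norm_coeff_RYop_le {w : Matrix (Fin (d + 1)) (Fin (d + 1)) ℝ} {f : YSeries d} {N : ℕ}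
    {K : ℝ} (hK : 0 ≤ K) (hf : ∀ m, m.degree ≤ N → ‖coeff m f‖ ≤ K) {m : Osc d →₀ ℕ}
    (hm : m.degree ≤ N) :
    ‖coeff m (RYop w f)‖ ≤ (∑ A, ∑ B, |w A B * sg B| * (2 * (N + 1))) * K := by
  rw [RYop_apply, map_sum, Finset.sum_mul]
  refine norm_sum_le_of_le _ fun A _ => ?_
  rw [map_sum, Finset.sum_mul]
  refine norm_sum_le_of_le _ fun B _ => ?_
  rw [map_smul, smul_eq_mul, norm_mul, norm_neg, ← Complex.ofReal_mul, Complex.norm_real,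
    Real.norm_eq_abs, mul_assoc]
  refine mul_le_mul_of_nonneg_left ?_ (abs_nonneg _)
  rw [Fin.sum_univ_two, map_add]
  refine (norm_add_le_of_le (norm_coeff_X_mul_pd_le hK hf hm)
    (norm_coeff_X_mul_pd_le hK hf hm)).trans_eq ?_
  ring

/-- Smooth sections that are parallel and vanish at a point vanish on star-shaped sets. -/
theorem parallel_eq_zero (hω : ∀ μ A B, SmoothFun fun x => ω₀ μ x A B) {x₀ : U}
    (hs : StarConvex ℝ (x₀ : Fin d → ℝ) (U : Set (Fin d → ℝ))) {f : U → YSeries d}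
    (hf : SmoothSeries f) (heq : ∀ μ x, dX μ f x + RYop (ω₀ μ x) (f x) = 0) (h0 : f x₀ = 0)
    (x : U) : f x = 0 := by
  ext m₀
  set N := m₀.degree with hN
  -- As the connection preserves the degree, the coefficients of degree at most N satisfy a closed
  -- finite linear system along the segment from x₀ to x.
  set S : Finset (Osc d →₀ ℕ) := (Finsupp.finite_of_degree_le N).toFinset with hS
  have hmS : ∀ {m : Osc d →₀ ℕ}, m ∈ S ↔ m.degree ≤ N := by simp [hS]
  set v : Fin d → ℝ := x - x₀ with hv
  set γ : ℝ → Fin d → ℝ := fun t => x₀ + t • v with hγ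
  have hγc : Continuous γ := by fun_prop
  have hγU : ∀ t ∈ Icc (0 : ℝ) 1, γ t ∈ U := fun t ht => hs.add_smul_sub_mem x.2 ht.1 ht.2
  set F : (Osc d →₀ ℕ) → (Fin d → ℝ) → ℂ := fun m => extendZero fun x => coeff m (f x) with hF
  have hdF : ∀ t ∈ Icc (0 : ℝ) 1, ∀ m, HasDerivAt (fun t => F m (γ t))
      (fderiv ℝ (F m) (γ t) v) t := fun t ht m => by
    have h1 : HasFDerivAt (F m) (fderiv ℝ (F m) (γ t)) (γ t) :=
      ((hf m).differentiableAt ⟨γ t, hγU t ht⟩).hasFDerivAt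
    have h2 : HasDerivAt γ v t :=
      (((hasDerivAt_id t).smul_const v).const_add _).congr_deriv (one_smul _ _)
    exact h1.comp_hasDerivAt t h2
  have hder : ∀ (t : ℝ) (ht : t ∈ Icc (0 : ℝ) 1) m, fderiv ℝ (F m) (γ t) v
      = -∑ μ, v μ • coeff m (RYop (ω₀ μ ⟨γ t, hγU t ht⟩) (f ⟨γ t, hγU t ht⟩)) := fun t ht m => by
    rw [clm_apply_eq_sum, ← Finset.sum_neg_distrib]
    refine Finset.sum_congr rfl fun μ _ => ?_
    have h1 := congrArg (coeff m) (heq μ ⟨γ t, hγU t ht⟩)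
    rw [map_add, coeff_dX, map_zero] at h1
    rw [← smul_neg, ← eq_neg_of_add_eq_zero_left h1]
    rfl
  have hc : ContinuousOn (fun t => ∑ μ, |v μ| * ∑ A, ∑ B,
      |extendZero (fun x => ω₀ μ x A B) (γ t) * sg B| * (2 * ((N : ℝ) + 1))) (Icc 0 1) := by
    refine continuousOn_finset_sum _ fun μ _ => continuousOn_const.mul <|
      continuousOn_finset_sum _ fun A _ => continuousOn_finset_sum _ fun B _ => ?_
    have h1 : ContinuousOn (fun t => extendZero (fun x => ω₀ μ x A B) (γ t)) (Icc 0 1) :=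
      (ContDiffOn.continuousOn (hω μ A B)).comp hγc.continuousOn hγU
    exact ((h1.mul continuousOn_const).abs).mul continuousOn_const
  obtain ⟨K, hK⟩ := isCompact_Icc.exists_bound_of_continuousOn hc
  -- Grönwall for the vector of these coefficients in the sup norm, with zero initial value.
  have key := eq_zero_of_abs_deriv_le_mul_abs_self_of_eq_zero_right
    (f := fun t => fun m : S => F m (γ t)) (f' := fun t => fun m : S => fderiv ℝ (F m) (γ t) v)
    (a := 0) (b := 1) (K := K)
    (continuousOn_pi.2 fun m t ht => (hdF t ht m).continuousAt.continuousWithinAt)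
    (fun t ht => hasDerivWithinAt_pi.2 fun m => (hdF t ⟨ht.1, ht.2.le⟩ m).hasDerivWithinAt)
    (by
      funext m
      simp only [hγ, zero_smul, add_zero, hF, extendZero_coe, h0, map_zero, Pi.zero_apply])
    (fun t ht => by
      have ht' : t ∈ Icc (0 : ℝ) 1 := ⟨ht.1, ht.2.le⟩
      set z : U := ⟨γ t, hγU t ht'⟩ with hz
      set g : S → ℂ := fun m => F m (γ t) with hg
      have hb : ∀ m : Osc d →₀ ℕ, m.degree ≤ N → ‖coeff m (f z)‖ ≤ ‖g‖ := fun m hm => by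
        have := norm_le_pi_norm g ⟨m, hmS.2 hm⟩
        have e : g ⟨m, hmS.2 hm⟩ = coeff m (f z) :=
          extendZero_coe (fun x => coeff m (f x)) z
        rwa [e] at this
      have hKt := (le_abs_self _).trans (hK t ht')
      refine (pi_norm_le_iff_of_nonneg ?_).2 fun m => ?_
      · refine mul_nonneg (le_trans ?_ hKt) (norm_nonneg _)
        positivity
      · rw [hder t ht', norm_neg]
        refine le_trans ?_ (mul_le_mul_of_nonneg_right hKt (norm_nonneg g))
        rw [Finset.sum_mul]
        refine norm_sum_le_of_le _ fun μ _ => ?_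
        rw [norm_smul, Real.norm_eq_abs, mul_assoc]
        refine mul_le_mul_of_nonneg_left ?_ (abs_nonneg _)
        refine (norm_coeff_RYop_le (norm_nonneg g) hb (hmS.1 m.2)).trans_eq ?_
        have e : ∀ A B, extendZero (fun x => ω₀ μ x A B) (γ t) = ω₀ μ z A B := fun A B =>
          extendZero_coe (fun x => ω₀ μ x A B) z
        simp only [e]
        rfl)
    1 (by simp)
  have h1 := congrFun key ⟨m₀, hmS.2 le_rfl⟩
  have hγ1 : γ 1 = x := by simp [hγ, hv]
  simp only [hγ1, hF, extendZero_coe] at h1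
  rw [h1, map_zero]; rfl

end HigherSpin

end

/-! ### Parallel sections: existence and star products -/

noncomputable section

namespace HigherSpin

open MvPowerSeries Set

variable {d : ℕ} {V : Fin (d + 1) → ℝ} {U : TopologicalSpace.Opens (Fin d → ℝ)}
  {ω₀ : Fin d → U → Matrix (Fin (d + 1)) (Fin (d + 1)) ℝ}

/-- Star commutators are derivations. -/
theorem gcomm_star {σ : Type*} [Fintype σ] {b : σ → σ → ℂ} {a f g : MvPowerSeries σ ℂ}
    (ha : IsPoly a) (hf : IsPoly f) (hg : IsPoly g) :
    gcomm b a (gstar b f g) = gstar b (gcomm b a f) g + gstar b f (gcomm b a g) := by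
  have h1 : gstar b (gcomm b a f) g = gstar b (gstar b a f) g - gstar b (gstar b f a) g :=
    (starR (b := b) g hg.rightGood).map_sub _ _
  have h2 : gstar b f (gcomm b a g) = gstar b f (gstar b a g) - gstar b f (gstar b g a) :=
    (starL (b := b) f hf.leftGood).map_sub _ _
  rw [h1, h2, gcomm, star_assoc_left ha (.inr hf.leftGood), star_assoc_middle ha (.inr hf.leftGood),
    star_assoc_left hf (.inr hg.leftGood)]
  abel

theorem RYop_star {w : Matrix (Fin (d + 1)) (Fin (d + 1)) ℝ} (hw : ∀ A B, w A B = -w B A)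
    {f g : YSeries d} (hf : IsPoly f) (hg : IsPoly g) :
    RYop w (gstar bY f g) = gstar bY (RYop w f) g + gstar bY f (RYop w g) := by
  simp only [← commY_Wm hw, commY_eq, gcomm_star (isPoly_Wm w) hf hg]

theorem RYop_X (w : Matrix (Fin (d + 1)) (Fin (d + 1)) ℝ) (k : Fin 2) (C : Fin (d + 1)) :
    RYop w (X (k, C) : YSeries d) = -∑ B, (w C B * sg B : ℂ) • X (k, B) := by
  apply emb_injective
  rw [emb_RYop, emb_X, ← neg_one_smul ℂ, emb_smul, emb_sum, neg_one_smul]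
  refine (Rop_yv w k C).trans ?_
  simp only [emb_smul, emb_X]; rfl

theorem RYop_one (w : Matrix (Fin (d + 1)) (Fin (d + 1)) ℝ) : RYop w (1 : YSeries d) = 0 := by
  simp [RYop_apply]

theorem isParallel_one : IsParallel ω₀ fun _ => (1 : YSeries d) where
  smooth := SmoothSeries.const 1
  poly _ := isPoly_one
  eq μ x := by rw [dX_const, RYop_one, add_zero]

theorem IsParallel.add {f g : U → YSeries d} (hf : IsParallel ω₀ f) (hg : IsParallel ω₀ g) :
    IsParallel ω₀ fun x => f x + g x where
  smooth := hf.smooth.add hg.smooth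
  poly x := (hf.poly x).add (hg.poly x)
  eq μ x := by
    rw [dX_add hf.smooth hg.smooth, map_add]
    linear_combination (exp := 1) hf.eq μ x + hg.eq μ x

theorem IsParallel.smul {f : U → YSeries d} (c : ℂ) (hf : IsParallel ω₀ f) :
    IsParallel ω₀ fun x => c • f x where
  smooth := hf.smooth.const_smul c
  poly x := (hf.poly x).smul c
  eq μ x := by rw [dX_const_smul _ hf.smooth, map_smul, ← smul_add, hf.eq, smul_zero]

theorem IsParallel.sub {f g : U → YSeries d} (hf : IsParallel ω₀ f) (hg : IsParallel ω₀ g) :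
    IsParallel ω₀ fun x => f x - g x := by
  simpa only [neg_smul, one_smul, ← sub_eq_add_neg] using hf.add (hg.smul (-1))

theorem isParallel_zero : IsParallel ω₀ fun _ => (0 : YSeries d) := by
  simpa using (isParallel_one (ω₀ := ω₀)).smul 0

theorem IsParallel.sum {ι : Type*} (s : Finset ι) {f : ι → U → YSeries d}
    (hf : ∀ i ∈ s, IsParallel ω₀ (f i)) : IsParallel ω₀ fun x => ∑ i ∈ s, f i x := by
  classical
  induction s using Finset.induction_on with
  | empty => simpa using isParallel_zero
  | insert a s ha ih =>
    simp only [Finset.sum_insert ha]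
    exact (hf a (Finset.mem_insert_self a s)).add (ih fun i hi => hf i (Finset.mem_insert_of_mem hi))

theorem IsParallel.ext (hω : ∀ μ A B, SmoothFun fun x => ω₀ μ x A B) {x₀ : U}
    (hs : StarConvex ℝ (x₀ : Fin d → ℝ) (U : Set (Fin d → ℝ))) {f g : U → YSeries d}
    (hf : IsParallel ω₀ f) (hg : IsParallel ω₀ g) (h : f x₀ = g x₀) (x : U) : f x = g x := by
  have h1 := hf.sub hg
  exact sub_eq_zero.1 (parallel_eq_zero hω hs h1.smooth h1.eq (sub_eq_zero.2 h) x)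

/-- Products of a parallel section with the parallel linear functions. -/
theorem IsParallel.frame_smul (hω : IsAdSConnection V ω₀) {M : U → Matrix (Fin (d + 1)) (Fin (d + 1)) ℝ}
    (hM : ∀ A B, SmoothFun fun x => M x A B)
    (hdM : ∀ μ x A B, partialX μ (fun x => M x A B) x = ∑ C, M x A C * (ω₀ μ x C B * sg B))
    {T : Fin (d + 1) → YSeries d →ₗ[ℂ] YSeries d} (hT : ∀ B, FinOrd (T B))
    (hTp : ∀ B f, IsPoly f → IsPoly (T B f))
    (hTR : ∀ w : Matrix (Fin (d + 1)) (Fin (d + 1)) ℝ, (∀ A B, w A B = -w B A) → ∀ A f, IsPoly f →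
      RYop w (T A f) = -∑ B, (w A B * sg B : ℂ) • T B f + T A (RYop w f))
    {g : U → YSeries d} (hg : IsParallel ω₀ g) (A : Fin (d + 1)) :
    IsParallel ω₀ fun x => ∑ B, (M x A B : ℂ) • T B (g x) where
  smooth := SmoothSeries.sum _ fun B _ => SmoothSeries.smul (hM A B).ofReal (hg.smooth.map (hT B))
  poly x := IsPoly.sum _ _ fun B _ => (hTp B _ (hg.poly x)).smul _
  eq μ x := by
    rw [dX_sum _ fun B _ => SmoothSeries.smul (hM A B).ofReal (hg.smooth.map (hT B)), map_sum]
    have e1 : ∀ B, dX μ (fun x => (M x A B : ℂ) • T B (g x)) x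
        = (∑ C, (M x A C * (ω₀ μ x C B * sg B) : ℂ) • T B (g x)) + (M x A B : ℂ) • T B (dX μ g x) :=
      fun B => by
        rw [dX_smul (hM A B).ofReal (hg.smooth.map (hT B)), partialX_ofReal (hM A B), hdM,
          dX_map (hT B) hg.smooth, ← Finset.sum_smul]
        push_cast; rfl
    have e2 : ∀ B, RYop (ω₀ μ x) ((M x A B : ℂ) • T B (g x))
        = -(∑ C, (M x A B * (ω₀ μ x B C * sg C) : ℂ) • T C (g x))
          + (M x A B : ℂ) • T B (RYop (ω₀ μ x) (g x)) := fun B => by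
      rw [map_smul, hTR _ (hω.antisymm μ x) B _ (hg.poly x), smul_add, smul_neg, Finset.smul_sum]
      simp only [smul_smul]
    simp only [e1, e2, Finset.sum_add_distrib, Finset.sum_neg_distrib]
    -- After renaming indices, the derivative of the frame cancels the rotation of the linear
    -- function produced by the connection.
    rw [Finset.sum_comm (f := fun B C => (M x A C * (ω₀ μ x C B * sg B) : ℂ) • T B (g x))]
    have e3 : ∑ B, (M x A B : ℂ) • T B (dX μ g x) + ∑ B, (M x A B : ℂ) • T B (RYop (ω₀ μ x) (g x))
        = 0 := by
      rw [← Finset.sum_add_distrib]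
      refine Finset.sum_eq_zero fun B _ => ?_
      rw [← smul_add, ← map_add, hg.eq, map_zero, smul_zero]
    linear_combination (exp := 1) e3

/-- The parallel linear functions are rows of the parallel frame applied to Y, and star
multiplication by them preserves parallel sections. Building f₀ from variables by star products
builds a parallel section. Closure under star multiplication on both sides is carried through the
same induction, using associativity. -/
theorem exists_parallel_star (hω : IsAdSConnection V ω₀) {x₀ : U}
    (hs : StarConvex ℝ (x₀ : Fin d → ℝ) (U : Set (Fin d → ℝ))) {f₀ : YSeries d} (hf₀ : IsPoly f₀) :
    ∃ f, IsParallel ω₀ f ∧ f x₀ = f₀ ∧ ∀ g, IsParallel ω₀ g →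
      IsParallel ω₀ (fun x => gstar bY (f x) (g x)) ∧
      IsParallel ω₀ fun x => gstar bY (g x) (f x) := by
  obtain ⟨M, hM, hM0, hdM⟩ := exists_parallel_frame hω hs
  have hl : ∀ (k : Fin 2) (A : Fin (d + 1)) g, IsParallel ω₀ g →
      IsParallel ω₀ fun x => ∑ B, (M x A B : ℂ) • gstar bY (X (k, B)) (g x) := fun k A g hg =>
    hg.frame_smul hω hM hdM (T := fun B => starL (b := bY) (X (k, B)) (isPoly_X _).leftGood)
      (fun B => finOrd_starL _) (fun B f hf => (isPoly_X _).star hf)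
      (fun w hw A f hf => by
        simp only [starL_apply]
        rw [RYop_star hw (isPoly_X _) hf, RYop_X, ← neg_one_smul ℂ, star_smul_left,
          Compat.sum_star (.inl hf.rightGood), neg_one_smul]
        simp only [star_smul_left]) A
  have hr : ∀ (k : Fin 2) (A : Fin (d + 1)) g, IsParallel ω₀ g →
      IsParallel ω₀ fun x => ∑ B, (M x A B : ℂ) • gstar bY (g x) (X (k, B)) := fun k A g hg =>
    hg.frame_smul hω hM hdM (T := fun B => starR (b := bY) (X (k, B)) (isPoly_X _).rightGood)
      (fun B => finOrd_starR _) (fun B f hf => hf.star (isPoly_X _))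
      (fun w hw A f hf => by
        simp only [starR_apply]
        rw [RYop_star hw hf (isPoly_X _), RYop_X, ← neg_one_smul ℂ, star_smul_right,
          ← star_flip bY f, Compat.sum_star (.inl hf.leftGood), neg_one_smul, add_comm]
        simp only [star_smul_left, star_flip]) A
  refine hf₀.star_induction (b := bY) (P := fun f₀ => ∃ f, IsParallel ω₀ f ∧ f x₀ = f₀ ∧
    ∀ g, IsParallel ω₀ g → IsParallel ω₀ (fun x => gstar bY (f x) (g x)) ∧
      IsParallel ω₀ fun x => gstar bY (g x) (f x)) ?_ ?_ ?_ ?_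
  · refine ⟨_, isParallel_one, rfl, fun g hg => ?_⟩
    simp only [star_one_left, star_one_right]
    exact ⟨hg, hg⟩
  · rintro _ _ - - ⟨f, hf, rfl, h⟩ ⟨f', hf', rfl, h'⟩
    refine ⟨_, hf.add hf', rfl, fun g hg => ⟨?_, ?_⟩⟩
    · simp only [star_add_left' (.inr (hf.poly _).leftGood) (.inr (hf'.poly _).leftGood)]
      exact (h g hg).1.add (h' g hg).1
    · simp only [star_add_right' (.inl (hf.poly _).rightGood) (.inl (hf'.poly _).rightGood)]
      exact (h g hg).2.add (h' g hg).2
  · rintro c _ - ⟨f, hf, rfl, h⟩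
    refine ⟨_, hf.smul c, rfl, fun g hg => ?_⟩
    simp only [star_smul_left, star_smul_right]
    exact ⟨(h g hg).1.smul c, (h g hg).2.smul c⟩
  · rintro ⟨k, A⟩ _ - ⟨f, hf, rfl, h⟩
    refine ⟨_, hl k A f hf, ?_, fun g hg => ⟨?_, ?_⟩⟩
    · simp only [hM0]
      rw [Finset.sum_eq_single A (fun B _ hB => by rw [Matrix.one_apply_ne hB.symm]; simp)
        (by simp), Matrix.one_apply_eq, Complex.ofReal_one, one_smul]
    · have e : ∀ x, gstar bY (∑ B, (M x A B : ℂ) • gstar bY (X (k, B)) (f x)) (g x)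
          = ∑ B, (M x A B : ℂ) • gstar bY (X (k, B)) (gstar bY (f x) (g x)) := fun x => by
        rw [Compat.sum_star (.inl (hg.poly x).rightGood)]
        exact Finset.sum_congr rfl fun B _ => by
          rw [star_smul_left, star_assoc_left (isPoly_X _) (.inr (hf.poly x).leftGood)]
      simp only [e]
      exact hl k A _ (h g hg).1
    · have e : ∀ x, gstar bY (g x) (∑ B, (M x A B : ℂ) • gstar bY (X (k, B)) (f x))
          = gstar bY (∑ B, (M x A B : ℂ) • gstar bY (g x) (X (k, B))) (f x) := fun x => by
        rw [← star_flip, Compat.sum_star (.inl (hg.poly x).leftGood),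
          Compat.sum_star (.inl (hf.poly x).rightGood)]
        exact Finset.sum_congr rfl fun B _ => by
          rw [star_smul_left, star_smul_left, star_flip,
            star_assoc_left (hg.poly x) (.inl (hf.poly x).rightGood)]
      simp only [e]
      exact (h _ (hr k A g hg)).2

theorem exists_parallel (hω : IsAdSConnection V ω₀) {x₀ : U}
    (hs : StarConvex ℝ (x₀ : Fin d → ℝ) (U : Set (Fin d → ℝ))) {f₀ : YSeries d} (hf₀ : IsPoly f₀) :
    ∃ f, IsParallel ω₀ f ∧ f x₀ = f₀ := by
  obtain ⟨f, h1, h2, -⟩ := exists_parallel_star hω hs hf₀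
  exact ⟨f, h1, h2⟩

/-- By uniqueness f is the section constructed from its value at x₀, and that section has the
closure property by construction. -/
theorem IsParallel.star (hω : IsAdSConnection V ω₀) {x₀ : U}
    (hs : StarConvex ℝ (x₀ : Fin d → ℝ) (U : Set (Fin d → ℝ))) {f g : U → YSeries d}
    (hf : IsParallel ω₀ f) (hg : IsParallel ω₀ g) :
    IsParallel ω₀ fun x => starY (f x) (g x) := by
  obtain ⟨f', h1, h2, h3⟩ := exists_parallel_star hω hs (hf.poly x₀)
  obtain rfl : f' = f := funext (h1.ext hω.smooth hs hf h2)
  simp only [starY_eq]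
  exact (h3 g hg).1

theorem IsParallel.commY (hω : IsAdSConnection V ω₀) {x₀ : U}
    (hs : StarConvex ℝ (x₀ : Fin d → ℝ) (U : Set (Fin d → ℝ))) {f g : U → YSeries d}
    (hf : IsParallel ω₀ f) (hg : IsParallel ω₀ g) :
    IsParallel ω₀ fun x => HigherSpin.commY (f x) (g x) :=
  (hf.star hω hs hg).sub (hg.star hω hs hf)

theorem isPoly_tY (i j : Fin 2) : IsPoly (tY i j : YSeries d) := by
  refine IsPoly.sum _ _ fun A _ => ?_
  rw [lower_eq]; exact (isPoly_X _).mul ((isPoly_X _).smul _)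

theorem isParallel_tY (hω : IsAdSConnection V ω₀) (i j : Fin 2) :
    IsParallel ω₀ fun _ => (tY i j : YSeries d) where
  smooth := SmoothSeries.const _
  poly _ := isPoly_tY i j
  eq μ x := by
    apply emb_injective
    rw [dX_const, zero_add, ← commY_Wm (hω.antisymm μ x), commY, ← neg_sub, ← neg_one_smul ℂ,
      emb_smul]
    change (-1 : ℂ) • emb (HigherSpin.commY (tY i j) (Wm (ω₀ μ x))) = _
    rw [← sp2Act_emb, sp2Act_emb_Wm, smul_zero, emb_zero]

end HigherSpin

end

/-! ### Hermitian conjugation, invariance and reality of symbols -/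

noncomputable section

namespace HigherSpin

open MvPowerSeries Set

variable {d : ℕ} {V : Fin (d + 1) → ℝ} {U : TopologicalSpace.Opens (Fin d → ℝ)}
  {ω₀ : Fin d → U → Matrix (Fin (d + 1)) (Fin (d + 1)) ℝ}

/-! ### Hermitian conjugation of symbols -/

/-- The symbol `\bar f(iY)` of the Hermitian conjugate. -/
def conjY : YSeries d →ₛₗ[starRingEnd ℂ] YSeries d where
  toFun f := fun m => Complex.I ^ m.degree * starRingEnd ℂ (coeff m f)
  map_add' f g := by
    ext m
    change Complex.I ^ m.degree * starRingEnd ℂ (coeff m (f + g)) =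
      Complex.I ^ m.degree * starRingEnd ℂ (coeff m f)
        + Complex.I ^ m.degree * starRingEnd ℂ (coeff m g)
    rw [map_add, map_add, mul_add]
  map_smul' c f := by
    ext m
    change Complex.I ^ m.degree * starRingEnd ℂ (coeff m (c • f)) =
      starRingEnd ℂ c * (Complex.I ^ m.degree * starRingEnd ℂ (coeff m f))
    rw [map_smul, smul_eq_mul, map_mul]; ring

theorem coeff_conjY (f : YSeries d) (m : Osc d →₀ ℕ) :
    coeff m (conjY f) = Complex.I ^ m.degree * starRingEnd ℂ (coeff m f) := rfl

theorem conjY_one : conjY (1 : YSeries d) = 1 := by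
  classical
  ext m
  rw [coeff_conjY, coeff_one]
  split_ifs with h
  · subst h; simp
  · simp

theorem conjY_X_mul (s : Osc d) (f : YSeries d) :
    conjY (X s * f) = Complex.I • (X s * conjY f) := by
  ext m
  rw [coeff_conjY, map_smul, coeff_X_mul', coeff_X_mul', smul_eq_mul]
  split_ifs with h
  · obtain ⟨n, rfl⟩ := exists_add_of_le h
    rw [add_tsub_cancel_left, coeff_conjY, map_add, Finsupp.degree_single, add_comm, pow_succ]
    ring
  · simp

theorem pd_conjY (s : Osc d) (f : YSeries d) : pd s (conjY f) = Complex.I • conjY (pd s f) := by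
  ext m
  rw [coeff_pd, coeff_conjY, map_smul, smul_eq_mul, coeff_conjY, coeff_pd, map_add,
    Finsupp.degree_single, map_mul, pow_succ]
  simp only [map_add, map_natCast, map_one]
  ring

theorem isPoly_conjY {f : YSeries d} (hf : IsPoly f) : IsPoly (conjY f) :=
  hf.induction (P := fun f => IsPoly (conjY f)) (by rw [conjY_one]; exact isPoly_one)
    (fun f g h1 h2 => by rw [map_add]; exact h1.add h2)
    (fun c f h => by rw [map_smulₛₗ]; exact h.smul _)
    (fun s f _ h => by rw [conjY_X_mul]; exact ((isPoly_X s).mul h).smul _)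

theorem RYop_conjY (w : Matrix (Fin (d + 1)) (Fin (d + 1)) ℝ) (f : YSeries d) :
    RYop w (conjY f) = conjY (RYop w f) := by
  simp only [RYop_apply, map_sum, map_smulₛₗ, conjY_X_mul, pd_conjY, mul_smul_comm]
  refine Finset.sum_congr rfl fun A _ => Finset.sum_congr rfl fun B _ => ?_
  rw [map_neg, map_mul, Complex.conj_ofReal, Complex.conj_ofReal]

theorem IsParallel.conjY {f : U → YSeries d} (hf : IsParallel ω₀ f) :
    IsParallel ω₀ fun x => conjY (f x) := by
  have hs : ∀ m, SmoothFun fun x => starRingEnd ℂ (coeff m (f x)) := fun m =>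
    (hf.smooth m).clm Complex.conjCLE.toContinuousLinearMap
  refine ⟨fun m => (SmoothFun.const _).mul (hs m), fun x => isPoly_conjY (hf.poly x),
    fun μ x => ?_⟩
  have h1 : dX μ (fun x => HigherSpin.conjY (f x)) x = HigherSpin.conjY (dX μ f x) := by
    ext m
    rw [coeff_dX, coeff_conjY, coeff_dX]
    simp only [coeff_conjY]
    rw [partialX_mul (SmoothFun.const _) (hs m), partialX_const, zero_mul, zero_add]
    congr 1
    exact partialX_clm (hf.smooth m) Complex.conjCLE.toContinuousLinearMap μ x
  rw [h1, RYop_conjY, ← map_add, hf.eq, map_zero]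

theorem conj_bY (p q : Osc d) : starRingEnd ℂ (bY p q) = bY p q := Complex.conj_ofReal _

/-- The derivative term acquires the square of i, and this sign is the antisymmetry of the
contraction matrix. Conjugation therefore reverses star products. -/
theorem conjY_X_star (p : Osc d) (f : YSeries d) :
    conjY (gstar bY (X p) f) = Complex.I • gstar bY (conjY f) (X p) := by
  rw [X_star, star_X, map_add, conjY_X_mul, dB_apply, dB_apply, map_sum, smul_add, Finset.smul_sum]
  congr 1
  refine Finset.sum_congr rfl fun q _ => ?_
  rw [map_smulₛₗ, conj_bY, pd_conjY, smul_smul, smul_smul]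
  congr 1
  have h := bY_swap p q
  linear_combination -Complex.I * Complex.I * h + bY p q * Complex.I_mul_I

theorem conjY_star {f g : YSeries d} (hf : IsPoly f) (hg : IsPoly g) :
    conjY (gstar bY f g) = gstar bY (conjY g) (conjY f) := by
  have hg' := isPoly_conjY hg
  refine hf.star_induction (b := bY)
    (P := fun f => conjY (gstar bY f g) = gstar bY (conjY g) (conjY f)) ?_ ?_ ?_ ?_
  · rw [star_one_left, conjY_one, star_one_right]
  · intro f f' hf hf' h h'
    rw [star_add_left' (.inl hg.rightGood) (.inl hg.rightGood), map_add, h, h', map_add,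
      star_add_right' (.inr hg'.leftGood) (.inr hg'.leftGood)]
  · intro c f _ h
    rw [star_smul_left, map_smulₛₗ, h, map_smulₛₗ, star_smul_right]
  · intro s f hf h
    rw [star_assoc_left (isPoly_X s) (.inl hg.rightGood), conjY_X_star, h, conjY_X_star,
      star_smul_right, star_assoc_right (isPoly_X s) (.inr hg'.leftGood)]

/-! ### Even symbols -/

theorem coeff_X_mul_pd_self (s : Osc d) (f : YSeries d) (m : Osc d →₀ ℕ) :
    coeff m (X s * pd s f) = (m s : ℂ) * coeff m f := by
  rw [coeff_X_mul_pd]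
  split_ifs with h
  · obtain ⟨n, rfl⟩ := exists_add_of_le h
    rw [add_tsub_cancel_left, add_comm n, Finsupp.add_apply, Finsupp.single_eq_same, mul_comm,
      add_comm 1]
  · rw [Finsupp.single_le_iff, Nat.one_le_iff_ne_zero, not_not] at h
    rw [h, Nat.cast_zero, zero_mul]

theorem commY_tY_zero_one (f : YSeries d) : commY (tY 0 1) f
    = ∑ A, (X (1, A) * pd (1, A) f - X (0, A) * pd (0, A) f) := by
  apply emb_injective
  rw [← sp2Act_emb, sp2Act, emb_sum]
  refine Finset.sum_congr rfl fun A _ => ?_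
  simp only [eY_one, eY_zero, eZ_one, eZ_zero, emb_sub, emb_mul, emb_X, pd_inr_emb, pd_inl_emb,
    neg_zero, mul_zero, add_zero, yv]
  ring

/-- The generator t_12 counts the oscillators of one sp(2) index minus those of the other.
Invariance forces equal numbers, hence even total degree. -/
theorem even_of_sp2 {f : YSeries d} (hf : commY (tY 0 1) f = 0) {m : Osc d →₀ ℕ}
    (hm : coeff m f ≠ 0) : Even m.degree := by
  have h := congrArg (coeff m) hf
  rw [commY_tY_zero_one, map_sum, map_zero] at h
  simp only [map_sub, coeff_X_mul_pd_self, ← sub_mul, ← Finset.sum_mul] at h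
  have h1 := (mul_eq_zero.1 h).resolve_right hm
  rw [Finset.sum_sub_distrib, sub_eq_zero] at h1
  have h2 : ∑ A, m (1, A) = ∑ A, m (0, A) := by exact_mod_cast h1
  rw [Finsupp.degree_eq_sum, Fintype.sum_prod_type, Fin.sum_univ_two, h2]
  exact ⟨_, rfl⟩

/-- The two reality conditions put the power of i on opposite sides; they agree because the degree
is even, so that this power is its own inverse. -/
theorem isReal_emb_iff {f : YSeries d} (hf : commY (tY 0 1) f = 0) :
    IsReal (emb f) ↔ conjY f = -f := by
  have key : ∀ n : Osc d →₀ ℕ, starRingEnd ℂ (coeff n f) = -(Complex.I ^ n.degree * coeff n f)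
      ↔ Complex.I ^ n.degree * starRingEnd ℂ (coeff n f) = -coeff n f := fun n => by
    by_cases h : coeff n f = 0
    · simp [h]
    · obtain ⟨k, hk⟩ := even_of_sp2 hf h
      have hI : Complex.I ^ n.degree * Complex.I ^ n.degree = 1 := by
        rw [hk, ← two_mul, pow_mul, Complex.I_sq, ← mul_pow]; norm_num
      constructor
      · intro h1; rw [h1]; linear_combination -(coeff n f) * hI
      · intro h1
        linear_combination Complex.I ^ n.degree * h1 - starRingEnd ℂ (coeff n f) * hI
  have hdeg : ∀ n : Osc d →₀ ℕ,
      (∑ p, n.embDomain (Function.Embedding.inr : Osc d ↪ Osc d ⊕ Osc d) (Sum.inl p) = 0) ∧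
      ∑ p, n.embDomain (Function.Embedding.inr : Osc d ↪ Osc d ⊕ Osc d) (Sum.inr p) = n.degree :=
    fun n => by
      constructor
      · exact Finset.sum_eq_zero fun p _ => Finsupp.embDomain_of_notMem_range _ _ _ (by simp)
      · rw [Finsupp.degree_eq_sum]
        exact Finset.sum_congr rfl fun p _ => Finsupp.embDomain_apply_self _ n p
  constructor
  · intro h
    ext n
    rw [coeff_conjY, map_neg, ← key]
    have h1 := h (n.embDomain Function.Embedding.inr)
    rwa [coeff_emb, (hdeg n).1, (hdeg n).2, pow_zero, one_mul] at h1
  · intro h m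
    obtain ⟨n, rfl⟩ | ⟨p, hp⟩ := exists_embDomain_or m
    · rw [coeff_emb, (hdeg n).1, (hdeg n).2, pow_zero, one_mul, key, ← coeff_conjY, h, map_neg]
    · rw [coeff_eq_zero_of_pd_inl (fun p => pd_inl_emb p _) hp]; simp

/-! ### Symbols of the higher spin algebra -/

theorem isHuSymbol_iff {f : YSeries d} : IsHuSymbol f ↔
    IsPoly f ∧ (∀ i j, commY (tY i j) f = 0) ∧ conjY f = -f :=
  ⟨fun h => ⟨h.poly, h.sp2, (isReal_emb_iff (h.sp2 0 1)).1 h.isReal⟩,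
    fun h => ⟨h.1, h.2.1, (isReal_emb_iff (h.2.1 0 1)).2 h.2.2⟩⟩

theorem commY_add_right {a : YSeries d} (ha : IsPoly a) (f g : YSeries d) :
    commY a (f + g) = commY a f + commY a g := by
  simp only [commY_eq, ← ad_apply ha, map_add]

theorem commY_smul_right {a : YSeries d} (ha : IsPoly a) (c : ℂ) (f : YSeries d) :
    commY a (c • f) = c • commY a f := by
  simp only [commY_eq, ← ad_apply ha, map_smul]

theorem isPoly_commY {a f : YSeries d} (ha : IsPoly a) (hf : IsPoly f) : IsPoly (commY a f) := by
  rw [commY_eq, gcomm]; exact (ha.star hf).sub (hf.star ha)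

theorem IsHuSymbol.add {f g : YSeries d} (hf : IsHuSymbol f) (hg : IsHuSymbol g) :
    IsHuSymbol (f + g) := by
  rw [isHuSymbol_iff] at *
  refine ⟨hf.1.add hg.1, fun i j => ?_, ?_⟩
  · rw [commY_add_right (isPoly_tY i j), hf.2.1, hg.2.1, add_zero]
  · rw [map_add, hf.2.2, hg.2.2, neg_add]

theorem IsHuSymbol.real_smul {f : YSeries d} (c : ℝ) (hf : IsHuSymbol f) :
    IsHuSymbol ((c : ℂ) • f) := by
  rw [isHuSymbol_iff] at *
  refine ⟨hf.1.smul _, fun i j => ?_, ?_⟩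
  · rw [commY_smul_right (isPoly_tY i j), hf.2.1, smul_zero]
  · rw [map_smulₛₗ, hf.2.2, Complex.conj_ofReal, smul_neg]

theorem IsHuSymbol.commY {f g : YSeries d} (hf : IsHuSymbol f) (hg : IsHuSymbol g) :
    IsHuSymbol (HigherSpin.commY f g) := by
  rw [isHuSymbol_iff] at *
  refine ⟨isPoly_commY hf.1 hg.1, fun i j => ?_, ?_⟩
  · have h1 := hf.2.1 i j
    have h2 := hg.2.1 i j
    rw [commY_eq] at h1 h2
    rw [commY_eq, commY_eq, gcomm_jacobi (isPoly_tY i j) hf.1, h1, h2, ← ad_apply hf.1, map_zero,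
      add_zero, ← zero_smul ℂ (0 : YSeries d), gcomm_smul_left, zero_smul, zero_smul]
  · rw [commY_eq, gcomm, map_sub, conjY_star hf.1 hg.1, conjY_star hg.1 hf.1, hf.2.2, hg.2.2]
    simp only [← neg_one_smul ℂ f, ← neg_one_smul ℂ g, star_smul_left, star_smul_right]
    module

/-- Membership in the higher spin algebra is preserved by parallel transport. -/
theorem IsParallel.isHuSymbol (hω : IsAdSConnection V ω₀) {x₀ : U}
    (hs : StarConvex ℝ (x₀ : Fin d → ℝ) (U : Set (Fin d → ℝ))) {f : U → YSeries d}
    (hf : IsParallel ω₀ f) (h : IsHuSymbol (f x₀)) (x : U) : IsHuSymbol (f x) := by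
  rw [isHuSymbol_iff] at *
  -- Each condition states that a parallel section vanishes, namely the commutator with the parallel
  -- t_ij or the sum of f and its conjugate. It holds everywhere once it holds at x₀.
  refine ⟨hf.poly x, fun i j => ?_, ?_⟩
  · exact ((isParallel_tY hω i j).commY hω hs hf).ext hω.smooth hs isParallel_zero (h.2.1 i j) x
  · have h1 := (hf.conjY.add hf).ext hω.smooth hs isParallel_zero
      (by rw [h.2.2, neg_add_cancel]) x
    exact eq_neg_of_add_eq_zero_left h1

/-- The coefficients g^{ij} at x₀ are extended to parallel sections; t_ij is constant and parallel,
so both factorizations propagate by uniqueness. -/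
theorem IsParallel.isIdealSymbol (hω : IsAdSConnection V ω₀) {x₀ : U}
    (hs : StarConvex ℝ (x₀ : Fin d → ℝ) (U : Set (Fin d → ℝ))) {f : U → YSeries d}
    (hf : IsParallel ω₀ f) (h : IsIdealSymbol (f x₀)) (x : U) : IsIdealSymbol (f x) := by
  obtain ⟨g, hg, h1, h2⟩ := h
  choose G hG hG0 using fun i j => exists_parallel hω hs (hg i j)
  have hT := isParallel_tY hω
  refine ⟨fun i j => G i j x, fun i j => (hG i j).poly x, ?_, ?_⟩
  · refine hf.ext hω.smooth hs (IsParallel.sum _ fun i _ => IsParallel.sum _ fun j _ =>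
      (hT i j).star hω hs (hG i j)) ?_ x
    simp only [hG0]; exact h1
  · refine hf.ext hω.smooth hs (IsParallel.sum _ fun i _ => IsParallel.sum _ fun j _ =>
      (hG i j).star hω hs (hT i j)) ?_ x
    simp only [hG0]; exact h2

theorem isPoly_projY {f : ZYSeries d} (hf : IsPoly f) : IsPoly (projY f) := by
  simp only [← projL_apply]
  refine hf.induction (P := fun f => IsPoly (projL f)) ?_ ?_ ?_ ?_
  · rw [projL_apply, ← emb_one, projY_emb]; exact isPoly_one
  · intro f g h1 h2; rw [map_add]; exact h1.add h2
  · intro c f h; rw [map_smul]; exact h.smul c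
  · rintro (p | p) f - h
    · rw [projL_apply, projY_mul, show X (Sum.inl p) = zv p.1 p.2 from rfl, projY_zv, zero_mul]
      exact isPoly_zero
    · rw [projL_apply, projY_mul, show X (Sum.inr p) = yv p.1 p.2 from rfl, projY_yv]
      exact (isPoly_X _).mul h

/-- Vacuum symmetries are parallel sections of the higher spin algebra. -/
theorem isVacuumSymmetry_iff (hω : IsAdSConnection V ω₀) {ε : U → ZYSeries d} :
    IsVacuumSymmetry ω₀ ε ↔ ∃ f, IsParallel ω₀ f ∧ (∀ x, IsHuSymbol (f x)) ∧
      ε = fun x => emb (f x) := by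
  have hcomm : ∀ (μ : Fin d) x (f : YSeries d), comm (emb (W0 ω₀ μ x)) (emb f)
      = emb (RYop (ω₀ μ x) f) := fun μ x f => by
    rw [← emb_commY, W0_eq, commY_Wm (hω.antisymm μ x)]
  constructor
  · intro h
    have he : ∀ x, emb (projY (ε x)) = ε x := fun x => emb_projY fun p => by
      rw [← comm_S0]; exact h.onS p x
    have hsm : SmoothSeries fun x => projY (ε x) := by
      simpa only [projL_apply] using h.smooth.map finOrd_projL
    refine ⟨fun x => projY (ε x), ⟨hsm, fun x => isPoly_projY (h.poly x), fun μ x => ?_⟩,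
      fun x => ⟨isPoly_projY (h.poly x), fun i j => ?_, ?_⟩, funext fun x => (he x).symm⟩
    · apply emb_injective
      rw [emb_add, emb_zero, ← hcomm, ← dX_emb hsm]
      simp only [he]
      exact h.onW μ x
    · apply emb_injective
      rw [← sp2Act_emb, he, ← comm_tTot, h.sp2, emb_zero]
    · rw [he]; exact h.isReal x
  · rintro ⟨f, hf, hh, rfl⟩
    refine ⟨smooth_emb hf.smooth, fun x => emb_isPoly (hf.poly x), fun i j x => ?_,
      fun x => (hh x).isReal, fun p x => ?_, fun μ x => ?_⟩
    · rw [comm_tTot, sp2Act_emb, (hh x).sp2, emb_zero]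
    · rw [comm_S0, pd_inl_emb]
    · rw [dX_emb hf.smooth, hcomm, ← emb_add, hf.eq, emb_zero]

end HigherSpin

end

/-! ### The Weyl algebra and its symbols -/

noncomputable section

namespace HigherSpin

open MvPowerSeries

variable {d : ℕ}

/-! ### Symbols of operators -/

/-- Left star multiplication by the oscillators, as a representation of the free algebra. -/
def rhoFree (d : ℕ) : FreeAlgebra ℂ (Osc d) →ₐ[ℂ] Module.End ℂ (YSeries d) :=
  FreeAlgebra.lift ℂ fun p => starL (b := bY) (X p) (isPoly_X p).leftGood

theorem rhoFree_ι (p : Osc d) (f : YSeries d) :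
    rhoFree d (FreeAlgebra.ι ℂ p) f = gstar bY (X p) f := by
  rw [rhoFree, FreeAlgebra.lift_ι_apply]; rfl

theorem two_mul_bY (p q : Osc d) : 2 * bY p q = ((eps p.1 q.1 * eta p.2 q.2 : ℝ) : ℂ) := by
  unfold bY; push_cast; ring

theorem gcomm_X_X_star (p q : Osc d) (f : YSeries d) :
    gstar bY (X p) (gstar bY (X q) f) - gstar bY (X q) (gstar bY (X p) f)
      = (2 * bY p q) • f := by
  have h : ∀ p q : Osc d, gstar bY (X p) (gstar bY (X q) f)
      = gstar bY (X p * X q) f + bY p q • f := fun p q => by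
    rw [← star_assoc_X_left (.inr (isPoly_X q).leftGood), X_star, dB_X,
      star_add_left' (.inr ((isPoly_X p).mul (isPoly_X q)).leftGood)
        (.inr (isPoly_one.smul _).leftGood), star_smul_left, star_one_left]
  rw [h p q, h q p, mul_comm (X q), bY_swap p q]
  module

theorem rhoFree_rel ⦃a b : FreeAlgebra ℂ (Osc d)⦄ (h : WeylRel d a b) :
    rhoFree d a = rhoFree d b := by
  obtain ⟨p, q⟩ := h
  refine LinearMap.ext fun f => ?_
  rw [map_sub, map_mul, map_mul, LinearMap.sub_apply, Module.End.mul_apply, Module.End.mul_apply,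
    rhoFree_ι, rhoFree_ι, rhoFree_ι, rhoFree_ι, gcomm_X_X_star, AlgHom.commutes,
    Module.algebraMap_end_apply, two_mul_bY]

/-- The representation of the Weyl algebra by left star multiplication. -/
def rho (d : ℕ) : Weyl d →ₐ[ℂ] Module.End ℂ (YSeries d) :=
  RingQuot.liftAlgHom ℂ ⟨rhoFree d, rhoFree_rel⟩

theorem rho_mk (a : FreeAlgebra ℂ (Osc d)) : rho d (weylMk d a) = rhoFree d a :=
  RingQuot.liftAlgHom_mkAlgHom_apply _ _ _ _

theorem weylMk_surjective : Function.Surjective (weylMk d) := RingQuot.mkAlgHom_surjective _ _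

/-- Induction on elements of the Weyl algebra. -/
theorem Weyl.induction {P : Weyl d → Prop} (scalar : ∀ c : ℂ, P (algebraMap ℂ _ c))
    (gen : ∀ p, P (Yhat p)) (mul : ∀ a b, P a → P b → P (a * b))
    (add : ∀ a b, P a → P b → P (a + b)) (a : Weyl d) : P a := by
  obtain ⟨x, rfl⟩ := weylMk_surjective a
  induction x using FreeAlgebra.induction with
  | grade0 c => rw [AlgHom.commutes]; exact scalar c
  | grade1 p => exact gen p
  | mul x y hx hy => rw [map_mul]; exact mul _ _ hx hy
  | add x y hx hy => rw [map_add]; exact add _ _ hx hy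

theorem rho_Yhat (p : Osc d) (f : YSeries d) : rho d (Yhat p) f = gstar bY (X p) f := by
  rw [Yhat, rho_mk, rhoFree_ι]

/-- The Weyl symbol of an operator. -/
def symb : Weyl d →ₗ[ℂ] YSeries d := (LinearMap.applyₗ (1 : YSeries d)) ∘ₗ (rho d).toLinearMap

theorem symb_apply (a : Weyl d) : symb a = rho d a 1 := rfl

theorem symb_Yhat (p : Osc d) : symb (Yhat p) = X p := by
  rw [symb_apply, rho_Yhat, star_one_right]

theorem symb_algebraMap (c : ℂ) : symb (algebraMap ℂ (Weyl d) c) = c • 1 := by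
  rw [symb_apply, AlgHom.commutes, Module.algebraMap_end_apply]

/-- An operator acts by left star multiplication with its value on 1. This passes to products by
associativity and makes the symbol map multiplicative. -/
theorem isPoly_symb_and_rho (a : Weyl d) :
    IsPoly (symb a) ∧ ∀ f, rho d a f = gstar bY (symb a) f := by
  induction a using Weyl.induction with
  | scalar c =>
    rw [symb_algebraMap]
    refine ⟨isPoly_one.smul c, fun f => ?_⟩
    rw [AlgHom.commutes, Module.algebraMap_end_apply, star_smul_left, star_one_left]
  | gen p =>
    rw [symb_Yhat]
    exact ⟨isPoly_X p, rho_Yhat p⟩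
  | mul a b ha hb =>
    have e : symb (a * b) = gstar bY (symb a) (symb b) := by
      rw [symb_apply, map_mul, Module.End.mul_apply, ← symb_apply b, ha.2]
    refine ⟨e ▸ ha.1.star hb.1, fun f => ?_⟩
    rw [map_mul, Module.End.mul_apply, ha.2, hb.2, e, star_assoc_left ha.1 (.inr hb.1.leftGood)]
  | add a b ha hb =>
    rw [map_add]
    refine ⟨ha.1.add hb.1, fun f => ?_⟩
    rw [map_add, LinearMap.add_apply, ha.2, hb.2,
      star_add_left' (.inr ha.1.leftGood) (.inr hb.1.leftGood)]

theorem isPoly_symb (a : Weyl d) : IsPoly (symb a) := (isPoly_symb_and_rho a).1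

theorem symb_mul (a b : Weyl d) : symb (a * b) = gstar bY (symb a) (symb b) := by
  rw [symb_apply, map_mul, Module.End.mul_apply, ← symb_apply b, (isPoly_symb_and_rho a).2]

theorem exists_symb_eq {f : YSeries d} (hf : IsPoly f) : ∃ a : Weyl d, symb a = f :=
  hf.star_induction (b := bY) (P := fun f => ∃ a : Weyl d, symb a = f)
    ⟨algebraMap ℂ _ 1, by rw [symb_algebraMap, one_smul]⟩
    (by rintro _ _ - - ⟨a, rfl⟩ ⟨b, rfl⟩; exact ⟨a + b, map_add _ _ _⟩)
    (by rintro c _ - ⟨a, rfl⟩; exact ⟨c • a, map_smul _ _ _⟩)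
    (by rintro p _ - ⟨a, rfl⟩; exact ⟨Yhat p * a, by rw [symb_mul, symb_Yhat]⟩)

/-! ### Weyl ordering -/

/-- Symmetrized multiplication by an oscillator. -/
def jordanMul (p : Osc d) : Module.End ℂ (Weyl d) :=
  (1 / 2 : ℂ) • (LinearMap.mulLeft ℂ (Yhat p) + LinearMap.mulRight ℂ (Yhat p))

theorem jordanMul_apply (p : Osc d) (a : Weyl d) :
    jordanMul p a = (1 / 2 : ℂ) • (Yhat p * a + a * Yhat p) := rfl

theorem Yhat_mul_Yhat (p q : Osc d) : (Yhat p * Yhat q : Weyl d)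
    = Yhat q * Yhat p + (2 * bY p q) • 1 := by
  rw [two_mul_bY, ← sub_eq_iff_eq_add', Yhat_comm, Algebra.algebraMap_eq_smul_one]

/-- The commutator of two generators is a scalar. It enters with opposite signs from the left and
from the right multiplications. -/
theorem jordanMul_comm (p q : Osc d) :
    jordanMul p * jordanMul q = jordanMul q * (jordanMul p : Module.End ℂ (Weyl d)) := by
  refine LinearMap.ext fun a => ?_
  simp only [Module.End.mul_apply, jordanMul_apply, mul_smul_comm, smul_mul_assoc, ← smul_add,
    mul_add, add_mul, ← mul_assoc]
  have h1 := congrArg (· * a) (Yhat_mul_Yhat p q)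
  have h2 := congrArg (a * ·) (Yhat_mul_Yhat p q)
  simp only [add_mul, mul_add, smul_mul_assoc, mul_smul_comm, one_mul, mul_one,
    ← mul_assoc] at h1 h2
  rw [h1, h2]
  congr 2
  abel

/-- Symmetrized multiplications by generators commute, so polynomials act through the commutative
algebra they generate; evaluating on 1 gives symmetric ordering. -/
theorem exists_weylOrdering : ∃ o : MvPolynomial (Osc d) ℂ →ₗ[ℂ] Weyl d, o 1 = 1 ∧
    ∀ p f, o (MvPolynomial.X p * f) = jordanMul p (o f) := by
  set S : Set (Module.End ℂ (Weyl d)) := Set.range jordanMul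
  have := Algebra.isMulCommutative_adjoin ℂ (s := S) (by
    rintro _ ⟨p, rfl⟩ _ ⟨q, rfl⟩; exact jordanMul_comm p q)
  letI : CommRing (Algebra.adjoin ℂ S) :=
    { (Algebra.adjoin ℂ S).toRing with mul_comm := fun a b => this.is_comm.comm a b }
  let φ : MvPolynomial (Osc d) ℂ →ₐ[ℂ] Algebra.adjoin ℂ S :=
    MvPolynomial.aeval (S₁ := Algebra.adjoin ℂ S) fun p => ⟨jordanMul p, Algebra.subset_adjoin ⟨p, rfl⟩⟩
  refine ⟨(LinearMap.applyₗ (1 : Weyl d)) ∘ₗ (Algebra.adjoin ℂ S).val.toLinearMap ∘ₗ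
    φ.toLinearMap, ?_, fun p f => ?_⟩
  · change ((φ 1 : Algebra.adjoin ℂ S) : Module.End ℂ (Weyl d)) 1 = 1
    rw [map_one φ]; rfl
  · change ((φ (MvPolynomial.X p * f) : Algebra.adjoin ℂ S) : Module.End ℂ (Weyl d)) 1 = _
    rw [map_mul, MvPolynomial.aeval_X]; rfl

/-- The commutator with a generator is a derivation with scalar values on generators, so under
symmetric ordering it becomes a constant-coefficient derivation. -/
theorem Yhat_comm_weylOrdering {o : MvPolynomial (Osc d) ℂ →ₗ[ℂ] Weyl d} (h1 : o 1 = 1)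
    (hX : ∀ p f, o (MvPolynomial.X p * f) = jordanMul p (o f)) (p : Osc d)
    (f : MvPolynomial (Osc d) ℂ) :
    Yhat p * o f - o f * Yhat p = ∑ q, (2 * bY p q) • o (MvPolynomial.pderiv q f) := by
  classical
  induction f using MvPolynomial.induction_on with
  | C c =>
    rw [← mul_one (MvPolynomial.C c), ← MvPolynomial.smul_eq_C_mul, map_smul, h1]
    simp
  | add f g hf hg =>
    simp only [map_add, mul_add, add_mul, smul_add, Finset.sum_add_distrib, ← hf, ← hg]
    abel
  | mul_X f q hf =>
    have e : ∀ r, MvPolynomial.pderiv r (f * MvPolynomial.X q)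
        = MvPolynomial.X q * MvPolynomial.pderiv r f + if r = q then f else 0 := fun r => by
      rw [Derivation.leibniz, MvPolynomial.pderiv_X, Pi.single_apply, smul_eq_mul, smul_eq_mul]
      by_cases h : r = q
      · subst h; simp; ring
      · rw [if_neg h, if_neg (fun h' => h h'.symm)]; ring
    have e2 : ∑ r, (2 * bY p r) • o (if r = q then f else 0) = (2 * bY p q) • o f := by
      rw [Finset.sum_eq_single q (fun r _ h => by simp [h]) (by simp), if_pos rfl]
    simp only [e, map_add, hX, smul_add, Finset.sum_add_distrib, e2]
    simp only [← map_smul (jordanMul q), ← map_sum, ← hf]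
    rw [mul_comm f, hX]
    simp only [jordanMul_apply]
    have h2 := congrArg (· * o f) (Yhat_mul_Yhat p q)
    have h3 := congrArg (o f * ·) (Yhat_mul_Yhat p q)
    simp only [add_mul, mul_add, smul_mul_assoc, mul_smul_comm, one_mul, mul_one,
      ← mul_assoc] at h2 h3
    simp only [mul_sub, sub_mul, mul_add, add_mul, smul_mul_assoc, mul_smul_comm, ← mul_assoc, h2,
      h3]
    module

/-- Left multiplication by a generator is symmetrized multiplication plus half the commutator, which
matches multiplication plus contraction in the star product. Products of operators follow by
associativity. -/
theorem weylOrdering_star {o : MvPolynomial (Osc d) ℂ →ₗ[ℂ] Weyl d} (h1 : o 1 = 1)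
    (hX : ∀ p f, o (MvPolynomial.X p * f) = jordanMul p (o f)) (a : Weyl d) :
    ∀ f : MvPolynomial (Osc d) ℂ, ∃ g : MvPolynomial (Osc d) ℂ,
      (g : YSeries d) = gstar bY (symb a) f ∧ a * o f = o g := by
  induction a using Weyl.induction with
  | scalar c =>
    refine fun f => ⟨c • f, ?_, ?_⟩
    · rw [symb_algebraMap, star_smul_left, star_one_left]; simp
    · rw [map_smul, Algebra.smul_def]
  | gen p =>
    refine fun f => ⟨MvPolynomial.X p * f + ∑ q, bY p q • MvPolynomial.pderiv q f, ?_, ?_⟩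
    · rw [symb_Yhat, X_star, dB_apply, MvPolynomial.coe_add, MvPolynomial.coe_mul,
        MvPolynomial.coe_X]
      congr 1
      have := map_sum (MvPolynomial.coeToMvPowerSeries.ringHom (σ := Osc d) (R := ℂ))
        (fun q => bY p q • MvPolynomial.pderiv q f) Finset.univ
      simp only [MvPolynomial.coeToMvPowerSeries.ringHom_apply] at this
      rw [this]
      refine Finset.sum_congr rfl fun q _ => ?_
      rw [MvPolynomial.coe_smul, pd_apply, pderiv_coe]
    · have h := Yhat_comm_weylOrdering h1 hX p f
      have h' : ∑ q, (2 * bY p q) • o (MvPolynomial.pderiv q f)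
          = (2 : ℂ) • ∑ q, bY p q • o (MvPolynomial.pderiv q f) := by
        rw [Finset.smul_sum]; exact Finset.sum_congr rfl fun q _ => by rw [smul_smul]
      rw [h'] at h
      rw [map_add, hX, map_sum, jordanMul_apply]
      simp only [map_smul]
      have h2 : ∑ q, bY p q • o (MvPolynomial.pderiv q f)
          = (1 / 2 : ℂ) • (Yhat p * o f - o f * Yhat p) := by
        rw [h, smul_smul]; norm_num
      rw [h2]; module
  | mul a b ha hb =>
    intro f
    obtain ⟨g, hg, hg'⟩ := hb f
    obtain ⟨k, hk, hk'⟩ := ha g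
    refine ⟨k, ?_, ?_⟩
    · rw [hk, hg, symb_mul, star_assoc_left (isPoly_symb a) (.inr (isPoly_symb b).leftGood)]
    · rw [mul_assoc, hg', hk']
  | add a b ha hb =>
    intro f
    obtain ⟨g, hg, hg'⟩ := ha f
    obtain ⟨k, hk, hk'⟩ := hb f
    refine ⟨g + k, ?_, ?_⟩
    · rw [MvPolynomial.coe_add, hg, hk, map_add,
        star_add_left' (.inr (isPoly_symb a).leftGood) (.inr (isPoly_symb b).leftGood)]
    · rw [add_mul, hg', hk', map_add]

/-- Applying `weylOrdering_star` to the polynomial 1 exhibits each operator as the symmetric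
ordering of its own symbol. -/
theorem symb_injective : Function.Injective (symb (d := d)) := by
  obtain ⟨o, h1, hX⟩ := exists_weylOrdering (d := d)
  refine (injective_iff_map_eq_zero _).2 fun a ha => ?_
  obtain ⟨g, hg, hg'⟩ := weylOrdering_star h1 hX a 1
  rw [MvPolynomial.coe_one, star_one_right, ha] at hg
  rw [h1, mul_one] at hg'
  rw [hg', MvPolynomial.coe_injective _ _ (hg.trans MvPolynomial.coe_zero.symm), map_zero]

end HigherSpin

end

/-! ### Identification of the global symmetry algebra -/

noncomputable section

namespace HigherSpin

open MvPowerSeries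

variable {d : ℕ} {V : Fin (d + 1) → ℝ} {U : TopologicalSpace.Opens (Fin d → ℝ)}
  {ω₀ : Fin d → U → Matrix (Fin (d + 1)) (Fin (d + 1)) ℝ}

theorem symb_tHat (i j : Fin 2) : symb (tHat i j : Weyl d) = tY i j := by
  have h : ∀ A B : Fin (d + 1), symb (Yhat (i, A) * Yhat (j, B) + Yhat (j, B) * Yhat (i, A))
      = (2 : ℂ) • (X (i, A) * X (j, B)) := fun A B => by
    rw [map_add, symb_mul, symb_mul, symb_Yhat, symb_Yhat, X_star, X_star, dB_X, dB_X,
      bY_swap (i, A), mul_comm (X (j, B))]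
    module
  simp only [tHat, map_smul, map_sum, h]
  simp only [tY, lower, Finset.mul_sum, Finset.smul_sum, y₀, mul_smul_comm, smul_smul]
  refine Finset.sum_congr rfl fun A _ => Finset.sum_congr rfl fun B _ => ?_
  congr 1; ring

theorem symb_dagger (a : Weyl d) : symb (dagger a).unop = conjY (symb a) := by
  induction a using Weyl.induction with
  | scalar c =>
    rw [dagger_algebraMap, MulOpposite.unop_op, symb_algebraMap, symb_algebraMap, map_smulₛₗ,
      conjY_one]
  | gen p =>
    rw [Yhat, dagger_mk, daggerFree_ι, MulOpposite.unop_op, map_smul, ← Yhat, symb_Yhat,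
      ← mul_one (X p), conjY_X_mul, conjY_one]
  | mul a b ha hb =>
    rw [map_mul, MulOpposite.unop_mul, symb_mul, symb_mul, ha, hb,
      conjY_star (isPoly_symb a) (isPoly_symb b)]
  | add a b ha hb => rw [map_add, MulOpposite.unop_add, map_add, map_add, map_add, ha, hb]

theorem symb_commY (a b : Weyl d) : symb (a * b - b * a) = commY (symb a) (symb b) := by
  rw [map_sub, symb_mul, symb_mul, commY_eq, gcomm]

/-- The symbol map is injective and carries commutators to star commutators and † to conjugation of
symbols, so the defining conditions correspond one by one. -/
theorem mem_huInf_iff {a : Weyl d} : a ∈ huInf d ↔ IsHuSymbol (symb a) := by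
  rw [isHuSymbol_iff]
  change ((∀ i j, tHat i j * a = a * tHat i j) ∧ (dagger a).unop = -a) ↔ _
  have h1 : (∀ i j, tHat i j * a = a * tHat i j) ↔ ∀ i j, commY (tY i j) (symb a) = 0 := by
    refine forall_congr' fun i => forall_congr' fun j => ?_
    rw [← symb_tHat, ← symb_commY, map_eq_zero_iff _ symb_injective, sub_eq_zero]
  have h2 : (dagger a).unop = -a ↔ conjY (symb a) = -symb a := by
    rw [← symb_dagger, ← map_neg, symb_injective.eq_iff]
  rw [h1, h2]
  exact ⟨fun h => ⟨isPoly_symb a, h⟩, fun h => h.2⟩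

theorem mem_huIdeal_iff {a : huInf d} : a ∈ huIdeal d ↔ IsIdealSymbol (symb (a : Weyl d)) := by
  change (∃ g : Fin 2 → Fin 2 → Weyl d, (a : Weyl d) = ∑ i, ∑ j, tHat i j * g i j ∧
    (a : Weyl d) = ∑ i, ∑ j, g i j * tHat i j) ↔ _
  have e1 : ∀ g : Fin 2 → Fin 2 → Weyl d, symb (∑ i, ∑ j, tHat i j * g i j)
      = ∑ i, ∑ j, starY (tY i j) (symb (g i j)) := fun g => by
    simp only [map_sum, symb_mul, symb_tHat, starY_eq]
  have e2 : ∀ g : Fin 2 → Fin 2 → Weyl d, symb (∑ i, ∑ j, g i j * tHat i j)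
      = ∑ i, ∑ j, starY (symb (g i j)) (tY i j) := fun g => by
    simp only [map_sum, symb_mul, symb_tHat, starY_eq]
  constructor
  · rintro ⟨g, h1, h2⟩
    exact ⟨fun i j => symb (g i j), fun i j => isPoly_symb _, by rw [← e1, ← h1],
      by rw [← e2, ← h2]⟩
  · rintro ⟨g, hg, h1, h2⟩
    choose G hG using fun i j => exists_symb_eq (hg i j)
    simp only [← hG] at h1 h2
    exact ⟨G, symb_injective (h1.trans (e1 G).symm), symb_injective (h2.trans (e2 G).symm)⟩

open Classical in
/-- The class in the higher spin algebra of the operator with a given symbol. -/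
def huClass (f : YSeries d) : HU d :=
  if h : ∃ a : huInf d, symb (a : Weyl d) = f then LieSubmodule.Quotient.mk h.choose else 0

theorem huClass_symb (a : huInf d) :
    huClass (symb (a : Weyl d)) = LieSubmodule.Quotient.mk a := by
  have h : ∃ b : huInf d, symb (b : Weyl d) = symb (a : Weyl d) := ⟨a, rfl⟩
  rw [huClass, dif_pos h]
  congr 1
  exact Subtype.ext (symb_injective h.choose_spec)

theorem IsHuSymbol.exists_symb {f : YSeries d} (hf : IsHuSymbol f) :
    ∃ a : huInf d, symb (a : Weyl d) = f := by
  obtain ⟨a, rfl⟩ := exists_symb_eq hf.poly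
  exact ⟨⟨a, mem_huInf_iff.2 hf⟩, rfl⟩

theorem huClass_add {f g : YSeries d} (hf : IsHuSymbol f) (hg : IsHuSymbol g) :
    huClass (f + g) = huClass f + huClass g := by
  obtain ⟨a, rfl⟩ := hf.exists_symb
  obtain ⟨b, rfl⟩ := hg.exists_symb
  rw [huClass_symb, huClass_symb, ← map_add]
  exact huClass_symb (a + b)

theorem huClass_smul {f : YSeries d} (hf : IsHuSymbol f) (c : ℝ) :
    huClass ((c : ℂ) • f) = c • huClass f := by
  obtain ⟨a, rfl⟩ := hf.exists_symb
  rw [huClass_symb, ← map_smul]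
  exact huClass_symb (c • a)

theorem huClass_commY {f g : YSeries d} (hf : IsHuSymbol f) (hg : IsHuSymbol g) :
    huClass (commY f g) = ⁅huClass f, huClass g⁆ := by
  obtain ⟨a, rfl⟩ := hf.exists_symb
  obtain ⟨b, rfl⟩ := hg.exists_symb
  rw [huClass_symb, huClass_symb, ← symb_commY]
  exact huClass_symb ⁅a, b⁆

theorem huClass_eq_zero_iff {f : YSeries d} (hf : IsHuSymbol f) :
    huClass f = 0 ↔ IsIdealSymbol f := by
  obtain ⟨a, rfl⟩ := hf.exists_symb
  rw [huClass_symb, ← mem_huIdeal_iff]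
  exact LieSubmodule.Quotient.mk_eq_zero'

theorem exists_huClass_eq (h : HU d) : ∃ f : YSeries d, IsHuSymbol f ∧ huClass f = h := by
  obtain ⟨a, rfl⟩ := LieSubmodule.Quotient.surjective_mk' _ h
  exact ⟨symb (a : Weyl d), mem_huInf_iff.1 a.2, huClass_symb a⟩

/-! ### The global symmetry algebra -/

theorem IsVacuumSymmetry.exists_symbol (hω : IsAdSConnection V ω₀) {ε : U → ZYSeries d}
    (h : IsVacuumSymmetry ω₀ ε) (x : U) : ∃ f : YSeries d, IsHuSymbol f ∧ ε x = emb f := by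
  obtain ⟨f, -, hf, rfl⟩ := (isVacuumSymmetry_iff hω).1 h
  exact ⟨f x, hf x, rfl⟩

/-- Existence is parallel extension of f, which keeps the symbol conditions at every point;
uniqueness is that of parallel sections. -/
theorem existsUnique_vacuumSymmetry (hω : IsAdSConnection V ω₀) {x₀ : U}
    (hs : StarConvex ℝ (x₀ : Fin d → ℝ) (U : Set (Fin d → ℝ))) {f : YSeries d}
    (hf : IsHuSymbol f) : ∃! ε : U → ZYSeries d, IsVacuumSymmetry ω₀ ε ∧ ε x₀ = emb f := by
  obtain ⟨F, hF, rfl⟩ := exists_parallel hω hs hf.poly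
  refine ⟨fun x => emb (F x), ⟨(isVacuumSymmetry_iff hω).2
    ⟨F, hF, hF.isHuSymbol hω hs hf, rfl⟩, rfl⟩, ?_⟩
  rintro ε ⟨h, h0⟩
  obtain ⟨g, hg, -, rfl⟩ := (isVacuumSymmetry_iff hω).1 h
  funext x
  rw [hg.ext hω.smooth hs hF (emb_injective h0) x]

/-- The class of a vacuum symmetry in the higher spin algebra. -/
def vacuumClass (x₀ : U) (ε : U → ZYSeries d) : HU d := huClass (projY (ε x₀))

theorem vacuumSymmetry_add (hω : IsAdSConnection V ω₀) (x₀ : U) {ε₁ ε₂ : U → ZYSeries d}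
    (h₁ : IsVacuumSymmetry ω₀ ε₁) (h₂ : IsVacuumSymmetry ω₀ ε₂) :
    IsVacuumSymmetry ω₀ (ε₁ + ε₂) ∧
      vacuumClass x₀ (ε₁ + ε₂) = vacuumClass x₀ ε₁ + vacuumClass x₀ ε₂ := by
  obtain ⟨f, hf, hf', rfl⟩ := (isVacuumSymmetry_iff hω).1 h₁
  obtain ⟨g, hg, hg', rfl⟩ := (isVacuumSymmetry_iff hω).1 h₂
  have e : ((fun x => emb (f x)) + fun x => emb (g x) : U → ZYSeries d)
      = fun x => emb (f x + g x) := funext fun x => (emb_add _ _).symm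
  rw [e]
  refine ⟨(isVacuumSymmetry_iff hω).2 ⟨_, hf.add hg, fun x => (hf' x).add (hg' x), rfl⟩, ?_⟩
  simp only [vacuumClass, projY_emb]
  exact huClass_add (hf' x₀) (hg' x₀)

theorem vacuumSymmetry_smul (hω : IsAdSConnection V ω₀) (x₀ : U) (c : ℝ) {ε : U → ZYSeries d}
    (h : IsVacuumSymmetry ω₀ ε) : IsVacuumSymmetry ω₀ (fun x => (c : ℂ) • ε x) ∧
      vacuumClass x₀ (fun x => (c : ℂ) • ε x) = c • vacuumClass x₀ ε := by
  obtain ⟨f, hf, hf', rfl⟩ := (isVacuumSymmetry_iff hω).1 h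
  simp only [← emb_smul]
  refine ⟨(isVacuumSymmetry_iff hω).2 ⟨_, hf.smul _, fun x => (hf' x).real_smul c, rfl⟩, ?_⟩
  simp only [vacuumClass, projY_emb]
  exact huClass_smul (hf' x₀) c

theorem vacuumSymmetry_comm (hω : IsAdSConnection V ω₀) {x₀ : U}
    (hs : StarConvex ℝ (x₀ : Fin d → ℝ) (U : Set (Fin d → ℝ))) {ε₁ ε₂ : U → ZYSeries d}
    (h₁ : IsVacuumSymmetry ω₀ ε₁) (h₂ : IsVacuumSymmetry ω₀ ε₂) :
    IsVacuumSymmetry ω₀ (fun x => comm (ε₁ x) (ε₂ x)) ∧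
      vacuumClass x₀ (fun x => comm (ε₁ x) (ε₂ x)) = ⁅vacuumClass x₀ ε₁, vacuumClass x₀ ε₂⁆ := by
  obtain ⟨f, hf, hf', rfl⟩ := (isVacuumSymmetry_iff hω).1 h₁
  obtain ⟨g, hg, hg', rfl⟩ := (isVacuumSymmetry_iff hω).1 h₂
  simp only [← emb_commY]
  refine ⟨(isVacuumSymmetry_iff hω).2
    ⟨_, hf.commY hω hs hg, fun x => (hf' x).commY (hg' x), rfl⟩, ?_⟩
  simp only [vacuumClass, projY_emb]
  exact huClass_commY (hf' x₀) (hg' x₀)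

theorem exists_vacuumClass_eq (hω : IsAdSConnection V ω₀) {x₀ : U}
    (hs : StarConvex ℝ (x₀ : Fin d → ℝ) (U : Set (Fin d → ℝ))) (h : HU d) :
    ∃ ε : U → ZYSeries d, IsVacuumSymmetry ω₀ ε ∧ vacuumClass x₀ ε = h := by
  obtain ⟨f, hf, rfl⟩ := exists_huClass_eq h
  obtain ⟨ε, ⟨h1, h2⟩, -⟩ := existsUnique_vacuumSymmetry hω hs hf
  exact ⟨ε, h1, by rw [vacuumClass, h2, projY_emb]⟩

/-- The class is read off at x₀ only; parallel transport spreads membership in the ideal from x₀ to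
every point. -/
theorem vacuumClass_eq_zero_iff (hω : IsAdSConnection V ω₀) {x₀ : U}
    (hs : StarConvex ℝ (x₀ : Fin d → ℝ) (U : Set (Fin d → ℝ))) {ε : U → ZYSeries d}
    (h : IsVacuumSymmetry ω₀ ε) : vacuumClass x₀ ε = 0 ↔
      ∀ x, ∃ f : YSeries d, IsIdealSymbol f ∧ ε x = emb f := by
  obtain ⟨f, hf, hf', rfl⟩ := (isVacuumSymmetry_iff hω).1 h
  rw [vacuumClass, projY_emb, huClass_eq_zero_iff (hf' x₀)]
  constructor
  · exact fun h x => ⟨f x, hf.isIdealSymbol hω hs h x, rfl⟩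
  · intro h
    obtain ⟨g, hg, h0⟩ := h x₀
    rwa [emb_injective h0]

end HigherSpin

end

/-! ### Assembly of the theorem -/

open HigherSpin in
theorem mainTheorem8 (d : ℕ) (U : TopologicalSpace.Opens (Fin d → ℝ)) (V : Fin (d + 1) → ℝ)
    (hV : normV V = 1) (κ : ℝ) (ω₀ : Fin d → U → Matrix (Fin (d + 1)) (Fin (d + 1)) ℝ)
    (hω₀ : IsAdSConnection V ω₀) :
    -- the star products that occur below are free of infinities
    ((∀ f g : ZYSeries d, IsPoly f → StarDefined f g ∧ StarDefined g f) ∧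
      (∀ f : ZYSeries d, StarDefined f (klein V))) ∧
    -- the vacuum solves the nonlinear system
    IsSolution V κ (fun μ x => emb (W0 ω₀ μ x)) (fun p (_ : U) => S0 p) (fun _ => 0) ∧
    -- the general solution of the linearized system
    (∀ (W₁ : Fin d → U → ZYSeries d) (S₁ : Osc d → U → ZYSeries d) (B₁ : U → ZYSeries d),
      IsLinearizedSolution V κ ω₀ W₁ S₁ B₁ ↔
        ∃ (ω : Fin d → U → YSeries d) (C : U → YSeries d) (ε : U → ZYSeries d),
          IsFreeSolution V κ ω₀ ω C ∧
          SmoothSeries ε ∧ (∀ i j x, comm (tTot i j) (ε x) = 0) ∧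
          (∀ x, B₁ x = emb (C x)) ∧
          (∀ p x, S₁ p x = MvPowerSeries.pderiv (R := ℂ) (Sum.inl p) (ε x) + solS V κ (C x) p) ∧
          (∀ μ x, W₁ μ x = dX μ ε x + comm (emb (W0 ω₀ μ x)) (ε x)
            + (emb (ω μ x) + solW V κ (frame V ω₀ μ x) (C x)))) ∧
    -- in the gauge in which the exact part of `S₁` vanishes
    (∀ (W₁ : Fin d → U → ZYSeries d) (C : U → YSeries d),
      IsLinearizedSolution V κ ω₀ W₁ (fun p x => solS V κ (C x) p) (fun x => emb (C x)) ↔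
        ∃ ω : Fin d → U → YSeries d, IsFreeSolution V κ ω₀ ω C ∧
          ∀ μ x, W₁ μ x = emb (ω μ x) + solW V κ (frame V ω₀ μ x) (C x)) ∧
    -- the solution belongs to the regular class
    (∀ f : YSeries d, IsPoly f → IsRegular V (emb f) ∧ (∀ p, IsRegular V (solS V κ f p)) ∧
      ∀ E : Fin (d + 1) → ℝ, IsRegular V (solW V κ E f)) ∧
    (∀ (f : YSeries d) (m : (Osc d ⊕ Osc d) →₀ ℕ),
      (∀ p, MvPowerSeries.coeff m (solS V κ f p) = ∑ n ∈ Finset.range (m.degree + 1),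
        MvPowerSeries.coeff m (solS V κ (MvPowerSeries.homogeneousComponent n f) p)) ∧
      ∀ E : Fin (d + 1) → ℝ, MvPowerSeries.coeff m (solW V κ E f) =
        ∑ n ∈ Finset.range (m.degree + 1),
          MvPowerSeries.coeff m (solW V κ E (MvPowerSeries.homogeneousComponent n f))) ∧
    -- the global symmetry algebra of the vacuum
    (∀ x₀ : U, StarConvex ℝ (x₀ : Fin d → ℝ) (U : Set (Fin d → ℝ)) →
      (∀ ε : U → ZYSeries d, IsVacuumSymmetry ω₀ ε →
        ∀ x, ∃ f : YSeries d, IsHuSymbol f ∧ ε x = emb f) ∧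
      (∀ f : YSeries d, IsHuSymbol f →
        ∃! ε : U → ZYSeries d, IsVacuumSymmetry ω₀ ε ∧ ε x₀ = emb f) ∧
      ∃ Φ : (U → ZYSeries d) → HU d,
        (∀ ε₁ ε₂, IsVacuumSymmetry ω₀ ε₁ → IsVacuumSymmetry ω₀ ε₂ →
          IsVacuumSymmetry ω₀ (ε₁ + ε₂) ∧ Φ (ε₁ + ε₂) = Φ ε₁ + Φ ε₂) ∧
        (∀ (c : ℝ) (ε : U → ZYSeries d), IsVacuumSymmetry ω₀ ε →
          IsVacuumSymmetry ω₀ (fun x => (c : ℂ) • ε x) ∧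
            Φ (fun x => (c : ℂ) • ε x) = c • Φ ε) ∧
        (∀ ε₁ ε₂, IsVacuumSymmetry ω₀ ε₁ → IsVacuumSymmetry ω₀ ε₂ →
          IsVacuumSymmetry ω₀ (fun x => comm (ε₁ x) (ε₂ x)) ∧
            Φ (fun x => comm (ε₁ x) (ε₂ x)) = ⁅Φ ε₁, Φ ε₂⁆) ∧
        (∀ h : HU d, ∃ ε, IsVacuumSymmetry ω₀ ε ∧ Φ ε = h) ∧
        (∀ ε, IsVacuumSymmetry ω₀ ε →
          (Φ ε = 0 ↔ ∀ x, ∃ f : YSeries d, IsIdealSymbol f ∧ ε x = emb f))) := by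
  refine ⟨⟨starDefined_poly, starDefined_klein V⟩, isSolution_vacuum hω₀ hV κ,
    isLinearizedSolution_iff_exists hω₀ hV κ, isLinearizedSolution_gauge_iff hω₀ hV κ,
    fun f hf => ⟨isRegular_of_isPoly (emb_isPoly hf), isRegular_solS κ hf, isRegular_solW κ hf⟩,
    fun f m => ⟨coeff_solS_eq_sum κ f m, coeff_solW_eq_sum κ f m⟩, fun x₀ hs => ?_⟩
  exact ⟨fun ε h => h.exists_symbol hω₀, fun f hf => existsUnique_vacuumSymmetry hω₀ hs hf,
    vacuumClass x₀, fun ε₁ ε₂ => vacuumSymmetry_add hω₀ x₀,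
    fun c ε => vacuumSymmetry_smul hω₀ x₀ c, fun ε₁ ε₂ => vacuumSymmetry_comm hω₀ hs,
    exists_vacuumClass_eq hω₀ hs, fun ε => vacuumClass_eq_zero_iff hω₀ hs⟩
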